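/- **Setting.** Let $v_F>0$, $g_2,g_4\in\mathbb R$, let $\hat V_2,\hat V_4:\mathbb R\to\mathbb R$, and let $\mu_0,\mu_+,\mu_-\in\mathbb R$ with $\mu_++\mu_-=2\mu_0$. For $L>0$ let $a^\pm_{r,k}$ ($r=\pm$, $k\in\frac{\pi}{L}(2\mathbb Z+1)$) be fermion creation/annihilation operators on the fermion Fock space $\mathcal F$ over the filled Dirac sea $\Psi_0$, i.e. $\{a^-_{r,k},a^+_{r',k'}\}=\delta_{r,r'}\delta_{k,k'}$, $\{a^\pm_{r,k},a^\pm_{r',k'}\}=0$ and $a^-_{r,rk}\Psi_0=a^+_{r,-rk}\Psi_0=0$ for $k>0$; let $\mathcal D\subset\mathcal F$ be the dense space of finite-particle vectors. Put $:\!A\!:\;=A-\langle\Psi_0,A\Psi_0\rangle$, $$\rho_r(p)=\sum_k :\!a^+_{r,k}a^-_{r,k+p}\!:\quad(p\in\tfrac{2\pi}{L}\mathbb Z),\qquad Q_r=\rho_r(0),\qquad \psi^\pm_r(x)=L^{-1/2}\sum_k a^\pm_{r,k}e^{\mp ikx},$$ $$\tilde g_i(p)=\frac{g_i\hat V_i(p)}{\pi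 v_F},\quad v(p)=v_F\sqrt{(1+\tilde g_4(p))^2-\tilde g_2(p)^2},\quad K(p)=\sqrt{\frac{1+\tilde g_4(p)-\tilde g_2(p)}{1+\tilde g_4(p)+\tilde g_2(p)}},\quad v=v(0),\ K=K(0).$$ The Hamiltonian is $H=H_0+g_2H_2+g_4H_4-\sum_r(\mu_r-\mu_0)Q_r$ with $H_0=\sum_{r,k}r v_F k:\!a^+_{r,k}a^-_{r,k}\!:$ and $$H_2=\sum_r\tfrac1L\hat V_2(0)Q_rQ_{-r}+\sum_r\sum_{p>0}\tfrac1L\hat V_2(p)\big(\rho_r(p)\rho_{-r}(-p)+\rho_r(-p)\rho_{-r}(p)\big),$$ $$H_4=\sum_r\tfrac1L\hat V_4(0)Q_r^2+\sum_r\sum_{p>0}\tfrac1L\hat V_4(p):\!\big(\rho_r(p)\rho_r(-p)+\rho_r(-p)\rho_r(p)\big)\!:,$$ understood as the operator associated with the closure of the quadratic form which these expressions define on $\mathcal D$. Assume, for all $p\in\frac{2\pi}L\mathbb Z$, that $\hat V_i(p)=\hat V_i(-p)$ and $|g_2\hat V_2(p)|<\pi v_F+g_4\hat V_4(p)$, and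 that $$\sum_{p>0}\frac{p\,g_2^2\hat V_2(p)^2}{\pi v_F(\pi v_F+g_4\hat V_4(p))}<\infty,\qquad \sum_{p>0}\Big(\frac{g_2\hat V_2(p)}{\pi v_F+g_4\hat V_4(p)}\Big)^2<\infty .$$ (The last condition follows from the previous one if $\pi v_F+g_4\hat V_4$ is bounded away from $0$, e.g. if $\hat V_4(p)\to0$ as $|p|\to\infty$.) The total density and the current are (the closures of) $\rho(p)=\rho_+(p)+\rho_-(p)$ and $j(p)=K(p)v(p)(\rho_+(p)-\rho_-(p))$, and the average current in a state $\Psi$ is $I=L^{-1}\int_{-L/2}^{L/2}\langle\Psi,j(x)\Psi\rangle dx=L^{-1}\langle\Psi,j(p=0)\Psi\rangle$. A ground state is a unit eigenvector of $H$ for the minimum of its spectrum. Two-point functions are understood as distributions: $\int\!\!\int f(x)g(y)\langle\Psi,\psi^+_r(x)\psi^-_r(y)\Psi\rangle\,dx\,dy$ over $[-L/2,L/2]^2$ for $f,g\in L^2$. Write $\Psi_{g_2,g_4}$ for a ground state of $H_0+g_2H_2+g_4H_4$ (the case $\mu_\pm=\mu_0$). **Theorem.** (A) For every $L>0$: 1.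 $H$ is self-adjoint, $K(p)v(p)=v_F(1+\tilde g_4(p)-\tilde g_2(p))$, and with $\rho(p,t)=e^{iHt}\rho(p)e^{-iHt}$, $j(p,t)=e^{iHt}j(p)e^{-iHt}$ the continuity equation $\partial_t\rho(p,t)+ip\,j(p,t)=0$ holds for all $p\in\frac{2\pi}L\mathbb Z$ and $t\in\mathbb R$, strongly on the domain of $H$ (which $e^{-iHt}$ maps into the domains of $\rho(p)$ and $j(p)$). 2. $H$ has a ground state. 3. If $\mu_+-\mu_0$ is an integer multiple of $2\pi Kv/L$, then the ground state $\Psi$ of $H$ is unique up to a phase, its average current is $$I=\frac{\mu_+-\mu_-}{2\pi},\qquad\text{so that}\qquad G=\frac{I}{\mu_+-\mu_-}=\frac1{2\pi}\quad\text{if }\mu_+\ne\mu_-,$$ and for $r=\pm$ $$\langle\Psi,\psi^+_r(x)\psi^-_r(y)\Psi\rangle=e^{-ir(Kv)^{-1}(\mu_r-\mu_0)(x-y)}\langle\Psi_{g_2,g_4},\psi^+_r(x)\psi^-_r(y)\Psi_{g_2,g_4}\rangle .$$ (B) Suppose the assumptions hold for all $L>0$, with fixed $v_F,g_i,\hat V_i$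 and arbitrary fixed $\mu_\pm$, $\mu_++\mu_-=2\mu_0$. Let $\Psi_L$ and $\Psi_{g_2,g_4,L}$ be any ground states for length $L$. As $L\to\infty$, the average currents satisfy $I_L\to(\mu_+-\mu_-)/2\pi$, hence $I_L/(\mu_+-\mu_-)\to1/2\pi$ if $\mu_+\neq\mu_-$, and for all $f,g\in L^2(\mathbb R)$ and $r=\pm$ $$\int\!\!\int_{[-L/2,L/2]^2} f(x)g(y)\Big(\langle\Psi_L,\psi^+_r(x)\psi^-_r(y)\Psi_L\rangle-e^{-ir(Kv)^{-1}(\mu_r-\mu_0)(x-y)}\langle\Psi_{g_2,g_4,L},\psi^+_r(x)\psi^-_r(y)\Psi_{g_2,g_4,L}\rangle\Big)dx\,dy\to0 .$$ -/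

import Mathlib

open MeasureTheory Filter Topology

noncomputable section

namespace Luttinger

/-! ### Fermion Fock space over the filled Dirac sea -/

/-- A fermion mode `(r, n)`: chirality `r = ±1` (right/left mover) and momentum `k = π (2 n + 1) / L`. -/
abbrev Mode : Type := ℤˣ × ℤ

/-- The modes that are filled in the Dirac sea: those with `r k < 0`. -/
def InSea (m : Mode) : Prop := (m.1 : ℤ) * (2 * m.2 + 1) < 0

instance (m : Mode) : Decidable (InSea m) := by unfold InSea; infer_instance

/-- Finite-particle vectors. The basis vector labelled by a finite set `S` of modes is the Slater
determinant in which exactly the modes of `S` are excited with respect to the Dirac sea: a mode of `S`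
outside the sea carries a particle and a mode of `S` in the sea carries a hole. The Dirac sea itself
is the basis vector labelled by `∅`. -/
abbrev FockAlg : Type := Finset Mode →₀ ℂ

/-- The fermion Fock space, the Hilbert space completion of `FockAlg`. -/
abbrev Fock : Type := lp (fun _ : Finset Mode => ℂ) 2

/-- The inclusion of the finite-particle vectors in the Fock space. -/
def toFock : FockAlg →ₗ[ℂ] Fock :=
  Finsupp.linearCombination ℂ (fun S : Finset Mode => lp.single 2 S (1 : ℂ))

/-- The Dirac sea. -/
def vac : FockAlg := Finsupp.single ∅ 1

/-- The Jordan–Wigner sign of the mode `m` relative to the excited modes `S`. -/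
def jwSign (m : Mode) (S : Finset Mode) : ℂ :=
  (-1) ^ (S.filter (fun x => toLex x < toLex m)).card

/-- Removes the excitation `m`. -/
def excAnn (m : Mode) : FockAlg →ₗ[ℂ] FockAlg :=
  Finsupp.linearCombination ℂ (fun S : Finset Mode =>
    if m ∈ S then Finsupp.single (S.erase m) (jwSign m S) else 0)

/-- Adds the excitation `m`. -/
def excCre (m : Mode) : FockAlg →ₗ[ℂ] FockAlg :=
  Finsupp.linearCombination ℂ (fun S : Finset Mode =>
    if m ∈ S then 0 else Finsupp.single (insert m S) (jwSign m S))

/-- The fermion annihilation operator `a⁻_{r,k}` (it creates a hole if the mode is in the sea). -/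
def ann (m : Mode) : FockAlg →ₗ[ℂ] FockAlg := if InSea m then excCre m else excAnn m

/-- The fermion creation operator `a⁺_{r,k}` (it removes a hole if the mode is in the sea). -/
def cre (m : Mode) : FockAlg →ₗ[ℂ] FockAlg := if InSea m then excAnn m else excCre m

/-- Wick ordering `:A: = A - ⟨Ψ₀, A Ψ₀⟩`, with `Ψ₀` the Dirac sea. -/
def wick (A : FockAlg →ₗ[ℂ] FockAlg) : FockAlg →ₗ[ℂ] FockAlg :=
  A - (A vac ∅) • LinearMap.id

/-- The density `ρ_r(p) = ∑_k :a⁺_{r,k} a⁻_{r,k+p}:` at `p = 2 π n / L`; on each basis vector only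
finitely many terms are nonzero. -/
def density (r : ℤˣ) (n : ℤ) : FockAlg →ₗ[ℂ] FockAlg :=
  Finsupp.linearCombination ℂ (fun S : Finset Mode =>
    ∑ᶠ l : ℤ, wick (cre (r, l) ∘ₗ ann (r, l + n)) (Finsupp.single S 1))

/-- The chiral charge `Q_r = ρ_r(0)`. -/
def charge (r : ℤˣ) : FockAlg →ₗ[ℂ] FockAlg := density r 0

/-- The allowed boson momenta `p = 2 π n / L`. -/
def momentum (L : ℝ) (n : ℤ) : ℝ := 2 * Real.pi * n / L

/-- The allowed fermion momenta `k = π (2 n + 1) / L`. -/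
def fermionMomentum (L : ℝ) (n : ℤ) : ℝ := Real.pi * (2 * n + 1) / L

/-- The inner product `⟨χ, ψ⟩` of finite-particle vectors. -/
def algInner (χ ψ : FockAlg) : ℂ := inner ℂ (toFock χ) (toFock ψ)

theorem toFock_apply (χ : FockAlg) (S : Finset Mode) : toFock χ S = χ S := by
  induction χ using Finsupp.induction_linear with
  | zero => simp
  | add f g hf hg => simp [hf, hg]
  | single T c =>
    simp only [toFock, Finsupp.linearCombination_single, lp.coeFn_smul, Pi.smul_apply,
      smul_eq_mul]
    by_cases h : S = T
    · subst h; simp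
    · rw [lp.single_apply_ne _ _ _ h, Finsupp.single_eq_of_ne h, mul_zero]

theorem toFock_injective : Function.Injective toFock := by
  intro χ ψ h
  ext S
  rw [← toFock_apply, ← toFock_apply, h]

theorem norm_le_of_reindex (e : Finset Mode → Finset Mode) (P : Finset Mode → Prop)
    (he : Set.InjOn e {S | P S}) (f g : Fock) (h : ∀ S, P S → ‖f S‖ ≤ ‖g (e S)‖)
    (h0 : ∀ S, ¬ P S → f S = 0) : ‖f‖ ≤ ‖g‖ := by
  classical
  refine lp.norm_le_of_forall_sum_le (by norm_num) (norm_nonneg _) fun s => ?_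
  have hs : ∑ S ∈ s, ‖f S‖ ^ (2 : ENNReal).toReal =
      ∑ S ∈ s.filter P, ‖f S‖ ^ (2 : ENNReal).toReal := by
    refine (Finset.sum_filter_of_ne fun S _ hS => ?_).symm
    by_contra hP
    exact hS (by simp [h0 S hP])
  rw [hs]
  have hinj : Set.InjOn e (s.filter P : Finset (Finset Mode)) := fun a ha b hb hab =>
    he (by simpa using (Finset.mem_filter.mp ha).2) (by simpa using (Finset.mem_filter.mp hb).2) hab
  calc ∑ S ∈ s.filter P, ‖f S‖ ^ (2 : ENNReal).toReal
      ≤ ∑ S ∈ s.filter P, ‖g (e S)‖ ^ (2 : ENNReal).toReal :=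
        Finset.sum_le_sum fun S hS => Real.rpow_le_rpow (norm_nonneg _)
          (h S (Finset.mem_filter.mp hS).2) (by norm_num)
    _ = ∑ T ∈ (s.filter P).image e, ‖g T‖ ^ (2 : ENNReal).toReal :=
        (Finset.sum_image (f := fun T => ‖g T‖ ^ (2 : ENNReal).toReal) hinj).symm
    _ ≤ ‖g‖ ^ (2 : ENNReal).toReal := lp.sum_rpow_le_norm_rpow (by norm_num) g _

theorem excAnn_apply (m : Mode) (χ : FockAlg) (S : Finset Mode) :
    excAnn m χ S = if m ∈ S then 0 else jwSign m (insert m S) * χ (insert m S) := by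
  induction χ using Finsupp.induction_linear with
  | zero => simp
  | add f g hf hg => simp only [map_add, Finsupp.add_apply, hf, hg]; split_ifs <;> ring
  | single T c =>
    simp only [excAnn, Finsupp.linearCombination_single, Finsupp.smul_apply, smul_eq_mul]
    by_cases hT : m ∈ T <;> by_cases hS : m ∈ S
    · have : T.erase m ≠ S := fun h => by simp [← h] at hS
      simp [hT, hS, this]
    · by_cases hTS : T.erase m = S
      · have : T = insert m S := by rw [← hTS, Finset.insert_erase hT]
        subst this
        simp [hS, mul_comm]
      · have : T ≠ insert m S := fun h => hTS (by rw [h, Finset.erase_insert hS])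
        simp [hT, hS, this, hTS]
    · simp [hT, hS]
    · have : T ≠ insert m S := fun h => hT (by simp [h])
      simp [hT, hS, this]

theorem excCre_apply (m : Mode) (χ : FockAlg) (S : Finset Mode) :
    excCre m χ S = if m ∈ S then jwSign m (S.erase m) * χ (S.erase m) else 0 := by
  induction χ using Finsupp.induction_linear with
  | zero => simp
  | add f g hf hg => simp only [map_add, Finsupp.add_apply, hf, hg]; split_ifs <;> ring
  | single T c =>
    simp only [excCre, Finsupp.linearCombination_single, Finsupp.smul_apply, smul_eq_mul]
    by_cases hT : m ∈ T <;> by_cases hS : m ∈ S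
    · have : T ≠ S.erase m := fun h => by simp [h] at hT
      simp [hT, hS, this]
    · simp [hT, hS]
    · by_cases hTS : T = S.erase m
      · subst hTS
        simp [hS, Finset.insert_erase hS, mul_comm]
      · have : insert m T ≠ S := fun h => hTS (by rw [← h, Finset.erase_insert hT])
        simp [hT, hS, this, hTS]
    · have : insert m T ≠ S := fun h => hS (by simp [← h])
      simp [hT, hS, this]

theorem norm_jwSign (m : Mode) (S : Finset Mode) : ‖jwSign m S‖ = 1 := by simp [jwSign]

theorem norm_toFock_ann_le (m : Mode) (χ : FockAlg) : ‖toFock (ann m χ)‖ ≤ ‖toFock χ‖ := by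
  unfold ann
  split_ifs
  · refine norm_le_of_reindex (fun S => S.erase m) (fun S => m ∈ S) ?_ _ _ ?_ ?_
    · intro S hS T hT h
      simp only at h
      rw [← Finset.insert_erase (show m ∈ S from hS), h, Finset.insert_erase (show m ∈ T from hT)]
    · intro S hS
      simp [toFock_apply, excCre_apply, hS, norm_jwSign]
    · intro S hS
      simp [toFock_apply, excCre_apply, hS]
  · refine norm_le_of_reindex (fun S => insert m S) (fun S => m ∉ S) ?_ _ _ ?_ ?_
    · intro S hS T hT h
      simp only at h
      rw [← Finset.erase_insert (show m ∉ S from hS), h, Finset.erase_insert (show m ∉ T from hT)]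
    · intro S hS
      simp [toFock_apply, excAnn_apply, hS, norm_jwSign]
    · intro S hS
      have : m ∈ S := by simpa using hS
      simp [toFock_apply, excAnn_apply, this]

theorem denseRange_toFock : DenseRange toFock := by
  intro f
  refine mem_closure_of_tendsto (lp.hasSum_single (by norm_num) f)
    (Filter.Eventually.of_forall fun s => ?_)
  refine ⟨∑ i ∈ s, Finsupp.single i (f i), ?_⟩
  rw [map_sum]
  refine Finset.sum_congr rfl fun i _ => ?_
  simp [toFock, ← lp.single_smul]

/-- The closed operator on the Fock space obtained from an operator on the finite-particle vectors. -/
def closedOp (A : FockAlg →ₗ[ℂ] FockAlg) : Fock →ₗ.[ℂ] Fock :=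
  LinearPMap.closure
    { domain := LinearMap.range toFock
      toFun := toFock ∘ₗ A ∘ₗ (LinearEquiv.ofInjective toFock toFock_injective).symm.toLinearMap }

/-- The annihilation operator `a⁻_{r,k}` as a bounded operator on the Fock space, the continuous
extension of `ann`. -/
def annihilation (m : Mode) : Fock →L[ℂ] Fock := (toFock ∘ₗ ann m).extendOfNorm toFock

theorem annihilation_toFock (m : Mode) (χ : FockAlg) :
    annihilation m (toFock χ) = toFock (ann m χ) :=
  LinearMap.extendOfNorm_eq denseRange_toFock
    ⟨1, fun χ => by simpa using norm_toFock_ann_le m χ⟩ χ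

/-- The smeared field `∫ g(y) ψ⁻_r(y) dy`, `y ∈ [-L/2, L/2]`, applied to `Ψ`, where
`ψ⁻_r(y) = L^{-1/2} ∑_k a⁻_{r,k} e^{i k y}`. -/
def smearedField (L : ℝ) (r : ℤˣ) (g : ℝ → ℂ) (Ψ : Fock) : Fock :=
  ∑' n : ℤ, (((√L)⁻¹ : ℝ) * ∫ y in (-(L / 2))..(L / 2),
    g y * Complex.exp (Complex.I * fermionMomentum L n * y)) • annihilation (r, n) Ψ

/-- The two-point correlation function as a distribution:
`∫∫ f(x) g(y) ⟨Ψ, ψ⁺_r(x) ψ⁻_r(y) Ψ⟩ dx dy` over `[-L/2, L/2]²`, with `ψ⁺_r(x) = ψ⁻_r(x)†`. -/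
def twoPoint (L : ℝ) (r : ℤˣ) (Ψ : Fock) (f g : ℝ → ℂ) : ℂ :=
  inner ℂ (smearedField L r (fun x => starRingEnd ℂ (f x)) Ψ) (smearedField L r g Ψ)

/-- The plane wave `x ↦ e^{i q x}`. -/
def planeWave (q : ℝ) (x : ℝ) : ℂ := Complex.exp (Complex.I * q * x)

/-! ### The model -/

/-- The parameters of the Luttinger model with `g₂` and `g₄` interactions: Fermi velocity, coupling
constants, Fourier transforms of the interaction potentials, the reference chemical potential `μ₀`,
and the chemical potentials `μ r` of the right- (`r = 1`) and left-movers (`r = -1`). -/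
structure Model where
  vF : ℝ
  g₂ : ℝ
  g₄ : ℝ
  V₂ : ℝ → ℝ
  V₄ : ℝ → ℝ
  μ₀ : ℝ
  μ : ℤˣ → ℝ

namespace Model

variable (M : Model) (L : ℝ)

/-- `g̃₂(p) = g₂ V₂(p) / (π v_F)` -/
def gt₂ (p : ℝ) : ℝ := M.g₂ * M.V₂ p / (Real.pi * M.vF)

/-- `g̃₄(p) = g₄ V₄(p) / (π v_F)` -/
def gt₄ (p : ℝ) : ℝ := M.g₄ * M.V₄ p / (Real.pi * M.vF)

/-- The renormalized Fermi velocity. -/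
def v (p : ℝ) : ℝ := M.vF * √((1 + M.gt₄ p) ^ 2 - M.gt₂ p ^ 2)

/-- The Luttinger parameter. -/
def K (p : ℝ) : ℝ := √((1 + M.gt₄ p - M.gt₂ p) / (1 + M.gt₄ p + M.gt₂ p))

/-- The conditions on the model on the circle of length `L`. The field `implementable` is automatic if
`π v_F + g₄ V₄` is bounded away from zero (given `finite_energy`). -/
structure Admissible : Prop where
  vF_pos : 0 < M.vF
  mu_sum : M.μ 1 + M.μ (-1) = 2 * M.μ₀
  even₂ : ∀ n : ℤ, M.V₂ (momentum L n) = M.V₂ (-momentum L n)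
  even₄ : ∀ n : ℤ, M.V₄ (momentum L n) = M.V₄ (-momentum L n)
  stable : ∀ n : ℤ, |M.g₂ * M.V₂ (momentum L n)| < Real.pi * M.vF + M.g₄ * M.V₄ (momentum L n)
  finite_energy : Summable fun n : ℕ =>
    momentum L (n + 1) * (M.g₂ * M.V₂ (momentum L (n + 1))) ^ 2 /
      (Real.pi * M.vF * (Real.pi * M.vF + M.g₄ * M.V₄ (momentum L (n + 1))))
  implementable : Summable fun n : ℕ =>
    (M.g₂ * M.V₂ (momentum L (n + 1)) /
      (Real.pi * M.vF + M.g₄ * M.V₄ (momentum L (n + 1)))) ^ 2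

/-- `H₀ = ∑_{r,k} r v_F k :a⁺_{r,k} a⁻_{r,k}:`. -/
def freeHamiltonian : FockAlg →ₗ[ℂ] FockAlg :=
  Finsupp.linearCombination ℂ (fun S : Finset Mode =>
    ∑ᶠ m : Mode, ((((m.1 : ℤ) : ℝ) * M.vF * fermionMomentum L m.2 : ℝ) : ℂ) •
      wick (cre m ∘ₗ ann m) (Finsupp.single S 1))

/-- The sesquilinear form `⟨χ, H₂ ψ⟩` of the interaction between fermions of opposite chirality. Only
finitely many terms of the sum over `p > 0` are nonzero. -/
def form₂ (χ ψ : FockAlg) : ℂ :=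
  ∑ r : ℤˣ, ((1 / L * M.V₂ 0 : ℝ) : ℂ) * algInner χ (charge r (charge (-r) ψ)) +
  ∑ᶠ n : ℕ, ∑ r : ℤˣ, ((1 / L * M.V₂ (momentum L (n + 1)) : ℝ) : ℂ) *
    algInner χ ((density r (n + 1) ∘ₗ density (-r) (-(n + 1)) +
      density r (-(n + 1)) ∘ₗ density (-r) (n + 1)) ψ)

/-- The sesquilinear form `⟨χ, H₄ ψ⟩` of the interaction between fermions of equal chirality, each
`p > 0` term being Wick ordered. Only finitely many terms of the sum over `p > 0` are nonzero. -/
def form₄ (χ ψ : FockAlg) : ℂ :=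
  ∑ r : ℤˣ, ((1 / L * M.V₄ 0 : ℝ) : ℂ) * algInner χ (charge r (charge r ψ)) +
  ∑ᶠ n : ℕ, ∑ r : ℤˣ, ((1 / L * M.V₄ (momentum L (n + 1)) : ℝ) : ℂ) *
    algInner χ (wick (density r (n + 1) ∘ₗ density r (-(n + 1)) +
      density r (-(n + 1)) ∘ₗ density r (n + 1)) ψ)

/-- The sesquilinear form `⟨χ, H ψ⟩` of `H = H₀ + g₂ H₂ + g₄ H₄ - ∑_r (μ_r - μ₀) Q_r`. -/
def form (χ ψ : FockAlg) : ℂ :=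
  algInner χ (M.freeHamiltonian L ψ) + M.g₂ * M.form₂ L χ ψ + M.g₄ * M.form₄ L χ ψ -
    ∑ r : ℤˣ, ((M.μ r - M.μ₀ : ℝ) : ℂ) * algInner χ (charge r ψ)

/-- `H` is the operator associated with the closure of the quadratic form: `H Ψ = Φ` iff `Ψ` is the
limit, in the norm and in the sense of the form, of finite-particle vectors `u n`, and
`⟨χ, H u n⟩ → ⟨χ, Φ⟩` for all finite-particle `χ`. -/
def IsHamiltonian (H : Fock →ₗ.[ℂ] Fock) : Prop :=
  ∀ Ψ Φ : Fock, (Ψ, Φ) ∈ H.graph ↔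
    ∃ u : ℕ → FockAlg,
      Tendsto (fun n => toFock (u n)) atTop (𝓝 Ψ) ∧
      Tendsto (fun nm : ℕ × ℕ => M.form L (u nm.1 - u nm.2) (u nm.1 - u nm.2)) atTop (𝓝 0) ∧
      ∀ χ : FockAlg, Tendsto (fun n => M.form L χ (u n)) atTop (𝓝 (inner ℂ (toFock χ) Φ))

/-- `Ψ` is a normalized ground state: a unit eigenvector of the Hamiltonian for the lowest energy. -/
def IsGroundState (Ψ : Fock) : Prop :=
  ‖Ψ‖ = 1 ∧ ∃ H : Fock →ₗ.[ℂ] Fock, M.IsHamiltonian L H ∧ ∃ E : ℝ,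
    (Ψ, (E : ℂ) • Ψ) ∈ H.graph ∧
    ∀ Φ : H.domain, E * ‖(Φ : Fock)‖ ^ 2 ≤ (inner ℂ (Φ : Fock) (H Φ)).re

/-- The total density `ρ(p) = ρ₊(p) + ρ₋(p)` at `p = 2 π n / L`. -/
def totalDensity (n : ℤ) : Fock →ₗ.[ℂ] Fock := closedOp (density 1 n + density (-1) n)

/-- The current `j(p) = K(p) v(p) (ρ₊(p) - ρ₋(p))` at `p = 2 π n / L`. -/
def current (n : ℤ) : Fock →ₗ.[ℂ] Fock :=
  closedOp (((M.K (momentum L n) * M.v (momentum L n) : ℝ) : ℂ) • (density 1 n - density (-1) n))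

/-- `I` is the average current `L⁻¹ ∫ ⟨Ψ, j(x) Ψ⟩ dx = L⁻¹ ⟨Ψ, j(p = 0) Ψ⟩` (and `Ψ` is in the domain of
`j(p = 0)`). -/
def HasAverageCurrent (Ψ : Fock) (I : ℝ) : Prop :=
  ∃ Φ : Fock, (Ψ, Φ) ∈ (M.current L 0).graph ∧ inner ℂ Ψ Φ / L = I

/-- The same model with both chemical potentials equal to `μ₀`, with Hamiltonian
`H₀ + g₂ H₂ + g₄ H₄`. -/
def neutral : Model := { M with μ := fun _ => M.μ₀ }

/-- The effective Fermi momentum shift `(K v)⁻¹ (μ_r - μ₀)`, with `K = K(0)` and `v = v(0)`. -/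
def momentumShift (r : ℤˣ) : ℝ := (M.K 0 * M.v 0)⁻¹ * (M.μ r - M.μ₀)

end Model

/-- `U t = e^{-i H t}`: `U` is the strongly continuous unitary group generated by `H`. -/
structure IsTimeEvolution (H : Fock →ₗ.[ℂ] Fock) (U : ℝ → Fock →L[ℂ] Fock) : Prop where
  zero : U 0 = 1
  add : ∀ s t, U (s + t) = U s * U t
  isometry : ∀ t Ψ, ‖U t Ψ‖ = ‖Ψ‖
  continuous : ∀ Ψ, Continuous fun t => U t Ψ
  deriv : ∀ Ψ : H.domain, HasDerivAt (fun t => U t Ψ) (-Complex.I • H Ψ) 0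

end Luttinger

end

noncomputable section

namespace Luttinger

open scoped symmDiff ComplexConjugate

/-! The model is solved exactly by bosonization. A commutator of two densities commutes with every
fermion operator, hence is a scalar, and the filled sea makes this scalar nonzero (`density_comm`);
so the densities of nonzero momentum are, up to normalization, boson operators (`ccr_bos`). Kronig's
identity (`kronig_finite`, `hasSum_low`) expresses the free energy through products of two densities
and squares of charges, so the whole Hamiltonian is quadratic in bosons and charges
(`hasSum_tform`). The same identity gives completeness: a basis vector without boson content is a
Dirac sea with shifted Fermi points, and an induction on the energy shows that the boson states over
all shifted seas span the finite-particle vectors (`span_bosState`). The shifted seas are the images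
of the original one under Klein factors, which commute with the bosons.

At each momentum a Bogoliubov transformation removes the terms mixing the two chiralities. It is
realized concretely by a matrix `BogParam.coeff` between occupation numbers. Its vacuum is an
explicit function on paired occupation numbers, square summable by `implementable`. The transpose of
the matrix belongs to the inverse transformation (`BogParam.coeff_symm`), so rows as well as columns
are normalized, and the dressed vectors form a Hilbert basis. In this basis the form is diagonal
(`hasSum_form`): charge energy, boson energies, and a vacuum shift that is finite by
`finite_energy`. The operator of the closed form is the diagonal operator because the
finite-particle vectors are a form core (`denseRange_weighted`), which rests on a diagonal upper
bound for the form on combinations of boson states. Self-adjointness and the time evolution are then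
read off. At nonzero momentum the density and the current are proportional to the sum and the
difference of an operator lowering the energy by ω and one raising it by ω; these evolve by opposite
phases, and differentiation exchanges sum and difference (`continuity_of_eq`).

A ground state contains no dressed bosons and minimizes the charge energy, which up to a constant is
π/(2L) times (v/K)(w₊ − w₋)² + Kv(w₊ + w₋ − J)², over integer shifts w of the Fermi points, where J
= (μ₊ − μ₀)L/(πKv). The current in the sector w is Kv(w₊ + w₋)/L, so Kv cancels against J and the
conductance is universal. If J = 2k, the only minimizer is w₊ = w₋ = k. The Klein factor creating
this sector multiplies the fields by plane waves (`smearedField_kleinOp`) and commutes with the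
Bogoliubov transformation (`BogParam.kleinOp_dressed`), which gives the two-point function. For
general potentials all minimizers lie within a distance of J/2 that is bounded uniformly in L
(`bound_of_isMin`), and different sectors do not interfere (`twoPoint_sum`). The momenta are then
wrong by O(1/L), an error that disappears by dominated convergence (`tendsto_dephase`). -/

/-- The mode `m` is occupied in the basis vector labelled by the excitations `S`. -/
def Occ (m : Mode) (S : Finset Mode) : Prop := ¬ (m ∈ S ↔ InSea m)

instance (m : Mode) (S : Finset Mode) : Decidable (Occ m S) := by unfold Occ; infer_instance

theorem occ_toggle_self (m : Mode) (S : Finset Mode) : Occ m (S ∆ {m}) ↔ ¬ Occ m S := by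
  simp only [Occ, Finset.mem_symmDiff, Finset.mem_singleton]; tauto

theorem occ_toggle_of_ne {m m' : Mode} (h : m ≠ m') (S : Finset Mode) :
    Occ m (S ∆ {m'}) ↔ Occ m S := by
  simp only [Occ, Finset.mem_symmDiff, Finset.mem_singleton]; tauto

theorem occ_empty (m : Mode) : Occ m ∅ ↔ InSea m := by simp [Occ]

theorem symmDiff_singleton_of_mem {m : Mode} {S : Finset Mode} (h : m ∈ S) :
    S ∆ {m} = S.erase m := by
  ext x; simp only [Finset.mem_symmDiff, Finset.mem_singleton, Finset.mem_erase]
  by_cases hx : x = m <;> simp_all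

theorem symmDiff_singleton_of_notMem {m : Mode} {S : Finset Mode} (h : m ∉ S) :
    S ∆ {m} = insert m S := by
  ext x; simp only [Finset.mem_symmDiff, Finset.mem_singleton, Finset.mem_insert]
  by_cases hx : x = m <;> simp_all

theorem jwSign_congr {m : Mode} {S T : Finset Mode} (h : ∀ x, x ≠ m → (x ∈ S ↔ x ∈ T)) :
    jwSign m S = jwSign m T := by
  unfold jwSign
  congr 2
  ext x
  simp only [Finset.mem_filter]
  refine and_congr_left fun hx => h x ?_
  rintro rfl
  exact lt_irrefl _ hx

theorem jwSign_toggle (m m' : Mode) (S : Finset Mode) :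
    jwSign m (S ∆ {m'}) = if toLex m' < toLex m then -jwSign m S else jwSign m S := by
  split_ifs with h
  · unfold jwSign
    by_cases hm : m' ∈ S
    · rw [symmDiff_singleton_of_mem hm, Finset.filter_erase]
      rw [← Finset.card_erase_add_one (s := S.filter _) (a := m') (by simp [hm, h]), pow_succ]
      simp
    · rw [symmDiff_singleton_of_notMem hm, Finset.filter_insert, if_pos h,
        Finset.card_insert_of_notMem (by simp [hm]), pow_succ]
      simp
  · unfold jwSign
    congr 2
    ext x
    simp only [Finset.mem_filter, Finset.mem_symmDiff, Finset.mem_singleton]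
    refine and_congr_left fun hx => ?_
    have : x ≠ m' := by rintro rfl; exact h hx
    tauto

theorem jwSign_mul_self (m : Mode) (S : Finset Mode) : jwSign m S * jwSign m S = 1 := by
  simp [jwSign, ← mul_pow]

theorem conj_jwSign (m : Mode) (S : Finset Mode) : conj (jwSign m S) = jwSign m S := by
  simp [jwSign]

/-! ### Fermion operators as signed toggles, and the anticommutation relations -/

/-- The creation operator (`b = true`) or annihilation operator (`b = false`) of a mode. -/
def fop (b : Bool) (m : Mode) : FockAlg →ₗ[ℂ] FockAlg := if b then cre m else ann m

theorem fop_true (m : Mode) : fop true m = cre m := rfl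
theorem fop_false (m : Mode) : fop false m = ann m := rfl

/-- The particle–hole convention of the sea is absorbed into `Occ`, so that creation and
annihilation of every mode follow one rule: toggle the mode and multiply by its Jordan–Wigner sign,
which does not depend on the mode itself. The anticommutation relations reduce to case distinctions
on this formula. -/
theorem fop_apply (b : Bool) (m : Mode) (χ : FockAlg) (S : Finset Mode) :
    fop b m χ S = if (Occ m S ↔ b = true) then jwSign m S * χ (S ∆ {m}) else 0 := by
  have e1 : m ∈ S → jwSign m (S.erase m) = jwSign m S := fun h =>
    jwSign_congr fun x hx => by simp [hx]
  have e2 : m ∉ S → jwSign m (insert m S) = jwSign m S := fun h =>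
    jwSign_congr fun x hx => by simp [hx]
  by_cases hS : m ∈ S
  · by_cases hm : InSea m <;> cases b <;>
      simp [fop, ann, cre, hm, Occ, hS, excCre_apply, excAnn_apply, e1 hS, symmDiff_singleton_of_mem hS]
  · by_cases hm : InSea m <;> cases b <;>
      simp [fop, ann, cre, hm, Occ, hS, excCre_apply, excAnn_apply, e2 hS, symmDiff_singleton_of_notMem hS]

theorem toggle_comm (S : Finset Mode) (m m' : Mode) : S ∆ {m} ∆ {m'} = S ∆ {m'} ∆ {m} :=
  symmDiff_right_comm _ _ _

/-- Of two distinct modes exactly one precedes the other, so toggling both changes exactly one of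
the two signs according to the order of the operations. -/
theorem fop_anticomm {m m' : Mode} (h : m ≠ m') (b b' : Bool) (χ : FockAlg) :
    fop b m (fop b' m' χ) = -fop b' m' (fop b m χ) := by
  ext S
  simp only [Finsupp.neg_apply, fop_apply, occ_toggle_of_ne h, occ_toggle_of_ne h.symm, toggle_comm S m' m,
    jwSign_toggle]
  have h' : toLex m ≠ toLex m' := fun e => h (toLex.injective e)
  rcases lt_or_gt_of_ne h' with hl | hl
  · simp only [hl, not_lt_of_gt hl, if_true, if_false]
    split_ifs <;> ring
  · simp only [hl, not_lt_of_gt hl, if_true, if_false]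
    split_ifs <;> ring

theorem fop_fop_self (b : Bool) (m : Mode) (χ : FockAlg) : fop b m (fop b m χ) = 0 := by
  ext S
  simp only [fop_apply, occ_toggle_self]
  by_cases h : Occ m S <;> cases b <;> simp [h]

theorem fop_not_add (b : Bool) (m : Mode) (χ : FockAlg) :
    fop b m (fop (!b) m χ) + fop (!b) m (fop b m χ) = χ := by
  ext S
  have : jwSign m S * (jwSign m S * χ S) = χ S := by rw [← mul_assoc, jwSign_mul_self, one_mul]
  simp only [Finsupp.add_apply, fop_apply, occ_toggle_self, jwSign_toggle, lt_irrefl, if_false,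
    symmDiff_symmDiff_cancel_right]
  by_cases h : Occ m S <;> cases b <;> simp [h, this]

theorem ann_cre (m m' : Mode) (χ : FockAlg) :
    ann m (cre m' χ) = (if m = m' then χ else 0) - cre m' (ann m χ) := by
  split_ifs with h
  · subst h
    exact eq_sub_of_add_eq (fop_not_add false m χ)
  · rw [zero_sub]; exact fop_anticomm h false true χ

theorem ann_ann (m m' : Mode) (χ : FockAlg) : ann m (ann m' χ) = -ann m' (ann m χ) := by
  by_cases h : m = m'
  · subst h; rw [show ann m (ann m χ) = 0 from fop_fop_self false m χ, neg_zero]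
  · exact fop_anticomm h false false χ

theorem cre_cre (m m' : Mode) (χ : FockAlg) : cre m (cre m' χ) = -cre m' (cre m χ) := by
  by_cases h : m = m'
  · subst h; rw [show cre m (cre m χ) = 0 from fop_fop_self true m χ, neg_zero]
  · exact fop_anticomm h true true χ

/-! ### The inner product of finite-particle vectors -/

theorem algInner_single_left (S : Finset Mode) (c : ℂ) (χ : FockAlg) :
    algInner (Finsupp.single S c) χ = conj c * χ S := by
  have : toFock (Finsupp.single S c) = lp.single 2 S c := by
    simp [toFock, ← lp.single_smul]
  rw [algInner, this, lp.inner_single_left, toFock_apply]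
  simp [mul_comm]

theorem algInner_add_left (χ χ' ψ : FockAlg) :
    algInner (χ + χ') ψ = algInner χ ψ + algInner χ' ψ := by
  simp [algInner]

theorem algInner_add_right (χ ψ ψ' : FockAlg) :
    algInner χ (ψ + ψ') = algInner χ ψ + algInner χ ψ' := by
  simp [algInner]

theorem algInner_sub_right (χ ψ ψ' : FockAlg) :
    algInner χ (ψ - ψ') = algInner χ ψ - algInner χ ψ' := by
  simp [algInner]

theorem algInner_smul_left (c : ℂ) (χ ψ : FockAlg) :
    algInner (c • χ) ψ = conj c * algInner χ ψ := by
  simp [algInner, mul_comm]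

theorem algInner_smul_right (c : ℂ) (χ ψ : FockAlg) :
    algInner χ (c • ψ) = c * algInner χ ψ := by
  simp [algInner]

theorem algInner_sum_right {ι : Type*} (A : Finset ι) (χ : FockAlg) (f : ι → FockAlg) :
    algInner χ (∑ i ∈ A, f i) = ∑ i ∈ A, algInner χ (f i) := by
  simp [algInner, map_sum]

theorem algInner_sum_left {ι : Type*} (A : Finset ι) (χ : FockAlg) (f : ι → FockAlg) :
    algInner (∑ i ∈ A, f i) χ = ∑ i ∈ A, algInner (f i) χ := by
  simp [algInner, map_sum]

theorem algInner_conj (χ ψ : FockAlg) : conj (algInner χ ψ) = algInner ψ χ := by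
  simp [algInner]

/-- Two operators are formally adjoint if they are so on the basis vectors. -/
theorem algInner_adjoint_of_single {A B : FockAlg →ₗ[ℂ] FockAlg}
    (h : ∀ S T, A (Finsupp.single T 1) S = conj (B (Finsupp.single S 1) T)) (χ ψ : FockAlg) :
    algInner χ (A ψ) = algInner (B χ) ψ := by
  induction χ using Finsupp.induction_linear with
  | zero => simp [algInner]
  | add f g hf hg => simp only [map_add, algInner_add_left, hf, hg]
  | single S c =>
    induction ψ using Finsupp.induction_linear with
    | zero => simp [algInner]
    | add f g hf hg => simp only [map_add, algInner_add_right, hf, hg]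
    | single T d =>
      have e1 : Finsupp.single S c = c • Finsupp.single S (1 : ℂ) := by simp
      have e2 : Finsupp.single T d = d • Finsupp.single T (1 : ℂ) := by simp
      rw [e1, e2]
      simp only [map_smul, algInner_smul_left, algInner_smul_right]
      rw [← algInner_conj (Finsupp.single T 1), algInner_single_left, algInner_single_left, h]
      simp

theorem algInner_fop (b : Bool) (m : Mode) (χ ψ : FockAlg) :
    algInner χ (fop b m ψ) = algInner (fop (!b) m χ) ψ := by
  refine algInner_adjoint_of_single (fun S T => ?_) χ ψ
  rw [fop_apply, fop_apply]
  by_cases h : S = T ∆ {m}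
  · subst h
    simp only [occ_toggle_self, jwSign_toggle, lt_irrefl, if_false, symmDiff_symmDiff_cancel_right]
    by_cases h : Occ m T <;> cases b <;> simp [h, conj_jwSign]
  · have h' : T ≠ S ∆ {m} := by rintro rfl; simp at h
    rw [Finsupp.single_eq_of_ne h'.symm, Finsupp.single_eq_of_ne (Ne.symm h)]
    simp

theorem algInner_ann (m : Mode) (χ ψ : FockAlg) :
    algInner χ (ann m ψ) = algInner (cre m χ) ψ := algInner_fop false m χ ψ

theorem algInner_cre (m : Mode) (χ ψ : FockAlg) :
    algInner χ (cre m ψ) = algInner (ann m χ) ψ := algInner_fop true m χ ψ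

theorem algInner_left_injective {χ ψ : FockAlg} (h : ∀ φ, algInner φ χ = algInner φ ψ) : χ = ψ := by
  ext S
  simpa [algInner_single_left] using h (Finsupp.single S 1)

theorem fop_single (b : Bool) (m : Mode) (S : Finset Mode) (c : ℂ) :
    fop b m (Finsupp.single S c) =
      if (Occ m S ↔ b = false) then Finsupp.single (S ∆ {m}) (jwSign m S * c) else 0 := by
  ext T
  rw [fop_apply]
  by_cases h : T = S ∆ {m}
  · subst h
    simp only [occ_toggle_self, jwSign_toggle, lt_irrefl, if_false, symmDiff_symmDiff_cancel_right]
    by_cases h : Occ m S <;> cases b <;> simp [h]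
  · have h' : S ≠ T ∆ {m} := by rintro rfl; simp at h
    rw [Finsupp.single_eq_of_ne h'.symm]
    have : (if (Occ m S ↔ b = false) then Finsupp.single (S ∆ {m}) (jwSign m S * c) else 0 : FockAlg) T
        = 0 := by
      split_ifs
      · rw [Finsupp.single_eq_of_ne h]
      · rfl
    rw [this]; simp

theorem cre_single (m : Mode) (S : Finset Mode) (c : ℂ) :
    cre m (Finsupp.single S c) =
      if Occ m S then 0 else Finsupp.single (S ∆ {m}) (jwSign m S * c) := by
  have := fop_single true m S c
  by_cases h : Occ m S <;> simpa [h, fop_true] using this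

theorem ann_single (m : Mode) (S : Finset Mode) (c : ℂ) :
    ann m (Finsupp.single S c) =
      if Occ m S then Finsupp.single (S ∆ {m}) (jwSign m S * c) else 0 := by
  have := fop_single false m S c
  by_cases h : Occ m S <;> simpa [h, fop_false] using this

theorem cre_ann_self_single (m : Mode) (S : Finset Mode) (c : ℂ) :
    cre m (ann m (Finsupp.single S c)) = if Occ m S then Finsupp.single S c else 0 := by
  rw [ann_single]
  split_ifs with h
  · rw [cre_single, if_neg (by rw [occ_toggle_self]; simpa using h)]
    simp only [jwSign_toggle, lt_irrefl, if_false, symmDiff_symmDiff_cancel_right, ← mul_assoc,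
      jwSign_mul_self, one_mul]
  · simp

theorem cre_ann_single_of_ne {m m' : Mode} (hm : m ≠ m') (S : Finset Mode) (c : ℂ) :
    cre m (ann m' (Finsupp.single S c)) =
      if Occ m' S ∧ ¬ Occ m S then
        Finsupp.single (S ∆ {m'} ∆ {m}) (jwSign m (S ∆ {m'}) * (jwSign m' S * c)) else 0 := by
  rw [ann_single]
  by_cases h : Occ m' S <;> by_cases h' : Occ m S <;>
    simp only [h, h', cre_single, occ_toggle_of_ne hm, if_true, if_false, map_zero, not_true,
      not_false_eq_true, and_true, and_false]

theorem cre_ann_vac_apply (m m' : Mode) :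
    cre m (ann m' vac) ∅ = if m = m' ∧ InSea m then 1 else 0 := by
  by_cases h : m = m'
  · subst h
    rw [vac, cre_ann_self_single]
    by_cases h : InSea m <;> simp [h, occ_empty]
  · rw [vac, cre_ann_single_of_ne h]
    split_ifs with h1 h2
    · exact absurd h2.1 h
    · refine Finsupp.single_eq_of_ne fun h2 => ?_
      have : m ∈ (∅ : Finset Mode) ∆ {m'} ∆ {m} := by
        simp only [Finset.mem_symmDiff, Finset.mem_singleton]; simp [h]
      rw [← h2] at this; simp at this
    · tauto
    · rfl

theorem wick_cre_ann (m m' : Mode) (χ : FockAlg) :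
    wick (cre m ∘ₗ ann m') χ = cre m (ann m' χ) - (if m = m' ∧ InSea m then (1 : ℂ) else 0) • χ := by
  rw [wick, LinearMap.comp_apply, cre_ann_vac_apply]; rfl

/-! ### Densities, their adjoints and their commutators -/

/-- The summand of the density. -/
def dterm (r : ℤˣ) (n l : ℤ) : FockAlg →ₗ[ℂ] FockAlg := wick (cre (r, l) ∘ₗ ann (r, l + n))

theorem dterm_apply (r : ℤˣ) (n l : ℤ) (χ : FockAlg) :
    dterm r n l χ = cre (r, l) (ann (r, l + n) χ) -
      (if n = 0 ∧ InSea (r, l) then (1 : ℂ) else 0) • χ := by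
  rw [dterm, wick_cre_ann]
  simp [Prod.ext_iff]

theorem inSea_one (l : ℤ) : InSea (1, l) ↔ l < 0 := by
  simp only [InSea, Units.val_one, one_mul]; omega

theorem inSea_neg_one (l : ℤ) : InSea (-1, l) ↔ 0 ≤ l := by
  simp only [InSea, Units.val_neg, Units.val_one, neg_mul, one_mul]; omega

theorem inSea_congr_of_lt (r : ℤˣ) {n l : ℤ} (h : |n| < |l|) : InSea (r, l) ↔ InSea (r, l + n) := by
  rcases Int.units_eq_one_or r with rfl | rfl
  · rw [inSea_one, inSea_one]
    rcases abs_cases n with ⟨h1, _⟩ | ⟨h1, _⟩ <;> rcases abs_cases l with ⟨h2, _⟩ | ⟨h2, _⟩ <;> omega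
  · rw [inSea_neg_one, inSea_neg_one]
    rcases abs_cases n with ⟨h1, _⟩ | ⟨h1, _⟩ <;> rcases abs_cases l with ⟨h2, _⟩ | ⟨h2, _⟩ <;> omega

/-- Away from the excitations and from the Fermi point the two modes are both filled or both empty.
Then nothing can hop, and for `n = 0` the Wick constant cancels the occupation number. Hence only
finitely many summands act on a given basis vector. -/
theorem dterm_single_eq_zero {r : ℤˣ} {n l : ℤ} {S : Finset Mode} (h1 : (r, l) ∉ S)
    (h2 : (r, l + n) ∉ S) (h3 : InSea (r, l) ↔ InSea (r, l + n)) (c : ℂ) :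
    dterm r n l (Finsupp.single S c) = 0 := by
  rw [dterm_apply]
  by_cases hn : n = 0
  · subst hn
    rw [add_zero, cre_ann_self_single]
    by_cases h : InSea (r, l) <;> simp [Occ, h1, h]
  · rw [cre_ann_single_of_ne (by simp [hn]), if_neg (by simp only [Occ, h1, h2, h3]; tauto)]
    simp [hn]

theorem dterm_support_finite (r : ℤˣ) (n : ℤ) (S : Finset Mode) (c : ℂ) :
    (Function.support fun l => dterm r n l (Finsupp.single S c)).Finite := by
  have f1 : {l : ℤ | (r, l) ∈ S}.Finite :=
    S.finite_toSet.preimage (f := fun l : ℤ => (r, l)) (by intro a _ b _ h; simpa using h)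
  have f2 : {l : ℤ | (r, l + n) ∈ S}.Finite :=
    S.finite_toSet.preimage (f := fun l : ℤ => (r, l + n)) (by intro a _ b _ h; simpa using h)
  have f3 : {l : ℤ | |l| ≤ |n|}.Finite :=
    (Set.finite_Icc (-|n|) |n|).subset fun l hl => abs_le.mp hl
  refine ((f1.union f2).union f3).subset fun l hl => ?_
  by_contra hc
  simp only [Set.mem_union, Set.mem_ofPred_eq, not_or, not_le] at hc
  exact hl (dterm_single_eq_zero hc.1.1 hc.1.2 (inSea_congr_of_lt r hc.2) c)

/-- Truncation to all sufficiently large finite sets of momenta, rather than to one set depending on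
the vector, allows several densities and vectors to be treated with a common cutoff. -/
theorem density_eventually (r : ℤˣ) (n : ℤ) (χ : FockAlg) :
    ∀ᶠ A : Finset ℤ in atTop, density r n χ = ∑ l ∈ A, dterm r n l χ := by
  induction χ using Finsupp.induction_linear with
  | zero => simp
  | add f g hf hg =>
    filter_upwards [hf, hg] with A h1 h2
    simp only [map_add, h1, h2, Finset.sum_add_distrib]
  | single S c =>
    filter_upwards [eventually_ge_atTop (dterm_support_finite r n S 1).toFinset] with A hA
    have e2 : Finsupp.single S c = c • Finsupp.single S (1 : ℂ) := by simp
    rw [e2]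
    simp only [map_smul, ← Finset.smul_sum]
    congr 1
    rw [density, Finsupp.linearCombination_single, one_smul]
    refine finsum_eq_sum_of_support_subset _ fun l hl => ?_
    exact hA ((dterm_support_finite r n S 1).mem_toFinset.mpr hl)

theorem density_ann (r r' : ℤˣ) (n l : ℤ) (χ : FockAlg) :
    density r n (ann (r', l) χ) =
      ann (r', l) (density r n χ) - if r = r' then ann (r', l + n) χ else 0 := by
  obtain ⟨A, ⟨h1, h2⟩, h3⟩ := (((density_eventually r n χ).and
    (density_eventually r n (ann (r', l) χ))).and (eventually_ge_atTop {l})).exists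
  rw [h1, h2, map_sum, eq_sub_iff_add_eq, ← eq_sub_iff_add_eq', ← Finset.sum_sub_distrib]
  have : ∀ k, ann (r', l) (dterm r n k χ) - dterm r n k (ann (r', l) χ) =
      if l = k then (if r = r' then ann (r', l + n) χ else 0) else 0 := by
    intro k
    simp only [dterm_apply, map_sub, map_smul, ann_cre, ann_ann (r, k + n) (r', l), map_neg]
    by_cases hk : l = k <;> by_cases hr : r = r'
    · subst hk hr; simp
    · simp [hk, hr, Ne.symm hr]
    · simp [hk]
    · simp [hk]
  rw [Finset.sum_congr rfl fun k _ => this k, Finset.sum_ite_eq, if_pos (h3 (Finset.mem_singleton_self _))]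

theorem density_cre (r r' : ℤˣ) (n l : ℤ) (χ : FockAlg) :
    density r n (cre (r', l) χ) =
      cre (r', l) (density r n χ) + if r = r' then cre (r', l - n) χ else 0 := by
  obtain ⟨A, ⟨h1, h2⟩, h3⟩ := (((density_eventually r n χ).and
    (density_eventually r n (cre (r', l) χ))).and (eventually_ge_atTop {l - n})).exists
  rw [h1, h2, map_sum, ← sub_eq_iff_eq_add', ← Finset.sum_sub_distrib]
  have : ∀ k, dterm r n k (cre (r', l) χ) - cre (r', l) (dterm r n k χ) =
      if l - n = k then (if r = r' then cre (r', l - n) χ else 0) else 0 := by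
    intro k
    simp only [dterm_apply, map_sub, map_smul, ann_cre, cre_cre (r', l)]
    have : k + n = l ↔ l - n = k := by omega
    by_cases hk : l - n = k <;> by_cases hr : r = r'
    · subst hr; simp [← hk]
    · simp [hr]
    · simp [this, hk]
    · simp [hk, hr]
  rw [Finset.sum_congr rfl fun k _ => this k, Finset.sum_ite_eq, if_pos (h3 (Finset.mem_singleton_self _))]

theorem algInner_density (r : ℤˣ) (n : ℤ) (χ ψ : FockAlg) :
    algInner χ (density r n ψ) = algInner (density r (-n) χ) ψ := by
  obtain ⟨A, hA⟩ := eventually_atTop.mp (density_eventually r n ψ)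
  obtain ⟨B, hB⟩ := eventually_atTop.mp (density_eventually r (-n) χ)
  -- The summand at `l` for momentum `n` is adjoint to the summand at `l + n` for momentum `-n`. So
  -- `C` must contain `A`, and its translate by `n` must contain `B`.
  let C := A ∪ B.map (Equiv.subRight n).toEmbedding
  rw [hA C Finset.subset_union_left, hB (C.map (Equiv.addRight n).toEmbedding) (by
    intro x hx
    simp only [C, Finset.mem_map, Finset.mem_union, Equiv.coe_toEmbedding, Equiv.subRight_apply,
      Equiv.coe_addRight]
    exact ⟨x - n, Or.inr ⟨x, hx, rfl⟩, by ring⟩), algInner_sum_right, algInner_sum_left, Finset.sum_map]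
  refine Finset.sum_congr rfl fun l _ => ?_
  simp only [dterm_apply, Equiv.coe_toEmbedding, Equiv.coe_addRight, algInner_sub_right,
    algInner_smul_right, algInner_cre, algInner_ann]
  rw [← algInner_conj ψ, ← algInner_conj ψ (_ - _), algInner_sub_right, algInner_smul_right]
  by_cases hn : n = 0
  · subst hn; by_cases h : InSea (r, l) <;> simp [h, algInner_conj]
  · simp [hn]

theorem single_insert (m : Mode) {S : Finset Mode} (hm : m ∉ S) :
    Finsupp.single (insert m S) (1 : ℂ) =
      jwSign m S • fop (!decide (InSea m)) m (Finsupp.single S 1) := by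
  have h1 : (Occ m S ↔ (!decide (InSea m)) = false) := by simp [Occ, hm]
  rw [fop_single, if_pos h1, Finsupp.smul_single, symmDiff_singleton_of_notMem hm, mul_one,
    smul_eq_mul, jwSign_mul_self]

/-- An operator commuting with the fermion operators vanishes if it annihilates the Dirac sea. -/
theorem eq_zero_of_commute {X : FockAlg →ₗ[ℂ] FockAlg}
    (hX : ∀ b m χ, X (fop b m χ) = fop b m (X χ)) (h0 : X vac = 0) (χ : FockAlg) : X χ = 0 := by
  have : ∀ S : Finset Mode, X (Finsupp.single S 1) = 0 := by
    intro S
    induction S using Finset.induction_on with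
    | empty => exact h0
    | insert m S hm ih => rw [single_insert m hm, map_smul, hX, ih, map_zero, smul_zero]
  induction χ using Finsupp.induction_linear with
  | zero => simp
  | add f g hf hg => rw [map_add, hf, hg, add_zero]
  | single S c =>
    have e2 : Finsupp.single S c = c • Finsupp.single S (1 : ℂ) := by simp
    rw [e2, map_smul, this, smul_zero]

/-- An operator commuting with the fermion operators is a multiple of the identity. -/
theorem eq_smul_of_commute {X : FockAlg →ₗ[ℂ] FockAlg}
    (hX : ∀ b m χ, X (fop b m χ) = fop b m (X χ)) (χ : FockAlg) : X χ = (X vac ∅) • χ := by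
  have h0 : X vac = (X vac ∅) • vac := by
    ext S
    rcases S.eq_empty_or_nonempty with rfl | ⟨m, hm⟩
    · simp [vac]
    · have h1 : fop (decide (InSea m)) m (X vac) (S ∆ {m}) = 0 := by
        rw [← hX, vac, fop_single, if_neg (by simp [Occ]), map_zero]; rfl
      have h2 : (Occ m (S ∆ {m}) ↔ decide (InSea m) = true) := by
        rw [occ_toggle_self]; simp [Occ, hm]
      rw [fop_apply, if_pos h2, symmDiff_symmDiff_cancel_right] at h1
      have h3 : jwSign m (S ∆ {m}) ≠ 0 := by simp [jwSign]
      rw [(mul_eq_zero.mp h1).resolve_left h3]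
      have : S ≠ ∅ := by rintro rfl; simp at hm
      rw [vac, Finsupp.smul_apply, Finsupp.single_eq_of_ne this, smul_zero]
  have := eq_zero_of_commute (X := X - (X vac ∅) • LinearMap.id)
    (fun b m χ => by simp [hX]) (by simp [sub_eq_zero]; exact h0) χ
  simpa [sub_eq_zero] using this

theorem exists_subset_Ico (A : Finset ℤ) (k : ℕ) : ∃ N : ℕ, k ≤ N ∧ A ⊆ Finset.Ico (-(N : ℤ)) N := by
  refine ⟨A.sup (fun x => x.natAbs + 1) + k, by omega, fun x hx => ?_⟩
  have := Finset.le_sup (f := fun x : ℤ => x.natAbs + 1) hx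
  simp only [Finset.mem_Ico] at *
  omega

/-- This is the spectral flow: the net number of sea levels crossing the Fermi point under a shift
by `n`. It produces both the anomalous term in the density commutators and the charge carried by a
Klein factor. The window has to be at least as wide as the shift for the count to be complete. -/
theorem sum_inSea_shift (r : ℤˣ) (n : ℤ) {N : ℕ} (hN : n.natAbs ≤ N) :
    ∑ l ∈ Finset.Ico (-(N : ℤ)) N, ((if InSea (r, l - n) then (1 : ℂ) else 0) -
      if InSea (r, l) then 1 else 0) = (r : ℤ) * n := by
  rw [Finset.sum_sub_distrib, Finset.sum_boole, Finset.sum_boole]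
  rcases Int.units_eq_one_or r with rfl | rfl
  · simp only [inSea_one]
    have e1 : (Finset.Ico (-(N : ℤ)) N).filter (fun l => l - n < 0) = Finset.Ico (-(N : ℤ)) n := by
      ext x; simp only [Finset.mem_filter, Finset.mem_Ico]; omega
    have e2 : (Finset.Ico (-(N : ℤ)) N).filter (fun l => l < 0) = Finset.Ico (-(N : ℤ)) 0 := by
      ext x; simp only [Finset.mem_filter, Finset.mem_Ico]; omega
    rw [e1, e2, ← Int.cast_natCast, ← Int.cast_natCast (R := ℂ), Int.card_Ico, Int.card_Ico,
      Int.toNat_of_nonneg (by omega), Int.toNat_of_nonneg (by omega)]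
    push_cast; simp
  · simp only [inSea_neg_one]
    have e1 : (Finset.Ico (-(N : ℤ)) N).filter (fun l => 0 ≤ l - n) = Finset.Ico n N := by
      ext x; simp only [Finset.mem_filter, Finset.mem_Ico]; omega
    have e2 : (Finset.Ico (-(N : ℤ)) N).filter (fun l => 0 ≤ l) = Finset.Ico (0 : ℤ) N := by
      ext x; simp only [Finset.mem_filter, Finset.mem_Ico]; omega
    rw [e1, e2, ← Int.cast_natCast, ← Int.cast_natCast (R := ℂ), Int.card_Ico, Int.card_Ico,
      Int.toNat_of_nonneg (by omega), Int.toNat_of_nonneg (by omega)]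
    push_cast; simp

/-- Formally the commutator is the difference of two translates of the same sum and would vanish. In
the sea both sums diverge, and only the termwise difference is meaningful. It counts the levels
between the two Fermi points. -/
theorem density_density_vac (r r' : ℤˣ) (n n' : ℤ) :
    (density r n (density r' n' vac) - density r' n' (density r n vac)) ∅ =
      if r = r' ∧ n + n' = 0 then ((r : ℤ) * n : ℂ) else 0 := by
  obtain ⟨A, hA⟩ := eventually_atTop.mp ((density_eventually r' n' vac).and
    (density_eventually r' n' (density r n vac)))
  obtain ⟨N, hN, hAN⟩ := exists_subset_Ico A n.natAbs
  obtain ⟨h1, h2⟩ := hA _ hAN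
  rw [h1, h2, map_sum, ← Finset.sum_sub_distrib]
  have : ∀ l, density r n (dterm r' n' l vac) - dterm r' n' l (density r n vac) =
      if r = r' then cre (r', l - n) (ann (r', l + n') vac) - cre (r', l) (ann (r', l + n' + n) vac)
      else 0 := by
    intro l
    simp only [dterm_apply, map_sub, map_smul, density_cre, density_ann]
    split_ifs <;> simp <;> abel
  rw [Finset.sum_congr rfl fun l _ => this l]
  by_cases hr : r = r'
  · subst hr
    simp only [if_true, true_and, Finsupp.finsetSum_apply, Finsupp.sub_apply, cre_ann_vac_apply,
      Prod.mk.injEq]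
    by_cases hn : n + n' = 0
    · have e : ∀ l, l - n = l + n' := fun l => by omega
      have e' : ∀ l, l = l + n' + n := fun l => by omega
      rw [if_pos hn, ← sum_inSea_shift r n hN]
      refine Finset.sum_congr rfl fun l _ => ?_
      rw [← e]
      simp
    · have e : ∀ l, ¬ l - n = l + n' := fun l => by omega
      have e' : ∀ l, ¬ l = l + n' + n := fun l => by omega
      simp [e, e', hn]
  · simp [hr]

/-- The commutation relations of the densities. -/
theorem density_comm (r r' : ℤˣ) (n n' : ℤ) (χ : FockAlg) :
    density r n (density r' n' χ) = density r' n' (density r n χ) +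
      (if r = r' ∧ n + n' = 0 then ((r : ℤ) * n : ℂ) else 0) • χ := by
  rw [← sub_eq_iff_eq_add', ← density_density_vac]
  -- Commutation with a density only shifts the momentum of a fermion operator, and such shifts
  -- commute. The commutator of two densities therefore commutes with all fermion operators.
  refine eq_smul_of_commute (X := density r n ∘ₗ density r' n' - density r' n' ∘ₗ density r n)
    (fun b m χ => ?_) χ
  obtain ⟨s, l⟩ := m
  cases b
  · simp only [fop_false, LinearMap.sub_apply, LinearMap.comp_apply, density_ann, map_sub]
    by_cases h1 : r = s <;> by_cases h2 : r' = s <;>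
      simp [h1, h2, density_ann, add_right_comm l n n'] <;> abel
  · simp only [fop_true, LinearMap.sub_apply, LinearMap.comp_apply, density_cre, map_sub, map_add]
    by_cases h1 : r = s <;> by_cases h2 : r' = s <;>
      simp [h1, h2, density_cre, sub_right_comm l n n'] <;> abel

/-! ### Kronig's identity in a finite window -/

/-- Kronig's identity in a finite system of fermion modes, for operators satisfying the canonical
anticommutation relations. -/
theorem kronig_finite {R : Type*} [Ring R] [Algebra ℂ R] (c cd : ℤ → R)
    (h1 : ∀ a b, c a * c b = -(c b * c a)) (h2 : ∀ a b, cd a * cd b = -(cd b * cd a))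
    (h3 : ∀ a b, c a * cd b = (if a = b then 1 else 0) - cd b * c a) (N : ℕ) :
    let Λ := Finset.Ico (-(N : ℤ)) N
    (2 : R) * ∑ a ∈ Λ, ∑ b ∈ Λ, ∑ x ∈ Λ, ∑ y ∈ Λ,
      (if a + x = b + y ∧ b < a then cd a * c b * (cd x * c y) else 0) =
    ∑ a ∈ Λ, ((2 * a + 1 : ℤ) : R) * (cd a * c a) - (∑ a ∈ Λ, cd a * c a) ^ 2 +
      (2 * N : R) * ∑ a ∈ Λ, cd a * c a := by
  intro Λ
  -- `P` collects the products in which the right factor lowers the label and the left one raises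
  -- it, `M` the opposite order, and `T` all momentum transfers. The identity follows by eliminating
  -- `M` and `T` from three relations: `T` is `P + M` plus the squared number operator, `M` is `P`
  -- minus the energy, and `T` is the window size times the number operator.
  set P := ∑ a ∈ Λ, ∑ b ∈ Λ, ∑ x ∈ Λ, ∑ y ∈ Λ,
      (if a + x = b + y ∧ b < a then cd a * c b * (cd x * c y) else 0) with hP
  set M := ∑ a ∈ Λ, ∑ b ∈ Λ, ∑ x ∈ Λ, ∑ y ∈ Λ,
      (if a + x = b + y ∧ a < b then cd a * c b * (cd x * c y) else 0) with hM
  set T := ∑ a ∈ Λ, ∑ b ∈ Λ, ∑ x ∈ Λ, ∑ y ∈ Λ,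
      (if a + x = b + y then cd a * c b * (cd x * c y) else 0) with hT
  have hcard : (Λ.card : R) = 2 * N := by
    simp only [Λ, Int.card_Ico]
    rw [show ((N : ℤ) - -(N : ℤ)).toNat = 2 * N by omega]; push_cast; rfl
  have eT : T = P + (∑ a ∈ Λ, cd a * c a) ^ 2 + M := by
    have : (∑ a ∈ Λ, cd a * c a) ^ 2 = ∑ a ∈ Λ, ∑ b ∈ Λ, ∑ x ∈ Λ, ∑ y ∈ Λ,
        (if a = b ∧ x = y then cd a * c b * (cd x * c y) else 0) := by
      rw [sq, Finset.sum_mul_sum]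
      refine Finset.sum_congr rfl fun a ha => ?_
      have : ∀ b ∈ Λ, (∑ x ∈ Λ, ∑ y ∈ Λ,
          if a = b ∧ x = y then cd a * c b * (cd x * c y) else 0) =
          if a = b then ∑ x ∈ Λ, cd a * c b * (cd x * c x) else 0 := by
        intro b _
        split_ifs with hab
        · refine Finset.sum_congr rfl fun x hx => ?_
          simp [hab, hx]
        · simp [hab]
      rw [Finset.sum_congr rfl this, Finset.sum_ite_eq, if_pos ha]
    rw [this, hT, hP, hM]
    simp only [← Finset.sum_add_distrib]
    refine Finset.sum_congr rfl fun a _ => Finset.sum_congr rfl fun b _ =>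
      Finset.sum_congr rfl fun x _ => Finset.sum_congr rfl fun y _ => ?_
    rcases lt_trichotomy a b with h | h | h
    · simp [h, h.ne, h.not_gt]
    · subst h; simp
    · simp [h, h.ne', h.not_gt]
  -- Exchanging the two factors turns `P` into `M` up to commutators, which for each pair `a < b`
  -- leave the difference of the occupation numbers of `b` and `a`. In total the occupation number
  -- of `a` is weighted by the number of labels below `a` minus the number above, which is `2a + 1`.
  have eM : M = P - ∑ a ∈ Λ, ((2 * a + 1 : ℤ) : R) * (cd a * c a) := by
    have e1 : P = ∑ a ∈ Λ, ∑ b ∈ Λ, ∑ x ∈ Λ, ∑ y ∈ Λ,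
        (if a + x = b + y ∧ a < b then cd x * c y * (cd a * c b) else 0) := by
      rw [hP]
      simp only [← Finset.sum_product' Λ Λ (fun _ _ => _)]
      rw [Finset.sum_comm]
      refine Finset.sum_congr rfl fun p _ => Finset.sum_congr rfl fun q _ => ?_
      refine if_congr ?_ rfl rfl
      omega
    rw [eq_sub_iff_add_eq, ← eq_sub_iff_add_eq', e1, hM]
    simp only [← Finset.sum_sub_distrib]
    have e2 : ∀ a ∈ Λ, ∀ b ∈ Λ, (∑ x ∈ Λ, ∑ y ∈ Λ,
        ((if a + x = b + y ∧ a < b then cd x * c y * (cd a * c b) else 0) -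
          if a + x = b + y ∧ a < b then cd a * c b * (cd x * c y) else 0)) =
        if a < b then cd b * c b - cd a * c a else 0 := by
      intro a ha b hb
      have : ∀ x ∈ Λ, ∀ y ∈ Λ,
        ((if a + x = b + y ∧ a < b then cd x * c y * (cd a * c b) else 0) -
          if a + x = b + y ∧ a < b then cd a * c b * (cd x * c y) else 0) =
          if b = x then (if a = y then (if a < b then cd b * c b - cd a * c a else 0) else 0)
            else 0 := by
        intro x _ y _
        have key : cd x * c y * (cd a * c b) - cd a * c b * (cd x * c y) =
            (if y = a then cd x * c b else 0) - (if b = x then cd a * c y else 0) := by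
          have i1 : cd x * c y * (cd a * c b) = (if y = a then cd x * c b else 0) -
              cd x * cd a * (c y * c b) := by
            rw [mul_assoc, ← mul_assoc (c y), h3]; split_ifs <;> noncomm_ring
          have i2 : cd a * c b * (cd x * c y) = (if b = x then cd a * c y else 0) -
              cd a * cd x * (c b * c y) := by
            rw [mul_assoc, ← mul_assoc (c b), h3]; split_ifs <;> noncomm_ring
          rw [i1, i2, h2 a x, h1 b y]; noncomm_ring
        by_cases hab : a < b
        · by_cases h : a + x = b + y
          · simp only [h, hab, and_self, if_true, key]
            by_cases hx : b = x
            · have hy : a = y := by omega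
              simp [hx, hy]
            · have hy : ¬ y = a := by omega
              simp [hx, hy]
          · have : ¬ (b = x ∧ a = y) := by omega
            simp only [h, false_and, if_false, sub_zero]
            by_cases hx : b = x
            · have hy : ¬ a = y := by omega
              simp [hx, hy]
            · simp [hx]
        · simp [hab]
      rw [Finset.sum_congr rfl fun x hx => Finset.sum_congr rfl fun y hy => this x hx y hy]
      simp [ha, hb]
    rw [Finset.sum_congr rfl fun a ha => Finset.sum_congr rfl fun b hb => e2 a ha b hb]
    have e3 : ∀ a ∈ Λ, ∀ b ∈ Λ, (if a < b then cd b * c b - cd a * c a else 0) =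
        (if a < b then cd b * c b else 0) - if a < b then cd a * c a else 0 := by
      intro a _ b _; split_ifs <;> simp
    rw [Finset.sum_congr rfl fun a ha => Finset.sum_congr rfl fun b hb => e3 a ha b hb]
    simp only [Finset.sum_sub_distrib]
    rw [Finset.sum_comm, ← Finset.sum_sub_distrib]
    refine Finset.sum_congr rfl fun a ha => ?_
    rw [← Finset.sum_filter, ← Finset.sum_filter, Finset.sum_const, Finset.sum_const]
    have f1 : Λ.filter (fun b => b < a) = Finset.Ico (-(N : ℤ)) a := by
      ext x; simp only [Λ, Finset.mem_filter, Finset.mem_Ico] at *; omega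
    have f2 : Λ.filter (fun b => a < b) = Finset.Ico (a + 1) N := by
      ext x; simp only [Λ, Finset.mem_filter, Finset.mem_Ico] at *; omega
    simp only [Λ, Finset.mem_Ico] at ha
    rw [f1, f2, Int.card_Ico, Int.card_Ico, nsmul_eq_mul, nsmul_eq_mul, ← sub_mul]
    congr 1
    rw [← Int.cast_natCast, ← Int.cast_natCast (R := R), Int.toNat_of_nonneg (by omega),
      Int.toNat_of_nonneg (by omega), ← Int.cast_sub]
    congr 1; ring
  -- Normal ordering yields one occupation number for each of the `2N` values of `b`. The quartic
  -- remainder changes sign under exchange of `b` and `y` while the constraint is symmetric, so it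
  -- equals its own negative and vanishes.
  have eT' : T = (2 * N : R) * ∑ a ∈ Λ, cd a * c a := by
    have e1 : ∀ a b x y, (if a + x = b + y then cd a * c b * (cd x * c y) else 0) =
        (if b = x then (if a = y then cd a * c a else 0) else 0) -
        if a + x = b + y then cd a * cd x * (c b * c y) else 0 := by
      intro a b x y
      have i2 : cd a * c b * (cd x * c y) = (if b = x then cd a * c y else 0) -
          cd a * cd x * (c b * c y) := by
        rw [mul_assoc, ← mul_assoc (c b), h3]; split_ifs <;> noncomm_ring
      by_cases h : a + x = b + y
      · simp only [h, if_true, i2]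
        by_cases hx : b = x
        · have hy : a = y := by omega
          simp [hx, hy]
        · simp [hx]
      · simp only [h, if_false, sub_zero]
        by_cases hx : b = x
        · have hy : ¬ a = y := by omega
          simp [hx, hy]
        · simp [hx]
    have e2 : ∑ a ∈ Λ, ∑ b ∈ Λ, ∑ x ∈ Λ, ∑ y ∈ Λ,
        (if a + x = b + y then cd a * cd x * (c b * c y) else 0) = 0 := by
      refine Finset.sum_eq_zero fun a _ => ?_
      have : ∑ b ∈ Λ, ∑ x ∈ Λ, ∑ y ∈ Λ,
          (if a + x = b + y then cd a * cd x * (c b * c y) else 0) =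
          -∑ b ∈ Λ, ∑ x ∈ Λ, ∑ y ∈ Λ,
          (if a + x = b + y then cd a * cd x * (c b * c y) else 0) := by
        conv_lhs => rw [Finset.sum_comm]
        conv_rhs => rw [Finset.sum_comm]
        rw [← Finset.sum_neg_distrib]
        refine Finset.sum_congr rfl fun x _ => ?_
        conv_lhs => rw [Finset.sum_comm]
        rw [← Finset.sum_neg_distrib]
        refine Finset.sum_congr rfl fun y _ => ?_
        rw [← Finset.sum_neg_distrib]
        refine Finset.sum_congr rfl fun b _ => ?_
        rw [add_comm b y]
        split_ifs
        · rw [h1 b y, mul_neg]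
        · simp
      have h0 : (2 : ℂ) • (∑ b ∈ Λ, ∑ x ∈ Λ, ∑ y ∈ Λ,
          (if a + x = b + y then cd a * cd x * (c b * c y) else 0)) = 0 := by
        rw [two_smul]; nth_rw 1 [this]; exact neg_add_cancel _
      exact (smul_eq_zero_iff_right two_ne_zero).mp h0
    rw [hT]
    simp only [e1, Finset.sum_sub_distrib]
    rw [e2, sub_zero, ← hcard, ← nsmul_eq_mul, Finset.smul_sum]
    refine Finset.sum_congr rfl fun a ha => ?_
    rw [← Finset.sum_const]
    refine Finset.sum_congr rfl fun b hb => ?_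
    simp [ha, hb]
  rw [eM] at eT
  rw [two_mul]
  have := eT.symm.trans eT'
  rw [← this]
  abel

open scoped symmDiff ComplexConjugate

/-! ### Labels ordered by energy, and Kronig's identity on the Fock space -/

/-- The modes of chirality `r`, ordered by the sign of their energy: negative labels are in the sea. -/
def idx (r : ℤˣ) (j : ℤ) : ℤ := if r = 1 then j else -j - 1

theorem idx_idx (r : ℤˣ) (j : ℤ) : idx r (idx r j) = j := by unfold idx; split_ifs <;> ring

theorem idx_injective (r : ℤˣ) : Function.Injective (idx r) :=
  Function.Involutive.injective (idx_idx r)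

theorem idx_add (r : ℤˣ) (j n : ℤ) : idx r j + r * n = idx r (j + n) := by
  rcases Int.units_eq_one_or r with rfl | rfl
  · simp [idx]
  · simp [idx]; ring

/-- The mode of chirality `r` with label `j`. -/
def md (r : ℤˣ) (j : ℤ) : Mode := (r, idx r j)

theorem inSea_md (r : ℤˣ) (j : ℤ) : InSea (md r j) ↔ j < 0 := by
  rcases Int.units_eq_one_or r with rfl | rfl
  · simp [md, idx, inSea_one]
  · simp only [md, idx, inSea_neg_one]
    rw [if_neg (by decide)]; omega

theorem md_injective (r : ℤˣ) : Function.Injective (md r) := fun _ _ h =>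
  idx_injective r (Prod.ext_iff.mp h).2

theorem md_idx (m : Mode) : md m.1 (idx m.1 m.2) = m := by simp [md, idx_idx]

/-- The charge of chirality `r`. -/
def chg (r : ℤˣ) (S : Finset Mode) : ℤ :=
  ∑ m ∈ S with m.1 = r, if InSea m then -1 else 1

/-- The energy of the excitations of chirality `r`, in units of `π v_F / L`. -/
def eng (r : ℤˣ) (S : Finset Mode) : ℕ :=
  ∑ m ∈ S with m.1 = r, (2 * m.2 + 1).natAbs

/-- All modes of chirality `r` in `S` have labels in `[-N, N)`. -/
def Within (r : ℤˣ) (S : Finset Mode) (N : ℕ) : Prop :=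
  ∀ j : ℤ, md r j ∈ S → j ∈ Finset.Ico (-(N : ℤ)) N

theorem exists_within (r : ℤˣ) (S T : Finset Mode) :
    ∃ N : ℕ, Within r S N ∧ Within r T N := by
  obtain ⟨N, -, h⟩ := exists_subset_Ico ((S ∪ T).image fun m => idx r m.2) 0
  have : ∀ j : ℤ, md r j ∈ S ∪ T → j ∈ Finset.Ico (-(N : ℤ)) N := fun j hj =>
    h (Finset.mem_image.mpr ⟨_, hj, by simp [md, idx_idx]⟩)
  exact ⟨N, fun j hj => this j (Finset.mem_union_left _ hj),
    fun j hj => this j (Finset.mem_union_right _ hj)⟩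

/-- The occupied labels of a window are those of the sea, corrected by the excitations with sign −1
for holes. The weight 1 then counts the charge, and the weight `2a + 1` the energy. -/
theorem sum_occ {r : ℤˣ} {S : Finset Mode} {N : ℕ} (h : Within r S N) (w : ℤ → ℤ) :
    ∑ a ∈ Finset.Ico (-(N : ℤ)) N, (if Occ (md r a) S then w a else 0) =
      ∑ a ∈ Finset.Ico (-(N : ℤ)) 0, w a +
      ∑ m ∈ S with m.1 = r, (if InSea m then -1 else 1) * w (idx r m.2) := by
  have e1 : ∀ a, (if Occ (md r a) S then w a else 0) = (if a < 0 then w a else 0) +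
      if md r a ∈ S then (if InSea (md r a) then -1 else 1) * w a else 0 := by
    intro a
    by_cases h1 : md r a ∈ S <;> by_cases h2 : a < 0 <;> simp [Occ, inSea_md, h1, h2]
  simp only [e1, Finset.sum_add_distrib]
  congr 1
  · rw [← Finset.sum_filter]
    congr 1
    ext x; simp only [Finset.mem_filter, Finset.mem_Ico]; omega
  · rw [← Finset.sum_filter]
    refine Finset.sum_bij' (fun a _ => md r a) (fun m _ => idx r m.2) ?_ ?_ ?_ ?_ ?_
    · intro a ha; simpa [md] using (Finset.mem_filter.mp ha).2
    · intro m hm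
      obtain ⟨h1, rfl⟩ := Finset.mem_filter.mp hm
      have : md m.1 (idx m.1 m.2) ∈ S := by rwa [md_idx]
      exact Finset.mem_filter.mpr ⟨h _ this, this⟩
    · intro a _; simp [md, idx_idx]
    · intro m hm
      obtain ⟨h1, rfl⟩ := Finset.mem_filter.mp hm
      exact md_idx m
    · intro a _; simp [md, idx_idx]

theorem sum_occ_one {r : ℤˣ} {S : Finset Mode} {N : ℕ} (h : Within r S N) :
    ∑ a ∈ Finset.Ico (-(N : ℤ)) N, (if Occ (md r a) S then (1 : ℤ) else 0) = N + chg r S := by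
  rw [sum_occ h (fun _ => 1)]
  simp [chg]

theorem sum_odd (N : ℕ) : ∑ a ∈ Finset.Ico (-(N : ℤ)) 0, (2 * a + 1) = -(N : ℤ) ^ 2 := by
  induction N with
  | zero => simp
  | succ N ih =>
    have : Finset.Ico (-((N + 1 : ℕ) : ℤ)) 0 = insert (-(N + 1 : ℤ)) (Finset.Ico (-(N : ℤ)) 0) := by
      ext x; simp only [Finset.mem_insert, Finset.mem_Ico]; push_cast; omega
    rw [this, Finset.sum_insert (by simp), ih]
    push_cast; ring

theorem sum_occ_odd {r : ℤˣ} {S : Finset Mode} {N : ℕ} (h : Within r S N) :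
    ∑ a ∈ Finset.Ico (-(N : ℤ)) N, (if Occ (md r a) S then (2 * a + 1 : ℤ) else 0) =
      -(N : ℤ) ^ 2 + eng r S := by
  rw [sum_occ h, sum_odd, eng]
  push_cast
  congr 1
  refine Finset.sum_congr rfl fun m hm => ?_
  obtain ⟨h1, rfl⟩ := Finset.mem_filter.mp hm
  obtain ⟨s, j, rfl⟩ : ∃ s j, m = md s j := ⟨m.1, idx m.1 m.2, (md_idx m).symm⟩
  simp only [inSea_md]
  simp only [md, idx_idx]
  rcases Int.units_eq_one_or s with rfl | rfl
  · rw [show idx 1 j = j from rfl]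
    by_cases hj : j < 0
    · simp only [hj, if_true, abs_of_neg (show 2 * j + 1 < 0 by omega)]; ring
    · simp only [hj, if_false, abs_of_nonneg (show 0 ≤ 2 * j + 1 by omega)]; ring
  · rw [show idx (-1) j = -j - 1 from rfl]
    by_cases hj : j < 0
    · simp only [hj, if_true, abs_of_nonneg (show 0 ≤ 2 * (-j - 1) + 1 by omega)]; ring
    · simp only [hj, if_false, abs_of_neg (show 2 * (-j - 1) + 1 < 0 by omega)]; ring

/-- The density with positive momentum in the direction of motion; it lowers the energy. -/
def low (r : ℤˣ) (n : ℕ) : FockAlg →ₗ[ℂ] FockAlg := density r (r * n)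

theorem low_single {r : ℤˣ} {S : Finset Mode} {N : ℕ} (h : Within r S N) {n : ℕ} (hn : n ≠ 0) :
    low r n (Finsupp.single S 1) = ∑ a ∈ Finset.Ico (-(N : ℤ)) N, ∑ b ∈ Finset.Ico (-(N : ℤ)) N,
      if b = a + n then cre (md r a) (ann (md r b) (Finsupp.single S 1)) else 0 := by
  obtain ⟨A, hA⟩ := eventually_atTop.mp (density_eventually r (r * n) (Finsupp.single S 1))
  have hterm : ∀ a : ℤ, dterm r (r * n) (idx r a) (Finsupp.single S 1) =
      cre (md r a) (ann (md r (a + n)) (Finsupp.single S 1)) := by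
    intro a
    rw [dterm_apply, idx_add]
    simp [md, hn]
  -- Below the window all modes are filled and above it all are empty. A hop downwards that leaves
  -- the window has either a filled target or an empty source.
  have hzero : ∀ a : ℤ, ¬ (a ∈ Finset.Ico (-(N : ℤ)) N ∧ a + n ∈ Finset.Ico (-(N : ℤ)) N) →
      cre (md r a) (ann (md r (a + n)) (Finsupp.single S (1 : ℂ))) = 0 := by
    intro a ha
    rw [cre_ann_single_of_ne (fun e => by have := md_injective r e; omega), if_neg]
    rintro ⟨h1, h2⟩
    simp only [Occ, inSea_md] at h1 h2
    have i1 := h a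
    have i2 := h (a + n)
    simp only [Finset.mem_Ico] at *
    by_cases j1 : md r a ∈ S
    · have := i1 j1
      by_cases j2 : md r (a + n) ∈ S
      · have := i2 j2; omega
      · have : ¬ (a < 0 ∧ a + n < 0 ∧ False) := by tauto
        simp only [j1, j2, true_iff, false_iff, not_lt] at h1 h2
        omega
    · by_cases j2 : md r (a + n) ∈ S
      · have := i2 j2
        simp only [j1, j2, true_iff, false_iff, not_lt] at h1 h2
        omega
      · simp only [j1, j2, false_iff, not_lt] at h1 h2
        omega
  have hsub : (Finset.Ico (-(N : ℤ)) N).image (idx r) ⊆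
      A ∪ (Finset.Ico (-(N : ℤ)) N).image (idx r) := Finset.subset_union_right
  rw [low, hA _ Finset.subset_union_left, ← Finset.sum_subset hsub, Finset.sum_image
    fun _ _ _ _ hab => idx_injective r hab]
  · refine Finset.sum_congr rfl fun a ha => ?_
    rw [hterm, Finset.sum_ite_eq']
    split_ifs with hb
    · rfl
    · exact hzero a fun hc => hb hc.2
  · intro l _ hl
    rw [← idx_idx r l, hterm, hzero]
    intro hc
    exact hl (Finset.mem_image.mpr ⟨_, hc.1, idx_idx r l⟩)

theorem low_single_eq_zero {r : ℤˣ} {S : Finset Mode} {N : ℕ} (h : Within r S N) {n : ℕ}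
    (hn : 2 * N < n) : low r n (Finsupp.single S 1) = 0 := by
  rw [low_single h (by omega)]
  refine Finset.sum_eq_zero fun a ha => Finset.sum_eq_zero fun b hb => if_neg ?_
  simp only [Finset.mem_Ico] at *
  omega

/-- The operator which multiplies the basis vector labelled by `S` by `f S`. -/
def diagOp (f : Finset Mode → ℂ) : FockAlg →ₗ[ℂ] FockAlg :=
  Finsupp.linearCombination ℂ (fun S => Finsupp.single S (f S))

theorem diagOp_single (f : Finset Mode → ℂ) (S : Finset Mode) (c : ℂ) :
    diagOp f (Finsupp.single S c) = f S • Finsupp.single S c := by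
  simp [diagOp, mul_comm]

theorem diagOp_apply (f : Finset Mode → ℂ) (χ : FockAlg) (S : Finset Mode) :
    diagOp f χ S = f S * χ S := by
  induction χ using Finsupp.induction_linear with
  | zero => simp
  | add f g hf hg => simp only [map_add, Finsupp.add_apply, hf, hg]; ring
  | single T c =>
    rw [diagOp_single]
    by_cases h : S = T
    · subst h; simp
    · simp [Finsupp.single_eq_of_ne h]

theorem sum_low_single {r : ℤˣ} {S T : Finset Mode} {N : ℕ} (hS : Within r S N)
    (hT : Within r T N) {k : ℕ} (hk : 2 * N ≤ k) :
    ∑ n ∈ Finset.range k, 2 * algInner (low r (n + 1) (Finsupp.single T 1))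
      (low r (n + 1) (Finsupp.single S 1)) =
    ((eng r S : ℂ) - (chg r S : ℂ) ^ 2) * algInner (Finsupp.single T 1) (Finsupp.single S 1) := by
  set Λ := Finset.Ico (-(N : ℤ)) N with hΛ
  set c : ℤ → Module.End ℂ FockAlg := fun a => ann (md r a) with hc
  set cd : ℤ → Module.End ℂ FockAlg := fun a => cre (md r a) with hcd
  have key := kronig_finite c cd
    (fun a b => LinearMap.ext fun χ => by simpa [hc] using ann_ann (md r a) (md r b) χ)
    (fun a b => LinearMap.ext fun χ => by simpa [hcd] using cre_cre (md r a) (md r b) χ)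
    (fun a b => LinearMap.ext fun χ => by
      have := ann_cre (md r a) (md r b) χ
      simp only [(md_injective r).eq_iff] at this
      simp only [hc, hcd, Module.End.mul_apply, LinearMap.sub_apply, this]
      split_ifs <;> rfl) N
  have key2 := LinearMap.congr_fun key (Finsupp.single S (1 : ℂ))
  have n1 : ∀ a, (cd a * c a) (Finsupp.single S (1 : ℂ)) =
      ((if Occ (md r a) S then (1 : ℤ) else 0 : ℤ) : ℂ) • Finsupp.single S (1 : ℂ) := by
    intro a
    simp only [hc, hcd, Module.End.mul_apply, cre_ann_self_single]
    split_ifs <;> simp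
  have n2 : (∑ a ∈ Λ, cd a * c a) (Finsupp.single S (1 : ℂ)) =
      ((N + chg r S : ℤ) : ℂ) • Finsupp.single S (1 : ℂ) := by
    rw [LinearMap.sum_apply, Finset.sum_congr rfl fun a _ => n1 a, ← Finset.sum_smul,
      ← Int.cast_sum, sum_occ_one hS]
  have n3 : (∑ a ∈ Λ, ((2 * a + 1 : ℤ) : Module.End ℂ FockAlg) * (cd a * c a))
      (Finsupp.single S (1 : ℂ)) =
      ((-(N : ℤ) ^ 2 + eng r S : ℤ) : ℂ) • Finsupp.single S (1 : ℂ) := by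
    rw [LinearMap.sum_apply, ← sum_occ_odd hS, Int.cast_sum, Finset.sum_smul]
    refine Finset.sum_congr rfl fun a _ => ?_
    rw [Module.End.mul_apply, n1, map_smul, Module.End.intCast_apply,
      ← Int.cast_smul_eq_zsmul ℂ, smul_smul]
    split_ifs <;> simp
  -- The dependence on the cutoff cancels: with energy E and charge Q, the expression (−N² + E) − (N
  -- + Q)² + 2N(N + Q) equals E − Q².
  have rhs : ((∑ a ∈ Λ, ((2 * a + 1 : ℤ) : Module.End ℂ FockAlg) * (cd a * c a) -
      (∑ a ∈ Λ, cd a * c a) ^ 2 + (2 * N : Module.End ℂ FockAlg) * ∑ a ∈ Λ, cd a * c a))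
      (Finsupp.single S (1 : ℂ)) =
      ((eng r S : ℂ) - (chg r S : ℂ) ^ 2) • Finsupp.single S (1 : ℂ) := by
    have e : (2 * N : Module.End ℂ FockAlg) = algebraMap ℂ (Module.End ℂ FockAlg) (2 * N) := by
      rw [map_mul, map_natCast, map_ofNat]
    rw [e, LinearMap.add_apply, LinearMap.sub_apply, n3, sq (∑ a ∈ Λ, cd a * c a), Module.End.mul_apply,
      Module.End.mul_apply, n2, map_smul, n2, Module.algebraMap_end_apply, smul_smul, smul_smul,
      ← sub_smul, ← add_smul]
    congr 1
    push_cast; ring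
  rw [rhs] at key2
  have key3 := congrArg (algInner (Finsupp.single T 1)) key2
  rw [algInner_smul_right] at key3
  rw [← key3]
  have two : (2 : Module.End ℂ FockAlg) = algebraMap ℂ (Module.End ℂ FockAlg) 2 := by
    rw [map_ofNat]
  rw [two, Module.End.mul_apply, Module.algebraMap_end_apply, algInner_smul_right, ← Finset.mul_sum]
  congr 1
  have e1 : ∀ n ∈ Finset.range k, algInner (low r (n + 1) (Finsupp.single T 1))
      (low r (n + 1) (Finsupp.single S 1)) = ∑ a ∈ Λ, ∑ b ∈ Λ, ∑ x ∈ Λ, ∑ y ∈ Λ,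
      if a = b + (n + 1 : ℕ) ∧ y = x + (n + 1 : ℕ) then
        algInner (Finsupp.single T 1) ((cd a * c b * (cd x * c y)) (Finsupp.single S 1)) else 0 := by
    intro n _
    rw [low_single hS (by omega), low_single hT (by omega)]
    simp only [algInner_sum_left]
    simp only [algInner_sum_right]
    rw [Finset.sum_comm]
    refine Finset.sum_congr rfl fun a _ => Finset.sum_congr rfl fun b _ =>
      Finset.sum_congr rfl fun x _ => Finset.sum_congr rfl fun y _ => ?_
    have base : algInner (cre (md r b) (ann (md r a) (Finsupp.single T 1)))
        (cre (md r x) (ann (md r y) (Finsupp.single S 1))) =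
        algInner (Finsupp.single T 1)
          ((cd a * c b * (cd x * c y)) (Finsupp.single S 1)) := by
      rw [← algInner_ann, ← algInner_cre]; rfl
    have z1 : ∀ φ : FockAlg, algInner 0 φ = 0 := fun φ => by simp [algInner]
    have z2 : ∀ φ : FockAlg, algInner φ 0 = 0 := fun φ => by simp [algInner]
    split_ifs with h1 h2 h3 h4 h5
    all_goals first | exact base | exact z1 _ | exact z2 _ | (exfalso; tauto)
  rw [Finset.sum_congr rfl e1, Finset.sum_comm]
  simp only [LinearMap.sum_apply, algInner_sum_right]
  refine Finset.sum_congr rfl fun a ha => ?_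
  rw [Finset.sum_comm]
  refine Finset.sum_congr rfl fun b hb => ?_
  rw [Finset.sum_comm]
  refine Finset.sum_congr rfl fun x _ => ?_
  rw [Finset.sum_comm]
  refine Finset.sum_congr rfl fun y _ => ?_
  simp only [Finset.mem_Ico] at ha hb
  split_ifs with h
  -- The pair `(a, b)` fixes the momentum transfer `n + 1 = a - b`. Since both labels lie in a
  -- window of length `2N ≤ k`, the index `n` is in the range of the sum.
  · rw [Finset.sum_eq_single_of_mem (a - b - 1).toNat (by simp only [Finset.mem_range]; omega)]
    · rw [if_pos (by omega)]
    · intro n _ hn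
      exact if_neg (by omega)
  · rw [Finset.sum_eq_zero]
    · simp [algInner]
    · intro n _
      exact if_neg (by omega)

/-- Kronig's identity as an identity of forms, free of cutoffs. It serves twice: it bosonizes the
free Hamiltonian, and, all diagonal terms being nonnegative, it shows that a basis vector with
energy equal to the squared charge is killed by every lowering density. -/
theorem hasSum_low (r : ℤˣ) (χ ψ : FockAlg) :
    HasSum (fun n : ℕ => 2 * algInner (low r (n + 1) χ) (low r (n + 1) ψ))
      (algInner χ (diagOp (fun S => (eng r S : ℂ) - (chg r S : ℂ) ^ 2) ψ)) := by
  induction χ using Finsupp.induction_linear with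
  | zero => simp [algInner]
  | add f g hf hg => simpa only [map_add, algInner_add_left, mul_add] using hf.add hg
  | single T c =>
    induction ψ using Finsupp.induction_linear with
    | zero => simp [algInner]
    | add f g hf hg => simpa only [map_add, algInner_add_right, mul_add] using hf.add hg
    | single S d =>
      have e1 : Finsupp.single S d = d • Finsupp.single S (1 : ℂ) := by simp
      have e2 : Finsupp.single T c = c • Finsupp.single T (1 : ℂ) := by simp
      rw [e1, e2]
      simp only [map_smul, algInner_smul_left, algInner_smul_right, diagOp_single]
      obtain ⟨N, hS, hT⟩ := exists_within r S T
      have := hasSum_sum_of_ne_finset_zero (s := Finset.range (2 * N)) (L := SummationFilter.unconditional ℕ)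
        (f := fun n : ℕ => 2 * algInner (low r (n + 1) (Finsupp.single T 1))
          (low r (n + 1) (Finsupp.single S 1))) (fun n hn => by
            rw [low_single_eq_zero hS (by simp at hn; omega)]; simp [algInner])
      rw [sum_low_single hS hT le_rfl] at this
      have h1 := this.mul_left (conj c * d)
      have h2 : ∀ z w : ℂ, conj c * d * (z * w) = z * (d * (conj c * w)) := fun z w => by ring
      have h3 : ∀ z w : ℂ, conj c * d * (z * w) = d * (z * (conj c * w)) := fun z w => by ring
      simp only [h2] at h1
      have h4 := h1.congr_fun (g := fun n : ℕ => 2 * (d * (conj c * algInner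
        (low r (n + 1) (Finsupp.single T 1)) (low r (n + 1) (Finsupp.single S 1)))))
        (fun n => rfl)
      rw [mul_left_comm] at h4
      exact h4

theorem low_eventually_zero (r : ℤˣ) (ψ : FockAlg) : ∀ᶠ n in atTop, low r n ψ = 0 := by
  induction ψ using Finsupp.induction_linear with
  | zero => simp
  | add f g hf hg => filter_upwards [hf, hg] with n h1 h2; rw [map_add, h1, h2, add_zero]
  | single S d =>
    obtain ⟨N, hS, -⟩ := exists_within r S S
    filter_upwards [eventually_gt_atTop (2 * N)] with n hn
    have e1 : Finsupp.single S d = d • Finsupp.single S (1 : ℂ) := by simp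
    rw [e1, map_smul, low_single_eq_zero hS hn, smul_zero]

/-! ### Charges and energies of the basis vectors -/

theorem sum_filter_toggle (g : Mode → ℤ) (r : ℤˣ) (S : Finset Mode) (m : Mode) :
    ∑ x ∈ S ∆ {m} with x.1 = r, g x = ∑ x ∈ S with x.1 = r, g x +
      if m.1 = r then (if m ∈ S then -g m else g m) else 0 := by
  simp only [Finset.sum_filter]
  by_cases h : m ∈ S
  · rw [symmDiff_singleton_of_mem h, Finset.sum_erase_eq_sub h]
    split_ifs <;> ring
  · rw [symmDiff_singleton_of_notMem h, Finset.sum_insert h]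
    split_ifs <;> ring

theorem chg_toggle (r : ℤˣ) (S : Finset Mode) (m : Mode) :
    chg r (S ∆ {m}) = chg r S + if m.1 = r then (if Occ m S then -1 else 1) else 0 := by
  rw [chg, sum_filter_toggle, chg]
  by_cases h : m ∈ S <;> by_cases h' : InSea m <;> simp [h, h', Occ]

theorem eng_toggle (r s : ℤˣ) (S : Finset Mode) (j : ℤ) :
    (eng r (S ∆ {md s j}) : ℤ) = eng r S +
      if s = r then (if Occ (md s j) S then -(2 * j + 1) else 2 * j + 1) else 0 := by
  have h0 : (((2 * (md s j).2 + 1).natAbs : ℕ) : ℤ) =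
      if InSea (md s j) then -(2 * j + 1) else 2 * j + 1 := by
    simp only [inSea_md]
    rcases Int.units_eq_one_or s with rfl | rfl
    · rw [show (md 1 j).2 = j from rfl]; split_ifs <;> omega
    · rw [show (md (-1) j).2 = -j - 1 from rfl]; split_ifs <;> omega
  simp only [eng, Nat.cast_sum]
  rw [sum_filter_toggle (fun m => (((2 * m.2 + 1).natAbs : ℕ) : ℤ)), h0]
  rw [show (md s j).1 = s from rfl]
  by_cases h : md s j ∈ S <;> by_cases h' : InSea (md s j) <;> simp [h, h', Occ]

theorem charge_single (r : ℤˣ) (S : Finset Mode) (c : ℂ) :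
    charge r (Finsupp.single S c) = (chg r S : ℂ) • Finsupp.single S c := by
  obtain ⟨A, hA1, hA2⟩ := ((density_eventually r 0 (Finsupp.single S c)).and
    (eventually_ge_atTop ((S.filter (fun m => m.1 = r)).image Prod.snd))).exists
  rw [charge, hA1]
  have : ∀ l, dterm r 0 l (Finsupp.single S c) =
      ((if (r, l) ∈ S then (if InSea (r, l) then -1 else 1) else 0 : ℤ) : ℂ) •
        Finsupp.single S c := by
    intro l
    rw [dterm_apply, add_zero, cre_ann_self_single]
    by_cases h : (r, l) ∈ S <;> by_cases h' : InSea (r, l) <;> simp [Occ, h, h']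
  rw [Finset.sum_congr rfl fun l _ => this l, ← Finset.sum_smul, ← Int.cast_sum, chg]
  congr 2
  rw [← Finset.sum_filter]
  refine Finset.sum_bij' (fun l _ => (r, l)) (fun m _ => m.2) ?_ ?_ ?_ ?_ ?_
  · intro l hl; simpa using (Finset.mem_filter.mp hl).2
  · intro m hm
    obtain ⟨h1, rfl⟩ := Finset.mem_filter.mp hm
    exact Finset.mem_filter.mpr ⟨hA2 (Finset.mem_image_of_mem _ hm), h1⟩
  · intro l _; rfl
  · intro m hm
    obtain ⟨h1, rfl⟩ := Finset.mem_filter.mp hm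
    rfl
  · intro l _; rfl

theorem charge_eq_diagOp (r : ℤˣ) : charge r = diagOp (fun S => (chg r S : ℂ)) :=
  Finsupp.lhom_ext fun S c => by rw [charge_single, diagOp_single]

theorem algInner_self (χ : FockAlg) : algInner χ χ = ((‖toFock χ‖ ^ 2 : ℝ) : ℂ) := by
  rw [algInner, inner_self_eq_norm_sq_to_K]; simp

theorem hasSum_norm_low (r : ℤˣ) (S : Finset Mode) :
    HasSum (fun n : ℕ => 2 * ‖toFock (low r (n + 1) (Finsupp.single S 1))‖ ^ 2)
      ((eng r S : ℝ) - (chg r S : ℝ) ^ 2) := by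
  have := hasSum_low r (Finsupp.single S 1) (Finsupp.single S 1)
  rw [diagOp_single, algInner_smul_right, algInner_single_left] at this
  simp only [algInner_self] at this
  rw [← Complex.hasSum_ofReal]
  convert this using 1
  · ext n; push_cast; rfl
  · simp

theorem low_eq_zero_of_eng {r : ℤˣ} {S : Finset Mode} (h : (eng r S : ℝ) = (chg r S : ℝ) ^ 2) {n : ℕ}
    (hn : n ≠ 0) : low r n (Finsupp.single S 1) = 0 := by
  have h1 := hasSum_norm_low r S
  rw [h, sub_self, hasSum_zero_iff_of_nonneg (fun n => by positivity)] at h1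
  have h2 := congrFun h1 (n - 1)
  rw [Nat.sub_add_cancel (Nat.pos_of_ne_zero hn)] at h2
  refine toFock_injective ?_
  rw [map_zero]
  simpa using h2

/-- If `b` were occupied above an empty `a`, then moving the particle from `b` to `a` would be one
term of the lowering density with transfer `b - a`. Different hops lead to different basis vectors,
so this term could not cancel, although the density annihilates the vector. -/
theorem occ_of_lt {r : ℤˣ} {S : Finset Mode} (h : (eng r S : ℝ) = (chg r S : ℝ) ^ 2) {a b : ℤ}
    (hab : a < b) (hb : Occ (md r b) S) : Occ (md r a) S := by
  by_contra ha
  obtain ⟨n, hn⟩ : ∃ n : ℕ, b = a + n := ⟨(b - a).toNat, by omega⟩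
  have hn0 : n ≠ 0 := by omega
  obtain ⟨N₀, hN₀, -⟩ := exists_within r S S
  obtain ⟨N, hNN, hNab⟩ := exists_subset_Ico {a, b} N₀
  have hN : Within r S N := fun j hj => by
    have := hN₀ j hj
    simp only [Finset.mem_Ico] at *
    omega
  have hne : ∀ i j : ℤ, i ≠ j → md r i ≠ md r j := fun i j hij e => hij (md_injective r e)
  have key := DFunLike.congr_fun (low_eq_zero_of_eng h hn0) (S ∆ {md r b} ∆ {md r a})
  have hterm : ∀ x y : ℤ, y = x + n → (x ≠ a ∨ y ≠ b) →
      cre (md r x) (ann (md r y) (Finsupp.single S (1 : ℂ))) (S ∆ {md r b} ∆ {md r a}) = 0 := by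
    intro x y hxy hx
    rw [cre_ann_single_of_ne (hne _ _ (by omega))]
    split_ifs with ho
    · refine Finsupp.single_eq_of_ne fun he => ?_
      have he1 : md r x ∈ S ∆ (S ∆ {md r b} ∆ {md r a}) := by
        rw [he, symmDiff_assoc S, symmDiff_symmDiff_cancel_left]
        simp [Finset.mem_symmDiff, hne x y (by omega)]
      have he2 : md r y ∈ S ∆ (S ∆ {md r b} ∆ {md r a}) := by
        rw [he, symmDiff_assoc S, symmDiff_symmDiff_cancel_left]
        simp [Finset.mem_symmDiff, hne y x (by omega)]
      rw [symmDiff_assoc S, symmDiff_symmDiff_cancel_left] at he1 he2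
      simp only [Finset.mem_symmDiff, Finset.mem_singleton, (md_injective r).eq_iff] at he1 he2
      omega
    · rfl
  rw [low_single hN hn0, Finsupp.finsetSum_apply, Finset.sum_eq_single_of_mem a (hNab (by simp)),
    Finsupp.finsetSum_apply, Finset.sum_eq_single_of_mem b (hNab (by simp)), if_pos hn,
    cre_ann_single_of_ne (hne _ _ (by omega)), if_pos ⟨hb, ha⟩] at key
  · simp [jwSign] at key
  · intro y _ hy
    split_ifs with hxy
    · exact hterm a y hxy (Or.inr hy)
    · rfl
  · intro x _ hx
    rw [Finsupp.finsetSum_apply]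
    refine Finset.sum_eq_zero fun y _ => ?_
    split_ifs with hxy
    · exact hterm x y hxy (Or.inl hx)
    · rfl

/-- A basis vector of minimal energy among those of equal charge is a Dirac sea filled to a
different level. -/
theorem occ_iff_lt_chg {r : ℤˣ} {S : Finset Mode} (h : (eng r S : ℝ) = (chg r S : ℝ) ^ 2) (j : ℤ) :
    Occ (md r j) S ↔ j < chg r S := by
  obtain ⟨N, hN, -⟩ := exists_within r S S
  -- By `occ_of_lt` the occupied labels form an initial segment of the window, and their number `N +
  -- chg r S` fixes where the segment ends.
  have hcount := sum_occ_one hN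
  rw [Finset.sum_boole] at hcount
  have hout : ∀ j : ℤ, j ∉ Finset.Ico (-(N : ℤ)) N → (Occ (md r j) S ↔ j < 0) := fun j hj => by
    have : md r j ∉ S := fun h' => hj (hN j h')
    simp [Occ, this, inSea_md]
  have hle := Finset.card_filter_le (Finset.Ico (-(N : ℤ)) N) (fun a => Occ (md r a) S)
  rw [Int.card_Ico] at hle
  by_cases hj : j ∈ Finset.Ico (-(N : ℤ)) N
  · simp only [Finset.mem_Ico] at hj
    constructor
    · intro ho
      have hsub : Finset.Ico (-(N : ℤ)) (j + 1) ⊆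
          (Finset.Ico (-(N : ℤ)) N).filter fun a => Occ (md r a) S := by
        intro a ha
        simp only [Finset.mem_Ico, Finset.mem_filter] at *
        refine ⟨by omega, ?_⟩
        rcases (show a < j ∨ a = j by omega) with h1 | rfl
        · exact occ_of_lt h h1 ho
        · exact ho
      have := Finset.card_le_card hsub
      rw [Int.card_Ico] at this
      have h2 : ((Finset.filter (fun a => Occ (md r a) S) (Finset.Ico (-(N : ℤ)) N)).card : ℤ) =
        N + chg r S := by exact_mod_cast hcount
      omega
    · intro hlt
      by_contra ho
      have hsub : ((Finset.Ico (-(N : ℤ)) N).filter fun a => Occ (md r a) S) ⊆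
          Finset.Ico (-(N : ℤ)) j := by
        intro a ha
        simp only [Finset.mem_Ico, Finset.mem_filter] at *
        refine ⟨ha.1.1, ?_⟩
        by_contra hc
        rcases (show j < a ∨ j = a by omega) with h1 | rfl
        · exact ho (occ_of_lt h h1 ha.2)
        · exact ho ha.2
      have := Finset.card_le_card hsub
      rw [Int.card_Ico] at this
      have h2 : ((Finset.filter (fun a => Occ (md r a) S) (Finset.Ico (-(N : ℤ)) N)).card : ℤ) =
        N + chg r S := by exact_mod_cast hcount
      omega
  · rw [hout j hj]
    have h2 : ((Finset.filter (fun a => Occ (md r a) S) (Finset.Ico (-(N : ℤ)) N)).card : ℤ) =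
        N + chg r S := by exact_mod_cast hcount
    simp only [Finset.mem_Ico] at hj
    omega

/-! ### Shifts of the Fermi points -/

/-- Shifts the momenta of chirality `r` by `w r`. -/
def shiftMode (w : ℤˣ → ℤ) : Mode ≃ Mode where
  toFun m := (m.1, m.2 + w m.1)
  invFun m := (m.1, m.2 - w m.1)
  left_inv m := by simp
  right_inv m := by simp

/-- The Dirac sea with shifted Fermi points. -/
def shiftSea (w : ℤˣ → ℤ) : Finset Mode :=
  (Finset.univ ×ˢ Finset.Ico (-(|w 1| + |w (-1)| + 1)) (|w 1| + |w (-1)| + 1)).filter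
    fun m => ¬ (InSea ((shiftMode w).symm m) ↔ InSea m)

theorem mem_shiftSea (w : ℤˣ → ℤ) (m : Mode) :
    m ∈ shiftSea w ↔ ¬ (InSea ((shiftMode w).symm m) ↔ InSea m) := by
  rw [shiftSea, Finset.mem_filter, and_iff_right_iff_imp]
  obtain ⟨r, l⟩ := m
  intro h
  simp only [Finset.mem_product, Finset.mem_univ, true_and, Finset.mem_Ico]
  have := inSea_congr_of_lt r (n := -w r) (l := l)
  have h1 : ¬ |w r| < |l| := fun hc => h (by
    rw [← abs_neg] at hc; exact (this hc).symm)
  have h2 : |w r| ≤ |w 1| + |w (-1)| := by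
    rcases Int.units_eq_one_or r with rfl | rfl
    · linarith [abs_nonneg (w (-1))]
    · linarith [abs_nonneg (w 1)]
  have := abs_le.mp (show |l| ≤ |w 1| + |w (-1)| by omega)
  omega

/-- The label of a basis vector after a shift of the occupied momenta. -/
def shiftSet (w : ℤˣ → ℤ) (S : Finset Mode) : Finset Mode :=
  S.map (shiftMode w).toEmbedding ∆ shiftSea w

theorem shiftSet_injective (w : ℤˣ → ℤ) : Function.Injective (shiftSet w) := fun S T h => by
  have := symmDiff_left_injective _ h
  exact Finset.map_injective _ this

theorem occ_shiftSet (w : ℤˣ → ℤ) (m : Mode) (S : Finset Mode) :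
    Occ (shiftMode w m) (shiftSet w S) ↔ Occ m S := by
  simp only [Occ, shiftSet, Finset.mem_symmDiff, mem_shiftSea, Finset.mem_map_equiv,
    Equiv.symm_apply_apply]
  tauto

theorem shiftSet_toggle (w : ℤˣ → ℤ) (m : Mode) (S : Finset Mode) :
    shiftSet w (S ∆ {m}) = shiftSet w S ∆ {shiftMode w m} := by
  ext x
  simp only [shiftSet, Finset.mem_symmDiff, Finset.mem_map_equiv, Finset.mem_singleton,
    Equiv.symm_apply_eq]
  tauto

theorem jwSign_symmDiff (m : Mode) (S T : Finset Mode) :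
    jwSign m (S ∆ T) = jwSign m S * jwSign m T := by
  induction T using Finset.induction_on with
  | empty => rw [← Finset.bot_eq_empty, symmDiff_bot]; simp [jwSign]
  | insert x T hx ih =>
    rw [← symmDiff_singleton_of_notMem hx, ← symmDiff_assoc, jwSign_toggle, jwSign_toggle, ih]
    split_ifs <;> ring

theorem jwSign_map (w : ℤˣ → ℤ) (m : Mode) (S : Finset Mode) :
    jwSign (shiftMode w m) (S.map (shiftMode w).toEmbedding) = jwSign m S := by
  unfold jwSign
  rw [Finset.filter_map, Finset.card_map]
  congr 2
  refine Finset.filter_congr fun x _ => ?_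
  obtain ⟨r, l⟩ := x
  obtain ⟨r', l'⟩ := m
  simp only [Function.comp, Equiv.coe_toEmbedding, shiftMode, Equiv.coe_fn_mk, Prod.Lex.toLex_lt_toLex]
  constructor
  · rintro (h | ⟨rfl, h⟩)
    · exact Or.inl h
    · exact Or.inr ⟨rfl, by simpa using h⟩
  · rintro (h | ⟨h1, h⟩)
    · exact Or.inl h
    · subst h1; exact Or.inr ⟨rfl, by simpa using h⟩

/-- The sign in the definition of the Klein factor. -/
def kleinSign (w : ℤˣ → ℤ) (S : Finset Mode) : ℂ := ∏ m ∈ S, jwSign (shiftMode w m) (shiftSea w)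

theorem kleinSign_toggle (w : ℤˣ → ℤ) (m : Mode) (S : Finset Mode) :
    kleinSign w (S ∆ {m}) = kleinSign w S * jwSign (shiftMode w m) (shiftSea w) := by
  unfold kleinSign
  by_cases h : m ∈ S
  · rw [symmDiff_singleton_of_mem h, ← Finset.prod_erase_mul _ _ h, mul_assoc, jwSign_mul_self,
      mul_one]
  · rw [symmDiff_singleton_of_notMem h, Finset.prod_insert h, mul_comm]

theorem kleinSign_mul_self (w : ℤˣ → ℤ) (S : Finset Mode) : kleinSign w S * kleinSign w S = 1 := by
  simp [kleinSign, ← Finset.prod_mul_distrib, jwSign_mul_self]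

theorem conj_kleinSign (w : ℤˣ → ℤ) (S : Finset Mode) : conj (kleinSign w S) = kleinSign w S := by
  simp [kleinSign, map_prod, conj_jwSign]

/-- The Klein factor: it shifts the momenta of the fermions of chirality `r` by `w r`. -/
def klein (w : ℤˣ → ℤ) : FockAlg →ₗ[ℂ] FockAlg :=
  Finsupp.linearCombination ℂ (fun S => Finsupp.single (shiftSet w S) (kleinSign w S))

theorem klein_single (w : ℤˣ → ℤ) (S : Finset Mode) (c : ℂ) :
    klein w (Finsupp.single S c) = Finsupp.single (shiftSet w S) (kleinSign w S * c) := by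
  simp [klein, mul_comm]

theorem klein_vac (w : ℤˣ → ℤ) : klein w vac = Finsupp.single (shiftSea w) 1 := by
  rw [vac, klein_single]
  have : shiftSet w ∅ = shiftSea w := by simp [shiftSet]
  simp [kleinSign, this]

/-- The sign of a shifted mode relative to `shiftSet w S` is its old sign times its sign relative to
`shiftSea w`. Each toggle changes `kleinSign` by exactly the latter factor, so the intertwining
relation holds without a stray sign. -/
theorem klein_fop (w : ℤˣ → ℤ) (b : Bool) (m : Mode) (χ : FockAlg) :
    klein w (fop b m χ) = fop b (shiftMode w m) (klein w χ) := by
  refine LinearMap.congr_fun (f := klein w ∘ₗ fop b m) (g := fop b (shiftMode w m) ∘ₗ klein w)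
    (Finsupp.lhom_ext fun S c => ?_) χ
  simp only [LinearMap.comp_apply, klein_single, fop_single, occ_shiftSet]
  split_ifs
  · rw [klein_single, shiftSet_toggle, kleinSign_toggle, shiftSet, jwSign_symmDiff, jwSign_map]
    congr 1; ring
  · simp

theorem algInner_klein (w : ℤˣ → ℤ) (χ ψ : FockAlg) :
    algInner (klein w χ) (klein w ψ) = algInner χ ψ := by
  induction χ using Finsupp.induction_linear with
  | zero => simp [algInner]
  | add f g hf hg => simp only [map_add, algInner_add_left, hf, hg]
  | single S c =>
    induction ψ using Finsupp.induction_linear with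
    | zero => simp [algInner]
    | add f g hf hg => simp only [map_add, algInner_add_right, hf, hg]
    | single T d =>
      rw [klein_single, klein_single, algInner_single_left, algInner_single_left]
      by_cases h : S = T
      · subst h
        simp only [Finsupp.single_eq_same, map_mul, conj_kleinSign]
        linear_combination (conj c * d) * kleinSign_mul_self w S
      · rw [Finsupp.single_eq_of_ne h, Finsupp.single_eq_of_ne ((shiftSet_injective w).ne h)]
        simp

/-- A shift of the momenta merely relabels the summands, but the Wick constants refer to the
unshifted sea. The mismatch occurs only at zero momentum, where it is the spectral flow; thus Klein
factors change charges and commute with bosons. -/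
theorem density_klein (w : ℤˣ → ℤ) (r : ℤˣ) (n : ℤ) (χ : FockAlg) :
    density r n (klein w χ) = klein w (density r n χ) +
      (if n = 0 then ((r : ℤ) * w r : ℂ) else 0) • klein w χ := by
  obtain ⟨A, hA⟩ := eventually_atTop.mp (density_eventually r n χ)
  obtain ⟨B, hB⟩ := eventually_atTop.mp (density_eventually r n (klein w χ))
  obtain ⟨N, hN, hAN⟩ := exists_subset_Ico (A ∪ B.map (Equiv.subRight (w r)).toEmbedding)
    (-w r).natAbs
  set Λ := Finset.Ico (-(N : ℤ)) N
  rw [hA Λ (Finset.union_subset_left hAN), hB (Λ.map (Equiv.addRight (w r)).toEmbedding) (by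
    intro x hx
    refine Finset.mem_map.mpr ⟨x - w r, hAN (Finset.mem_union_right _ ?_), by simp⟩
    exact Finset.mem_map.mpr ⟨x, hx, rfl⟩), Finset.sum_map, map_sum]
  have e : (if n = 0 then ((r : ℤ) * w r : ℂ) else 0) = ∑ l ∈ Λ, if n = 0 then
      (if InSea (r, l) then (1 : ℂ) else 0) - (if InSea (r, l + w r) then 1 else 0) else 0 := by
    split_ifs
    · have := sum_inSea_shift r (-w r) hN
      rw [← neg_inj, ← Finset.sum_neg_distrib] at this
      simp only [sub_neg_eq_add, neg_sub] at this
      rw [this]; push_cast; ring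
    · simp
  rw [e, Finset.sum_smul, ← Finset.sum_add_distrib]
  refine Finset.sum_congr rfl fun l _ => ?_
  have h1 : klein w (cre (r, l) (ann (r, l + n) χ)) =
      cre (r, l + w r) (ann (r, l + w r + n) (klein w χ)) := by
    rw [← fop_true, klein_fop, ← fop_false, klein_fop]
    simp only [shiftMode, Equiv.coe_fn_mk, fop_true, fop_false]
    rw [add_right_comm]
  simp only [dterm_apply, Equiv.coe_toEmbedding, Equiv.coe_addRight, map_sub, map_smul, h1]
  by_cases hn : n = 0
  · simp only [hn, true_and, if_true, add_zero, sub_smul]; abel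
  · simp [hn]

/-- Minimal energy for both chiralities means that each is filled exactly up to the label given by
its charge. Labels increase with `r` times the momentum, hence the factor `r` in the shift. -/
theorem eq_shiftSea {S : Finset Mode} (h : ∀ r, (eng r S : ℝ) = (chg r S : ℝ) ^ 2) :
    S = shiftSea (fun r => r * chg r S) := by
  ext m
  obtain ⟨s, j, rfl⟩ : ∃ s j, m = md s j := ⟨m.1, idx m.1 m.2, (md_idx m).symm⟩
  have h1 := occ_iff_lt_chg (h s) j
  have h2 : (shiftMode (fun r : ℤˣ => (r : ℤ) * chg r S)).symm (md s j) = md s (j - chg s S) := by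
    simp only [shiftMode, Equiv.coe_fn_symm_mk, md]
    rw [sub_eq_add_neg, ← mul_neg, idx_add, sub_eq_add_neg]
  rw [mem_shiftSea, h2]
  simp only [Occ, inSea_md] at *
  have : j - chg s S < 0 ↔ j < chg s S := by omega
  rw [this]
  tauto

/-! ### The Fock basis generated by canonical commutation relations -/

/-- The canonical commutation relations for annihilation operators `a` and creation operators `ad`. -/
structure CCR {𝕜 J E : Type*} [RCLike 𝕜] [DecidableEq J] [AddCommGroup E] [Module 𝕜 E]
    (a ad : J → E →ₗ[𝕜] E) : Prop where
  comm_ann : ∀ i j x, a i (a j x) = a j (a i x)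
  comm_cre : ∀ i j x, ad i (ad j x) = ad j (ad i x)
  comm : ∀ i j x, a i (ad j x) = ad j (a i x) + if i = j then x else 0

theorem finsupp_nat_induction {J : Type*} [DecidableEq J] {P : (J →₀ ℕ) → Prop} (h0 : P 0)
    (h1 : ∀ m j, P m → P (m + Finsupp.single j 1)) (m : J →₀ ℕ) : P m := by
  have : ∀ s : Multiset J, P (Multiset.toFinsupp s) := by
    intro s
    induction s using Multiset.induction with
    | empty => simpa using h0
    | cons a s ih =>
      have : Multiset.toFinsupp (a ::ₘ s) = Multiset.toFinsupp s + Finsupp.single a 1 := by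
        rw [← Multiset.singleton_add, map_add, Multiset.toFinsupp_singleton, add_comm]
      rw [this]; exact h1 _ _ ih
  simpa using this (Finsupp.toMultiset m)

section FockBasis

variable {𝕜 J E : Type*} [RCLike 𝕜] [DecidableEq J] [AddCommGroup E] [Module 𝕜 E]

/-- The creation operators generate a commutative monoid of endomorphisms, in which a product over a
finitely supported exponent does not depend on any order. -/
theorem exists_raised (ad : J → E →ₗ[𝕜] E) (h : ∀ i j x, ad i (ad j x) = ad j (ad i x)) (Ω : E) :
    ∃ f : (J →₀ ℕ) → E, f 0 = Ω ∧ ∀ j m, ad j (f m) = f (m + Finsupp.single j 1) := by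
  have hc : ∀ x ∈ Set.range ad, ∀ y ∈ Set.range ad,
      (x : Module.End 𝕜 E) * (y : Module.End 𝕜 E) = (y : Module.End 𝕜 E) * x := by
    rintro _ ⟨i, rfl⟩ _ ⟨j, rfl⟩
    exact LinearMap.ext (h i j)
  let : CommMonoid (Submonoid.closure (Set.range ad : Set (Module.End 𝕜 E))) :=
    { mul_comm := (Submonoid.isMulCommutative_closure (Module.End 𝕜 E) hc).is_comm.comm }
  let x : J → Submonoid.closure (Set.range ad : Set (Module.End 𝕜 E)) := fun j =>
    ⟨ad j, Submonoid.subset_closure ⟨j, rfl⟩⟩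
  refine ⟨fun m => ((m.prod fun j k => x j ^ k : Submonoid.closure (Set.range ad)) :
    Module.End 𝕜 E) Ω, by simp, fun j m => ?_⟩
  beta_reduce
  rw [add_comm, Finsupp.prod_add_index' (by simp) (fun _ _ _ => pow_add _ _ _),
    Finsupp.prod_single_index (h := fun i k => x i ^ k) (pow_zero _), pow_one]
  rfl

/-- Only the relations and a vacuum are needed, not an inner product: the monomials in the creation
operators are divided by the square roots of factorials. The construction is applied both to the
bosons on the fermion space and to the transformed bosons on functions of occupation numbers. The
truncated subtraction at an empty mode is harmless because its coefficient is zero. -/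
theorem exists_fockBasis {a ad : J → E →ₗ[𝕜] E} (h : CCR a ad) {Ω : E} (hΩ : ∀ j, a j Ω = 0) :
    ∃ e : (J →₀ ℕ) → E, e 0 = Ω ∧
      (∀ j m, ad j (e m) = ((√(m j + 1) : ℝ) : 𝕜) • e (m + Finsupp.single j 1)) ∧
      ∀ j m, a j (e m) = ((√(m j) : ℝ) : 𝕜) • e (m - Finsupp.single j 1) := by
  obtain ⟨f, hf0, hf⟩ := exists_raised ad h.comm_cre Ω
  have ha : ∀ j m, a j (f m) = (m j : 𝕜) • f (m - Finsupp.single j 1) := by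
    intro j m
    induction m using finsupp_nat_induction with
    | h0 => simp [hf0, hΩ]
    | h1 m i ih =>
      rw [← hf, h.comm, ih, map_smul, hf]
      by_cases hij : j = i
      · subst hij
        rw [if_pos rfl, add_tsub_cancel_right]
        by_cases hm : m j = 0
        · simp [hm]
        · rw [tsub_add_cancel_of_le (by simpa using Nat.one_le_iff_ne_zero.mpr hm)]
          simp [add_smul]
      · rw [if_neg hij, add_zero]
        have h1 : (m + Finsupp.single i 1 : J →₀ ℕ) j = m j := by
          simp [Ne.symm hij]
        rw [h1]
        by_cases hm : m j = 0
        · simp [hm]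
        · congr 2
          ext k
          simp only [Finsupp.add_apply, Finsupp.tsub_apply, Finsupp.single_apply]
          by_cases hk : j = k
          · subst hk; simp [Ne.symm hij]
          · simp [hk]
  let N : (J →₀ ℕ) → ℝ := fun m => m.prod fun _ k => √(k.factorial)
  have hN0 : ∀ m, N m ≠ 0 := fun m => by
    refine Finset.prod_ne_zero_iff.mpr fun j _ => ?_
    positivity
  have hN : ∀ m j, N (m + Finsupp.single j 1) = N m * √(m j + 1) := by
    intro m j
    have e1 : N m = √((m j).factorial) * (m.erase j).prod fun _ k => √(k.factorial) :=
      (Finsupp.mul_prod_erase' m j _ (by simp)).symm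
    have e2 : N (m + Finsupp.single j 1) = √((m j + 1).factorial) *
        ((m + Finsupp.single j 1).erase j).prod fun _ k => √(k.factorial) := by
      have := (Finsupp.mul_prod_erase' (m + Finsupp.single j 1) j (fun _ k => √(k.factorial))
        (by simp)).symm
      simpa [N] using this
    have e3 : (m + Finsupp.single j 1).erase j = m.erase j := by
      rw [Finsupp.erase_add, Finsupp.erase_single, add_zero]
    rw [e1, e2, e3, Nat.factorial_succ]
    push_cast
    rw [Real.sqrt_mul (by positivity)]; ring
  refine ⟨fun m => (((N m)⁻¹ : ℝ) : 𝕜) • f m, by simp [N, hf0], fun j m => ?_, fun j m => ?_⟩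
  · simp only [map_smul, hf, smul_smul]
    congr 1
    rw [hN, ← RCLike.ofReal_mul]
    congr 1
    have := hN0 m
    have h2 : √((m j : ℝ) + 1) ≠ 0 := by positivity
    field_simp
  · simp only [map_smul, ha, smul_smul]
    by_cases hm : m j = 0
    · simp [hm]
    · congr 1
      have hle : Finsupp.single j 1 ≤ m := by simpa using Nat.one_le_iff_ne_zero.mpr hm
      have h3 := hN (m - Finsupp.single j 1) j
      rw [tsub_add_cancel_of_le hle] at h3
      have h4 : (((m - Finsupp.single j 1 : J →₀ ℕ) j : ℕ) : ℝ) + 1 = m j := by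
        simp only [Finsupp.tsub_apply, Finsupp.single_eq_same]
        rw [Nat.cast_sub (Nat.one_le_iff_ne_zero.mpr hm)]; simp
      rw [h4] at h3
      have h5 := hN0 (m - Finsupp.single j 1)
      have h6 : √(m j : ℝ) ≠ 0 := by
        have : (0 : ℝ) < m j := by exact_mod_cast Nat.pos_of_ne_zero hm
        positivity
      rw [← RCLike.ofReal_natCast, ← RCLike.ofReal_mul, ← RCLike.ofReal_mul, h3]
      congr 1
      field_simp
      rw [Real.sq_sqrt (by positivity)]

/-- Adjointness moves one creation operator across the inner product and lowers the other index,
which is an induction on the occupation numbers that ends at the vacuum. -/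
theorem orthonormal_fockBasis {H : Type*} [NormedAddCommGroup H] [InnerProductSpace 𝕜 H]
    {a ad : J → E →ₗ[𝕜] E} (ι : E →ₗ[𝕜] H)
    (hadj : ∀ j x y, inner 𝕜 (ι (ad j x)) (ι y) = inner 𝕜 (ι x) (ι (a j y)))
    {e : (J →₀ ℕ) → E}
    (had : ∀ j m, ad j (e m) = ((√(m j + 1) : ℝ) : 𝕜) • e (m + Finsupp.single j 1))
    (ha : ∀ j m, a j (e m) = ((√(m j) : ℝ) : 𝕜) • e (m - Finsupp.single j 1))
    (h0 : ‖ι (e 0)‖ = 1) : Orthonormal 𝕜 (fun m => ι (e m)) := by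
  rw [orthonormal_iff_ite]
  have hne : ∀ (m : J →₀ ℕ) j, ((√(m j + 1) : ℝ) : 𝕜) ≠ 0 := fun m j =>
    RCLike.ofReal_ne_zero.mpr (by positivity)
  have key : ∀ (m k : J →₀ ℕ) j, ((√(m j + 1) : ℝ) : 𝕜) *
      inner 𝕜 (ι (e (m + Finsupp.single j 1))) (ι (e k)) =
      ((√(k j) : ℝ) : 𝕜) * inner 𝕜 (ι (e m)) (ι (e (k - Finsupp.single j 1))) := by
    intro m k j
    have := hadj j (e m) (e k)
    rwa [had, ha, map_smul, map_smul, inner_smul_left, inner_smul_right, RCLike.conj_ofReal] at this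
  intro m
  induction m using finsupp_nat_induction with
  | h0 =>
    intro k
    rcases eq_or_ne 0 k with rfl | hk
    · rw [inner_self_eq_norm_sq_to_K, h0]; simp
    · rw [if_neg hk]
      obtain ⟨j, hj⟩ := Finsupp.ne_iff.mp hk.symm
      have h1 := key (k - Finsupp.single j 1) 0 j
      have hle : Finsupp.single j 1 ≤ k := by simpa using Nat.one_le_iff_ne_zero.mpr hj
      rw [tsub_add_cancel_of_le hle] at h1
      simp only [Finsupp.coe_zero, Pi.zero_apply, Nat.cast_zero, Real.sqrt_zero, RCLike.ofReal_zero,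
        zero_mul] at h1
      rw [← inner_conj_symm, (mul_eq_zero.mp h1).resolve_left (hne _ _), map_zero]
  | h1 m j ih =>
    intro k
    refine mul_left_cancel₀ (hne m j) ?_
    rw [key, ih]
    by_cases hk : k j = 0
    · have : m + Finsupp.single j 1 ≠ k := by rintro rfl; simp at hk
      simp [hk, this]
    · have hle : Finsupp.single j 1 ≤ k := by simpa using Nat.one_le_iff_ne_zero.mpr hk
      have : m = k - Finsupp.single j 1 ↔ m + Finsupp.single j 1 = k := by
        constructor
        · rintro rfl; exact tsub_add_cancel_of_le hle
        · rintro rfl; simp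
      by_cases h2 : m + Finsupp.single j 1 = k
      · rw [if_pos h2, if_pos (this.mpr h2), ← h2]; simp
      · rw [if_neg h2, if_neg (fun h3 => h2 (this.mp h3)), mul_zero, mul_zero]

/-! ### Bogoliubov transformations -/

/-- The partner of a mode under the Bogoliubov transformation. -/
def bar (j : ℤˣ × ℕ) : ℤˣ × ℕ := (-j.1, j.2)

theorem bar_bar (j : ℤˣ × ℕ) : bar (bar j) = j := by simp [bar]

theorem bar_ne (j : ℤˣ × ℕ) : bar j ≠ j := fun h => by
  have h1 : -j.1 = j.1 := congrArg Prod.fst h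
  rcases Int.units_eq_one_or j.1 with h2 | h2 <;> rw [h2] at h1 <;> exact absurd h1 (by decide)

theorem bar_snd (j : ℤˣ × ℕ) : (bar j).2 = j.2 := rfl

/-- The annihilation operators after a Bogoliubov transformation. -/
def bog (c s : ℕ → ℝ) (a ad : ℤˣ × ℕ → E →ₗ[𝕜] E) (j : ℤˣ × ℕ) : E →ₗ[𝕜] E :=
  ((c j.2 : ℝ) : 𝕜) • a j + ((s j.2 : ℝ) : 𝕜) • ad (bar j)

/-- A mode and its partner share the coefficients `c` and `s`, so the mixed commutators cancel in
pairs. The remaining one is `c² - s²` times the original. -/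
theorem CCR.bog {a ad : ℤˣ × ℕ → E →ₗ[𝕜] E} (h : CCR a ad) {c s : ℕ → ℝ}
    (hcs : ∀ n, c n ^ 2 - s n ^ 2 = 1) : CCR (bog c s a ad) (bog c s ad a) := by
  have hb : ∀ i j, i = bar j ↔ bar i = j := fun i j =>
    ⟨fun e => by rw [e, bar_bar], fun e => by rw [← e, bar_bar]⟩
  have hinj : ∀ i j, bar i = bar j ↔ i = j := fun i j => by rw [← hb, bar_bar]
  have hcm : ∀ i j x, ad j (a i x) = a i (ad j x) - if i = j then x else 0 := fun i j x => by
    rw [h.comm]; simp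
  refine ⟨fun i j x => ?_, fun i j x => ?_, fun i j x => ?_⟩
  · simp only [Luttinger.bog, LinearMap.add_apply, LinearMap.smul_apply, map_add, map_smul, h.comm,
      h.comm_ann i j, h.comm_cre (bar i), smul_add, smul_smul]
    have e1 : (j = bar i) ↔ (i = bar j) := by rw [hb i j, eq_comm]
    simp only [e1]
    split_ifs with hij
    · have e2 : i.2 = j.2 := by rw [hij]; rfl
      rw [e2]; module
    · module
  · simp only [Luttinger.bog, LinearMap.add_apply, LinearMap.smul_apply, map_add, map_smul, h.comm,
      h.comm_ann (bar i), h.comm_cre i j, smul_add, smul_smul]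
    have e1 : (bar i = j) ↔ (bar j = i) := by rw [← hb, eq_comm]
    simp only [e1]
    split_ifs with hij
    · have e2 : i.2 = j.2 := by rw [← hij]; rfl
      rw [e2]; module
    · module
  · have e0 : ((c i.2 : ℝ) : 𝕜) * c i.2 = 1 + s i.2 * s i.2 := by
      have := hcs i.2
      rw [← RCLike.ofReal_mul, ← RCLike.ofReal_mul, ← RCLike.ofReal_one, ← RCLike.ofReal_add]
      congr 1; linarith
    simp only [Luttinger.bog, LinearMap.add_apply, LinearMap.smul_apply, map_add, map_smul, h.comm,
      h.comm_ann i (bar j), h.comm_cre (bar i) j, smul_add, smul_smul, hinj]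
    by_cases hij : i = j
    · subst hij
      simp only [if_true, e0]
      module
    · simp only [if_neg hij, if_neg (Ne.symm hij)]
      module

end FockBasis

/-! ### Bosonization -/

/-- Boson modes: chirality `r` and momentum `r 2 π (n + 1) / L`. -/
abbrev BMode : Type := ℤˣ × ℕ

/-- Boson occupation numbers. -/
abbrev BOcc : Type := BMode →₀ ℕ

/-- The boson annihilation operators. -/
def bos (j : BMode) : FockAlg →ₗ[ℂ] FockAlg :=
  ((√(j.2 + 1))⁻¹ : ℂ) • density j.1 (j.1 * (j.2 + 1))

/-- The boson creation operators. -/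
def bosd (j : BMode) : FockAlg →ₗ[ℂ] FockAlg :=
  ((√(j.2 + 1))⁻¹ : ℂ) • density j.1 (-(j.1 * (j.2 + 1)))

theorem sqrt_ne (n : ℕ) : ((√(n + 1) : ℝ) : ℂ) ≠ 0 :=
  Complex.ofReal_ne_zero.mpr (by positivity)

theorem density_pos (j : BMode) (χ : FockAlg) :
    density j.1 (j.1 * (j.2 + 1)) χ = ((√(j.2 + 1) : ℝ) : ℂ) • bos j χ := by
  rw [bos, LinearMap.smul_apply, smul_smul, mul_inv_cancel₀ (sqrt_ne _), one_smul]

theorem density_neg (j : BMode) (χ : FockAlg) :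
    density j.1 (-(j.1 * (j.2 + 1))) χ = ((√(j.2 + 1) : ℝ) : ℂ) • bosd j χ := by
  rw [bosd, LinearMap.smul_apply, smul_smul, mul_inv_cancel₀ (sqrt_ne _), one_smul]

theorem low_eq (r : ℤˣ) (n : ℕ) (χ : FockAlg) :
    low r (n + 1) χ = ((√(n + 1) : ℝ) : ℂ) • bos (r, n) χ := by
  have := density_pos (r, n) χ
  simp only at this
  rw [← this, low]; push_cast; rfl

theorem unit_mul_self (r : ℤˣ) : (r : ℤ) * r = 1 := by
  rcases Int.units_eq_one_or r with rfl | rfl <;> rfl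

theorem unit_cast_mul_self (r : ℤˣ) : ((r : ℤ) : ℂ) * (r : ℤ) = 1 := by
  exact_mod_cast congrArg (Int.cast : ℤ → ℂ) (unit_mul_self r)

theorem unit_ne_zero (r : ℤˣ) : (r : ℤ) ≠ 0 := r.ne_zero

/-- With momentum directed along the chirality, the anomalous term is `r · r (n + 1) = n + 1`,
positive for right- and left-movers alike. The square root in the definition normalizes it to one.
-/
theorem ccr_bos : CCR bos bosd := by
  refine ⟨fun i j x => ?_, fun i j x => ?_, fun i j x => ?_⟩
  · simp only [bos, LinearMap.smul_apply, map_smul]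
    rw [density_comm, if_neg, zero_smul, add_zero, smul_comm]
    rintro ⟨h1, h2⟩
    rw [h1, ← mul_add, mul_eq_zero] at h2
    have := unit_ne_zero j.1
    omega
  · simp only [bosd, LinearMap.smul_apply, map_smul]
    rw [density_comm, if_neg, zero_smul, add_zero, smul_comm]
    rintro ⟨h1, h2⟩
    rw [h1, ← neg_add, ← mul_add, neg_eq_zero, mul_eq_zero] at h2
    have := unit_ne_zero j.1
    omega
  · simp only [bos, bosd, LinearMap.smul_apply, map_smul]
    rw [density_comm, smul_add, smul_add, smul_comm]
    congr 1
    by_cases hij : i = j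
    · subst hij
      rw [if_pos ⟨rfl, by ring⟩, if_pos rfl, smul_smul, smul_smul]
      have h1 := sqrt_ne i.2
      have h2 : ((√(i.2 + 1) : ℝ) : ℂ) * (√(i.2 + 1) : ℝ) = (i.2 + 1 : ℂ) := by
        rw [← Complex.ofReal_mul, Real.mul_self_sqrt (by positivity)]; push_cast; rfl
      have h3 := unit_cast_mul_self i.1
      convert one_smul ℂ x
      push_cast
      field_simp
      rw [sq, sq, h3, one_mul]
      exact h2.symm
    · rw [if_neg hij, if_neg, zero_smul, smul_zero, smul_zero]
      rintro ⟨h1, h2⟩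
      rw [h1, ← sub_eq_add_neg, ← mul_sub, mul_eq_zero] at h2
      have := unit_ne_zero j.1
      exact hij (Prod.ext h1 (by omega))

theorem algInner_bosd (j : BMode) (χ ψ : FockAlg) :
    algInner (bosd j χ) ψ = algInner χ (bos j ψ) := by
  simp only [bos, bosd, LinearMap.smul_apply, algInner_smul_left, algInner_smul_right,
    algInner_density]
  simp

theorem bos_vac (j : BMode) : bos j vac = 0 := by
  have := low_eq_zero_of_eng (r := j.1) (S := ∅) (by simp [eng, chg]) (Nat.succ_ne_zero j.2)
  rw [Nat.succ_eq_add_one, low_eq] at this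
  exact (smul_eq_zero_iff_right (sqrt_ne _)).mp this

/-- The normalized boson states over the Dirac sea. -/
def bosVec : BOcc → FockAlg := (exists_fockBasis ccr_bos bos_vac).choose

theorem bosVec_zero : bosVec 0 = vac := (exists_fockBasis ccr_bos bos_vac).choose_spec.1

theorem bosd_bosVec (j : BMode) (m : BOcc) :
    bosd j (bosVec m) = ((√(m j + 1) : ℝ) : ℂ) • bosVec (m + Finsupp.single j 1) :=
  (exists_fockBasis ccr_bos bos_vac).choose_spec.2.1 j m

theorem bos_bosVec (j : BMode) (m : BOcc) :
    bos j (bosVec m) = ((√(m j) : ℝ) : ℂ) • bosVec (m - Finsupp.single j 1) :=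
  (exists_fockBasis ccr_bos bos_vac).choose_spec.2.2 j m

theorem orthonormal_bosVec : Orthonormal ℂ (fun m => toFock (bosVec m)) := by
  refine orthonormal_fockBasis toFock (fun j x y => algInner_bosd j x y) bosd_bosVec bos_bosVec ?_
  have := algInner_self (bosVec 0)
  rw [bosVec_zero, vac, algInner_single_left] at this
  simp only [map_one, Finsupp.single_eq_same, mul_one] at this
  have h2 : ‖toFock (Finsupp.single ∅ 1)‖ ^ 2 = 1 := by exact_mod_cast this.symm
  rw [bosVec_zero, vac]
  nlinarith [norm_nonneg (toFock (Finsupp.single ∅ (1 : ℂ)))]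

/-- Labels of the boson states: the shifts of the Fermi points and the boson occupation numbers. -/
abbrev BLabel : Type := (ℤˣ → ℤ) × BOcc

/-- The boson states over all the shifted Dirac seas. -/
def bosState (x : BLabel) : FockAlg := klein x.1 (bosVec x.2)

theorem bosd_klein (w : ℤˣ → ℤ) (j : BMode) (χ : FockAlg) :
    bosd j (klein w χ) = klein w (bosd j χ) := by
  have : -((j.1 : ℤ) * (j.2 + 1)) ≠ 0 := by
    rw [neg_ne_zero]; exact mul_ne_zero (unit_ne_zero _) (by omega)
  simp only [bosd, LinearMap.smul_apply, density_klein, if_neg this, zero_smul, add_zero, map_smul]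

theorem bos_klein (w : ℤˣ → ℤ) (j : BMode) (χ : FockAlg) :
    bos j (klein w χ) = klein w (bos j χ) := by
  have : ((j.1 : ℤ) * (j.2 + 1)) ≠ 0 := mul_ne_zero (unit_ne_zero _) (by omega)
  simp only [bos, LinearMap.smul_apply, density_klein, if_neg this, zero_smul, add_zero, map_smul]

theorem bosd_bosState (j : BMode) (w : ℤˣ → ℤ) (m : BOcc) :
    bosd j (bosState (w, m)) = ((√(m j + 1) : ℝ) : ℂ) • bosState (w, m + Finsupp.single j 1) := by
  simp only [bosState, bosd_klein, bosd_bosVec, map_smul]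

theorem bos_bosState (j : BMode) (w : ℤˣ → ℤ) (m : BOcc) :
    bos j (bosState (w, m)) = ((√(m j) : ℝ) : ℂ) • bosState (w, m - Finsupp.single j 1) := by
  simp only [bosState, bos_klein, bos_bosVec, map_smul]

theorem charge_bosVec (r : ℤˣ) (m : BOcc) : charge r (bosVec m) = 0 := by
  induction m using finsupp_nat_induction with
  | h0 => rw [bosVec_zero, vac, charge_single]; simp [chg]
  | h1 m j ih =>
    have h1 := bosd_bosVec j m
    have h2 : charge r (bosd j (bosVec m)) = 0 := by
      have : 0 + -((j.1 : ℤ) * (j.2 + 1)) ≠ 0 := by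
        rw [zero_add, neg_ne_zero]; exact mul_ne_zero (unit_ne_zero _) (by omega)
      rw [bosd, LinearMap.smul_apply, map_smul, charge, density_comm,
        if_neg (fun h => this h.2), show density r 0 (bosVec m) = 0 from ih]
      simp
    rw [h1, map_smul] at h2
    exact (smul_eq_zero_iff_right (sqrt_ne _)).mp h2

theorem charge_bosState (r : ℤˣ) (x : BLabel) :
    charge r (bosState x) = ((r : ℤ) * x.1 r : ℂ) • bosState x := by
  rw [bosState, charge, density_klein, show density r 0 (bosVec x.2) = 0 from charge_bosVec r _]
  simp

theorem algInner_charge (r : ℤˣ) (χ ψ : FockAlg) :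
    algInner χ (charge r ψ) = algInner (charge r χ) ψ := by
  rw [charge, algInner_density, neg_zero]

/-- Within a sector this is orthonormality over the vacuum, since Klein factors are isometric.
Different sectors are eigenspaces of a symmetric charge with different eigenvalues. -/
theorem orthonormal_bosState : Orthonormal ℂ (fun x => toFock (bosState x)) := by
  rw [orthonormal_iff_ite]
  rintro ⟨w, m⟩ ⟨w', m'⟩
  change algInner (bosState (w, m)) (bosState (w', m')) = _
  by_cases hw : w = w'
  · subst hw
    rw [bosState, bosState, algInner_klein, algInner,
      orthonormal_iff_ite.mp orthonormal_bosVec m m']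
    simp
  · rw [if_neg (by simp [hw])]
    obtain ⟨r, hr⟩ := Function.ne_iff.mp hw
    have h1 := algInner_charge r (bosState (w, m)) (bosState (w', m'))
    rw [charge_bosState, charge_bosState, algInner_smul_left, algInner_smul_right, ← sub_eq_zero,
      ← sub_mul] at h1
    refine (mul_eq_zero.mp h1).resolve_left ?_
    rw [map_mul, map_intCast, map_intCast, ← mul_sub]
    refine mul_ne_zero (Int.cast_ne_zero.mpr (unit_ne_zero r)) ?_
    rw [sub_ne_zero]
    exact_mod_cast hr.symm

/-- The total excitation energy in units of `π v_F / L`. -/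
def toteng (S : Finset Mode) : ℕ := eng 1 S + eng (-1) S

theorem low_mem_span (r : ℤˣ) (n : ℕ) (S : Finset Mode) :
    low r (n + 1) (Finsupp.single S 1) ∈
      Submodule.span ℂ ((fun T => Finsupp.single T (1 : ℂ)) '' {T | toteng T < toteng S}) := by
  obtain ⟨N, hN, -⟩ := exists_within r S S
  rw [low_single hN (Nat.succ_ne_zero n)]
  refine Submodule.sum_mem _ fun a _ => Submodule.sum_mem _ fun b _ => ?_
  split_ifs with hb
  · have hne : md r a ≠ md r b := fun e => by have := md_injective r e; omega
    rw [cre_ann_single_of_ne hne]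
    split_ifs with ho
    · have e1 : ∀ (T : Finset Mode) (c : ℂ), Finsupp.single T c = c • Finsupp.single T (1 : ℂ) :=
        fun T c => by simp
      rw [e1]
      refine Submodule.smul_mem _ _ (Submodule.subset_span ⟨_, ?_, rfl⟩)
      have h1 := fun s => eng_toggle s r (S ∆ {md r b}) a
      have h2 := fun s => eng_toggle s r S b
      simp only [ho.1, if_true] at h2
      simp only [occ_toggle_of_ne hne, ho.2, if_false] at h1
      have a1 := h1 1
      have a2 := h1 (-1)
      have b1 := h2 1
      have b2 := h2 (-1)
      simp only [Set.mem_ofPred_eq, toteng]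
      have h01 : ¬ ((-1 : ℤˣ) = 1) := by decide
      have h02 : ¬ ((1 : ℤˣ) = -1) := by decide
      rcases Int.units_eq_one_or r with rfl | rfl
      · simp only [if_true, if_neg h02] at a1 a2 b1 b2
        omega
      · simp only [if_true, if_neg h01] at a1 a2 b1 b2
        omega
    · exact Submodule.zero_mem _
  · exact Submodule.zero_mem _

theorem kronig_operator (r : ℤˣ) (S : Finset Mode) : ∃ K : ℕ,
    ((eng r S : ℂ) - (chg r S : ℂ) ^ 2) • Finsupp.single S (1 : ℂ) =
      ∑ n ∈ Finset.range K, (2 : ℂ) • density r (-(r * (n + 1))) (low r (n + 1) (Finsupp.single S 1)) := by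
  obtain ⟨K, hK⟩ := eventually_atTop.mp (low_eventually_zero r (Finsupp.single S 1))
  refine ⟨K, algInner_left_injective fun φ => ?_⟩
  have h1 := hasSum_low r φ (Finsupp.single S 1)
  rw [diagOp_single] at h1
  rw [← h1.tsum_eq, tsum_eq_sum (s := Finset.range K), algInner_sum_right]
  · refine Finset.sum_congr rfl fun n _ => ?_
    rw [algInner_smul_right, algInner_density, neg_neg, low]
    push_cast; rfl
  · intro n hn
    rw [hK _ (by simp at hn; omega)]; simp [algInner]

/-- Induction on the excitation energy. The lowering densities reduce it, so they map a basis vector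
into the span, which is stable under boson creation; Kronig's identity then recovers the vector
itself unless energy equals squared charge for both chiralities. In that exceptional case the vector
is a shifted sea, that is, a Klein factor applied to the vacuum. -/
theorem span_bosState : Submodule.span ℂ (Set.range bosState) = ⊤ := by
  set P := Submodule.span ℂ (Set.range bosState) with hP
  have hbosd : ∀ j χ, χ ∈ P → bosd j χ ∈ P := by
    intro j χ hχ
    refine Submodule.span_induction (p := fun x _ => bosd j x ∈ P) ?_ (by simp)
      (fun x y _ _ hx hy => by rw [map_add]; exact P.add_mem hx hy)
      (fun c x _ hx => by rw [map_smul]; exact P.smul_mem c hx) hχ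
    rintro _ ⟨⟨w, m⟩, rfl⟩
    rw [bosd_bosState]
    exact P.smul_mem _ (Submodule.subset_span ⟨_, rfl⟩)
  have hS : ∀ k : ℕ, ∀ S, toteng S = k → Finsupp.single S (1 : ℂ) ∈ P := by
    intro k
    induction k using Nat.strong_induction_on with
    | _ k ih =>
      intro S hk
      have hlow : ∀ r n, low r (n + 1) (Finsupp.single S 1) ∈ P := by
        intro r n
        refine (Submodule.span_le.mpr ?_) (low_mem_span r n S)
        rintro _ ⟨T, hT, rfl⟩
        exact ih _ (hk ▸ hT) T rfl
      by_cases hr : ∃ r, (eng r S : ℝ) ≠ (chg r S : ℝ) ^ 2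
      · obtain ⟨r, hr⟩ := hr
        obtain ⟨K, hK⟩ := kronig_operator r S
        have hc : ((eng r S : ℂ) - (chg r S : ℂ) ^ 2) ≠ 0 := by
          rw [sub_ne_zero]; exact_mod_cast hr
        rw [← P.smul_mem_iff hc, hK]
        refine P.sum_mem fun n _ => P.smul_mem _ ?_
        have := density_neg (r, n) (low r (n + 1) (Finsupp.single S 1))
        simp only at this
        rw [this]
        exact P.smul_mem _ (hbosd _ _ (hlow r n))
      · push Not at hr
        rw [eq_shiftSea hr, ← klein_vac, ← bosVec_zero]
        exact Submodule.subset_span ⟨(_, 0), rfl⟩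
  rw [eq_top_iff]
  intro χ _
  induction χ using Finsupp.induction_linear with
  | zero => exact P.zero_mem
  | add f g hf hg => exact P.add_mem (hf trivial) (hg trivial)
  | single S c =>
    have e1 : Finsupp.single S c = c • Finsupp.single S (1 : ℂ) := by simp
    rw [e1]
    exact P.smul_mem c (hS _ S rfl)

/-! ### Functions of boson occupation numbers -/

theorem memℓp_two_iff {ι 𝕜 : Type*} [RCLike 𝕜] {f : ι → 𝕜} :
    Memℓp f 2 ↔ Summable fun i => ‖f i‖ ^ 2 := by
  rw [memℓp_gen_iff (by norm_num)]
  norm_num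

/-- The annihilation operators on functions of occupation numbers. -/
def lowerF (j : BMode) : (BOcc → ℝ) →ₗ[ℝ] (BOcc → ℝ) where
  toFun f m := √(m j + 1) * f (m + Finsupp.single j 1)
  map_add' f g := by ext m; simp [mul_add]
  map_smul' c f := by ext m; simp [mul_left_comm]

/-- The creation operators on functions of occupation numbers. -/
def raiseF (j : BMode) : (BOcc → ℝ) →ₗ[ℝ] (BOcc → ℝ) where
  toFun f m := √(m j) * f (m - Finsupp.single j 1)
  map_add' f g := by ext m; simp [mul_add]
  map_smul' c f := by ext m; simp [mul_left_comm]

theorem lowerF_apply (j : BMode) (f : BOcc → ℝ) (m : BOcc) :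
    lowerF j f m = √(m j + 1) * f (m + Finsupp.single j 1) := rfl

theorem raiseF_apply (j : BMode) (f : BOcc → ℝ) (m : BOcc) :
    raiseF j f m = √(m j) * f (m - Finsupp.single j 1) := rfl

theorem single_le_of_ne {m : BOcc} {j : BMode} (h : m j ≠ 0) : Finsupp.single j 1 ≤ m := by
  simpa using Nat.one_le_iff_ne_zero.mpr h

theorem ccr_fun : CCR (𝕜 := ℝ) lowerF raiseF := by
  refine ⟨fun i j f => ?_, fun i j f => ?_, fun i j f => ?_⟩
  · ext m
    simp only [lowerF_apply]
    by_cases hij : i = j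
    · subst hij; rfl
    · have h1 : (m + Finsupp.single i 1 : BOcc) j = m j := by simp [hij]
      have h2 : (m + Finsupp.single j 1 : BOcc) i = m i := by simp [Ne.symm hij]
      rw [h1, h2, add_right_comm]; ring
  · ext m
    simp only [raiseF_apply]
    by_cases hij : i = j
    · subst hij; rfl
    · have h1 : (m - Finsupp.single i 1 : BOcc) j = m j := by simp [hij]
      have h2 : (m - Finsupp.single j 1 : BOcc) i = m i := by simp [Ne.symm hij]
      rw [h1, h2, tsub_right_comm]; ring
  · ext m
    simp only [lowerF_apply, raiseF_apply, Pi.add_apply]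
    by_cases hij : i = j
    · subst hij
      rw [if_pos rfl, add_tsub_cancel_right]
      have h1 : (m + Finsupp.single i 1 : BOcc) i = m i + 1 := by simp
      rw [h1, ← mul_assoc]; push_cast
      rw [Real.mul_self_sqrt (by positivity)]
      by_cases hm : m i = 0
      · simp [hm]
      · rw [tsub_add_cancel_of_le (single_le_of_ne hm)]
        have h2 : (((m - Finsupp.single i 1 : BOcc) i : ℕ) : ℝ) + 1 = m i := by
          rw [Finsupp.tsub_apply, Finsupp.single_eq_same, Nat.cast_sub (Nat.one_le_iff_ne_zero.mpr hm)]
          simp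
        change _ = √(m i : ℝ) * (√((((m - Finsupp.single i 1 : BOcc) i : ℕ) : ℝ) + 1) * f m) + f m
        rw [h2, ← mul_assoc, Real.mul_self_sqrt (by positivity)]; ring
    · have h1 : (m + Finsupp.single i 1 : BOcc) j = m j := by simp [hij]
      have h2 : (m - Finsupp.single j 1 : BOcc) i = m i := by simp [Ne.symm hij]
      rw [if_neg hij, h1, h2]
      by_cases hm : m j = 0
      · simp [hm]
      · have h3 : m + Finsupp.single i 1 - Finsupp.single j 1 =
            m - Finsupp.single j 1 + Finsupp.single i 1 := by
          rw [tsub_add_eq_add_tsub (single_le_of_ne hm)]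
        rw [h3]; simp; ring

/-- Functions of occupation numbers which decay faster than any power of each occupation number. -/
def Rapid : Submodule ℝ (BOcc → ℝ) where
  carrier := {f | ∀ j (P : ℕ), Summable fun m : BOcc => ((m j : ℝ) + 1) ^ P * f m ^ 2}
  zero_mem' j P := by simp
  add_mem' {f g} hf hg j P := by
    refine Summable.of_nonneg_of_le (fun m => by positivity) (fun m => ?_)
      (((hf j P).add (hg j P)).mul_left 2)
    have h1 : (0 : ℝ) ≤ ((m j : ℝ) + 1) ^ P := by positivity
    simp only [Pi.add_apply]
    nlinarith [mul_nonneg h1 (sq_nonneg (f m - g m))]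
  smul_mem' c f hf j P := by
    refine ((hf j P).mul_left (c ^ 2)).congr fun m => ?_
    simp only [Pi.smul_apply, smul_eq_mul]; ring

/-- Mixed moments of two modes are dominated by pure ones. This is why bounds on single modes in
`Rapid` suffice for stability under the boson operators. -/
theorem mul_pow_le_add {x y : ℝ} (hx : 0 ≤ x) (hy : 0 ≤ y) (P : ℕ) :
    x * y ^ P ≤ x ^ (P + 1) + y ^ (P + 1) := by
  rcases le_total x y with h | h
  · calc x * y ^ P ≤ y * y ^ P := by gcongr
      _ = y ^ (P + 1) := by ring
      _ ≤ _ := le_add_of_nonneg_left (by positivity)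
  · calc x * y ^ P ≤ x * x ^ P := by gcongr
      _ = x ^ (P + 1) := by ring
      _ ≤ _ := le_add_of_nonneg_right (by positivity)

theorem add_single_injective (j : BMode) :
    Function.Injective fun m : BOcc => m + Finsupp.single j 1 := fun _ _ h => add_right_cancel h

theorem apply_add_single_le (m : BOcc) (j k : BMode) :
    (m k : ℝ) ≤ ((m + Finsupp.single j 1 : BOcc) k : ℝ) ∧
      ((m + Finsupp.single j 1 : BOcc) k : ℝ) ≤ m k + 1 := by
  rw [Finsupp.add_apply, Finsupp.single_apply]
  split_ifs <;> simp

theorem lowerF_mem {f : BOcc → ℝ} (hf : f ∈ Rapid) (j : BMode) : lowerF j f ∈ Rapid := by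
  intro k P
  have h := ((hf j (P + 1)).add (hf k (P + 1))).comp_injective (add_single_injective j)
  refine Summable.of_nonneg_of_le (fun m => by positivity) (fun m => ?_) h
  simp only [Function.comp, ← add_mul, lowerF_apply, mul_pow]
  rw [Real.sq_sqrt (by positivity), ← mul_assoc]
  refine mul_le_mul_of_nonneg_right ?_ (sq_nonneg _)
  have h1 := apply_add_single_le m j k
  have h2 := apply_add_single_le m j j
  calc ((m k : ℝ) + 1) ^ P * (m j + 1) = (m j + 1) * ((m k : ℝ) + 1) ^ P := by ring
    _ ≤ (m j + 1) ^ (P + 1) + ((m k : ℝ) + 1) ^ (P + 1) :=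
      mul_pow_le_add (by positivity) (by positivity) P
    _ ≤ _ := by gcongr <;> first | exact_mod_cast h2.1 | exact_mod_cast h1.1

theorem raiseF_eq_zero {f : BOcc → ℝ} {j : BMode} {m : BOcc}
    (h : m ∉ Set.range fun m : BOcc => m + Finsupp.single j 1) : raiseF j f m = 0 := by
  by_cases hm : m j = 0
  · simp [raiseF_apply, hm]
  · exact absurd ⟨m - Finsupp.single j 1, tsub_add_cancel_of_le (single_le_of_ne hm)⟩ h

theorem raiseF_add_single (f : BOcc → ℝ) (j : BMode) (m : BOcc) :
    raiseF j f (m + Finsupp.single j 1) = √(m j + 1) * f m := by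
  rw [raiseF_apply, add_tsub_cancel_right]; simp

theorem raiseF_mem {f : BOcc → ℝ} (hf : f ∈ Rapid) (j : BMode) : raiseF j f ∈ Rapid := by
  intro k P
  rw [← (add_single_injective j).summable_iff]
  · have h := ((hf j (P + 1)).add (hf k (P + 1))).mul_left (2 ^ P)
    refine Summable.of_nonneg_of_le (fun m => by simp only [Function.comp]; positivity)
      (fun m => ?_) h
    simp only [Function.comp, ← add_mul, raiseF_add_single, mul_pow]
    rw [Real.sq_sqrt (by positivity), ← mul_assoc, ← mul_assoc]
    refine mul_le_mul_of_nonneg_right ?_ (sq_nonneg _)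
    have h1 := apply_add_single_le m j k
    calc (((m + Finsupp.single j 1 : BOcc) k : ℝ) + 1) ^ P * (m j + 1)
        ≤ (2 * (m k + 1)) ^ P * (m j + 1) := by gcongr; linarith [show (0 : ℝ) ≤ m k by positivity]
      _ = 2 ^ P * ((m j + 1) * ((m k : ℝ) + 1) ^ P) := by rw [mul_pow]; ring
      _ ≤ _ := by gcongr; exact mul_pow_le_add (by positivity) (by positivity) P
  · intro m hm
    rw [raiseF_eq_zero hm]; simp

/-- The annihilation operators on rapidly decaying functions. -/
def lowerR (j : BMode) : Rapid →ₗ[ℝ] Rapid := (lowerF j).restrict fun _ hf => lowerF_mem hf j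

/-- The creation operators on rapidly decaying functions. -/
def raiseR (j : BMode) : Rapid →ₗ[ℝ] Rapid := (raiseF j).restrict fun _ hf => raiseF_mem hf j

theorem ccr_rapid : CCR (𝕜 := ℝ) lowerR raiseR := by
  refine ⟨fun i j f => Subtype.ext (ccr_fun.comm_ann i j f),
    fun i j f => Subtype.ext (ccr_fun.comm_cre i j f), fun i j f => Subtype.ext ?_⟩
  refine (ccr_fun.comm i j f).trans ?_
  split_ifs <;> rfl

/-- The inclusion of the rapidly decaying functions in the Hilbert space. -/
def rapidToLp : Rapid →ₗ[ℝ] lp (fun _ : BOcc => ℝ) 2 where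
  toFun f := ⟨f.1, memℓp_two_iff.mpr (by simpa using f.2 (1, 0) 0)⟩
  map_add' f g := rfl
  map_smul' c f := rfl

theorem inner_rapidToLp (f g : Rapid) : inner ℝ (rapidToLp f) (rapidToLp g) = ∑' m, f.1 m * g.1 m := by
  rw [lp.inner_eq_tsum]
  refine tsum_congr fun m => ?_
  change inner ℝ (f.1 m) (g.1 m) = _
  simp [mul_comm]

theorem inner_raiseR (j : BMode) (f g : Rapid) :
    inner ℝ (rapidToLp (raiseR j f)) (rapidToLp g) = inner ℝ (rapidToLp f) (rapidToLp (lowerR j g)) := by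
  rw [inner_rapidToLp, inner_rapidToLp, ← (add_single_injective j).tsum_eq]
  · refine tsum_congr fun m => ?_
    change raiseF j f.1 (m + Finsupp.single j 1) * _ = f.1 m * lowerF j g.1 m
    rw [raiseF_add_single, lowerF_apply]; ring
  · intro m hm
    by_contra h
    refine hm ?_
    change raiseF j f.1 m * _ = 0
    rw [raiseF_eq_zero h, zero_mul]

/-! ### The Bogoliubov vacuum -/

/-- All boson occupation numbers are equal for the two chiralities. -/
def IsPaired (m : BOcc) : Prop := ∀ n, m (1, n) = m (-1, n)

/-- The occupation numbers of the bosons with chirality `1`. -/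
def rightOcc (m : BOcc) : ℕ →₀ ℕ :=
  m.comapDomain (fun n => ((1 : ℤˣ), n)) fun _ _ _ _ h => congrArg Prod.snd h

theorem rightOcc_apply (m : BOcc) (n : ℕ) : rightOcc m n = m (1, n) := rfl

open Classical in
/-- The Bogoliubov vacuum, up to normalization. -/
def pairFun (t : ℕ → ℝ) (m : BOcc) : ℝ :=
  if IsPaired m then (rightOcc m).prod fun n k => (-t n) ^ k else 0

theorem pairFun_zero (t : ℕ → ℝ) : pairFun t 0 = 1 := by
  have : rightOcc 0 = 0 := by ext n; simp [rightOcc_apply]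
  simp [pairFun, IsPaired, this]

theorem isPaired_iff (m : BOcc) : IsPaired m ↔ ∀ j, m j = m (bar j) := by
  constructor
  · rintro h ⟨r, n⟩
    rcases Int.units_eq_one_or r with rfl | rfl
    · exact h n
    · simpa [bar] using (h n).symm
  · intro h n
    exact h (1, n)

theorem isPaired_add (m : BOcc) (j : BMode) :
    IsPaired (m + Finsupp.single j 1 + Finsupp.single (bar j) 1) ↔ IsPaired m := by
  rw [isPaired_iff, isPaired_iff]
  refine forall_congr' fun k => ?_
  have h1 : bar j = bar k ↔ j = k :=
    ⟨fun h => by rw [← bar_bar j, h, bar_bar], fun h => by rw [h]⟩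
  have h2 : j = bar k ↔ bar j = k :=
    ⟨fun h => by rw [h, bar_bar], fun h => by rw [← h, bar_bar]⟩
  have e1 : Finsupp.single (bar j) 1 (bar k) = Finsupp.single j 1 k := by
    simp only [Finsupp.single_apply, h1]
  have e2 : Finsupp.single j 1 (bar k) = Finsupp.single (bar j) 1 k := by
    simp only [Finsupp.single_apply, h2]
  rw [Finsupp.add_apply, Finsupp.add_apply, Finsupp.add_apply, Finsupp.add_apply, e1, e2]
  omega

theorem pairFun_add (t : ℕ → ℝ) (m : BOcc) (j : BMode) :
    pairFun t (m + Finsupp.single j 1 + Finsupp.single (bar j) 1) = -t j.2 * pairFun t m := by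
  by_cases h : IsPaired m
  · rw [pairFun, pairFun, if_pos ((isPaired_add m j).mpr h), if_pos h]
    have h1 : rightOcc (m + Finsupp.single j 1 + Finsupp.single (bar j) 1) =
        rightOcc m + Finsupp.single j.2 1 := by
      ext n
      obtain ⟨r, k⟩ := j
      rcases Int.units_eq_one_or r with rfl | rfl <;>
        simp [rightOcc_apply, bar, Finsupp.single_apply]
    rw [h1, Finsupp.prod_add_index' (by simp) fun _ _ _ => pow_add _ _ _,
      Finsupp.prod_single_index (h := fun n k => (-t n) ^ k) (pow_zero _)]
    ring
  · rw [pairFun, pairFun, if_neg (mt (isPaired_add m j).mp h), if_neg h, mul_zero]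

/-- The equation at `m` is nontrivial only if `m` is a paired configuration plus one boson in `bar
j`. There it says that adding a pair multiplies the amplitude by `-s/c`. -/
theorem bog_pairFun {c s : ℕ → ℝ} (hc : ∀ n, 0 < c n) (j : BMode) :
    bog c s lowerF raiseF j (pairFun fun n => s n / c n) = 0 := by
  ext m
  have hbog : ∀ f : BOcc → ℝ, bog c s lowerF raiseF j f m = c j.2 * (√(m j + 1) * f (m + Finsupp.single j 1)) +
    s j.2 * (√(m (bar j)) * f (m - Finsupp.single (bar j) 1)) := fun f => rfl
  rw [hbog, Pi.zero_apply]
  by_cases hm : m (bar j) = 0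
  · have : ¬ IsPaired (m + Finsupp.single j 1) := by
      rw [isPaired_iff]
      intro h
      have := h j
      simp [hm, bar_ne] at this
    simp [hm, pairFun, this]
  · obtain ⟨m', rfl⟩ : ∃ m', m = m' + Finsupp.single (bar j) 1 :=
      ⟨_, (tsub_add_cancel_of_le (single_le_of_ne hm)).symm⟩
    rw [add_tsub_cancel_right, add_right_comm, pairFun_add]
    by_cases hp : IsPaired m'
    · have h1 : ((m' + Finsupp.single (bar j) 1 : BOcc) j : ℝ) = m' j := by simp [bar_ne]
      have h2 : ((m' + Finsupp.single (bar j) 1 : BOcc) (bar j) : ℝ) = m' j + 1 := by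
        simp [((isPaired_iff _).mp hp j).symm]
      rw [h1, h2]
      have := (hc j.2).ne'
      field_simp; ring
    · simp [pairFun, hp]

/-- As `c` does not vanish, the equation for mode `j` determines the value with one more boson in
`j` from a value with fewer bosons. So the value at the empty configuration fixes everything,
without any assumption of decay. -/
theorem eq_pairFun {c s : ℕ → ℝ} (hc : ∀ n, 0 < c n) {f : BOcc → ℝ}
    (hf : ∀ j, bog c s lowerF raiseF j f = 0) : f = f 0 • pairFun fun n => s n / c n := by
  set g := f - f 0 • pairFun fun n => s n / c n with hg
  have hg0 : g 0 = 0 := by simp [hg, pairFun_zero]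
  have hgj : ∀ j, bog c s lowerF raiseF j g = 0 := fun j => by
    rw [hg, map_sub, map_smul, hf, bog_pairFun hc]; simp
  have key : ∀ N : ℕ, ∀ m : BOcc, m.degree = N → g m = 0 := by
    intro N
    induction N using Nat.strong_induction_on with
    | _ N ih =>
      intro m hm
      rcases eq_or_ne m 0 with rfl | h0
      · exact hg0
      · obtain ⟨j, hj⟩ := Finsupp.ne_iff.mp h0
        obtain ⟨m', rfl⟩ : ∃ m', m = m' + Finsupp.single j 1 :=
          ⟨_, (tsub_add_cancel_of_le (single_le_of_ne hj)).symm⟩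
        have h1 := congrFun (hgj j) m'
        have hbog : bog c s lowerF raiseF j g m' =
          c j.2 * (√(m' j + 1) * g (m' + Finsupp.single j 1)) +
          s j.2 * (√(m' (bar j)) * g (m' - Finsupp.single (bar j) 1)) := rfl
        have h3 : (m' - Finsupp.single (bar j) 1).degree ≤ m'.degree :=
          Finsupp.degree_mono tsub_le_self
        have h4 : (m' + Finsupp.single j 1).degree = m'.degree + 1 := by simp
        have h5 : g (m' - Finsupp.single (bar j) 1) = 0 := ih _ (by omega) _ rfl
        rw [hbog, h5] at h1
        have h2 : √((m' j : ℝ) + 1) ≠ 0 := by positivity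
        simpa [(hc j.2).ne', h2] using h1
  have : g = 0 := funext fun m => key _ m rfl
  rw [hg, sub_eq_zero] at this
  exact this

/-! ### The Bogoliubov vacuum is normalizable -/

theorem summable_div_one_sub {z : ℕ → ℝ} (h0 : ∀ n, 0 ≤ z n) (hz : Summable z) :
    Summable fun n => z n / (1 - z n) := by
  refine Summable.of_norm_bounded_eventually_nat (hz.mul_left 2) ?_
  filter_upwards [hz.tendsto_atTop_zero.eventually (gt_mem_nhds (show (0 : ℝ) < 1 / 2 by norm_num))]
    with n hn
  have := h0 n
  rw [Real.norm_of_nonneg (div_nonneg (h0 n) (by linarith)), div_le_iff₀ (by linarith)]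
  nlinarith

/-- Formally the sum factorizes into geometric series with product ∏ 1/(1 − zₙ). Each factor is 1 +
zₙ/(1 − zₙ), at most the exponential of zₙ/(1 − zₙ), and this bounds all finite partial sums. -/
theorem summable_prod_pow {z : ℕ → ℝ} (h0 : ∀ n, 0 ≤ z n) (h1 : ∀ n, z n < 1) (hz : Summable z) :
    Summable fun i : ℕ →₀ ℕ => i.prod fun n k => z n ^ k := by
  have hs := summable_div_one_sub h0 hz
  have hnn : ∀ n, 0 ≤ z n / (1 - z n) := fun n => div_nonneg (h0 n) (by linarith [h1 n])
  refine summable_of_sum_le (c := Real.exp (∑' n, z n / (1 - z n)))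
    (fun i => Finset.prod_nonneg fun n _ => pow_nonneg (h0 n) _) fun F => ?_
  set S := F.sup Finsupp.support
  set N := F.sup fun i => S.sup i
  have hS : ∀ i ∈ F, i.support ⊆ S := fun i hi => Finset.le_sup (f := Finsupp.support) hi
  have hN : ∀ i ∈ F, ∀ n ∈ S, i n ≤ N := fun i hi n hn =>
    (Finset.le_sup (f := i) hn).trans (Finset.le_sup (f := fun i : ℕ →₀ ℕ => S.sup i) hi)
  let T : S → Finset ℕ := fun _ => Finset.range (N + 1)
  calc ∑ i ∈ F, i.prod (fun n k => z n ^ k)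
      = ∑ i ∈ F, ∏ n : S, z n ^ (i n) := by
        refine Finset.sum_congr rfl fun i hi => ?_
        rw [Finsupp.prod_of_support_subset i (hS i hi) _ (by simp), ← Finset.prod_coe_sort]
    _ = ∑ p ∈ F.image (fun i => fun n : S => i n), ∏ n : S, z n ^ (p n) := by
        rw [Finset.sum_image]
        intro i hi k hk hik
        ext n
        by_cases hn : n ∈ S
        · exact congrFun hik ⟨n, hn⟩
        · rw [Finsupp.notMem_support_iff.mp fun h => hn (hS i hi h),
            Finsupp.notMem_support_iff.mp fun h => hn (hS k hk h)]
    _ ≤ ∑ p ∈ Fintype.piFinset T, ∏ n : S, z n ^ (p n) := by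
        refine Finset.sum_le_sum_of_subset_of_nonneg ?_
          fun p _ _ => Finset.prod_nonneg fun n _ => pow_nonneg (h0 n) _
        intro p hp
        obtain ⟨i, hi, rfl⟩ := Finset.mem_image.mp hp
        rw [Fintype.mem_piFinset]
        intro n
        exact Finset.mem_range.mpr (Nat.lt_succ_of_le (hN i hi n n.2))
    _ = ∏ n : S, ∑ k ∈ T n, z n ^ k := (Finset.prod_univ_sum T fun n k => z n ^ k).symm
    _ ≤ ∏ n : S, Real.exp (z n / (1 - z n)) := by
        refine Finset.prod_le_prod (fun n _ => Finset.sum_nonneg fun k _ => pow_nonneg (h0 n) _)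
          fun n _ => ?_
        have hn : 0 < 1 - z n := by linarith [h1 n]
        calc ∑ k ∈ T n, z n ^ k ≤ ∑' k, z n ^ k :=
              (summable_geometric_of_lt_one (h0 n) (h1 n)).sum_le_tsum _
                fun k _ => pow_nonneg (h0 n) _
          _ = z n / (1 - z n) + 1 := by
              rw [tsum_geometric_of_lt_one (h0 n) (h1 n)]; field_simp; ring
          _ ≤ _ := Real.add_one_le_exp _
    _ = Real.exp (∑ n ∈ S, z n / (1 - z n)) := by
        rw [← Real.exp_sum, Finset.sum_coe_sort S fun n => z n / (1 - z n)]
    _ ≤ _ := Real.exp_le_exp.mpr (hs.sum_le_tsum _ fun n _ => hnn n)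

/-- A geometric rate halfway between `y` and 1 absorbs the polynomial. The midpoint is positive even
when `y = 0`. -/
theorem exists_pow_mul_le {y : ℝ} (h0 : 0 ≤ y) (h1 : y < 1) (P : ℕ) :
    ∃ z C : ℝ, 0 ≤ z ∧ z < 1 ∧ ∀ k : ℕ, ((k : ℝ) + 1) ^ P * y ^ k ≤ C * z ^ k := by
  have hz : 0 < (1 + y) / 2 := by linarith
  have hr0 : 0 ≤ y / ((1 + y) / 2) := by positivity
  have hr1 : y / ((1 + y) / 2) < 1 := by rw [div_lt_one hz]; linarith
  obtain ⟨B, hB⟩ := (tendsto_pow_const_mul_const_pow_of_abs_lt_one P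
    (by rwa [abs_of_nonneg hr0] : |y / ((1 + y) / 2)| < 1)).bddAbove_range
  refine ⟨(1 + y) / 2, 2 ^ P * (B + 1), hz.le, by linarith, fun k => ?_⟩
  set r := y / ((1 + y) / 2)
  have hy : y ^ k = r ^ k * ((1 + y) / 2) ^ k := by
    rw [← mul_pow, div_mul_cancel₀ _ hz.ne']
  rw [hy, ← mul_assoc]
  refine mul_le_mul_of_nonneg_right ?_ (by positivity)
  have h2 : ((k : ℝ) + 1) ^ P ≤ 2 ^ P * (k ^ P + 1) := by
    rcases Nat.eq_zero_or_pos k with rfl | hk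
    · have : (1 : ℝ) ≤ 2 ^ P := one_le_pow₀ (by norm_num)
      have h3 : (0 : ℝ) ≤ 0 ^ P := by positivity
      simp only [Nat.cast_zero, zero_add, one_pow]
      nlinarith
    · have hk1 : (1 : ℝ) ≤ k := by exact_mod_cast hk
      calc ((k : ℝ) + 1) ^ P ≤ (2 * k) ^ P := by gcongr; linarith
        _ = 2 ^ P * k ^ P := mul_pow _ _ _
        _ ≤ _ := by gcongr; linarith
  calc ((k : ℝ) + 1) ^ P * r ^ k ≤ 2 ^ P * (k ^ P + 1) * r ^ k := by gcongr
    _ = 2 ^ P * (k ^ P * r ^ k + r ^ k) := by ring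
    _ ≤ _ := by
      gcongr
      · exact hB ⟨k, rfl⟩
      · exact pow_le_one₀ hr0 hr1.le

theorem prod_neg_pow_sq (t : ℕ → ℝ) (i : ℕ →₀ ℕ) :
    (i.prod fun n k => (-t n) ^ k) ^ 2 = i.prod fun n k => (t n ^ 2) ^ k := by
  rw [Finsupp.prod, Finsupp.prod, ← Finset.prod_pow]
  exact Finset.prod_congr rfl fun n _ => by rw [← pow_mul, mul_comm, pow_mul, neg_sq]

theorem pairFun_neg_sq (t : ℕ → ℝ) (m : BOcc) : pairFun (-t) m ^ 2 = pairFun t m ^ 2 := by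
  unfold pairFun
  split_ifs
  · rw [prod_neg_pow_sq, prod_neg_pow_sq]; simp
  · rfl

theorem rightOcc_injOn : Set.InjOn rightOcc {m | IsPaired m} := by
  intro m hm k hk h
  ext j
  obtain ⟨r, n⟩ := j
  rcases Int.units_eq_one_or r with rfl | rfl
  · exact DFunLike.congr_fun h n
  · rw [← show m (1, n) = m (-1, n) from hm n, ← show k (1, n) = k (-1, n) from hk n]
    exact DFunLike.congr_fun h n

theorem pairFun_mem {t : ℕ → ℝ} (h1 : ∀ n, |t n| < 1) (ht : Summable fun n => t n ^ 2) :
    pairFun t ∈ Rapid := by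
  intro j P
  have hy1 : ∀ n, t n ^ 2 < 1 := fun n => by rw [sq_lt_one_iff_abs_lt_one]; exact h1 n
  obtain ⟨z, C, hz0, hz1, hz⟩ := exists_pow_mul_le (sq_nonneg (t j.2)) (hy1 j.2) P
  -- The polynomial weight concerns one mode only. It is absorbed by raising the rate of that mode
  -- to `z < 1`, which affects neither the summability of the rates nor the product criterion.
  set Z := Function.update (fun n => t n ^ 2) j.2 z with hZ
  have hZj : Z j.2 = z := by simp [hZ]
  have hZn : ∀ n, n ≠ j.2 → Z n = t n ^ 2 := fun n hn => by simp [hZ, hn]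
  have hZ0 : ∀ n, 0 ≤ Z n := fun n => by
    by_cases hn : n = j.2
    · rw [hn, hZj]; exact hz0
    · rw [hZn n hn]; positivity
  have hZ1 : ∀ n, Z n < 1 := fun n => by
    by_cases hn : n = j.2
    · rw [hn, hZj]; exact hz1
    · rw [hZn n hn]; exact hy1 n
  have hZs : Summable Z := by
    refine (summable_congr_cofinite ?_).mpr ht
    filter_upwards [(Set.finite_singleton j.2).compl_mem_cofinite] with n hn
    exact hZn n hn
  have hs := (summable_prod_pow hZ0 hZ1 hZs).mul_left C
  have hsub : Summable fun m : {m // IsPaired m} => C * (rightOcc m.1).prod fun n k => Z n ^ k :=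
    hs.comp_injective (i := fun m : {m // IsPaired m} => rightOcc m.1)
      fun a b h => Subtype.ext (rightOcc_injOn a.2 b.2 h)
  refine (Subtype.val_injective (p := IsPaired)).summable_iff (fun m hm => ?_) |>.mp
    (Summable.of_nonneg_of_le (fun m => by simp only [Function.comp]; positivity) (fun m => ?_) hsub)
  · have : ¬ IsPaired m := fun h => hm ⟨⟨m, h⟩, rfl⟩
    simp [pairFun, this]
  · obtain ⟨m, hm⟩ := m
    have hmj : m j = rightOcc m j.2 := by
      obtain ⟨r, n⟩ := j
      rcases Int.units_eq_one_or r with rfl | rfl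
      · rfl
      · exact (hm n).symm
    simp only [Function.comp, pairFun, if_pos hm, hmj]
    set i := rightOcc m
    rw [prod_neg_pow_sq, ← Finsupp.mul_prod_erase' i j.2 (fun n k => (t n ^ 2) ^ k) (by simp),
      ← Finsupp.mul_prod_erase' i j.2 (fun n k => Z n ^ k) (by simp), ← mul_assoc, ← mul_assoc, hZj]
    have e2 : ((i.erase j.2).prod fun n k => Z n ^ k) =
        (i.erase j.2).prod fun n k => (t n ^ 2) ^ k := by
      refine Finset.prod_congr rfl fun n hn => ?_
      beta_reduce
      rw [hZn n (by rw [Finsupp.support_erase] at hn; exact Finset.ne_of_mem_erase hn)]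
    rw [e2]
    refine mul_le_mul_of_nonneg_right (hz _) (Finset.prod_nonneg fun n _ => by positivity)

/-! ### The Bogoliubov transformation of the boson Fock basis -/

/-- The parameters `c n = cosh θ n`, `s n = sinh θ n` of a Bogoliubov transformation that can be
implemented by a unitary operator. -/
structure BogParam (c s : ℕ → ℝ) : Prop where
  pos : ∀ n, 0 < c n
  sub_sq : ∀ n, c n ^ 2 - s n ^ 2 = 1
  summable : Summable fun n => (s n / c n) ^ 2

namespace BogParam

variable {c s : ℕ → ℝ} (h : BogParam c s)

include h

theorem neg : BogParam c (-s) :=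
  ⟨h.pos, fun n => by simpa using h.sub_sq n, by simpa [neg_div] using h.summable⟩

theorem abs_lt (n : ℕ) : |s n / c n| < 1 := by
  rw [← sq_lt_one_iff_abs_lt_one, div_pow, div_lt_one (by have := h.pos n; positivity)]
  linarith [h.sub_sq n]

/-- The unnormalized Bogoliubov vacuum. -/
def vacuum₀ : Rapid := ⟨pairFun fun n => s n / c n, pairFun_mem h.abs_lt h.summable⟩

theorem norm_vacuum₀_sq : ‖rapidToLp h.vacuum₀‖ ^ 2 = ∑' m, pairFun (fun n => s n / c n) m ^ 2 := by
  rw [← real_inner_self_eq_norm_sq, inner_rapidToLp]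
  exact tsum_congr fun m => (sq _).symm

theorem norm_vacuum₀_neg : ‖rapidToLp h.neg.vacuum₀‖ = ‖rapidToLp h.vacuum₀‖ := by
  rw [← sq_eq_sq₀ (norm_nonneg _) (norm_nonneg _), norm_vacuum₀_sq, norm_vacuum₀_sq]
  refine tsum_congr fun m => ?_
  rw [← pairFun_neg_sq]
  congr 2
  ext n; simp [neg_div]

theorem norm_vacuum₀_ne : ‖rapidToLp h.vacuum₀‖ ≠ 0 := by
  rw [norm_ne_zero_iff]
  intro h0
  have h1 : pairFun (fun n => s n / c n) 0 = 0 := congrFun (congrArg Subtype.val h0) 0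
  rw [pairFun_zero] at h1
  exact one_ne_zero h1

theorem exists_vec : ∃ e : BOcc → Rapid,
    e 0 = ‖rapidToLp h.vacuum₀‖⁻¹ • h.vacuum₀ ∧
      (∀ j m, bog c s raiseR lowerR j (e m) = √(m j + 1) • e (m + Finsupp.single j 1)) ∧
      ∀ j m, bog c s lowerR raiseR j (e m) = √(m j) • e (m - Finsupp.single j 1) := by
  refine exists_fockBasis (ccr_rapid.bog h.sub_sq) fun j => ?_
  rw [map_smul]
  have : bog c s lowerR raiseR j h.vacuum₀ = 0 := Subtype.ext (bog_pairFun h.pos j)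
  rw [this, smul_zero]

/-- The eigenvectors of the occupation numbers of the transformed bosons. -/
def vec : BOcc → Rapid := h.exists_vec.choose

/-- The component of the transformed basis vector `x` along the original basis vector `m`. -/
def coeff (x m : BOcc) : ℝ := (h.vec x).1 m

theorem raise_coeff (j : BMode) (x m : BOcc) :
    c j.2 * (√(m j) * h.coeff x (m - Finsupp.single j 1)) +
      s j.2 * (√(m (bar j) + 1) * h.coeff x (m + Finsupp.single (bar j) 1)) =
    √(x j + 1) * h.coeff (x + Finsupp.single j 1) m :=
  congrFun (congrArg Subtype.val (h.exists_vec.choose_spec.2.1 j x)) m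

theorem lower_coeff (j : BMode) (x m : BOcc) :
    c j.2 * (√(m j + 1) * h.coeff x (m + Finsupp.single j 1)) +
      s j.2 * (√(m (bar j)) * h.coeff x (m - Finsupp.single (bar j) 1)) =
    √(x j) * h.coeff (x - Finsupp.single j 1) m :=
  congrFun (congrArg Subtype.val (h.exists_vec.choose_spec.2.2 j x)) m

theorem coeff_zero (m : BOcc) :
    h.coeff 0 m = ‖rapidToLp h.vacuum₀‖⁻¹ * pairFun (fun n => s n / c n) m :=
  congrFun (congrArg Subtype.val h.exists_vec.choose_spec.1) m

/-- The inverse transformation: an original annihilation operator, acting on the argument `m`, is a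
combination of transformed operators, acting on the index `x`. -/
theorem coeff_add (j : BMode) (x m : BOcc) :
    √(m j + 1) * h.coeff x (m + Finsupp.single j 1) =
      c j.2 * (√(x j) * h.coeff (x - Finsupp.single j 1) m) -
        s j.2 * (√(x (bar j) + 1) * h.coeff (x + Finsupp.single (bar j) 1) m) := by
  rw [← h.lower_coeff, ← h.raise_coeff, bar_bar, bar_snd]
  linear_combination (-√(m j + 1) * h.coeff x (m + Finsupp.single j 1)) * h.sub_sq j.2

/-- Read as a function of the index `x`, the matrix satisfies the recursions of the transformation
with `-s`. The row `m = 0` is annihilated by its annihilators, so it is the opposite vacuum by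
`eq_pairFun`, with the same normalization; the creators then generate all other rows. This symmetry
turns orthonormality of the dressed vectors into their completeness. -/
theorem coeff_symm (x m : BOcc) : h.coeff x m = h.neg.coeff m x := by
  induction m using finsupp_nat_induction generalizing x with
  | h0 =>
    have h1 : ∀ j, bog c (-s) lowerF raiseF j (fun x => h.coeff x 0) = 0 := by
      intro j
      ext x
      change c j.2 * (√(x j + 1) * h.coeff (x + Finsupp.single j 1) 0) +
        -s j.2 * (√(x (bar j)) * h.coeff (x - Finsupp.single (bar j) 1) 0) = 0
      rw [← h.raise_coeff, ← h.lower_coeff]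
      simp [bar_bar, bar_snd]
      ring
    have h2 := congrFun (eq_pairFun h.pos h1) x
    rw [Pi.smul_apply, smul_eq_mul, h.coeff_zero, pairFun_zero, mul_one] at h2
    rw [h2, h.neg.coeff_zero, h.norm_vacuum₀_neg]
  | h1 m j ih =>
    have h0 : √((m j : ℝ) + 1) ≠ 0 := by positivity
    refine mul_left_cancel₀ h0 ?_
    rw [h.coeff_add, ih, ih, ← h.neg.raise_coeff]
    simp only [Pi.neg_apply]
    ring

theorem orthonormal_vec : Orthonormal ℝ fun x => rapidToLp (h.vec x) := by
  refine orthonormal_fockBasis (a := bog c s lowerR raiseR) (ad := bog c s raiseR lowerR) rapidToLp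
    (fun j x y => ?_) h.exists_vec.choose_spec.2.1 h.exists_vec.choose_spec.2.2 ?_
  · have e : inner ℝ (rapidToLp (lowerR (bar j) x)) (rapidToLp y) =
        inner ℝ (rapidToLp x) (rapidToLp (raiseR (bar j) y)) := by
      rw [real_inner_comm, ← inner_raiseR, real_inner_comm]
    simp only [bog, LinearMap.add_apply, LinearMap.smul_apply, map_add, map_smul, inner_add_left,
      inner_add_right, inner_smul_left, inner_smul_right, inner_raiseR, e]
    rfl
  · have : h.vec 0 = _ := h.exists_vec.choose_spec.1
    rw [this, map_smul, norm_smul, norm_inv, norm_norm, inv_mul_cancel₀ h.norm_vacuum₀_ne]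

theorem hasSum_coeff_mul (x y : BOcc) :
    HasSum (fun m => h.coeff x m * h.coeff y m) (if x = y then 1 else 0) := by
  have h1 := orthonormal_iff_ite.mp h.orthonormal_vec x y
  rw [← h1]
  have h2 := lp.hasSum_inner (𝕜 := ℝ) (rapidToLp (h.vec x)) (rapidToLp (h.vec y))
  have e : (fun m => h.coeff x m * h.coeff y m) = fun m =>
      inner ℝ (rapidToLp (h.vec x) m) (rapidToLp (h.vec y) m) := funext fun m => by
    change _ = inner ℝ (h.coeff x m) (h.coeff y m)
    simp [mul_comm]
  rw [e]
  exact h2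

/-- The rows of the transformation are normalized. -/
theorem hasSum_coeff_sq (m : BOcc) : HasSum (fun x => h.coeff x m ^ 2) 1 := by
  simpa [h.coeff_symm _ m, sq] using h.neg.hasSum_coeff_mul m m

theorem summable_mul_coeff_sq (j : BMode) (x : BOcc) :
    Summable fun m : BOcc => m j * h.coeff x m ^ 2 := by
  refine Summable.of_nonneg_of_le (fun m => by positivity) (fun m => ?_) ((h.vec x).2 j 1)
  rw [pow_one]
  exact mul_le_mul_of_nonneg_right (by linarith) (sq_nonneg _)

theorem lowerR_vec (j : BMode) (x : BOcc) :
    lowerR j (h.vec x) = (c j.2 * √(x j)) • h.vec (x - Finsupp.single j 1) -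
      (s j.2 * √(x (bar j) + 1)) • h.vec (x + Finsupp.single (bar j) 1) := by
  refine Subtype.ext (funext fun m => ?_)
  refine (h.coeff_add j x m).trans ?_
  rw [← mul_assoc, ← mul_assoc]
  rfl

/-- The expected number of original bosons in a dressed state is the squared norm of the annihilated
state, which is a combination of two orthogonal dressed vectors. It controls the form on expansions
of dressed states in boson states. -/
theorem tsum_mul_coeff_sq (j : BMode) (x : BOcc) :
    ∑' m : BOcc, m j * h.coeff x m ^ 2 = c j.2 ^ 2 * x j + s j.2 ^ 2 * (x (bar j) + 1) := by
  have h1 : ∑' m : BOcc, m j * h.coeff x m ^ 2 = ‖rapidToLp (lowerR j (h.vec x))‖ ^ 2 := by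
    rw [← real_inner_self_eq_norm_sq, inner_rapidToLp, ← (add_single_injective j).tsum_eq]
    · refine tsum_congr fun m => ?_
      change _ = (√(m j + 1) * h.coeff x (m + Finsupp.single j 1)) *
        (√(m j + 1) * h.coeff x (m + Finsupp.single j 1))
      rw [mul_mul_mul_comm, Real.mul_self_sqrt (by positivity)]
      simp [sq]
    · intro m hm
      by_contra hne
      refine hm ?_
      have : m j = 0 := by
        by_contra h0
        exact hne ⟨m - Finsupp.single j 1, tsub_add_cancel_of_le (single_le_of_ne h0)⟩
      simp [this]
  have h2 : x - Finsupp.single j 1 ≠ x + Finsupp.single (bar j) 1 := by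
    intro e
    have := DFunLike.congr_fun e (bar j)
    simp [bar_ne] at this
  rw [h1, lowerR_vec, map_sub, map_smul, map_smul, norm_sub_sq_real, norm_smul, norm_smul,
    inner_smul_left, inner_smul_right, h.orthonormal_vec.2 h2, h.orthonormal_vec.1,
    h.orthonormal_vec.1]
  simp only [mul_one, mul_zero, sub_zero, Real.norm_eq_abs, sq_abs, mul_pow]
  rw [Real.sq_sqrt (by positivity), Real.sq_sqrt (by positivity)]

end BogParam

/-! ### The two orthonormal bases of the Fock space -/

/-- Equality in Bessel's inequality puts `x` in the closed span of `v`, and `u` is orthogonal to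
that span. -/
theorem inner_eq_zero_of_hasSum {E ι : Type*} [NormedAddCommGroup E] [InnerProductSpace ℂ E]
    {v : ι → E} (hv : Orthonormal ℂ v) {x u : E} (hx : HasSum (fun i => ‖inner ℂ (v i) x‖ ^ 2) (‖x‖ ^ 2))
    (hu : ∀ i, inner ℂ u (v i) = 0) : inner ℂ u x = 0 := by
  have h1 : ∀ s : Finset ι, ‖x - ∑ i ∈ s, inner ℂ (v i) x • v i‖ ^ 2 =
      ‖x‖ ^ 2 - ∑ i ∈ s, ‖inner ℂ (v i) x‖ ^ 2 := by
    intro s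
    have e1 : inner ℂ x (∑ i ∈ s, inner ℂ (v i) x • v i) =
        ((∑ i ∈ s, ‖inner ℂ (v i) x‖ ^ 2 : ℝ) : ℂ) := by
      rw [inner_sum, Complex.ofReal_sum]
      refine Finset.sum_congr rfl fun i _ => ?_
      rw [inner_smul_right, ← inner_conj_symm x (v i), Complex.mul_conj']
      simp
    have e2 : ‖∑ i ∈ s, inner ℂ (v i) x • v i‖ ^ 2 = ∑ i ∈ s, ‖inner ℂ (v i) x‖ ^ 2 := by
      have := hv.inner_sum (fun i => inner ℂ (v i) x) (fun i => inner ℂ (v i) x) s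
      rw [inner_self_eq_norm_sq_to_K] at this
      have h2 : ((‖∑ i ∈ s, inner ℂ (v i) x • v i‖ ^ 2 : ℝ) : ℂ) =
          ((∑ i ∈ s, ‖inner ℂ (v i) x‖ ^ 2 : ℝ) : ℂ) := by
        rw [Complex.ofReal_sum]; push_cast
        refine Eq.trans (by simpa using this) (Finset.sum_congr rfl fun i _ => ?_)
        rw [← inner_conj_symm x (v i)]
        exact Complex.conj_mul' _
      exact_mod_cast h2
    rw [norm_sub_sq (𝕜 := ℂ), e1, e2]
    simp only [RCLike.re_to_complex, Complex.ofReal_re]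
    ring
  have h2 : ∀ s : Finset ι, ‖inner ℂ u x‖ ^ 2 ≤
      ‖u‖ ^ 2 * (‖x‖ ^ 2 - ∑ i ∈ s, ‖inner ℂ (v i) x‖ ^ 2) := by
    intro s
    have : inner ℂ u x = inner ℂ u (x - ∑ i ∈ s, inner ℂ (v i) x • v i) := by
      rw [inner_sub_right, inner_sum]
      simp [inner_smul_right, hu]
    rw [this, ← h1, ← mul_pow]
    exact pow_le_pow_left₀ (norm_nonneg _) (norm_inner_le_norm _ _) 2
  have h3 : Tendsto (fun s : Finset ι => ‖u‖ ^ 2 * (‖x‖ ^ 2 - ∑ i ∈ s, ‖inner ℂ (v i) x‖ ^ 2)) atTop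
      (𝓝 (‖u‖ ^ 2 * (‖x‖ ^ 2 - ‖x‖ ^ 2))) := (hx.const_sub _).const_mul _
  rw [sub_self, mul_zero] at h3
  have h4 := ge_of_tendsto' h3 h2
  have h5 : ‖inner ℂ u x‖ = 0 := by nlinarith [norm_nonneg (inner ℂ u x)]
  exact norm_eq_zero.mp h5

theorem dense_span_bosState :
    ⊤ ≤ (Submodule.span ℂ (Set.range fun X => toFock (bosState X))).topologicalClosure := by
  have h1 : Submodule.span ℂ (Set.range fun X => toFock (bosState X)) = LinearMap.range toFock := by
    rw [show (Set.range fun X => toFock (bosState X)) = toFock '' Set.range bosState from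
      Set.range_comp toFock bosState, ← LinearMap.map_span, span_bosState, Submodule.map_top]
  intro x _
  rw [h1]
  exact denseRange_toFock x

/-- The boson states as a Hilbert basis. -/
def bosBasis : HilbertBasis BLabel ℂ Fock := HilbertBasis.mk orthonormal_bosState dense_span_bosState

theorem bosBasis_apply (X : BLabel) : bosBasis X = toFock (bosState X) := by
  rw [bosBasis, HilbertBasis.coe_mk]

namespace BogParam

variable {c s : ℕ → ℝ} (h : BogParam c s)

include h

/-- The components of the dressed basis vectors in the basis of boson states. -/
def dcoeff (X Y : BLabel) : ℝ := if Y.1 = X.1 then h.coeff X.2 Y.2 else 0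

theorem hasSum_dcoeff_mul (X X' : BLabel) :
    HasSum (fun Y => h.dcoeff X Y * h.dcoeff X' Y) (if X = X' then 1 else 0) := by
  have hinj : Function.Injective fun m : BOcc => ((X.1, m) : BLabel) := fun _ _ e =>
    congrArg Prod.snd e
  refine (hinj.hasSum_iff fun Y hY => ?_).mp ?_
  · have : Y.1 ≠ X.1 := fun e => hY ⟨Y.2, by rw [← e]⟩
    simp [dcoeff, this]
  · by_cases hX : X.1 = X'.1
    · have e : (if X = X' then 1 else 0 : ℝ) = if X.2 = X'.2 then 1 else 0 :=
        if_congr ⟨fun e => by rw [e], fun e => Prod.ext hX e⟩ rfl rfl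
      rw [e]
      simpa [Function.comp_def, dcoeff, hX] using h.hasSum_coeff_mul X.2 X'.2
    · have hne : X ≠ X' := fun e => hX (by rw [e])
      simp [Function.comp_def, dcoeff, hX, hne, hasSum_zero]

theorem hasSum_dcoeff_sq (Y : BLabel) : HasSum (fun X => h.dcoeff X Y ^ 2) 1 := by
  have hinj : Function.Injective fun m : BOcc => ((Y.1, m) : BLabel) := fun _ _ e =>
    congrArg Prod.snd e
  refine (hinj.hasSum_iff fun X hX => ?_).mp ?_
  · have : Y.1 ≠ X.1 := fun e => hX ⟨X.2, by rw [e]⟩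
    simp [dcoeff, this]
  · simpa [Function.comp_def, dcoeff] using h.hasSum_coeff_sq Y.2

/-- The dressed basis vectors. -/
def dressed (X : BLabel) : Fock :=
  bosBasis.repr.symm ⟨fun Y => (h.dcoeff X Y : ℂ), memℓp_two_iff.mpr (by
    simpa [sq] using (h.hasSum_dcoeff_mul X X).summable)⟩

theorem inner_bosState_dressed (X Y : BLabel) :
    inner ℂ (toFock (bosState Y)) (h.dressed X) = h.dcoeff X Y := by
  rw [← bosBasis_apply, ← bosBasis.repr_apply_apply, dressed, LinearIsometryEquiv.apply_symm_apply]

theorem inner_dressed_bosState (X Y : BLabel) :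
    inner ℂ (h.dressed X) (toFock (bosState Y)) = h.dcoeff X Y := by
  rw [← inner_conj_symm, inner_bosState_dressed, Complex.conj_ofReal]

theorem orthonormal_dressed : Orthonormal ℂ h.dressed := by
  rw [orthonormal_iff_ite]
  intro X X'
  have h1 := bosBasis.hasSum_inner_mul_inner (h.dressed X) (h.dressed X')
  simp only [bosBasis_apply, inner_bosState_dressed, inner_dressed_bosState] at h1
  have h2 : HasSum (fun Y => (h.dcoeff X Y : ℂ) * h.dcoeff X' Y) (if X = X' then 1 else 0) := by
    have := Complex.hasSum_ofReal.mpr (h.hasSum_dcoeff_mul X X')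
    push_cast at this
    convert this using 1
    split_ifs <;> simp
  exact h1.unique h2

/-- By the normalization of the rows, each boson state attains equality in Bessel's inequality for
the dressed vectors. A vector orthogonal to these is thus orthogonal to all boson states. -/
theorem span_dressed : (Submodule.span ℂ (Set.range h.dressed))ᗮ = ⊥ := by
  rw [eq_bot_iff]
  intro u hu
  have h1 : ∀ X, inner ℂ u (h.dressed X) = 0 := fun X =>
    Submodule.inner_left_of_mem_orthogonal (Submodule.subset_span (Set.mem_range_self X)) hu
  have h2 : ∀ Y, inner ℂ u (toFock (bosState Y)) = 0 := fun Y => by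
    refine inner_eq_zero_of_hasSum h.orthonormal_dressed ?_ h1
    simp only [inner_dressed_bosState, Complex.norm_real, Real.norm_eq_abs, sq_abs]
    rw [orthonormal_bosState.1, one_pow]
    exact h.hasSum_dcoeff_sq Y
  rw [Submodule.mem_bot, ← bosBasis.repr.map_eq_zero_iff]
  ext Y
  rw [bosBasis.repr_apply_apply, bosBasis_apply, ← inner_conj_symm, h2]
  simp

/-- The dressed vectors as a Hilbert basis. -/
def basis : HilbertBasis BLabel ℂ Fock :=
  HilbertBasis.mkOfOrthogonalEqBot h.orthonormal_dressed h.span_dressed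

theorem basis_apply (X : BLabel) : h.basis X = h.dressed X := by
  rw [basis, HilbertBasis.coe_mkOfOrthogonalEqBot]

/-- The components of a finite-particle vector along the dressed vectors. -/
def comp (X : BLabel) : FockAlg →ₗ[ℂ] ℂ := (innerSL ℂ (h.dressed X)).toLinearMap ∘ₗ toFock

theorem comp_apply (X : BLabel) (ψ : FockAlg) : h.comp X ψ = inner ℂ (h.dressed X) (toFock ψ) := rfl

theorem comp_eq_repr (X : BLabel) (ψ : FockAlg) : h.comp X ψ = h.basis.repr (toFock ψ) X := by
  rw [h.basis.repr_apply_apply, basis_apply, comp_apply]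

theorem comp_bosState (X Y : BLabel) : h.comp X (bosState Y) = h.dcoeff X Y :=
  h.inner_dressed_bosState X Y

theorem hasSum_comp (χ ψ : FockAlg) :
    HasSum (fun X => conj (h.comp X χ) * h.comp X ψ) (algInner χ ψ) := by
  have h1 := h.basis.hasSum_inner_mul_inner (toFock χ) (toFock ψ)
  simp only [basis_apply] at h1
  simp only [comp_apply, inner_conj_symm]
  exact h1

/-- By linearity it suffices to test on the boson states, which span algebraically; there it is the
recursion `raise_coeff`. -/
theorem comp_bog (j : BMode) (X : BLabel) (ψ : FockAlg) :
    h.comp X (bog c s bos bosd j ψ) =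
      ((√(X.2 j + 1) : ℝ) : ℂ) * h.comp (X.1, X.2 + Finsupp.single j 1) ψ := by
  have : h.comp X ∘ₗ bog c s bos bosd j =
      ((√(X.2 j + 1) : ℝ) : ℂ) • h.comp (X.1, X.2 + Finsupp.single j 1) := by
    refine LinearMap.ext_on_range span_bosState fun Y => ?_
    obtain ⟨w, m⟩ := Y
    simp only [LinearMap.comp_apply, LinearMap.smul_apply, bog, LinearMap.add_apply, map_add,
      map_smul, bos_bosState, bosd_bosState, comp_bosState, smul_eq_mul]
    unfold dcoeff
    simp only
    split_ifs
    · have := h.raise_coeff j X.2 m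
      refine Eq.trans ?_ ((congrArg Complex.ofReal this).trans (Complex.ofReal_mul _ _))
      push_cast
      rfl
    · simp
  exact LinearMap.congr_fun this ψ

theorem comp_charge (r : ℤˣ) (X : BLabel) (ψ : FockAlg) :
    h.comp X (charge r ψ) = ((r : ℤ) * X.1 r : ℂ) * h.comp X ψ := by
  have : h.comp X ∘ₗ charge r = ((r : ℤ) * X.1 r : ℂ) • h.comp X := by
    refine LinearMap.ext_on_range span_bosState fun Y => ?_
    simp only [LinearMap.comp_apply, LinearMap.smul_apply, charge_bosState, map_smul, comp_bosState,
      smul_eq_mul]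
    unfold dcoeff
    split_ifs with e
    · rw [e]
    · simp
  exact LinearMap.congr_fun this ψ

theorem hasSum_bog (j : BMode) (χ ψ : FockAlg) :
    HasSum (fun X : BLabel => (X.2 j : ℂ) * (conj (h.comp X χ) * h.comp X ψ))
      (algInner (bog c s bos bosd j χ) (bog c s bos bosd j ψ)) := by
  have hinj : Function.Injective fun X : BLabel => ((X.1, X.2 + Finsupp.single j 1) : BLabel) := by
    rintro ⟨w, x⟩ ⟨w', x'⟩ e
    simp only [Prod.mk.injEq, add_left_inj] at e
    exact Prod.ext e.1 e.2
  refine (hinj.hasSum_iff fun X hX => ?_).mp ?_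
  · have : X.2 j = 0 := by
      by_contra h0
      exact hX ⟨(X.1, X.2 - Finsupp.single j 1), by
        simp only [tsub_add_cancel_of_le (single_le_of_ne h0)]⟩
    simp [this]
  · have h1 := h.hasSum_comp (bog c s bos bosd j χ) (bog c s bos bosd j ψ)
    simp only [comp_bog, map_mul, Complex.conj_ofReal] at h1
    convert h1 using 1
    ext X
    have e : ((√(X.2 j + 1) : ℝ) : ℂ) * ((√(X.2 j + 1) : ℝ) : ℂ) = X.2 j + 1 := by
      rw [← Complex.ofReal_mul, Real.mul_self_sqrt (by positivity)]; push_cast; rfl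
    simp only [Function.comp, Finsupp.add_apply, Finsupp.single_eq_same]
    push_cast
    linear_combination (-conj (h.comp (X.1, X.2 + Finsupp.single j 1) χ) *
      h.comp (X.1, X.2 + Finsupp.single j 1) ψ) * e

end BogParam

/-! ### The Hamiltonian in terms of bosons -/

theorem hasSum_of_eq {ι : Type*} {f g : ι → ℂ} {a b : ℂ} (h : HasSum f a) (hf : ∀ i, g i = f i)
    (hb : b = a) : HasSum g b := by
  rw [hb, funext hf]
  exact h

theorem algInner_bos (j : BMode) (χ ψ : FockAlg) :
    algInner (bos j χ) ψ = algInner χ (bosd j ψ) := by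
  rw [← algInner_conj, ← algInner_bosd, algInner_conj]

theorem bos_eventually_zero (r : ℤˣ) (ψ : FockAlg) : ∀ᶠ n : ℕ in atTop, bos (r, n) ψ = 0 := by
  filter_upwards [(tendsto_add_atTop_nat 1).eventually (low_eventually_zero r ψ)] with n hn
  rw [low_eq] at hn
  exact (smul_eq_zero_iff_right (sqrt_ne _)).mp hn

theorem sqrt_mul_self_cast (n : ℕ) : ((√(n + 1) : ℝ) : ℂ) * ((√(n + 1) : ℝ) : ℂ) = n + 1 := by
  rw [← Complex.ofReal_mul, Real.mul_self_sqrt (by positivity)]; push_cast; rfl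

theorem density_one_pos (n : ℕ) (χ : FockAlg) :
    density 1 (n + 1) χ = ((√(n + 1) : ℝ) : ℂ) • bos (1, n) χ := by
  simpa using density_pos (1, n) χ

theorem density_one_neg (n : ℕ) (χ : FockAlg) :
    density 1 (-(n + 1)) χ = ((√(n + 1) : ℝ) : ℂ) • bosd (1, n) χ := by
  simpa using density_neg (1, n) χ

theorem density_neg_one_pos (n : ℕ) (χ : FockAlg) :
    density (-1) (n + 1) χ = ((√(n + 1) : ℝ) : ℂ) • bosd (-1, n) χ := by
  simpa using density_neg (-1, n) χ

theorem density_neg_one_neg (n : ℕ) (χ : FockAlg) :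
    density (-1) (-(n + 1)) χ = ((√(n + 1) : ℝ) : ℂ) • bos (-1, n) χ := by
  simpa using density_pos (-1, n) χ

theorem algInner_freeHamiltonian (M : Model) (L : ℝ) (χ ψ : FockAlg) :
    algInner χ (M.freeHamiltonian L ψ) = ((M.vF * Real.pi / L : ℝ) : ℂ) *
      ∑ r : ℤˣ, algInner χ (diagOp (fun S => (eng r S : ℂ)) ψ) := by
  have h1 : M.freeHamiltonian L = ((M.vF * Real.pi / L : ℝ) : ℂ) •
      ∑ r : ℤˣ, diagOp (fun S => (eng r S : ℂ)) := by
    refine Finsupp.lhom_ext fun S d => ?_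
    have hS : Finsupp.single S d = d • Finsupp.single S (1 : ℂ) := by simp
    rw [hS, map_smul, map_smul]
    congr 1
    have h2 : ∀ m : Mode, ((((m.1 : ℤ) : ℝ) * M.vF * fermionMomentum L m.2 : ℝ) : ℂ) •
        wick (cre m ∘ₗ ann m) (Finsupp.single S 1) =
        (if m ∈ S then (M.vF * Real.pi / L : ℂ) * ((2 * m.2 + 1).natAbs : ℂ) else 0) •
          Finsupp.single S (1 : ℂ) := by
      intro m
      rw [wick_cre_ann, cre_ann_self_single]
      have e0 : (if Occ m S then Finsupp.single S (1 : ℂ) else 0) =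
        (if Occ m S then (1 : ℂ) else 0) • Finsupp.single S 1 := by split_ifs <;> simp
      rw [e0, ← sub_smul, smul_smul]
      congr 1
      have e1 : ((m.1 : ℤ) * (2 * m.2 + 1)).natAbs = (2 * m.2 + 1).natAbs := by
        rw [Int.natAbs_mul]; simp
      have e2 : ∀ z : ℤ, ((z.natAbs : ℕ) : ℂ) = (|z| : ℤ) := fun z => by
        rw [Int.abs_eq_natAbs]; simp
      have e3 : ((((m.1 : ℤ) : ℝ) * M.vF * fermionMomentum L m.2 : ℝ) : ℂ) =
          (M.vF * Real.pi / L : ℂ) * (((m.1 : ℤ) * (2 * m.2 + 1) : ℤ) : ℂ) := by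
        rw [fermionMomentum]; push_cast; ring
      rw [← e1, e2, e3]
      by_cases hm : m ∈ S <;> by_cases hs : InSea m
      · have : ¬ Occ m S := by simp [Occ, hm, hs]
        have h4 : (m.1 : ℤ) * (2 * m.2 + 1) < 0 := hs
        rw [abs_of_neg h4]
        simp [this, hm, hs]
      · have : Occ m S := by simp [Occ, hm, hs]
        have h4 : 0 ≤ (m.1 : ℤ) * (2 * m.2 + 1) := not_lt.mp hs
        rw [abs_of_nonneg h4]
        simp [this, hm, hs]
      · have : Occ m S := by simp [Occ, hm, hs]
        simp [this, hm, hs]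
      · have : ¬ Occ m S := by simp [Occ, hm, hs]
        simp [this, hm, hs]
    rw [Model.freeHamiltonian, Finsupp.linearCombination_single, one_smul]
    simp only [h2]
    rw [finsum_eq_sum_of_support_subset (s := S)]
    · rw [← Finset.sum_smul, Finset.sum_congr rfl fun m hm => if_pos hm, ← Finset.mul_sum,
        LinearMap.smul_apply, LinearMap.sum_apply]
      simp only [diagOp_single]
      rw [← Finset.sum_smul, smul_smul]
      congr 1
      push_cast
      congr 1
      simp only [eng]
      push_cast
      rw [← Finset.sum_fiberwise S (fun m => m.1)]
    · intro m hm
      by_contra h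
      exact hm (by simp [show m ∉ S by simpa using h])
  rw [h1, LinearMap.smul_apply, algInner_smul_right, LinearMap.sum_apply, algInner_sum_right]

namespace Model

variable (M : Model) (L : ℝ)

/-- The contribution of the momenta `±p`, `p = 2 π (n + 1) / L`, to the form of the Hamiltonian. -/
def tform (n : ℕ) (χ ψ : FockAlg) : ℂ :=
  ((momentum L (n + 1) * M.vF : ℝ) : ℂ) *
    (((1 + M.gt₄ (momentum L (n + 1)) : ℝ) : ℂ) *
      (algInner (bos (1, n) χ) (bos (1, n) ψ) + algInner (bos (-1, n) χ) (bos (-1, n) ψ)) +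
    ((M.gt₂ (momentum L (n + 1)) : ℝ) : ℂ) *
      (algInner χ (bos (1, n) (bos (-1, n) ψ)) + algInner (bos (1, n) (bos (-1, n) χ)) ψ))

/-- The contribution of the charges to the form of the Hamiltonian. -/
def zform (χ ψ : FockAlg) : ℂ :=
  ((M.vF * Real.pi / L : ℝ) : ℂ) * ∑ r : ℤˣ, algInner χ (charge r (charge r ψ)) +
  M.g₂ * ∑ r : ℤˣ, ((1 / L * M.V₂ 0 : ℝ) : ℂ) * algInner χ (charge r (charge (-r) ψ)) +
  M.g₄ * ∑ r : ℤˣ, ((1 / L * M.V₄ 0 : ℝ) : ℂ) * algInner χ (charge r (charge r ψ)) -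
    ∑ r : ℤˣ, ((M.μ r - M.μ₀ : ℝ) : ℂ) * algInner χ (charge r ψ)

theorem sum_units {A : Type*} [AddCommMonoid A] (f : ℤˣ → A) : ∑ r : ℤˣ, f r = f 1 + f (-1) := by
  rw [UnitsInt.univ]
  exact Finset.sum_pair (by decide)

theorem hasSum_free (χ ψ : FockAlg) :
    HasSum (fun n : ℕ => ((M.vF * Real.pi / L : ℝ) : ℂ) * (2 * (n + 1)) *
      (algInner (bos (1, n) χ) (bos (1, n) ψ) + algInner (bos (-1, n) χ) (bos (-1, n) ψ)))
      (algInner χ (M.freeHamiltonian L ψ) - ((M.vF * Real.pi / L : ℝ) : ℂ) *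
        ∑ r : ℤˣ, algInner χ (charge r (charge r ψ))) := by
  have h1 : ∀ r : ℤˣ, HasSum (fun n : ℕ => 2 * (n + 1) * algInner (bos (r, n) χ) (bos (r, n) ψ))
      (algInner χ (diagOp (fun S => (eng r S : ℂ)) ψ) - algInner χ (charge r (charge r ψ))) := by
    intro r
    refine hasSum_of_eq (hasSum_low r χ ψ) (fun n => ?_) ?_
    · rw [low_eq, low_eq, algInner_smul_left, algInner_smul_right, Complex.conj_ofReal,
        ← mul_assoc _ _ (algInner _ _), sqrt_mul_self_cast, mul_assoc]
    · rw [← algInner_sub_right]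
      congr 1
      ext S
      simp only [charge_eq_diagOp, Finsupp.sub_apply, diagOp_apply]
      ring
  rw [algInner_freeHamiltonian, ← mul_sub, ← Finset.sum_sub_distrib, sum_units]
  exact hasSum_of_eq (((h1 1).add (h1 (-1))).mul_left ((M.vF * Real.pi / L : ℝ) : ℂ))
    (fun n => by ring) rfl

theorem term₂_eq (n : ℕ) (χ ψ : FockAlg) :
    ∑ r : ℤˣ, ((1 / L * M.V₂ (momentum L (n + 1)) : ℝ) : ℂ) *
      algInner χ ((density r (n + 1) ∘ₗ density (-r) (-(n + 1)) +
        density r (-(n + 1)) ∘ₗ density (-r) (n + 1)) ψ) =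
    ((1 / L * M.V₂ (momentum L (n + 1)) : ℝ) : ℂ) * (2 * (n + 1)) *
      (algInner χ (bos (1, n) (bos (-1, n) ψ)) + algInner (bos (1, n) (bos (-1, n) χ)) ψ) := by
  rw [sum_units]
  simp only [LinearMap.add_apply, LinearMap.comp_apply, neg_neg, density_one_pos, density_one_neg,
    density_neg_one_pos, density_neg_one_neg, map_smul, smul_smul, sqrt_mul_self_cast,
    algInner_add_right, algInner_smul_right, algInner_bos, ccr_bos.comm_cre (1, n) (-1, n),
    ccr_bos.comm_ann (1, n) (-1, n)]
  ring

/-- Wick ordering removes precisely the commutator term `n + 1`. What is left is a boson number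
operator, so the interaction within one chirality contributes no vacuum energy by itself. -/
theorem wick_bilinear (n : ℕ) (r : ℤˣ) (ψ : FockAlg) :
    wick (density r (n + 1) ∘ₗ density r (-(n + 1)) + density r (-(n + 1)) ∘ₗ density r (n + 1)) ψ =
      (2 * (n + 1) : ℂ) • bosd (r, n) (bos (r, n) ψ) := by
  have h1 : ∀ χ : FockAlg, (density r (n + 1) ∘ₗ density r (-(n + 1)) +
      density r (-(n + 1)) ∘ₗ density r (n + 1)) χ =
      (2 * (n + 1) : ℂ) • bosd (r, n) (bos (r, n) χ) + (n + 1 : ℂ) • χ := by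
    intro χ
    rcases Int.units_eq_one_or r with rfl | rfl
    · simp only [LinearMap.add_apply, LinearMap.comp_apply, density_one_pos, density_one_neg,
        map_smul, smul_smul, sqrt_mul_self_cast, ccr_bos.comm, if_true]
      module
    · simp only [LinearMap.add_apply, LinearMap.comp_apply, density_neg_one_pos,
        density_neg_one_neg, map_smul, smul_smul, sqrt_mul_self_cast, ccr_bos.comm, if_true]
      module
  rw [wick, LinearMap.sub_apply, h1, h1, bos_vac]
  simp [vac]

theorem term₄_eq (n : ℕ) (χ ψ : FockAlg) :
    ∑ r : ℤˣ, ((1 / L * M.V₄ (momentum L (n + 1)) : ℝ) : ℂ) *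
      algInner χ (wick (density r (n + 1) ∘ₗ density r (-(n + 1)) +
        density r (-(n + 1)) ∘ₗ density r (n + 1)) ψ) =
    ((1 / L * M.V₄ (momentum L (n + 1)) : ℝ) : ℂ) * (2 * (n + 1)) *
      (algInner (bos (1, n) χ) (bos (1, n) ψ) + algInner (bos (-1, n) χ) (bos (-1, n) ψ)) := by
  rw [sum_units]
  simp only [wick_bilinear, algInner_smul_right, algInner_bos]
  ring

theorem hasSum_finsum_of_eventually {f : ℕ → ℂ} (h : ∀ᶠ n in atTop, f n = 0) :
    HasSum f (∑ᶠ n, f n) := by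
  have hf : f.support.Finite := by
    obtain ⟨N, hN⟩ := eventually_atTop.mp h
    exact (Set.finite_lt_nat N).subset fun n hn => by
      by_contra h2
      exact hn (hN n (not_lt.mp h2))
  rw [← tsum_eq_finsum (L := .unconditional ℕ) hf]
  exact (summable_of_hasFiniteSupport hf).hasSum

theorem hasSum_tform (hv : M.vF ≠ 0) (hL : L ≠ 0) (χ ψ : FockAlg) :
    HasSum (fun n => M.tform L n χ ψ) (M.form L χ ψ - M.zform L χ ψ) := by
  have h2 : HasSum (fun n : ℕ => ((1 / L * M.V₂ (momentum L (n + 1)) : ℝ) : ℂ) * (2 * (n + 1)) *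
      (algInner χ (bos (1, n) (bos (-1, n) ψ)) + algInner (bos (1, n) (bos (-1, n) χ)) ψ))
      (M.form₂ L χ ψ - ∑ r : ℤˣ, ((1 / L * M.V₂ 0 : ℝ) : ℂ) *
        algInner χ (charge r (charge (-r) ψ))) := by
    rw [form₂, add_sub_cancel_left]
    simp only [term₂_eq]
    refine hasSum_finsum_of_eventually ?_
    filter_upwards [bos_eventually_zero (-1) χ, bos_eventually_zero (-1) ψ] with n e1 e2
    rw [e1, e2]; simp [algInner]
  have h4 : HasSum (fun n : ℕ => ((1 / L * M.V₄ (momentum L (n + 1)) : ℝ) : ℂ) * (2 * (n + 1)) *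
      (algInner (bos (1, n) χ) (bos (1, n) ψ) + algInner (bos (-1, n) χ) (bos (-1, n) ψ)))
      (M.form₄ L χ ψ - ∑ r : ℤˣ, ((1 / L * M.V₄ 0 : ℝ) : ℂ) *
        algInner χ (charge r (charge r ψ))) := by
    rw [form₄, add_sub_cancel_left]
    simp only [term₄_eq]
    refine hasSum_finsum_of_eventually ?_
    filter_upwards [bos_eventually_zero (-1) χ, bos_eventually_zero 1 χ] with n e1 e2
    rw [e1, e2]; simp [algInner]
  have h := ((M.hasSum_free L χ ψ).add (h2.mul_left (M.g₂ : ℂ))).add (h4.mul_left (M.g₄ : ℂ))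
  have hv' : (M.vF : ℂ) ≠ 0 := Complex.ofReal_ne_zero.mpr hv
  have hL' : (L : ℂ) ≠ 0 := Complex.ofReal_ne_zero.mpr hL
  have hpi : (Real.pi : ℂ) ≠ 0 := Complex.ofReal_ne_zero.mpr Real.pi_ne_zero
  refine hasSum_of_eq h (fun n => ?_) ?_
  · simp only [tform, gt₂, gt₄, momentum]
    push_cast
    field_simp
    ring
  · rw [form, zform]; ring

end Model

theorem bog_apply (c s : ℕ → ℝ) (j : BMode) (ψ : FockAlg) :
    bog c s bos bosd j ψ = ((c j.2 : ℝ) : ℂ) • bos j ψ + ((s j.2 : ℝ) : ℂ) • bosd (bar j) ψ := rfl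

theorem algInner_bosd_right (j : BMode) (χ ψ : FockAlg) :
    algInner χ (bosd j ψ) = algInner (bos j χ) ψ := (algInner_bos j χ ψ).symm

/-- The last term arises from reordering `bosd` and `bos`, once for each chirality. Summed over the
momenta it becomes the shift of the vacuum energy. -/
theorem algInner_bog_add (c s : ℕ → ℝ) (n : ℕ) (χ ψ : FockAlg) :
    algInner (bog c s bos bosd (1, n) χ) (bog c s bos bosd (1, n) ψ) +
      algInner (bog c s bos bosd (-1, n) χ) (bog c s bos bosd (-1, n) ψ) =
    ((c n ^ 2 + s n ^ 2 : ℝ) : ℂ) *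
      (algInner (bos (1, n) χ) (bos (1, n) ψ) + algInner (bos (-1, n) χ) (bos (-1, n) ψ)) +
    ((2 * c n * s n : ℝ) : ℂ) *
      (algInner χ (bos (1, n) (bos (-1, n) ψ)) + algInner (bos (1, n) (bos (-1, n) χ)) ψ) +
    ((2 * s n ^ 2 : ℝ) : ℂ) * algInner χ ψ := by
  have e1 : bar ((1 : ℤˣ), n) = (-1, n) := rfl
  have e2 : bar ((-1 : ℤˣ), n) = (1, n) := by simp [bar]
  have e3 : ∀ r : ℤˣ, algInner (bosd (r, n) χ) (bosd (r, n) ψ) =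
      algInner (bos (r, n) χ) (bos (r, n) ψ) + algInner χ ψ := fun r => by
    rw [algInner_bosd, ccr_bos.comm, if_pos rfl, algInner_add_right, algInner_bosd_right]
  simp only [bog_apply, e1, e2, algInner_add_left, algInner_add_right, algInner_smul_left,
    algInner_smul_right, Complex.conj_ofReal, e3]
  simp only [algInner_bosd, algInner_bosd_right, ccr_bos.comm_ann (-1, n) (1, n)]
  push_cast
  ring

namespace Model

variable (M : Model) (L : ℝ)

/-- `√((1 + g̃₄)² - g̃₂²)` at the momentum `2 π (n + 1) / L`. -/
def ww (n : ℕ) : ℝ :=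
  √((1 + M.gt₄ (momentum L (n + 1))) ^ 2 - M.gt₂ (momentum L (n + 1)) ^ 2)

/-- The first coefficient of the diagonalizing Bogoliubov transformation. -/
def bc (n : ℕ) : ℝ := √((1 + M.gt₄ (momentum L (n + 1)) + M.ww L n) / (2 * M.ww L n))

/-- The second coefficient of the diagonalizing Bogoliubov transformation. -/
def bs (n : ℕ) : ℝ := M.gt₂ (momentum L (n + 1)) / (2 * M.ww L n * M.bc L n)

/-- The energies of the bosons. -/
def om (n : ℕ) : ℝ := momentum L (n + 1) * M.vF * M.ww L n

theorem momentum_pos {L : ℝ} (hL : 0 < L) (n : ℕ) : 0 < momentum L (n + 1) := by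
  unfold momentum; push_cast; positivity

end Model

namespace Model.Admissible

variable {M : Model} {L : ℝ} (h : M.Admissible L)

include h

theorem pi_vF_pos : 0 < Real.pi * M.vF := mul_pos Real.pi_pos h.vF_pos

theorem add_eq (p : ℝ) : Real.pi * M.vF + M.g₄ * M.V₄ p = Real.pi * M.vF * (1 + M.gt₄ p) := by
  rw [gt₄, mul_add, mul_div_cancel₀ _ h.pi_vF_pos.ne', mul_one]

theorem mul_eq (p : ℝ) : M.g₂ * M.V₂ p = Real.pi * M.vF * M.gt₂ p := by
  rw [gt₂, mul_div_cancel₀ _ h.pi_vF_pos.ne']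

theorem gt_lt (n : ℤ) : |M.gt₂ (momentum L n)| < 1 + M.gt₄ (momentum L n) := by
  have h1 := h.stable n
  rw [h.add_eq, h.mul_eq, abs_mul, abs_of_pos h.pi_vF_pos] at h1
  exact lt_of_mul_lt_mul_left h1 h.pi_vF_pos.le

theorem gt_lt' (n : ℕ) : |M.gt₂ (momentum L (n + 1))| < 1 + M.gt₄ (momentum L (n + 1)) := by
  exact_mod_cast h.gt_lt (n + 1)

theorem x_pos (n : ℕ) : 0 < 1 + M.gt₄ (momentum L (n + 1)) := (abs_nonneg _).trans_lt (h.gt_lt' n)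

theorem ww_sq (n : ℕ) : M.ww L n ^ 2 =
    (1 + M.gt₄ (momentum L (n + 1))) ^ 2 - M.gt₂ (momentum L (n + 1)) ^ 2 := by
  rw [ww, Real.sq_sqrt]
  have := h.gt_lt' n
  rw [sub_nonneg, ← sq_abs (M.gt₂ _)]
  exact pow_le_pow_left₀ (abs_nonneg _) this.le 2

theorem ww_pos (n : ℕ) : 0 < M.ww L n := by
  have := h.gt_lt' n
  refine Real.sqrt_pos.mpr ?_
  rw [sub_pos, ← sq_abs (M.gt₂ _)]
  exact pow_lt_pow_left₀ this (abs_nonneg _) two_ne_zero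

theorem bc_sq (n : ℕ) :
    M.bc L n ^ 2 = (1 + M.gt₄ (momentum L (n + 1)) + M.ww L n) / (2 * M.ww L n) := by
  have := h.x_pos n
  have := h.ww_pos n
  rw [bc, Real.sq_sqrt (by positivity)]

theorem bc_pos (n : ℕ) : 0 < M.bc L n := by
  have := h.x_pos n
  have := h.ww_pos n
  exact Real.sqrt_pos.mpr (by positivity)

theorem bs_sq (n : ℕ) :
    M.bs L n ^ 2 = (1 + M.gt₄ (momentum L (n + 1)) - M.ww L n) / (2 * M.ww L n) := by
  have h1 := h.x_pos n
  have h2 := h.ww_pos n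
  have h3 := h.ww_sq n
  rw [bs, div_pow, mul_pow, h.bc_sq]
  have : 1 + M.gt₄ (momentum L (n + 1)) + M.ww L n ≠ 0 := by positivity
  field_simp
  linear_combination h3

theorem sub_sq (n : ℕ) : M.bc L n ^ 2 - M.bs L n ^ 2 = 1 := by
  have h2 := h.ww_pos n
  rw [h.bc_sq, h.bs_sq]
  field_simp; ring

/-- With `c = cosh θ` and `s = sinh θ`, the choice of θ is tanh 2θ = g̃₂/(1 + g̃₄). This identity
and the next one give cosh 2θ and sinh 2θ multiplied by the boson energy, which matches the diagonal
and off-diagonal coefficients of the Hamiltonian. -/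
theorem om_mul_add_sq (n : ℕ) : M.om L n * (M.bc L n ^ 2 + M.bs L n ^ 2) =
    momentum L (n + 1) * M.vF * (1 + M.gt₄ (momentum L (n + 1))) := by
  have h2 := h.ww_pos n
  rw [h.bc_sq, h.bs_sq, om]
  field_simp; ring

theorem om_mul_mul (n : ℕ) : M.om L n * (2 * M.bc L n * M.bs L n) =
    momentum L (n + 1) * M.vF * M.gt₂ (momentum L (n + 1)) := by
  have h2 := h.ww_pos n
  have h3 := h.bc_pos n
  rw [bs, om]
  field_simp

/-- With x = 1 + g̃₄ and w² = x² − g̃₂², the square of `s/c` is (x − w)/(x + w). This is at most (x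
− w)(x + w)/x² = (g̃₂/x)², the summand of `implementable`. -/
theorem bogParam : BogParam (M.bc L) (M.bs L) := by
  refine ⟨h.bc_pos, h.sub_sq, ?_⟩
  refine Summable.of_nonneg_of_le (fun n => sq_nonneg _) (fun n => ?_) h.implementable
  have h1 := h.x_pos n
  have h2 := h.ww_pos n
  have h3 := h.ww_sq n
  have h4 := h.pi_vF_pos
  have e : M.g₂ * M.V₂ (momentum L (n + 1)) /
      (Real.pi * M.vF + M.g₄ * M.V₄ (momentum L (n + 1))) =
      M.gt₂ (momentum L (n + 1)) / (1 + M.gt₄ (momentum L (n + 1))) := by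
    rw [h.add_eq, h.mul_eq, mul_div_mul_left _ _ h4.ne']
  rw [e, div_pow, div_pow, h.bs_sq, h.bc_sq, div_div_div_cancel_right₀ (by positivity),
    div_le_div_iff₀ (by positivity) (by positivity)]
  set x := 1 + M.gt₄ (momentum L (n + 1))
  set w := M.ww L n
  have h6 : M.gt₂ (momentum L (n + 1)) ^ 2 = (x - w) * (x + w) := by linear_combination h3
  have h7 : 0 ≤ x - w := by
    have : 0 ≤ (x - w) * (x + w) := h6 ▸ sq_nonneg _
    exact nonneg_of_mul_nonneg_left this (by positivity)
  rw [h6, mul_assoc]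
  refine mul_le_mul_of_nonneg_left ?_ h7
  nlinarith

/-- In the same notation the vacuum energy of a mode is p v_F (x − w), which is at most p v_F
g̃₂²/x, that is, v_F times the summand of `finite_energy`. -/
theorem summable_om (hL : 0 < L) : Summable fun n => M.om L n * (2 * M.bs L n ^ 2) := by
  have h0 := (h.finite_energy.mul_left M.vF)
  refine Summable.of_nonneg_of_le (fun n => ?_) (fun n => ?_) h0
  · have h2 := h.ww_pos n
    have := momentum_pos hL n
    have := h.vF_pos
    unfold om; positivity
  have h1 := h.x_pos n
  have h2 := h.ww_pos n
  have h3 := h.ww_sq n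
  have h4 := h.pi_vF_pos
  have h5 := h.vF_pos
  have hp := momentum_pos hL n
  have e : momentum L (n + 1) * (M.g₂ * M.V₂ (momentum L (n + 1))) ^ 2 /
      (Real.pi * M.vF * (Real.pi * M.vF + M.g₄ * M.V₄ (momentum L (n + 1)))) =
      momentum L (n + 1) * (M.gt₂ (momentum L (n + 1)) ^ 2 / (1 + M.gt₄ (momentum L (n + 1)))) := by
    rw [h.add_eq, h.mul_eq]
    field_simp
  rw [e, om, h.bs_sq]
  set x := 1 + M.gt₄ (momentum L (n + 1))
  set w := M.ww L n
  have h6 : M.gt₂ (momentum L (n + 1)) ^ 2 = (x - w) * (x + w) := by linear_combination h3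
  have h7 : 0 ≤ x - w := by
    have : 0 ≤ (x - w) * (x + w) := h6 ▸ sq_nonneg _
    exact nonneg_of_mul_nonneg_left this (by positivity)
  have e2 : momentum L (n + 1) * M.vF * w * (2 * ((x - w) / (2 * w))) =
      M.vF * (momentum L (n + 1) * (x - w)) := by field_simp
  rw [e2, h6]
  refine mul_le_mul_of_nonneg_left (mul_le_mul_of_nonneg_left ?_ hp.le) h5.le
  rw [le_div_iff₀ h1]
  exact mul_le_mul_of_nonneg_left (by linarith) h7

theorem om_pos (hL : 0 < L) (n : ℕ) : 0 < M.om L n :=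
  mul_pos (mul_pos (momentum_pos hL n) h.vF_pos) (h.ww_pos n)

theorem tform_eq (n : ℕ) (χ ψ : FockAlg) :
    M.tform L n χ ψ = (M.om L n : ℂ) *
      (algInner (bog (M.bc L) (M.bs L) bos bosd (1, n) χ) (bog (M.bc L) (M.bs L) bos bosd (1, n) ψ) +
        algInner (bog (M.bc L) (M.bs L) bos bosd (-1, n) χ)
          (bog (M.bc L) (M.bs L) bos bosd (-1, n) ψ)) -
      ((M.om L n * (2 * M.bs L n ^ 2) : ℝ) : ℂ) * algInner χ ψ := by
  have h1 := congrArg Complex.ofReal (h.om_mul_add_sq n)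
  have h2 := congrArg Complex.ofReal (h.om_mul_mul n)
  rw [algInner_bog_add, tform]
  push_cast at h1 h2 ⊢
  linear_combination (-(algInner (bos (1, n) χ) (bos (1, n) ψ) +
    algInner (bos (-1, n) χ) (bos (-1, n) ψ))) * h1 - (algInner χ (bos (1, n) (bos (-1, n) ψ)) +
    algInner (bos (1, n) (bos (-1, n) χ)) ψ) * h2

end Model.Admissible

/-! ### Interchanging the sums over momenta and over basis vectors -/

theorem summable_diag {ι : Type*} {k : ℕ → ι → ℝ} (hk : ∀ n X, 0 ≤ k n X) {u : ι → ℂ} {a : ℕ → ℂ}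
    (hu : ∀ n, HasSum (fun X => (k n X : ℂ) * (conj (u X) * u X)) (a n)) (ha : Summable a) :
    Summable fun nX : ℕ × ι => k nX.1 nX.2 * ‖u nX.2‖ ^ 2 := by
  have h1 : ∀ n, HasSum (fun X => ((k n X * ‖u X‖ ^ 2 : ℝ) : ℂ)) (a n) := fun n =>
    hasSum_of_eq (hu n) (fun X => by rw [Complex.conj_mul']; push_cast; ring) rfl
  refine (summable_prod_of_nonneg fun nX => mul_nonneg (hk _ _) (sq_nonneg _)).mpr
    ⟨fun n => Complex.summable_ofReal.mp (h1 n).summable, Complex.summable_ofReal.mp ?_⟩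
  refine ha.congr fun n => ?_
  rw [← (h1 n).tsum_eq, Complex.ofReal_tsum]

/-- For equal vectors all terms are nonnegative, so the double sum converges once the iterated one
does. For different vectors the terms are dominated by those of the two diagonal cases, and the
order of summation may be exchanged. -/
theorem hasSum_diag {ι : Type*} {k : ℕ → ι → ℝ} (hk : ∀ n X, 0 ≤ k n X) {e : ι → ℝ}
    (he : ∀ X, HasSum (fun n => k n X) (e X)) {u v : ι → ℂ} {a b t : ℕ → ℂ} {S : ℂ}
    (hu : ∀ n, HasSum (fun X => (k n X : ℂ) * (conj (u X) * u X)) (a n)) (ha : Summable a)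
    (hv : ∀ n, HasSum (fun X => (k n X : ℂ) * (conj (v X) * v X)) (b n)) (hb : Summable b)
    (huv : ∀ n, HasSum (fun X => (k n X : ℂ) * (conj (u X) * v X)) (t n)) (ht : HasSum t S) :
    HasSum (fun X => (e X : ℂ) * (conj (u X) * v X)) S := by
  have hs : Summable fun nX : ℕ × ι => (k nX.1 nX.2 : ℂ) * (conj (u nX.2) * v nX.2) := by
    refine Summable.of_norm_bounded ((summable_diag hk hu ha).add (summable_diag hk hv hb))
      fun nX => ?_
    rw [norm_mul, norm_mul, RCLike.norm_conj, Complex.norm_of_nonneg (hk _ _), ← mul_add]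
    refine mul_le_mul_of_nonneg_left ?_ (hk _ _)
    nlinarith [sq_nonneg (‖u nX.2‖ - ‖v nX.2‖), sq_nonneg ‖u nX.2‖, sq_nonneg ‖v nX.2‖]
  obtain ⟨z, hz⟩ := hs
  have htot : HasSum t z := hz.prod_fiberwise (f := fun nX : ℕ × ι =>
    (k nX.1 nX.2 : ℂ) * (conj (u nX.2) * v nX.2)) huv
  rw [ht.unique htot]
  have hsw : HasSum (fun Xn : ι × ℕ => (k Xn.2 Xn.1 : ℂ) * (conj (u Xn.1) * v Xn.1)) z :=
    (Equiv.prodComm ι ℕ).hasSum_iff.mpr hz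
  refine hsw.prod_fiberwise (f := fun Xn : ι × ℕ =>
    (k Xn.2 Xn.1 : ℂ) * (conj (u Xn.1) * v Xn.1)) fun X => ?_
  exact (Complex.hasSum_ofReal.mpr (he X)).mul_right (conj (u X) * v X)

/-! ### The eigenvalues and the diagonalized form -/

namespace Model

variable (M : Model) (L : ℝ)

/-- The energy of the charges in the sector `w`. -/
def zeroE (w : ℤˣ → ℤ) : ℝ :=
  M.vF * Real.pi / L * ((w 1 : ℝ) ^ 2 + (w (-1) : ℝ) ^ 2) -
    M.g₂ * (1 / L * M.V₂ 0) * (2 * w 1 * w (-1)) +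
    M.g₄ * (1 / L * M.V₄ 0) * ((w 1 : ℝ) ^ 2 + (w (-1) : ℝ) ^ 2) -
    ((M.μ 1 - M.μ₀) * w 1 - (M.μ (-1) - M.μ₀) * w (-1))

/-- The energy of the bosons. -/
def bosE (x : BOcc) : ℝ := x.sum fun j k => M.om L j.2 * k

/-- The shift of the vacuum energy. -/
def vacE : ℝ := -∑' n, M.om L n * (2 * M.bs L n ^ 2)

/-- The eigenvalues of the Hamiltonian. -/
def energy (X : BLabel) : ℝ := M.zeroE L X.1 + M.bosE L X.2 + M.vacE L

end Model

namespace Model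

theorem hasSum_modes (D : ℕ → ℝ) (x : BOcc) :
    HasSum (fun n => D n * (x (1, n) + x (-1, n))) (x.sum fun j k => D j.2 * k) := by
  have e : (x.sum fun j k => D j.2 * k) =
      ∑ n ∈ x.support.image Prod.snd, D n * (x (1, n) + x (-1, n)) := by
    rw [Finsupp.sum_of_support_subset x
      (s := Finset.univ ×ˢ x.support.image Prod.snd) (fun j hj => by
        rw [Finset.mem_product]
        exact ⟨Finset.mem_univ _, Finset.mem_image_of_mem _ hj⟩) _ (by simp),
      Finset.sum_product_right]
    refine Finset.sum_congr rfl fun n _ => ?_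
    rw [sum_units]; ring
  rw [e]
  refine hasSum_sum_of_ne_finset_zero fun n hn => ?_
  have : ∀ r, x (r, n) = 0 := fun r => by
    by_contra h0
    exact hn (Finset.mem_image.mpr ⟨(r, n), Finsupp.mem_support_iff.mpr h0, rfl⟩)
  simp [this]

end Model

namespace Model.Admissible

variable {M : Model} {L : ℝ} (h : M.Admissible L)

include h

theorem hasSum_zform (χ ψ : FockAlg) :
    HasSum (fun X => (M.zeroE L X.1 : ℂ) * (conj (h.bogParam.comp X χ) * h.bogParam.comp X ψ))
      (M.zform L χ ψ) := by
  have hQ : ∀ r r' : ℤˣ, HasSum (fun X : BLabel => ((r : ℤ) * X.1 r : ℂ) * ((r' : ℤ) * X.1 r' : ℂ) *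
      (conj (h.bogParam.comp X χ) * h.bogParam.comp X ψ)) (algInner χ (charge r (charge r' ψ))) := by
    intro r r'
    refine hasSum_of_eq (h.bogParam.hasSum_comp χ (charge r (charge r' ψ))) (fun X => ?_) rfl
    rw [BogParam.comp_charge, BogParam.comp_charge]; ring
  have hQ1 : ∀ r : ℤˣ, HasSum (fun X : BLabel => ((r : ℤ) * X.1 r : ℂ) *
      (conj (h.bogParam.comp X χ) * h.bogParam.comp X ψ)) (algInner χ (charge r ψ)) := by
    intro r
    refine hasSum_of_eq (h.bogParam.hasSum_comp χ (charge r ψ)) (fun X => ?_) rfl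
    rw [BogParam.comp_charge]; ring
  have e1 := (((hQ 1 1).add (hQ (-1) (-1))).mul_left ((M.vF * Real.pi / L : ℝ) : ℂ))
  have e2 := ((((hQ 1 (-1)).mul_left ((1 / L * M.V₂ 0 : ℝ) : ℂ)).add
    ((hQ (-1) 1).mul_left ((1 / L * M.V₂ 0 : ℝ) : ℂ))).mul_left (M.g₂ : ℂ))
  have e3 := ((((hQ 1 1).mul_left ((1 / L * M.V₄ 0 : ℝ) : ℂ)).add
    ((hQ (-1) (-1)).mul_left ((1 / L * M.V₄ 0 : ℝ) : ℂ))).mul_left (M.g₄ : ℂ))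
  have e4 := ((hQ1 1).mul_left ((M.μ 1 - M.μ₀ : ℝ) : ℂ)).add
    ((hQ1 (-1)).mul_left ((M.μ (-1) - M.μ₀ : ℝ) : ℂ))
  refine hasSum_of_eq (((e1.add e2).add e3).sub e4) (fun X => ?_) ?_
  · rw [zeroE]
    simp only [Units.val_one, Units.val_neg]
    push_cast
    ring
  · rw [zform]
    simp only [sum_units, neg_neg]

/-- Adding its share of the vacuum energy makes the form of each momentum a positive multiple of
dressed number operators. This positivity is what `hasSum_diag` requires. -/
theorem hasSum_bosE (hL : 0 < L) (χ ψ : FockAlg) :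
    HasSum (fun X => (M.bosE L X.2 : ℂ) * (conj (h.bogParam.comp X χ) * h.bogParam.comp X ψ))
      (M.form L χ ψ - M.zform L χ ψ - M.vacE L * algInner χ ψ) := by
  have hX : ∀ χ ψ n, HasSum (fun X : BLabel =>
      ((M.om L n * (X.2 (1, n) + X.2 (-1, n)) : ℝ) : ℂ) *
        (conj (h.bogParam.comp X χ) * h.bogParam.comp X ψ))
      (M.tform L n χ ψ + ((M.om L n * (2 * M.bs L n ^ 2) : ℝ) : ℂ) * algInner χ ψ) := by
    intro χ ψ n
    refine hasSum_of_eq (((h.bogParam.hasSum_bog (1, n) χ ψ).add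
      (h.bogParam.hasSum_bog (-1, n) χ ψ)).mul_left (M.om L n : ℂ)) (fun X => ?_) ?_
    · push_cast; ring
    · rw [h.tform_eq]; ring
  have hn : ∀ χ ψ, HasSum (fun n => M.tform L n χ ψ +
      ((M.om L n * (2 * M.bs L n ^ 2) : ℝ) : ℂ) * algInner χ ψ)
      (M.form L χ ψ - M.zform L χ ψ - M.vacE L * algInner χ ψ) := by
    intro χ ψ
    refine hasSum_of_eq ((M.hasSum_tform L h.vF_pos.ne' hL.ne' χ ψ).add
      ((Complex.hasSum_ofReal.mpr (h.summable_om hL).hasSum).mul_right (algInner χ ψ)))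
      (fun n => rfl) ?_
    rw [vacE]; push_cast; ring
  exact hasSum_diag (k := fun n (X : BLabel) => M.om L n * (X.2 (1, n) + X.2 (-1, n)))
    (fun n X => mul_nonneg (h.om_pos hL n).le (by positivity)) (fun X => hasSum_modes _ X.2)
    (hX χ χ) (hn χ χ).summable (hX ψ ψ) (hn ψ ψ).summable (hX χ ψ) (hn χ ψ)

theorem hasSum_form (hL : 0 < L) (χ ψ : FockAlg) :
    HasSum (fun X => (M.energy L X : ℂ) * (conj (h.bogParam.comp X χ) * h.bogParam.comp X ψ))
      (M.form L χ ψ) := by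
  refine hasSum_of_eq (((h.hasSum_zform χ ψ).add (h.hasSum_bosE hL χ ψ)).add
    ((h.bogParam.hasSum_comp χ ψ).mul_left (M.vacE L : ℂ))) (fun X => ?_) ?_
  · rw [energy]; push_cast; ring
  · ring

end Model.Admissible

/-! ### Operators that are diagonal in a Hilbert basis -/

section Diagonal

variable {ι F : Type*} [NormedAddCommGroup F] [InnerProductSpace ℂ F]

theorem lp_norm_sq (f : lp (fun _ : ι => ℂ) 2) : ‖f‖ ^ 2 = ∑' i, ‖f i‖ ^ 2 := by
  have := lp.norm_rpow_eq_tsum (p := 2) (by norm_num) f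
  simpa using this

theorem lp_summable_sq (f : lp (fun _ : ι => ℂ) 2) : Summable fun i => ‖f i‖ ^ 2 :=
  memℓp_two_iff.mp f.2

theorem tendsto_lp {α : Type*} {l : Filter α} {f : α → lp (fun _ : ι => ℂ) 2}
    {f₀ : lp (fun _ : ι => ℂ) 2} {g : ι → ℝ} (hg : Summable fun i => g i ^ 2)
    (h : ∀ i, Tendsto (fun a => f a i) l (𝓝 (f₀ i))) (hb : ∀ᶠ a in l, ∀ i, ‖f a i - f₀ i‖ ≤ g i) :
    Tendsto f l (𝓝 f₀) := by
  rw [tendsto_iff_norm_sub_tendsto_zero]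
  have h1 : Tendsto (fun a => ∑' i, ‖f a i - f₀ i‖ ^ 2) l (𝓝 (∑' _ : ι, (0 : ℝ))) := by
    refine tendsto_tsum_of_dominated_convergence hg (fun i => ?_) ?_
    · have := ((h i).sub_const (f₀ i)).norm.pow 2
      simpa using this
    · filter_upwards [hb] with a ha i
      rw [Real.norm_of_nonneg (sq_nonneg _)]
      exact pow_le_pow_left₀ (norm_nonneg _) (ha i) 2
  rw [tsum_zero] at h1
  have h2 : ∀ a, ‖f a - f₀‖ = √(∑' i, ‖f a i - f₀ i‖ ^ 2) := fun a => by
    have := lp_norm_sq (f a - f₀)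
    rw [eq_comm, Real.sqrt_eq_iff_mul_self_eq (tsum_nonneg fun _ => sq_nonneg _) (norm_nonneg _),
      ← sq, this]
    rfl
  simp only [h2]
  simpa using h1.sqrt

theorem tendsto_of_repr {α : Type*} (b : HilbertBasis ι ℂ F) {l : Filter α} {f : α → F} {f₀ : F}
    {g : ι → ℝ} (hg : Summable fun i => g i ^ 2)
    (h : ∀ i, Tendsto (fun a => b.repr (f a) i) l (𝓝 (b.repr f₀ i)))
    (hb : ∀ᶠ a in l, ∀ i, ‖b.repr (f a) i - b.repr f₀ i‖ ≤ g i) : Tendsto f l (𝓝 f₀) := by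
  have := (b.repr.symm.continuous.tendsto _).comp (tendsto_lp hg h hb)
  simpa [Function.comp_def] using this

theorem hilbertBasis_ext (b : HilbertBasis ι ℂ F) {x y : F} (h : ∀ i, b.repr x i = b.repr y i) : x = y :=
  b.repr.injective (lp.ext (funext h))

theorem repr_self_apply [DecidableEq ι] (b : HilbertBasis ι ℂ F) (i j : ι) :
    b.repr (b i) j = if j = i then 1 else 0 := by
  rw [b.repr_apply_apply, orthonormal_iff_ite.mp b.orthonormal]

theorem tendsto_repr_apply {α : Type*} (b : HilbertBasis ι ℂ F) {l : Filter α} {f : α → F} {f₀ : F}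
    (h : Tendsto f l (𝓝 f₀)) (i : ι) : Tendsto (fun a => b.repr (f a) i) l (𝓝 (b.repr f₀ i)) := by
  simp only [b.repr_apply_apply]
  exact (tendsto_const_nhds (x := b i)).inner h

theorem hasSum_repr_inner (b : HilbertBasis ι ℂ F) (x y : F) :
    HasSum (fun i => conj (b.repr x i) * b.repr y i) (inner ℂ x y) := by
  refine hasSum_of_eq (b.hasSum_inner_mul_inner x y) (fun i => ?_) rfl
  rw [b.repr_apply_apply, b.repr_apply_apply, inner_conj_symm]

theorem summable_repr_sq (b : HilbertBasis ι ℂ F) (x : F) : Summable fun i => ‖b.repr x i‖ ^ 2 :=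
  lp_summable_sq _

/-- The self-adjoint operator with eigenvectors `b i` and eigenvalues `E i`. -/
def diagonal (b : HilbertBasis ι ℂ F) (E : ι → ℝ) : F →ₗ.[ℂ] F where
  domain :=
    { carrier := {x | Memℓp (fun i => (E i : ℂ) * b.repr x i) 2}
      zero_mem' := by
        have : (fun i => (E i : ℂ) * b.repr 0 i) = 0 := by ext i; simp
        change Memℓp (fun i => (E i : ℂ) * b.repr 0 i) 2
        rw [this]
        exact zero_memℓp
      add_mem' := fun hx hy => by
        have := hx.add hy
        simpa [mul_add, Pi.add_def] using this
      smul_mem' := fun c x hx => by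
        have := hx.const_smul c
        simpa [Pi.smul_def, mul_left_comm] using this }
  toFun :=
    { toFun := fun x => b.repr.symm ⟨_, x.2⟩
      map_add' := fun x y => hilbertBasis_ext b fun i => by simp [mul_add]; rfl
      map_smul' := fun c x => hilbertBasis_ext b fun i => by simp [mul_left_comm] }

theorem mem_graph_diagonal (b : HilbertBasis ι ℂ F) (E : ι → ℝ) (x y : F) :
    (x, y) ∈ (diagonal b E).graph ↔ ∀ i, b.repr y i = E i * b.repr x i := by
  rw [LinearPMap.mem_graph_iff]
  constructor
  · rintro ⟨z, hz1, hz2⟩ i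
    simp only at hz1 hz2
    rw [← hz2, ← hz1]
    change b.repr (b.repr.symm _) i = _
    simp
  · intro h
    have hx : Memℓp (fun i => (E i : ℂ) * b.repr x i) 2 := by
      have : (fun i => (E i : ℂ) * b.repr x i) = b.repr y := funext fun i => (h i).symm
      rw [this]
      exact (b.repr y).2
    refine ⟨⟨x, hx⟩, rfl, hilbertBasis_ext b fun i => ?_⟩
    rw [h]
    change b.repr (b.repr.symm _) i = _
    simp

theorem basis_mem_graph (b : HilbertBasis ι ℂ F) (E : ι → ℝ) (i : ι) :
    (b i, (E i : ℂ) • b i) ∈ (diagonal b E).graph := by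
  classical
  rw [mem_graph_diagonal]
  intro j
  rw [map_smul, lp.coeFn_smul, Pi.smul_apply, smul_eq_mul, repr_self_apply]
  split_ifs with h
  · rw [h]
  · simp

theorem dense_diagonal (b : HilbertBasis ι ℂ F) (E : ι → ℝ) : Dense ((diagonal b E).domain : Set F) := by
  have h1 : Submodule.span ℂ (Set.range b) ≤ (diagonal b E).domain := by
    rw [Submodule.span_le]
    rintro _ ⟨i, rfl⟩
    exact LinearPMap.mem_domain_of_mem_graph (basis_mem_graph b E i)
  have h2 : Dense (Submodule.span ℂ (Set.range b) : Set F) := by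
    rw [Submodule.dense_iff_topologicalClosure_eq_top]
    exact b.dense_span
  exact h2.mono h1

/-- Testing an element of the adjoint graph against the eigenvectors alone already forces the
defining relation for its components. -/
theorem isSelfAdjoint_diagonal [CompleteSpace F] (b : HilbertBasis ι ℂ F) (E : ι → ℝ) :
    IsSelfAdjoint (diagonal b E) := by
  rw [LinearPMap.isSelfAdjoint_def]
  refine LinearPMap.eq_of_eq_graph ?_
  rw [LinearPMap.adjoint_graph_eq_graph_adjoint (dense_diagonal b E)]
  ext ⟨x, y⟩
  rw [Submodule.mem_adjoint_iff, mem_graph_diagonal]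
  constructor
  · intro h i
    have := h _ _ (basis_mem_graph b E i)
    rw [inner_smul_left, Complex.conj_ofReal, sub_eq_zero] at this
    rw [b.repr_apply_apply, b.repr_apply_apply, this]
  · intro h u v huv
    rw [mem_graph_diagonal] at huv
    rw [sub_eq_zero]
    refine (hasSum_repr_inner b v x).unique (hasSum_of_eq (hasSum_repr_inner b u y) (fun i => ?_) rfl)
    simp only [h, huv, map_mul, Complex.conj_ofReal]
    ring

/-- Multiplication of the components by a bounded sequence. -/
theorem exists_diagMul (b : HilbertBasis ι ℂ F) (φ : ι → ℂ) (hφ : ∀ i, ‖φ i‖ = 1) :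
    ∃ U : F →L[ℂ] F, (∀ x i, b.repr (U x) i = φ i * b.repr x i) ∧ ∀ x, ‖U x‖ = ‖x‖ := by
  have hmem : ∀ x : F, Summable fun i => ‖φ i * b.repr x i‖ ^ 2 := fun x => by
    simpa [hφ] using summable_repr_sq b x
  let T : F →ₗ[ℂ] F :=
    { toFun := fun x => b.repr.symm ⟨_, memℓp_two_iff.mpr (hmem x)⟩
      map_add' := fun x y => hilbertBasis_ext b fun i => by simp [mul_add]; rfl
      map_smul' := fun c x => hilbertBasis_ext b fun i => by simp [mul_left_comm] }
  have hT : ∀ x i, b.repr (T x) i = φ i * b.repr x i := fun x i => by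
    change b.repr (b.repr.symm _) i = _
    simp
  have hn : ∀ x, ‖T x‖ = ‖x‖ := fun x => by
    rw [← b.repr.norm_map, ← b.repr.norm_map x, ← sq_eq_sq₀ (norm_nonneg _) (norm_nonneg _),
      lp_norm_sq, lp_norm_sq]
    simp [hT, hφ]
  exact ⟨T.mkContinuous 1 fun x => by rw [hn, one_mul], hT, hn⟩

/-- The unitary group generated by a diagonal operator. -/
def evolution (b : HilbertBasis ι ℂ F) (E : ι → ℝ) (t : ℝ) : F →L[ℂ] F :=
  (exists_diagMul b (fun i => Complex.exp ((-(t * E i) : ℝ) * Complex.I)) fun _ =>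
    Complex.norm_exp_ofReal_mul_I _).choose

theorem repr_evolution (b : HilbertBasis ι ℂ F) (E : ι → ℝ) (t : ℝ) (x : F) (i : ι) :
    b.repr (evolution b E t x) i = Complex.exp ((-(t * E i) : ℝ) * Complex.I) * b.repr x i :=
  (exists_diagMul b (fun i => Complex.exp ((-(t * E i) : ℝ) * Complex.I)) fun _ =>
    Complex.norm_exp_ofReal_mul_I _).choose_spec.1 x i

theorem norm_evolution (b : HilbertBasis ι ℂ F) (E : ι → ℝ) (t : ℝ) (x : F) :
    ‖evolution b E t x‖ = ‖x‖ :=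
  (exists_diagMul b (fun i => Complex.exp ((-(t * E i) : ℝ) * Complex.I)) fun _ =>
    Complex.norm_exp_ofReal_mul_I _).choose_spec.2 x

theorem norm_exp_sub_one_le (θ : ℝ) : ‖Complex.exp (θ * Complex.I) - 1‖ ≤ |θ| := by
  have := Real.norm_exp_I_mul_ofReal_sub_one_le (x := θ)
  rwa [mul_comm Complex.I, Real.norm_eq_abs] at this

theorem evolution_add (b : HilbertBasis ι ℂ F) (E : ι → ℝ) (s t : ℝ) :
    evolution b E (s + t) = evolution b E s * evolution b E t := by
  refine ContinuousLinearMap.ext fun x => hilbertBasis_ext b fun i => ?_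
  rw [mul_apply_eq_comp, repr_evolution, repr_evolution, repr_evolution, ← mul_assoc,
    ← Complex.exp_add]
  congr 2
  push_cast; ring

theorem evolution_zero (b : HilbertBasis ι ℂ F) (E : ι → ℝ) : evolution b E 0 = 1 :=
  ContinuousLinearMap.ext fun x => hilbertBasis_ext b fun i => by simp [repr_evolution]

theorem continuous_evolution (b : HilbertBasis ι ℂ F) (E : ι → ℝ) (x : F) :
    Continuous fun t => evolution b E t x := by
  rw [continuous_iff_continuousAt]
  intro t
  refine tendsto_of_repr b (g := fun i => 2 * ‖b.repr x i‖) ?_ (fun i => ?_) (.of_forall fun s i => ?_)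
  · simpa [mul_pow] using (summable_repr_sq b x).mul_left (2 ^ 2)
  · simp only [repr_evolution]
    exact Continuous.tendsto (by fun_prop) t
  · rw [repr_evolution, repr_evolution, ← sub_mul, norm_mul]
    refine mul_le_mul_of_nonneg_right ((norm_sub_le _ _).trans ?_) (norm_nonneg _)
    rw [Complex.norm_exp_ofReal_mul_I, Complex.norm_exp_ofReal_mul_I]; norm_num

theorem hasDerivAt_evolution (b : HilbertBasis ι ℂ F) (E : ι → ℝ) (x : (diagonal b E).domain) :
    HasDerivAt (fun t => evolution b E t x) (-Complex.I • diagonal b E x) 0 := by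
  have hx := (mem_graph_diagonal b E _ _).mp ((diagonal b E).mem_graph x)
  rw [hasDerivAt_iff_tendsto_slope]
  have hr : ∀ t i, b.repr (slope (fun t => evolution b E t x) 0 t) i =
      ((t : ℂ)⁻¹ * (Complex.exp ((-(t * E i) : ℝ) * Complex.I) - 1)) * b.repr (x : F) i := by
    intro t i
    have e : slope (fun t => evolution b E t (x : F)) 0 t = (t : ℂ)⁻¹ • (evolution b E t x - x) := by
      rw [slope_def_module, sub_zero, evolution_zero, one_apply_eq_self, ← Complex.coe_smul,
        Complex.ofReal_inv]
    rw [e, map_smul, map_sub, lp.coeFn_smul, lp.coeFn_sub, Pi.smul_apply, Pi.sub_apply,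
      repr_evolution, smul_eq_mul]
    ring
  have hr0 : ∀ i, b.repr (-Complex.I • diagonal b E x) i = -Complex.I * (E i * b.repr (x : F) i) := by
    intro i
    rw [map_smul, lp.coeFn_smul, Pi.smul_apply, smul_eq_mul, hx]
  refine tendsto_of_repr b (g := fun i => 2 * ‖b.repr (diagonal b E x) i‖) ?_ (fun i => ?_)
    (.of_forall fun t i => ?_)
  · simpa [mul_pow] using (summable_repr_sq b _).mul_left (2 ^ 2)
  · rw [hr0]
    simp only [hr]
    rw [← mul_assoc]
    refine Tendsto.mul_const _ ?_
    have h1 : HasDerivAt (fun t : ℝ => Complex.exp ((-(t * E i) : ℝ) * Complex.I)) (-Complex.I * E i) 0 := by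
      have h2 : HasDerivAt (fun t : ℝ => ((-(t * E i) : ℝ) : ℂ) * Complex.I) ((-(1 * E i) : ℝ) * Complex.I) 0 :=
        (((hasDerivAt_id (0 : ℝ)).mul_const (E i)).neg.ofReal_comp).mul_const _
      have h3 := h2.cexp
      simp only [zero_mul, neg_zero, Complex.ofReal_zero, Complex.exp_zero, one_mul] at h3
      convert h3 using 1
      push_cast; ring
    rw [hasDerivAt_iff_tendsto_slope] at h1
    refine h1.congr fun t => ?_
    rw [slope_def_module, sub_zero, ← Complex.coe_smul]
    simp
  · rw [hr, hr0, hx]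
    -- The difference quotients of the phases are bounded by `|E i|` uniformly in `t`, so the
    -- components of `diagonal b E x` dominate. At `t = 0` the inverse is zero and the bound is
    -- trivial.
    have h1 : ‖(t : ℂ)⁻¹ * (Complex.exp ((-(t * E i) : ℝ) * Complex.I) - 1)‖ ≤ |E i| := by
      rcases eq_or_ne t 0 with rfl | ht
      · simp
      · rw [norm_mul, norm_inv, Complex.norm_real, Real.norm_eq_abs]
        have := norm_exp_sub_one_le (-(t * E i))
        rw [abs_neg, abs_mul] at this
        rwa [inv_mul_le_iff₀ (by positivity)]
    calc _ ≤ ‖((t : ℂ)⁻¹ * (Complex.exp ((-(t * E i) : ℝ) * Complex.I) - 1)) * b.repr (x : F) i‖ +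
          ‖-Complex.I * (E i * b.repr (x : F) i)‖ := norm_sub_le _ _
      _ ≤ |E i| * ‖b.repr (x : F) i‖ + |E i| * ‖b.repr (x : F) i‖ := by
          refine add_le_add ?_ ?_
          · rw [norm_mul]; exact mul_le_mul_of_nonneg_right h1 (norm_nonneg _)
          · simp
      _ = _ := by simp; ring

end Diagonal

theorem isTimeEvolution_evolution {ι : Type*} (b : HilbertBasis ι ℂ Fock) (E : ι → ℝ) :
    IsTimeEvolution (diagonal b E) (evolution b E) :=
  ⟨evolution_zero b E, evolution_add b E, norm_evolution b E, continuous_evolution b E,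
    hasDerivAt_evolution b E⟩

/-! ### The operator associated with the closure of a diagonal quadratic form -/

section Form

variable {ι : Type} {b : HilbertBasis ι ℂ Fock} {E : ι → ℝ} {c : ℝ} {q : FockAlg → FockAlg → ℂ}

/-- The map `T` embeds the finite-particle vectors isometrically, for the shifted form norm, into
ℓ². The closure of the form becomes closure of the range of `T`. -/
theorem exists_weighted (hE : ∀ i, 1 ≤ E i + c)
    (hq : ∀ χ ψ, HasSum (fun i => (E i : ℂ) * (conj (b.repr (toFock χ) i) * b.repr (toFock ψ) i))
      (q χ ψ)) :
    ∃ T : FockAlg →ₗ[ℂ] lp (fun _ : ι => ℂ) 2,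
      (∀ ψ i, T ψ i = ((√(E i + c) : ℝ) : ℂ) * b.repr (toFock ψ) i) ∧
      ∀ χ ψ, inner ℂ (T χ) (T ψ) = q χ ψ + c * algInner χ ψ := by
  have hsum : ∀ χ ψ, HasSum (fun i => ((E i + c : ℝ) : ℂ) *
      (conj (b.repr (toFock χ) i) * b.repr (toFock ψ) i)) (q χ ψ + c * algInner χ ψ) := fun χ ψ =>
    hasSum_of_eq ((hq χ ψ).add ((hasSum_repr_inner b (toFock χ) (toFock ψ)).mul_left (c : ℂ)))
      (fun i => by push_cast; ring) rfl
  have hpos : ∀ i, 0 ≤ E i + c := fun i => by linarith [hE i]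
  have hmem : ∀ ψ : FockAlg, Memℓp (fun i => ((√(E i + c) : ℝ) : ℂ) * b.repr (toFock ψ) i) 2 := by
    intro ψ
    rw [memℓp_two_iff, ← Complex.summable_ofReal]
    refine (hsum ψ ψ).summable.congr fun i => ?_
    rw [Complex.conj_mul', norm_mul, Complex.norm_real, mul_pow, Real.norm_eq_abs, sq_abs,
      Real.sq_sqrt (hpos i)]
    push_cast; rfl
  refine ⟨⟨⟨fun ψ => ⟨_, hmem ψ⟩, fun χ ψ => ?_⟩, fun a ψ => ?_⟩, fun ψ i => rfl, fun χ ψ => ?_⟩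
  · ext i; simp [mul_add]; rfl
  · ext i; simp [mul_left_comm]
  · refine (lp.hasSum_inner (𝕜 := ℂ) _ _).unique (hasSum_of_eq (hsum χ ψ) (fun i => ?_) rfl)
    change inner ℂ (((√(E i + c) : ℝ) : ℂ) * b.repr (toFock χ) i)
      (((√(E i + c) : ℝ) : ℂ) * b.repr (toFock ψ) i) = _
    have : ((√(E i + c) : ℝ) : ℂ) * ((√(E i + c) : ℝ) : ℂ) = ((E i + c : ℝ) : ℂ) := by
      rw [← Complex.ofReal_mul, Real.mul_self_sqrt (hpos i)]
    rw [RCLike.inner_apply, map_mul, Complex.conj_ofReal, ← this]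
    ring

theorem inner_eq_of_weighted {ξ : lp (fun _ : ι => ℂ) 2} {T : FockAlg →ₗ[ℂ] lp (fun _ : ι => ℂ) 2}
    (hT : ∀ ψ i, T ψ i = ((√(E i + c) : ℝ) : ℂ) * b.repr (toFock ψ) i) {y : Fock}
    (h : ∀ i, ((√(E i + c) : ℝ) : ℂ) * ξ i = b.repr y i) (χ : FockAlg) :
    inner ℂ (T χ) ξ = inner ℂ (toFock χ) y := by
  refine (lp.hasSum_inner (𝕜 := ℂ) _ _).unique
    (hasSum_of_eq (hasSum_repr_inner b (toFock χ) y) (fun i => ?_) rfl)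
  rw [RCLike.inner_apply, hT, map_mul, Complex.conj_ofReal, ← h]
  ring

theorem tendsto_of_weighted (hE : ∀ i, 1 ≤ E i + c) {T : FockAlg →ₗ[ℂ] lp (fun _ : ι => ℂ) 2}
    (hT : ∀ ψ i, T ψ i = ((√(E i + c) : ℝ) : ℂ) * b.repr (toFock ψ) i)
    {u : ℕ → FockAlg} {ξ : lp (fun _ : ι => ℂ) 2} {x : Fock}
    (hξ : ∀ i, ξ i = ((√(E i + c) : ℝ) : ℂ) * b.repr x i)
    (h : Tendsto (fun n => T (u n)) atTop (𝓝 ξ)) : Tendsto (fun n => toFock (u n)) atTop (𝓝 x) := by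
  rw [tendsto_iff_norm_sub_tendsto_zero] at h ⊢
  refine squeeze_zero (fun n => norm_nonneg _) (fun n => ?_) h
  rw [← b.repr.norm_map]
  refine lp.norm_mono (by norm_num) fun i => ?_
  rw [map_sub, lp.coeFn_sub, lp.coeFn_sub, Pi.sub_apply, Pi.sub_apply, hT, hξ, ← mul_sub, norm_mul,
    Complex.norm_of_nonneg (Real.sqrt_nonneg _)]
  refine le_mul_of_one_le_left (norm_nonneg _) ?_
  rw [Real.one_le_sqrt]
  exact hE i

/-- Density of the range makes the form domain the full weighted ℓ² space. In one direction the
weighted vector is approximated in ℓ². In the other, a form-Cauchy sequence has a limit ξ with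
components √(E + c) x; testing against the dense range identifies ξ with (E + c)^(-1/2)(y + c x),
which is the eigenvalue relation. -/
theorem mem_graph_iff_form (hE : ∀ i, 1 ≤ E i + c)
    {T : FockAlg →ₗ[ℂ] lp (fun _ : ι => ℂ) 2}
    (hT : ∀ ψ i, T ψ i = ((√(E i + c) : ℝ) : ℂ) * b.repr (toFock ψ) i)
    (hTq : ∀ χ ψ, inner ℂ (T χ) (T ψ) = q χ ψ + c * algInner χ ψ) (hd : DenseRange T) (x y : Fock) :
    (x, y) ∈ (diagonal b E).graph ↔ ∃ u : ℕ → FockAlg,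
      Tendsto (fun n => toFock (u n)) atTop (𝓝 x) ∧
      Tendsto (fun nm : ℕ × ℕ => q (u nm.1 - u nm.2) (u nm.1 - u nm.2)) atTop (𝓝 0) ∧
      ∀ χ : FockAlg, Tendsto (fun n => q χ (u n)) atTop (𝓝 (inner ℂ (toFock χ) y)) := by
  have hpos : ∀ i, 0 ≤ E i + c := fun i => by linarith [hE i]
  have hsq : ∀ i, ((√(E i + c) : ℝ) : ℂ) * ((√(E i + c) : ℝ) : ℂ) = ((E i + c : ℝ) : ℂ) := fun i => by
    rw [← Complex.ofReal_mul, Real.mul_self_sqrt (hpos i)]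
  have hqT : ∀ χ ψ, q χ ψ = inner ℂ (T χ) (T ψ) - c * algInner χ ψ := fun χ ψ => by
    rw [hTq]; ring
  have hself : ∀ u : FockAlg, q u u = ((‖T u‖ ^ 2 - c * ‖toFock u‖ ^ 2 : ℝ) : ℂ) := fun u => by
    rw [hqT, inner_self_eq_norm_sq_to_K, algInner_self]; push_cast; rfl
  have hfst : Tendsto (fun nm : ℕ × ℕ => nm.1) atTop atTop := by
    rw [← prod_atTop_atTop_eq]; exact tendsto_fst
  have hsnd : Tendsto (fun nm : ℕ × ℕ => nm.2) atTop atTop := by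
    rw [← prod_atTop_atTop_eq]; exact tendsto_snd
  have hdiff : ∀ {G : Type} [NormedAddCommGroup G] {v : ℕ → G} {z : G}, Tendsto v atTop (𝓝 z) →
      Tendsto (fun nm : ℕ × ℕ => ‖v nm.1 - v nm.2‖ ^ 2) atTop (𝓝 0) := by
    intro G _ v z hv
    have := (((hv.comp hfst).sub (hv.comp hsnd)).norm).pow 2
    simpa using this
  rw [mem_graph_diagonal]
  constructor
  · intro h
    have hmem : Memℓp (fun i => ((√(E i + c) : ℝ) : ℂ) * b.repr x i) 2 := by
      rw [memℓp_two_iff]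
      refine Summable.of_nonneg_of_le (fun i => sq_nonneg _) (fun i => ?_)
        (summable_repr_sq b (y + (c : ℂ) • x))
      have e : b.repr (y + (c : ℂ) • x) i = ((E i + c : ℝ) : ℂ) * b.repr x i := by
        rw [map_add, map_smul, lp.coeFn_add, lp.coeFn_smul, Pi.add_apply, Pi.smul_apply, h,
          smul_eq_mul]
        push_cast; ring
      rw [e, norm_mul, norm_mul, Complex.norm_of_nonneg (Real.sqrt_nonneg _),
        Complex.norm_of_nonneg (hpos i)]
      refine pow_le_pow_left₀ (by positivity) (mul_le_mul_of_nonneg_right ?_ (norm_nonneg _)) 2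
      rw [Real.sqrt_le_left (hpos i)]
      nlinarith [hE i]
    set ξ : lp (fun _ : ι => ℂ) 2 := ⟨_, hmem⟩ with hξ
    have hξi : ∀ i, ξ i = ((√(E i + c) : ℝ) : ℂ) * b.repr x i := fun i => rfl
    obtain ⟨v, hv1, hv2⟩ := mem_closure_iff_seq_limit.mp (hd ξ)
    choose u hu using hv1
    obtain rfl : (fun n => T (u n)) = v := funext hu
    have hux := tendsto_of_weighted hE hT hξi hv2
    refine ⟨u, hux, ?_, fun χ => ?_⟩
    · simp only [hself, map_sub]
      have := (Complex.continuous_ofReal.tendsto _).comp ((hdiff hv2).sub ((hdiff hux).const_mul c))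
      simpa [Function.comp_def] using this
    · have h1 : inner ℂ (toFock χ) y = inner ℂ (T χ) ξ - c * inner ℂ (toFock χ) x := by
        rw [inner_eq_of_weighted hT (y := y + (c : ℂ) • x) (fun i => ?_), inner_add_right,
          inner_smul_right]
        · ring
        · rw [hξi, ← mul_assoc, hsq, map_add, map_smul, lp.coeFn_add, lp.coeFn_smul, Pi.add_apply,
            Pi.smul_apply, h, smul_eq_mul]
          push_cast; ring
      rw [h1]
      simp only [hqT]
      exact (tendsto_const_nhds.inner hv2).sub ((tendsto_const_nhds.inner hux).const_mul _)
  · rintro ⟨u, hux, hcau, hlim⟩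
    have hTc : CauchySeq fun n => T (u n) := by
      have h1 : Tendsto (fun nm : ℕ × ℕ => ‖T (u nm.1) - T (u nm.2)‖ ^ 2) atTop (𝓝 0) := by
        have h2 := (Complex.continuous_re.tendsto _).comp hcau
        have h3 := h2.add ((hdiff hux).const_mul c)
        simp only [Complex.zero_re, mul_zero, add_zero] at h3
        refine h3.congr fun nm => ?_
        simp only [Function.comp, hself, Complex.ofReal_re, map_sub]
        ring
      rw [cauchySeq_iff_tendsto_dist_atTop_0]
      have h4 := h1.sqrt
      simp only [Real.sqrt_sq (norm_nonneg _), Real.sqrt_zero] at h4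
      simpa [dist_eq_norm] using h4
    obtain ⟨ξ, hξ⟩ := cauchySeq_tendsto_of_complete hTc
    have hlp : ∀ i, Tendsto (fun n => T (u n) i) atTop (𝓝 (ξ i)) := fun i => by
      have h1 := (tendsto_iff_norm_sub_tendsto_zero.mp hξ)
      rw [tendsto_iff_norm_sub_tendsto_zero]
      exact squeeze_zero (fun _ => norm_nonneg _)
        (fun n => lp.norm_apply_le_norm (by norm_num) (T (u n) - ξ) i) h1
    have hξi : ∀ i, ξ i = ((√(E i + c) : ℝ) : ℂ) * b.repr x i := fun i => by
      refine tendsto_nhds_unique (hlp i) ?_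
      simp only [hT]
      exact (tendsto_repr_apply b hux i).const_mul _
    have hne : ∀ i, ((√(E i + c) : ℝ) : ℂ) ≠ 0 := fun i => by
      have : 0 < E i + c := by linarith [hE i]
      exact Complex.ofReal_ne_zero.mpr (by positivity)
    have hmem : Memℓp (fun i => ((√(E i + c) : ℝ) : ℂ)⁻¹ * b.repr (y + (c : ℂ) • x) i) 2 := by
      rw [memℓp_two_iff]
      refine Summable.of_nonneg_of_le (fun i => sq_nonneg _) (fun i => ?_)
        (summable_repr_sq b (y + (c : ℂ) • x))
      rw [norm_mul, norm_inv, Complex.norm_of_nonneg (Real.sqrt_nonneg _)]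
      refine pow_le_pow_left₀ (by positivity) (mul_le_of_le_one_left (norm_nonneg _) ?_) 2
      exact inv_le_one_of_one_le₀ (Real.one_le_sqrt.mpr (hE i))
    set ζ : lp (fun _ : ι => ℂ) 2 := ⟨_, hmem⟩ with hζ
    have hζi : ∀ i, ζ i = ((√(E i + c) : ℝ) : ℂ)⁻¹ * b.repr (y + (c : ℂ) • x) i := fun i => rfl
    have hin : ∀ χ, inner ℂ (T χ) ξ = inner ℂ (T χ) ζ := by
      intro χ
      rw [inner_eq_of_weighted hT (ξ := ζ) (y := y + (c : ℂ) • x)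
        (fun i => by rw [hζi, mul_inv_cancel_left₀ (hne i)]), inner_add_right, inner_smul_right]
      refine tendsto_nhds_unique (tendsto_const_nhds.inner hξ) ?_
      have := (hlim χ).add ((tendsto_const_nhds (x := toFock χ)).inner hux |>.const_mul (c : ℂ))
      refine this.congr fun n => ?_
      rw [hTq]; rfl
    have heq : ξ = ζ := hd.eq_of_inner_right ℂ hin
    intro i
    have h1 := hξi i
    rw [heq, hζi, map_add, map_smul, lp.coeFn_add, lp.coeFn_smul, Pi.add_apply, Pi.smul_apply,
      smul_eq_mul, inv_mul_eq_iff_eq_mul₀ (hne i), ← mul_assoc, hsq] at h1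
    push_cast at h1
    linear_combination h1

end Form

/-! ### The Hamiltonian is diagonal in the dressed basis -/

section BosonCombination

variable (S : Finset BLabel) (a : BLabel → ℝ)

/-- A linear combination of boson states. -/
def bosComb : FockAlg := ∑ Y ∈ S, (a Y : ℂ) • bosState Y

theorem algInner_bosState (X Y : BLabel) :
    algInner (bosState X) (bosState Y) = if X = Y then 1 else 0 :=
  orthonormal_iff_ite.mp orthonormal_bosState X Y

theorem algInner_bosComb {D : FockAlg →ₗ[ℂ] FockAlg} {d : BLabel → ℝ}
    (hD : ∀ Y, D (bosState Y) = (d Y : ℂ) • bosState Y) :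
    algInner (bosComb S a) (D (bosComb S a)) = ((∑ Y ∈ S, d Y * a Y ^ 2 : ℝ) : ℂ) := by
  simp only [bosComb, map_sum, map_smul, hD, algInner_sum_left, algInner_sum_right,
    algInner_smul_left, algInner_smul_right, algInner_bosState, Complex.conj_ofReal]
  rw [Complex.ofReal_sum]
  refine Finset.sum_congr rfl fun Y hY => ?_
  simp only [mul_ite, mul_one, mul_zero]
  rw [Finset.sum_ite_eq' S Y, if_pos hY]
  push_cast; ring

theorem algInner_bosComb_self :
    algInner (bosComb S a) (bosComb S a) = ((∑ Y ∈ S, a Y ^ 2 : ℝ) : ℂ) := by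
  simpa using algInner_bosComb S a (D := LinearMap.id) (d := fun _ => 1) (by simp)

theorem bosd_bos_bosState (j : BMode) (Y : BLabel) :
    (bosd j ∘ₗ bos j) (bosState Y) = (((Y.2 j : ℕ) : ℝ) : ℂ) • bosState Y := by
  obtain ⟨w, m⟩ := Y
  rw [LinearMap.comp_apply, bos_bosState, map_smul, bosd_bosState, smul_smul]
  by_cases hm : m j = 0
  · simp [hm]
  · have h1 : (((m - Finsupp.single j 1 : BOcc) j : ℕ) : ℝ) + 1 = m j := by
      rw [Finsupp.tsub_apply, Finsupp.single_eq_same, Nat.cast_sub (Nat.one_le_iff_ne_zero.mpr hm)]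
      simp
    rw [tsub_add_cancel_of_le (single_le_of_ne hm), h1, ← Complex.ofReal_mul,
      Real.mul_self_sqrt (by positivity)]

theorem algInner_bos_bosComb (j : BMode) :
    algInner (bos j (bosComb S a)) (bos j (bosComb S a)) =
      ((∑ Y ∈ S, (Y.2 j : ℝ) * a Y ^ 2 : ℝ) : ℂ) := by
  rw [algInner_bos, ← algInner_bosComb S a (bosd_bos_bosState j)]
  rfl

theorem algInner_bosd_bosComb (j : BMode) :
    algInner (bosd j (bosComb S a)) (bosd j (bosComb S a)) =
      ((∑ Y ∈ S, ((Y.2 j : ℝ) + 1) * a Y ^ 2 : ℝ) : ℂ) := by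
  rw [algInner_bosd, ccr_bos.comm, if_pos rfl, algInner_add_right, algInner_bosd_right,
    algInner_bos_bosComb, algInner_bosComb_self, ← Complex.ofReal_add, ← Finset.sum_add_distrib]
  simp only [add_mul, one_mul]

/-- The transformed operator is not diagonal on boson states, but its two parts separately have
diagonal squares. The inequality (x + y)² ≤ 2x² + 2y² thus removes all cross terms between different
boson states. -/
theorem re_algInner_bog_le (c s : ℕ → ℝ) (j : BMode) :
    (algInner (bog c s bos bosd j (bosComb S a)) (bog c s bos bosd j (bosComb S a))).re ≤
      ∑ Y ∈ S, (2 * c j.2 ^ 2 * Y.2 j + 2 * s j.2 ^ 2 * (Y.2 (bar j) + 1)) * a Y ^ 2 := by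
  set u := bosComb S a
  have h1 : ‖toFock (bos j u)‖ ^ 2 = ∑ Y ∈ S, (Y.2 j : ℝ) * a Y ^ 2 := by
    have := algInner_bos_bosComb S a j
    rw [algInner_self] at this
    exact_mod_cast this
  have h2 : ‖toFock (bosd (bar j) u)‖ ^ 2 = ∑ Y ∈ S, ((Y.2 (bar j) : ℝ) + 1) * a Y ^ 2 := by
    have := algInner_bosd_bosComb S a (bar j)
    rw [algInner_self] at this
    exact_mod_cast this
  have h3 : ‖toFock (bog c s bos bosd j u)‖ ≤
      |c j.2| * ‖toFock (bos j u)‖ + |s j.2| * ‖toFock (bosd (bar j) u)‖ := by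
    rw [bog_apply, map_add, map_smul, map_smul]
    refine (norm_add_le _ _).trans (le_of_eq ?_)
    rw [norm_smul, norm_smul, Complex.norm_real, Complex.norm_real]; rfl
  rw [algInner_self, Complex.ofReal_re]
  calc ‖toFock (bog c s bos bosd j u)‖ ^ 2
      ≤ (|c j.2| * ‖toFock (bos j u)‖ + |s j.2| * ‖toFock (bosd (bar j) u)‖) ^ 2 :=
        pow_le_pow_left₀ (norm_nonneg _) h3 2
    _ ≤ 2 * (|c j.2| * ‖toFock (bos j u)‖) ^ 2 + 2 * (|s j.2| * ‖toFock (bosd (bar j) u)‖) ^ 2 := by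
        nlinarith [sq_nonneg (|c j.2| * ‖toFock (bos j u)‖ - |s j.2| * ‖toFock (bosd (bar j) u)‖)]
    _ = 2 * c j.2 ^ 2 * ‖toFock (bos j u)‖ ^ 2 +
        2 * s j.2 ^ 2 * ‖toFock (bosd (bar j) u)‖ ^ 2 := by
        rw [mul_pow, mul_pow, sq_abs, sq_abs]; ring
    _ = _ := by
        rw [h1, h2, Finset.mul_sum, Finset.mul_sum, ← Finset.sum_add_distrib]
        exact Finset.sum_congr rfl fun Y _ => by ring

end BosonCombination

/-- With τ = (s/c)² one has c² + s² = (1 + τ)/(1 − τ), and τ tends to zero by summability; the value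
3 corresponds to τ = 1/2. -/
theorem BogParam.eventually_add_sq_le {c s : ℕ → ℝ} (h : BogParam c s) :
    ∀ᶠ n in atTop, c n ^ 2 + s n ^ 2 ≤ 3 := by
  filter_upwards [h.summable.tendsto_atTop_zero.eventually
    (gt_mem_nhds (show (0 : ℝ) < 1 / 2 by norm_num))] with n hn
  have h1 := h.pos n
  have h2 := h.sub_sq n
  rw [div_pow, div_lt_iff₀ (by positivity)] at hn
  linarith

namespace Model

variable (M : Model) (L : ℝ)

/-- A diagonal bound for the form of the Hamiltonian in the basis of boson states. -/
def bound (Y : BLabel) : ℝ :=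
  M.zeroE L Y.1 + (Y.2.sum fun j k => 2 * M.om L j.2 * (M.bc L j.2 ^ 2 + M.bs L j.2 ^ 2) * k) -
    M.vacE L

theorem zform_bosComb (S : Finset BLabel) (a : BLabel → ℝ) :
    M.zform L (bosComb S a) (bosComb S a) = ((∑ Y ∈ S, M.zeroE L Y.1 * a Y ^ 2 : ℝ) : ℂ) := by
  have hQ : ∀ r r' : ℤˣ, algInner (bosComb S a) (charge r (charge r' (bosComb S a))) =
      ((∑ Y ∈ S, ((r : ℤ) * Y.1 r * ((r' : ℤ) * Y.1 r') : ℝ) * a Y ^ 2 : ℝ) : ℂ) := fun r r' =>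
    algInner_bosComb S a (D := charge r ∘ₗ charge r') fun Y => by
      rw [LinearMap.comp_apply, charge_bosState, map_smul, charge_bosState, smul_smul]
      congr 1
      push_cast; ring
  have hQ1 : ∀ r : ℤˣ, algInner (bosComb S a) (charge r (bosComb S a)) =
      ((∑ Y ∈ S, ((r : ℤ) * Y.1 r : ℝ) * a Y ^ 2 : ℝ) : ℂ) := fun r =>
    algInner_bosComb S a (D := charge r) fun Y => by
      rw [charge_bosState]
      push_cast; rfl
  simp only [zform, sum_units, hQ, hQ1, neg_neg]
  simp only [← Complex.ofReal_mul, ← Complex.ofReal_add, ← Complex.ofReal_sub, Finset.mul_sum,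
    ← Finset.sum_add_distrib, ← Finset.sum_sub_distrib]
  congr 1
  refine Finset.sum_congr rfl fun Y _ => ?_
  rw [zeroE]
  simp only [Units.val_one, Units.val_neg]
  push_cast
  ring

end Model

namespace Model.Admissible

variable {M : Model} {L : ℝ} (h : M.Admissible L)

include h

/-- The two potentials deviate oppositely from `μ₀`, and the charge of chirality `r` is `r * w r`.
Hence the potential couples only to `w 1 + w (-1)`. -/
theorem zeroE_eq (w : ℤˣ → ℤ) : M.zeroE L w =
    Real.pi / (2 * L) * (M.vF * (1 + M.gt₄ 0 + M.gt₂ 0) * (w 1 - w (-1)) ^ 2 +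
      M.vF * (1 + M.gt₄ 0 - M.gt₂ 0) * (w 1 + w (-1)) ^ 2) - (M.μ 1 - M.μ₀) * (w 1 + w (-1)) := by
  have h1 : M.μ (-1) - M.μ₀ = -(M.μ 1 - M.μ₀) := by linarith [h.mu_sum]
  have h2 : M.g₂ * (1 / L * M.V₂ 0) = Real.pi * M.vF * M.gt₂ 0 / L := by
    rw [← h.mul_eq]; ring
  have h4 : M.g₄ * (1 / L * M.V₄ 0) = Real.pi * M.vF * M.gt₄ 0 / L := by
    rw [gt₄, mul_div_cancel₀ _ h.pi_vF_pos.ne']; ring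
  rw [zeroE, h1, h2, h4]
  ring

theorem gt_zero : |M.gt₂ 0| < 1 + M.gt₄ 0 := by
  simpa [momentum] using h.gt_lt 0

theorem Kv_pos : 0 < M.vF * (1 + M.gt₄ 0 - M.gt₂ 0) :=
  mul_pos h.vF_pos (by linarith [h.gt_zero, le_abs_self (M.gt₂ 0)])

theorem Kv_pos' : 0 < M.vF * (1 + M.gt₄ 0 + M.gt₂ 0) :=
  mul_pos h.vF_pos (by linarith [h.gt_zero, neg_abs_le (M.gt₂ 0)])

theorem exists_le_zeroE (hL : 0 < L) : ∃ C : ℝ, ∀ w, -C ≤ M.zeroE L w := by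
  set A := Real.pi / (2 * L) * (M.vF * (1 + M.gt₄ 0 - M.gt₂ 0)) with hA
  have hA0 : 0 < A := mul_pos (by positivity) h.Kv_pos
  refine ⟨(M.μ 1 - M.μ₀) ^ 2 / (4 * A), fun w => ?_⟩
  rw [h.zeroE_eq]
  have h1 : 0 ≤ Real.pi / (2 * L) * (M.vF * (1 + M.gt₄ 0 + M.gt₂ 0) * (w 1 - w (-1)) ^ 2) :=
    mul_nonneg (by positivity) (mul_nonneg h.Kv_pos'.le (sq_nonneg _))
  have h2 : 0 ≤ A * ((w 1 + w (-1)) - (M.μ 1 - M.μ₀) / (2 * A)) ^ 2 := by positivity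
  have h3 : A * ((w 1 + w (-1)) - (M.μ 1 - M.μ₀) / (2 * A)) ^ 2 =
      A * (w 1 + w (-1) : ℝ) ^ 2 - (M.μ 1 - M.μ₀) * (w 1 + w (-1)) + (M.μ 1 - M.μ₀) ^ 2 / (4 * A) := by
    field_simp; ring
  rw [hA] at h3
  rw [mul_add]
  linarith

theorem bosE_nonneg (hL : 0 < L) (x : BOcc) : 0 ≤ M.bosE L x :=
  Finset.sum_nonneg fun j _ => mul_nonneg (h.om_pos hL j.2).le (Nat.cast_nonneg _)

theorem exists_shift (hL : 0 < L) : ∃ C : ℝ, 0 ≤ C ∧ ∀ X, 1 ≤ M.energy L X + C := by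
  obtain ⟨C, hC⟩ := h.exists_le_zeroE hL
  refine ⟨max 0 (C + 1 - M.vacE L), le_max_left _ _, fun X => ?_⟩
  have := le_max_right 0 (C + 1 - M.vacE L)
  have := hC X.1
  have := h.bosE_nonneg hL X.2
  rw [energy]
  linarith

/-- A crude diagonal majorant suffices, since its only purpose is to make the expansion of a dressed
vector in boson states converge in the form norm. -/
theorem re_form_bosComb_le (hL : 0 < L) (S : Finset BLabel) (a : BLabel → ℝ) :
    (M.form L (bosComb S a) (bosComb S a)).re ≤ ∑ Y ∈ S, M.bound L Y * a Y ^ 2 := by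
  have h1 : HasSum (fun n => (M.tform L n (bosComb S a) (bosComb S a)).re)
      ((M.form L (bosComb S a) (bosComb S a)).re - ∑ Y ∈ S, M.zeroE L Y.1 * a Y ^ 2) := by
    have := Complex.hasSum_re (M.hasSum_tform L h.vF_pos.ne' hL.ne' (bosComb S a) (bosComb S a))
    rwa [M.zform_bosComb, Complex.sub_re, Complex.ofReal_re] at this
  have h2 : HasSum (fun n => ∑ Y ∈ S, (2 * M.om L n * (M.bc L n ^ 2 + M.bs L n ^ 2) *
      (Y.2 (1, n) + Y.2 (-1, n)) + M.om L n * (2 * M.bs L n ^ 2)) * a Y ^ 2)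
      (∑ Y ∈ S, ((Y.2.sum fun j k => 2 * M.om L j.2 * (M.bc L j.2 ^ 2 + M.bs L j.2 ^ 2) * k) -
        M.vacE L) * a Y ^ 2) := by
    refine hasSum_sum fun Y _ => ?_
    have := (hasSum_modes (fun n => 2 * M.om L n * (M.bc L n ^ 2 + M.bs L n ^ 2)) Y.2).add
      (h.summable_om hL).hasSum
    rw [vacE, sub_neg_eq_add]
    exact this.mul_right _
  have h3 := hasSum_le (fun n => ?_) h1 h2
  · rw [sub_le_iff_le_add, ← Finset.sum_add_distrib] at h3
    refine h3.trans (le_of_eq (Finset.sum_congr rfl fun Y _ => ?_))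
    rw [bound]; ring
  · rw [h.tform_eq, algInner_bosComb_self, Complex.sub_re, ← Complex.ofReal_mul, Complex.ofReal_re,
      Complex.re_ofReal_mul, Complex.add_re]
    have e1 := re_algInner_bog_le S a (M.bc L) (M.bs L) (1, n)
    have e2 := re_algInner_bog_le S a (M.bc L) (M.bs L) (-1, n)
    have e3 : bar ((1 : ℤˣ), n) = (-1, n) := rfl
    have e4 : bar ((-1 : ℤˣ), n) = (1, n) := by simp [bar]
    rw [e3] at e1
    rw [e4] at e2
    have e5 := mul_le_mul_of_nonneg_left (add_le_add e1 e2) (h.om_pos hL n).le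
    refine (sub_le_sub_right e5 _).trans (le_of_eq ?_)
    rw [← Finset.sum_add_distrib, Finset.mul_sum, Finset.mul_sum, ← Finset.sum_sub_distrib]
    refine Finset.sum_congr rfl fun Y _ => ?_
    simp only
    ring

/-- Mode by mode the expected occupation is known from `tsum_mul_coeff_sq`. The part proportional to
the occupation of `X` has finitely many terms, and the rest is eventually at most six times a
summable vacuum energy; then the sums are interchanged. -/
theorem summable_bound (hL : 0 < L) (X : BLabel) :
    Summable fun Y => M.bound L Y * h.bogParam.dcoeff X Y ^ 2 := by
  set D : ℕ → ℝ := fun n => 2 * M.om L n * (M.bc L n ^ 2 + M.bs L n ^ 2) with hD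
  have hD0 : ∀ n, 0 ≤ D n := fun n => by
    have := (h.om_pos hL n).le
    positivity
  have hB : ∀ n, HasSum (fun m : BOcc => ((D n * (m (1, n) + m (-1, n)) : ℝ) : ℂ) *
      (conj (h.bogParam.coeff X.2 m : ℂ) * h.bogParam.coeff X.2 m))
      ((D n * ((M.bc L n ^ 2 + M.bs L n ^ 2) * (X.2 (1, n) + X.2 (-1, n)) + 2 * M.bs L n ^ 2) : ℝ) : ℂ) := by
    intro n
    have e4 : bar ((-1 : ℤˣ), n) = (1, n) := by simp [bar]
    have h1 := ((h.bogParam.summable_mul_coeff_sq (1, n) X.2).hasSum.add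
      (h.bogParam.summable_mul_coeff_sq (-1, n) X.2).hasSum).mul_left (D n)
    rw [h.bogParam.tsum_mul_coeff_sq, h.bogParam.tsum_mul_coeff_sq, e4,
      show bar ((1 : ℤˣ), n) = (-1, n) from rfl] at h1
    refine hasSum_of_eq (Complex.hasSum_ofReal.mpr h1) (fun m => ?_) ?_
    · rw [Complex.conj_ofReal]; push_cast; ring
    · congr 1; ring
  have hs : Summable fun n => ((D n * ((M.bc L n ^ 2 + M.bs L n ^ 2) *
      (X.2 (1, n) + X.2 (-1, n)) + 2 * M.bs L n ^ 2) : ℝ) : ℂ) := by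
    rw [Complex.summable_ofReal]
    have s1 := (hasSum_modes (fun n => D n * (M.bc L n ^ 2 + M.bs L n ^ 2)) X.2).summable
    have s2 : Summable fun n => D n * (2 * M.bs L n ^ 2) := by
      refine Summable.of_norm_bounded_eventually_nat ((h.summable_om hL).mul_left 6) ?_
      filter_upwards [h.bogParam.eventually_add_sq_le] with n hn
      have := (h.om_pos hL n).le
      rw [Real.norm_of_nonneg (mul_nonneg (hD0 n) (by positivity))]
      have e : D n ≤ 6 * M.om L n := by simp only [hD]; nlinarith
      have := mul_le_mul_of_nonneg_right e (show 0 ≤ 2 * M.bs L n ^ 2 by positivity)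
      linarith
    exact (s1.add s2).congr fun n => by ring
  have hsum := hasSum_diag (k := fun n (m : BOcc) => D n * (m (1, n) + m (-1, n)))
    (fun n m => mul_nonneg (hD0 n) (by positivity)) (fun m => hasSum_modes D m)
    hB hs hB hs hB hs.hasSum
  have hsum' : Summable fun m : BOcc => (m.sum fun j k => D j.2 * k) * h.bogParam.coeff X.2 m ^ 2 := by
    rw [← Complex.summable_ofReal]
    refine hsum.summable.congr fun m => ?_
    rw [Complex.conj_ofReal]; push_cast; ring
  have h0 : Summable fun m : BOcc => h.bogParam.coeff X.2 m ^ 2 := by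
    simpa [sq] using (h.bogParam.hasSum_coeff_mul X.2 X.2).summable
  have hinj : Function.Injective fun m : BOcc => ((X.1, m) : BLabel) := fun _ _ e =>
    congrArg Prod.snd e
  refine (hinj.summable_iff fun Y hY => ?_).mp ?_
  · have : Y.1 ≠ X.1 := fun e => hY ⟨Y.2, by rw [← e]⟩
    simp [BogParam.dcoeff, this]
  · refine (hsum'.add (h0.mul_left (M.zeroE L X.1 - M.vacE L))).congr fun m => ?_
    simp only [Function.comp, BogParam.dcoeff, if_true, bound, hD]
    ring

end Model.Admissible

namespace Model.Admissible

variable {M : Model} {L : ℝ} (h : M.Admissible L)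

include h

theorem hasSum_form_repr (hL : 0 < L) (χ ψ : FockAlg) :
    HasSum (fun X => (M.energy L X : ℂ) *
      (conj (h.bogParam.basis.repr (toFock χ) X) * h.bogParam.basis.repr (toFock ψ) X))
      (M.form L χ ψ) := by
  simpa only [BogParam.comp_eq_repr] using h.hasSum_form hL χ ψ

/-- The finite-particle vectors are a form core. A dressed vector is in general not a
finite-particle vector, but the partial sums of its expansion in boson states converge in the form
norm by the diagonal bound. Their limit under `T` is a nonzero multiple of a unit vector of ℓ², and
these unit vectors are total. -/
theorem denseRange_weighted (hL : 0 < L) {c : ℝ} (hE : ∀ X, 1 ≤ M.energy L X + c)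
    {T : FockAlg →ₗ[ℂ] lp (fun _ : BLabel => ℂ) 2}
    (hT : ∀ ψ X, T ψ X = ((√(M.energy L X + c) : ℝ) : ℂ) * h.bogParam.basis.repr (toFock ψ) X)
    (hTq : ∀ χ ψ, inner ℂ (T χ) (T ψ) = M.form L χ ψ + c * algInner χ ψ) : DenseRange T := by
  set P := (LinearMap.range T).topologicalClosure with hP
  have hmem : ∀ X, lp.single 2 X (1 : ℂ) ∈ P := by
    intro X
    set a : BLabel → ℝ := h.bogParam.dcoeff X with ha
    have hterm : ∀ S, ∑ Y ∈ S, T ((a Y : ℂ) • bosState Y) = T (bosComb S a) := fun S => by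
      rw [bosComb, map_sum]
    have hnorm : ∀ S, ‖T (bosComb S a)‖ ^ 2 ≤ ∑ Y ∈ S, (M.bound L Y + c) * a Y ^ 2 := by
      intro S
      have h1 := hTq (bosComb S a) (bosComb S a)
      rw [inner_self_eq_norm_sq_to_K, algInner_bosComb_self] at h1
      have h2 := congrArg Complex.re h1
      have h3 : ((‖T (bosComb S a)‖ : ℂ) ^ 2).re = ‖T (bosComb S a)‖ ^ 2 := by
        rw [← Complex.ofReal_pow, Complex.ofReal_re]
      rw [Complex.add_re, ← Complex.ofReal_mul, Complex.ofReal_re] at h2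
      have h4 : ‖T (bosComb S a)‖ ^ 2 =
          (M.form L (bosComb S a) (bosComb S a)).re + c * ∑ Y ∈ S, a Y ^ 2 := h3.symm.trans h2
      rw [h4]
      refine (add_le_add_left (h.re_form_bosComb_le hL S a) _).trans (le_of_eq ?_)
      rw [Finset.mul_sum, ← Finset.sum_add_distrib]
      exact Finset.sum_congr rfl fun Y _ => by ring
    have hsumm : Summable fun Y => (M.bound L Y + c) * a Y ^ 2 := by
      have h0 : Summable fun Y => a Y ^ 2 := by
        simpa [sq] using (h.bogParam.hasSum_dcoeff_mul X X).summable
      exact ((h.summable_bound hL X).add (h0.mul_left c)).congr fun Y => by ring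
    have hconv : Summable fun Y => T ((a Y : ℂ) • bosState Y) := by
      rw [summable_iff_vanishing_norm]
      intro ε hε
      obtain ⟨S, hS⟩ := summable_iff_vanishing_norm.mp hsumm (ε ^ 2) (by positivity)
      refine ⟨S, fun t ht => ?_⟩
      rw [hterm]
      have h1 := (hnorm t).trans ((le_abs_self _).trans_lt (hS t ht)).le
      have h2 := ((hnorm t).trans (le_abs_self _)).trans_lt (hS t ht)
      exact lt_of_pow_lt_pow_left₀ 2 hε.le h2
    obtain ⟨η, hη⟩ := hconv
    have hηP : η ∈ P := by
      refine mem_closure_of_tendsto hη (.of_forall fun S => ?_)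
      rw [hterm]
      exact LinearMap.mem_range_self T _
    have hηX : ∀ X', η X' = ((√(M.energy L X' + c) : ℝ) : ℂ) * if X' = X then 1 else 0 := by
      intro X'
      have h1 : HasSum (fun Y => T ((a Y : ℂ) • bosState Y) X') (η X') :=
        hη.mapL (lp.evalCLM ℂ (fun _ : BLabel => ℂ) 2 X')
      have h2 := Complex.hasSum_ofReal.mpr (h.bogParam.hasSum_dcoeff_mul X' X)
      have h3 := h2.mul_left ((√(M.energy L X' + c) : ℝ) : ℂ)
      refine (h1.unique (hasSum_of_eq h3 (fun Y => ?_) rfl)).trans ?_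
      · rw [hT, ← BogParam.comp_eq_repr, map_smul, BogParam.comp_bosState, smul_eq_mul]
        push_cast; ring
      · split_ifs <;> simp
    have hne : ((√(M.energy L X + c) : ℝ) : ℂ) ≠ 0 := by
      have : 0 < M.energy L X + c := by linarith [hE X]
      exact Complex.ofReal_ne_zero.mpr (by positivity)
    have : lp.single 2 X (1 : ℂ) = ((√(M.energy L X + c) : ℝ) : ℂ)⁻¹ • η := by
      ext X'
      rw [lp.coeFn_smul, Pi.smul_apply, hηX, smul_eq_mul]
      by_cases hX : X' = X
      · subst hX; simp [hne]
      · simp [hX]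
    rw [this]
    exact P.smul_mem _ hηP
  intro f
  have h1 : f ∈ P := by
    refine (Submodule.isClosed_topologicalClosure _).mem_of_tendsto
      (lp.hasSum_single (by norm_num) f) (.of_forall fun S => Submodule.sum_mem _ fun X _ => ?_)
    have : lp.single 2 X (f X) = f X • lp.single (E := fun _ : BLabel => ℂ) 2 X 1 := by
      rw [← lp.single_smul]; simp
    rw [this]
    exact P.smul_mem _ (hmem X)
  exact h1

/-- The Hamiltonian. -/
def hamiltonian : Fock →ₗ.[ℂ] Fock := diagonal h.bogParam.basis (M.energy L)

theorem isHamiltonian (hL : 0 < L) : M.IsHamiltonian L h.hamiltonian := by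
  obtain ⟨c, -, hE⟩ := h.exists_shift hL
  obtain ⟨T, hT, hTq⟩ := exists_weighted hE (h.hasSum_form_repr hL)
  exact mem_graph_iff_form hE hT hTq (h.denseRange_weighted hL hE hT hTq)

theorem eq_hamiltonian (hL : 0 < L) {H : Fock →ₗ.[ℂ] Fock} (hH : M.IsHamiltonian L H) :
    H = h.hamiltonian :=
  LinearPMap.eq_of_eq_graph (Submodule.ext fun ⟨Ψ, Φ⟩ =>
    (hH Ψ Φ).trans (h.isHamiltonian hL Ψ Φ).symm)

theorem repr_hamiltonian (Ψ : h.hamiltonian.domain) (X : BLabel) :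
    h.bogParam.basis.repr (h.hamiltonian Ψ) X = M.energy L X * h.bogParam.basis.repr (Ψ : Fock) X :=
  (mem_graph_diagonal _ _ _ _).mp (h.hamiltonian.mem_graph Ψ) X

theorem isGroundState_iff (hL : 0 < L) (Ψ : Fock) : M.IsGroundState L Ψ ↔ ‖Ψ‖ = 1 ∧
    ∀ X, h.bogParam.basis.repr Ψ X ≠ 0 → ∀ Y, M.energy L X ≤ M.energy L Y := by
  constructor
  · rintro ⟨hn, H, hH, E, hE, hmin⟩
    obtain rfl := h.eq_hamiltonian hL hH
    refine ⟨hn, fun X hX Y => ?_⟩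
    have h1 := (mem_graph_diagonal _ _ _ _).mp hE X
    rw [map_smul, lp.coeFn_smul, Pi.smul_apply, smul_eq_mul] at h1
    have h2 : E = M.energy L X := Complex.ofReal_injective (mul_right_cancel₀ hX h1)
    have hY := basis_mem_graph h.bogParam.basis (M.energy L) Y
    have h3 := hmin ⟨_, LinearPMap.mem_domain_of_mem_graph hY⟩
    have h4 : h.hamiltonian ⟨_, LinearPMap.mem_domain_of_mem_graph hY⟩ =
        (M.energy L Y : ℂ) • h.bogParam.basis Y :=
      ((LinearPMap.image_iff (LinearPMap.mem_domain_of_mem_graph hY)).mpr hY).symm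
    rw [h4, inner_smul_right, inner_self_eq_norm_sq_to_K, h.bogParam.basis.orthonormal.1] at h3
    rw [← h2]
    simpa using h3
  · rintro ⟨hn, hmin⟩
    obtain ⟨X₀, hX₀⟩ : ∃ X, h.bogParam.basis.repr Ψ X ≠ 0 := by
      by_contra! h0
      have : Ψ = 0 := hilbertBasis_ext h.bogParam.basis fun X => by simp [h0]
      rw [this, norm_zero] at hn
      exact zero_ne_one hn
    refine ⟨hn, h.hamiltonian, h.isHamiltonian hL, M.energy L X₀, ?_, fun Φ => ?_⟩
    · refine (mem_graph_diagonal _ _ _ _).mpr fun X => ?_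
      rw [map_smul, lp.coeFn_smul, Pi.smul_apply, smul_eq_mul]
      by_cases hX : h.bogParam.basis.repr Ψ X = 0
      · simp [hX]
      · rw [le_antisymm (hmin X₀ hX₀ X) (hmin X hX X₀)]
    · have h1 := Complex.hasSum_re (hasSum_repr_inner h.bogParam.basis (Φ : Fock) (h.hamiltonian Φ))
      have h2 := (Complex.hasSum_re (hasSum_repr_inner h.bogParam.basis (Φ : Fock) Φ)).mul_left
        (M.energy L X₀)
      rw [show (inner ℂ (Φ : Fock) (Φ : Fock)).re = ‖(Φ : Fock)‖ ^ 2 from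
        inner_self_eq_norm_sq (𝕜 := ℂ) _] at h2
      refine hasSum_le (fun X => ?_) h2 h1
      rw [h.repr_hamiltonian, mul_left_comm, Complex.re_ofReal_mul, Complex.conj_mul',
        ← Complex.ofReal_pow, Complex.ofReal_re]
      exact mul_le_mul_of_nonneg_right (hmin X₀ hX₀ X) (sq_nonneg _)

end Model.Admissible

/-! ### Ground states -/

namespace Model

variable (M : Model) (L : ℝ)

/-- The renormalized velocity `K(0) v(0)` of the zero modes. -/
def kv : ℝ := M.vF * (1 + M.gt₄ 0 - M.gt₂ 0)

/-- The velocity `v(0) / K(0)` of the zero modes. -/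
def vk : ℝ := M.vF * (1 + M.gt₄ 0 + M.gt₂ 0)

/-- The value of `w 1 + w (-1)` at which the energy of the charges would be minimal. -/
def jmin : ℝ := (M.μ 1 - M.μ₀) * L / (Real.pi * M.kv)

/-- `w` minimizes the energy of the charges. -/
def IsMin (w : ℤˣ → ℤ) : Prop := ∀ w', M.zeroE L w ≤ M.zeroE L w'

end Model

namespace Model.Admissible

variable {M : Model} {L : ℝ} (h : M.Admissible L)

include h

theorem K_mul_v (n : ℤ) : M.K (momentum L n) * M.v (momentum L n) =
    M.vF * (1 + M.gt₄ (momentum L n) - M.gt₂ (momentum L n)) := by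
  have h1 := abs_lt.mp (h.gt_lt n)
  rw [K, v]
  set x := 1 + M.gt₄ (momentum L n)
  set y := M.gt₂ (momentum L n)
  have hm : 0 < x - y := by linarith
  have hp : 0 < x + y := by linarith
  have e : x ^ 2 - y ^ 2 = (x - y) * (x + y) := by ring
  rw [e, mul_left_comm, ← Real.sqrt_mul (by positivity),
    show (x - y) / (x + y) * ((x - y) * (x + y)) = (x - y) ^ 2 by field_simp, Real.sqrt_sq hm.le]

theorem K_mul_v_zero : M.K 0 * M.v 0 = M.kv := by
  simpa [momentum, kv] using h.K_mul_v 0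

theorem kv_pos : 0 < M.kv := h.Kv_pos

theorem vk_pos : 0 < M.vk := h.Kv_pos'

theorem zeroE_eq_sq (hL : 0 < L) (w : ℤˣ → ℤ) : M.zeroE L w =
    Real.pi / (2 * L) * (M.vk * (w 1 - w (-1)) ^ 2 + M.kv * (w 1 + w (-1) - M.jmin L) ^ 2) -
      Real.pi / (2 * L) * (M.kv * M.jmin L ^ 2) := by
  have h1 : Real.pi / (2 * L) * (M.kv * (2 * M.jmin L)) = M.μ 1 - M.μ₀ := by
    have := h.kv_pos
    have := Real.pi_pos
    rw [jmin]; field_simp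
  rw [h.zeroE_eq, ← h1, kv, vk]
  ring

theorem isMin_iff (hL : 0 < L) (w : ℤˣ → ℤ) : M.IsMin L w ↔ ∀ w' : ℤˣ → ℤ,
    M.vk * (w 1 - w (-1)) ^ 2 + M.kv * (w 1 + w (-1) - M.jmin L) ^ 2 ≤
      M.vk * (w' 1 - w' (-1)) ^ 2 + M.kv * (w' 1 + w' (-1) - M.jmin L) ^ 2 := by
  refine forall_congr' fun w' => ?_
  rw [h.zeroE_eq_sq hL, h.zeroE_eq_sq hL w', sub_le_sub_iff_right]
  exact mul_le_mul_iff_right₀ (by positivity)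

/-- Comparison with a symmetric integer trial shift gives a distance independent of `L`, although
`jmin` grows with `L`. This uniformity is what makes the thermodynamic limit independent of the
choice of minimizer. -/
theorem bound_of_isMin (hL : 0 < L) {w : ℤˣ → ℤ} (hw : M.IsMin L w) :
    |(w 1 + w (-1) - M.jmin L : ℝ)| ≤ 1 ∧ ∀ r, |(w r - M.jmin L / 2 : ℝ)| ≤ 1 + M.kv / M.vk := by
  have hk := h.kv_pos
  have hv := h.vk_pos
  -- For equal shifts rounded from `jmin / 2` the first square vanishes and the second is at most 1,
  -- so the minimum is at most `kv`. The bound `1 + kv / vk` then comes from `|x| ≤ 1 + x²`.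
  have h1 := (h.isMin_iff hL w).mp hw fun _ => round (M.jmin L / 2)
  have h2 : |M.jmin L / 2 - round (M.jmin L / 2)| ≤ 1 / 2 := abs_sub_round _
  have h3 : ((round (M.jmin L / 2) : ℝ) + round (M.jmin L / 2) - M.jmin L) ^ 2 ≤ 1 := by
    rw [sq_le_one_iff_abs_le_one]
    rw [abs_le] at h2 ⊢
    constructor <;> linarith
  have h4 : M.vk * (w 1 - w (-1) : ℝ) ^ 2 + M.kv * (w 1 + w (-1) - M.jmin L : ℝ) ^ 2 ≤ M.kv := by
    refine h1.trans ?_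
    nlinarith
  have h5 : |(w 1 + w (-1) - M.jmin L : ℝ)| ≤ 1 := by
    rw [← sq_le_one_iff_abs_le_one]
    have : 0 ≤ M.vk * (w 1 - w (-1) : ℝ) ^ 2 := by positivity
    have h6 : M.kv * (w 1 + w (-1) - M.jmin L : ℝ) ^ 2 ≤ M.kv * 1 := by linarith
    exact le_of_mul_le_mul_left h6 hk
  have h6 : (w 1 - w (-1) : ℝ) ^ 2 ≤ M.kv / M.vk := by
    rw [le_div_iff₀ hv]
    have : 0 ≤ M.kv * (w 1 + w (-1) - M.jmin L : ℝ) ^ 2 := by positivity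
    linarith
  have h7 : |(w 1 - w (-1) : ℝ)| ≤ 1 + M.kv / M.vk := by
    have := sq_abs (w 1 - w (-1) : ℝ)
    nlinarith [sq_nonneg (|(w 1 - w (-1) : ℝ)| - 1), abs_nonneg (w 1 - w (-1) : ℝ)]
  have h8 : 0 < M.kv / M.vk := by positivity
  refine ⟨h5, fun r => ?_⟩
  rw [abs_le] at h5 h7 ⊢
  rcases Int.units_eq_one_or r with rfl | rfl <;> constructor <;> linarith [h5.1, h5.2, h7.1, h7.2]

theorem finite_setOf_isMin (hL : 0 < L) : {w | M.IsMin L w}.Finite := by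
  set N : ℤ := ⌈|M.jmin L / 2| + (1 + M.kv / M.vk)⌉
  refine (Set.finite_Icc (fun _ : ℤˣ => -N) (fun _ => N)).subset fun w hw => ?_
  have h1 : ∀ r, |w r| ≤ N := fun r => by
    have h2 := (h.bound_of_isMin hL hw).2 r
    have h3 : (|w r| : ℝ) ≤ N := by
      refine le_trans ?_ (Int.le_ceil _)
      have := abs_add_le (w r - M.jmin L / 2 : ℝ) (M.jmin L / 2)
      rw [sub_add_cancel] at this
      linarith
    exact_mod_cast h3
  exact ⟨fun r => (abs_le.mp (h1 r)).1, fun r => (abs_le.mp (h1 r)).2⟩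

theorem exists_isMin (hL : 0 < L) : ∃ w, M.IsMin L w := by
  have hk := h.kv_pos
  have hv := h.vk_pos
  set f : (ℤˣ → ℤ) → ℝ := fun w =>
    M.vk * (w 1 - w (-1)) ^ 2 + M.kv * (w 1 + w (-1) - M.jmin L) ^ 2 with hf
  -- The energy is a positive definite quadratic function of the integer shifts, so a sublevel set
  -- is finite and a minimum is attained on it.
  have hfin : {w | f w ≤ f 0}.Finite := by
    set C := f 0 with hC
    set N : ℤ := ⌈|M.jmin L| + (1 + C / M.kv) + (1 + C / M.vk)⌉
    refine (Set.finite_Icc (fun _ : ℤˣ => -N) (fun _ => N)).subset fun w hw => ?_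
    have h4 : M.vk * (w 1 - w (-1) : ℝ) ^ 2 + M.kv * (w 1 + w (-1) - M.jmin L : ℝ) ^ 2 ≤ C := hw
    have h5 : (w 1 + w (-1) - M.jmin L : ℝ) ^ 2 ≤ C / M.kv := by
      rw [le_div_iff₀ hk]
      have : 0 ≤ M.vk * (w 1 - w (-1) : ℝ) ^ 2 := by positivity
      linarith
    have h6 : (w 1 - w (-1) : ℝ) ^ 2 ≤ C / M.vk := by
      rw [le_div_iff₀ hv]
      have : 0 ≤ M.kv * (w 1 + w (-1) - M.jmin L : ℝ) ^ 2 := by positivity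
      linarith
    have h7 : ∀ {x y : ℝ}, x ^ 2 ≤ y → |x| ≤ 1 + y := fun {x y} hxy => by
      have := sq_abs x
      nlinarith [sq_nonneg (|x| - 1), abs_nonneg x]
    have h8 := abs_le.mp (h7 h5)
    have h9 := abs_le.mp (h7 h6)
    have h10 := abs_le.mp (le_refl |M.jmin L|)
    have hN : |M.jmin L| + (1 + C / M.kv) + (1 + C / M.vk) ≤ N := Int.le_ceil _
    have h11 : ∀ r, |w r| ≤ N := fun r => by
      have h3 : (|w r| : ℝ) ≤ N := by
        rw [abs_le]
        have h12 : 0 ≤ C / M.kv := (sq_nonneg _).trans h5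
        have h13 : 0 ≤ C / M.vk := (sq_nonneg _).trans h6
        have h14 := abs_nonneg (M.jmin L)
        rcases Int.units_eq_one_or r with rfl | rfl <;> constructor <;>
          linarith [h8.1, h8.2, h9.1, h9.2, h10.1, h10.2]
      exact_mod_cast h3
    exact ⟨fun r => (abs_le.mp (h11 r)).1, fun r => (abs_le.mp (h11 r)).2⟩
  obtain ⟨w, hw, hmin⟩ := hfin.exists_minimalFor f _ ⟨0, le_refl (f 0)⟩
  refine ⟨w, (h.isMin_iff hL w).mpr fun w' => ?_⟩
  change f w ≤ f w'
  by_cases h0 : f w' ≤ f 0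
  · rcases le_total (f w) (f w') with h1 | h1
    · exact h1
    · exact hmin h0 h1
  · exact le_trans hw (not_le.mp h0).le

/-- If `jmin / 2` is an integer, both squares can vanish at once, and then they must. -/
theorem eq_of_isMin (hL : 0 < L) {k : ℤ} (hk : M.jmin L = 2 * k) {w : ℤˣ → ℤ} (hw : M.IsMin L w) :
    w = fun _ => k := by
  have h0 := h.kv_pos
  have hv := h.vk_pos
  have h1 := (h.isMin_iff hL w).mp hw fun _ => k
  rw [hk, sub_self] at h1
  have h2 : 0 ≤ M.vk * (w 1 - w (-1) : ℝ) ^ 2 := by positivity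
  have h3 : 0 ≤ M.kv * (w 1 + w (-1) - 2 * k : ℝ) ^ 2 := by positivity
  have e1 : (k + k - 2 * k : ℝ) = 0 := by ring
  rw [e1] at h1
  have h4 : M.vk * (w 1 - w (-1) : ℝ) ^ 2 = 0 := by linarith
  have h5 : M.kv * (w 1 + w (-1) - 2 * k : ℝ) ^ 2 = 0 := by linarith
  have h6 : (w 1 - w (-1) : ℝ) = 0 := by simpa [hv.ne'] using h4
  have h7 : (w 1 + w (-1) - 2 * k : ℝ) = 0 := by simpa [h0.ne'] using h5
  have h8 : w 1 - w (-1) = 0 := by exact_mod_cast h6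
  have h9 : w 1 + w (-1) - 2 * k = 0 := by exact_mod_cast h7
  funext r
  rcases Int.units_eq_one_or r with rfl | rfl <;> omega

theorem jmin_eq (hL : 0 < L) {k : ℤ}
    (hk : M.μ 1 - M.μ₀ = k * (2 * Real.pi * (M.K 0 * M.v 0) / L)) : M.jmin L = 2 * k := by
  have := h.kv_pos
  have := Real.pi_pos
  rw [jmin, hk, h.K_mul_v_zero]
  field_simp

theorem bosE_pos (hL : 0 < L) {x : BOcc} (hx : x ≠ 0) : 0 < M.bosE L x := by
  refine Finset.sum_pos (fun j hj => mul_pos (h.om_pos hL j.2) ?_) (Finsupp.support_nonempty_iff.mpr hx)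
  exact_mod_cast Nat.pos_of_ne_zero (Finsupp.mem_support_iff.mp hj)

theorem energy_min_iff (hL : 0 < L) (X : BLabel) :
    (∀ Y, M.energy L X ≤ M.energy L Y) ↔ X.2 = 0 ∧ M.IsMin L X.1 := by
  have h0 : M.bosE L 0 = 0 := by simp [bosE]
  constructor
  · intro hX
    have hX2 : X.2 = 0 := by
      by_contra hne
      have h1 := hX (X.1, 0)
      have h2 := h.bosE_pos hL hne
      simp only [energy, h0] at h1
      linarith
    refine ⟨hX2, fun w' => ?_⟩
    have h1 := hX (w', 0)
    simp only [energy, hX2] at h1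
    linarith
  · rintro ⟨h1, h2⟩ Y
    have h3 := h2 Y.1
    have h4 := h.bosE_nonneg hL Y.2
    rw [energy, energy, h1, h0]
    linarith

theorem isGroundState_iff' (hL : 0 < L) (Ψ : Fock) : M.IsGroundState L Ψ ↔ ‖Ψ‖ = 1 ∧
    ∀ X, h.bogParam.basis.repr Ψ X ≠ 0 → X.2 = 0 ∧ M.IsMin L X.1 := by
  rw [h.isGroundState_iff hL]
  exact and_congr_right fun _ => forall_congr' fun X => imp_congr_right fun _ =>
    h.energy_min_iff hL X

/-- A ground state is a combination of dressed vacua in the sectors of minimal energy. -/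
theorem exists_sum_of_isGroundState (hL : 0 < L) {Ψ : Fock} (hΨ : M.IsGroundState L Ψ) :
    ∃ (W : Finset (ℤˣ → ℤ)) (a : (ℤˣ → ℤ) → ℂ), (∀ w ∈ W, M.IsMin L w) ∧
      ∑ w ∈ W, ‖a w‖ ^ 2 = 1 ∧ Ψ = ∑ w ∈ W, a w • h.bogParam.dressed (w, 0) := by
  obtain ⟨hn, hs⟩ := (h.isGroundState_iff' hL Ψ).mp hΨ
  set W := (h.finite_setOf_isMin hL).toFinset with hW
  have hinj : Set.InjOn (fun w : ℤˣ → ℤ => ((w, 0) : BLabel)) W := fun a _ b _ e =>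
    congrArg Prod.fst e
  have h0 : ∀ X ∉ W.image fun w : ℤˣ → ℤ => ((w, 0) : BLabel), h.bogParam.basis.repr Ψ X = 0 := by
    intro X hX
    by_contra hne
    obtain ⟨h1, h2⟩ := hs X hne
    exact hX (Finset.mem_image.mpr ⟨X.1, by simpa [hW] using h2, Prod.ext rfl h1.symm⟩)
  refine ⟨W, fun w => h.bogParam.basis.repr Ψ (w, 0), fun w hw => by simpa [hW] using hw, ?_, ?_⟩
  · have h1 := lp_norm_sq (h.bogParam.basis.repr Ψ)
    rw [LinearIsometryEquiv.norm_map, hn, tsum_eq_sum (s := W.image fun w : ℤˣ → ℤ => ((w, 0) : BLabel))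
      (fun X hX => by rw [h0 X hX]; simp), Finset.sum_image hinj] at h1
    rw [← h1, one_pow]
  · have h1 := h.bogParam.basis.hasSum_repr Ψ
    have h2 : HasSum (fun X => h.bogParam.basis.repr Ψ X • h.bogParam.basis X)
        (∑ X ∈ W.image fun w : ℤˣ → ℤ => ((w, 0) : BLabel),
          h.bogParam.basis.repr Ψ X • h.bogParam.basis X) :=
      hasSum_sum_of_ne_finset_zero fun X hX => by rw [h0 X hX, zero_smul]
    rw [Finset.sum_image hinj] at h2
    exact (h1.unique h2).trans (Finset.sum_congr rfl fun w _ => by rw [BogParam.basis_apply])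

theorem isGroundState_dressed (hL : 0 < L) {w : ℤˣ → ℤ} (hw : M.IsMin L w) :
    M.IsGroundState L (h.bogParam.dressed (w, 0)) := by
  classical
  rw [h.isGroundState_iff' hL]
  refine ⟨h.bogParam.orthonormal_dressed.1 _, fun X hX => ?_⟩
  rw [← BogParam.basis_apply, repr_self_apply] at hX
  have : X = (w, 0) := by
    by_contra hne
    exact hX (if_neg hne)
  rw [this]
  exact ⟨rfl, hw⟩

end Model.Admissible

/-! ### Smeared fields -/

/-- The coefficients of the smeared field. -/
def fieldCoeff (L : ℝ) (g : ℝ → ℂ) (n : ℤ) : ℂ :=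
  ((√L)⁻¹ : ℝ) * ∫ y in (-(L / 2))..(L / 2), g y * Complex.exp (Complex.I * fermionMomentum L n * y)

theorem smearedField_eq (L : ℝ) (r : ℤˣ) (g : ℝ → ℂ) (Ψ : Fock) :
    smearedField L r g Ψ = ∑' n : ℤ, fieldCoeff L g n • annihilation (r, n) Ψ := rfl

/-- A plane wave of allowed boson momentum translates the fermion momenta. This is the counterpart,
on test functions, of a Klein factor. -/
theorem fieldCoeff_planeWave {L : ℝ} (hL : L ≠ 0) (g : ℝ → ℂ) (k n : ℤ) :
    fieldCoeff L (fun y => planeWave (2 * Real.pi * k / L) y * g y) n = fieldCoeff L g (n + k) := by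
  unfold fieldCoeff
  congr 1
  refine intervalIntegral.integral_congr fun y _ => ?_
  have hL' : (L : ℂ) ≠ 0 := Complex.ofReal_ne_zero.mpr hL
  simp only [planeWave, fermionMomentum]
  rw [mul_comm (Complex.exp _) (g y), mul_assoc, ← Complex.exp_add]
  congr 2
  push_cast
  field_simp
  ring

theorem norm_exp_I_mul (a b : ℝ) : ‖Complex.exp (Complex.I * a * b)‖ = 1 := by
  rw [show Complex.I * (a : ℂ) * b = ((a * b : ℝ) : ℂ) * Complex.I by push_cast; ring,
    Complex.norm_exp_ofReal_mul_I]

theorem norm_planeWave (q x : ℝ) : ‖planeWave q x‖ = 1 := norm_exp_I_mul q x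

theorem continuous_planeWave (q : ℝ) : Continuous (planeWave q) := by
  unfold planeWave; fun_prop

theorem memLp_planeWave_mul {g : ℝ → ℂ} {μ : Measure ℝ} (hg : MemLp g 2 μ) (q : ℝ) :
    MemLp (fun y => planeWave q y * g y) 2 μ := by
  refine (memLp_congr_norm ((continuous_planeWave q).aestronglyMeasurable.mul hg.1) hg.1
    (.of_forall fun y => ?_)).mpr hg
  change ‖planeWave q y * g y‖ = _
  rw [norm_mul, norm_planeWave, one_mul]

theorem hasSum_fieldCoeff_sq {L : ℝ} (hL : 0 < L) {g : ℝ → ℂ}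
    (hg : MemLp g 2 (volume.restrict (Set.Icc (-(L / 2)) (L / 2)))) :
    HasSum (fun n => ‖fieldCoeff L g n‖ ^ 2) (∫ y in (-(L / 2))..(L / 2), ‖g y‖ ^ 2) := by
  have hab : -(L / 2) < L / 2 := by linarith
  have hlen : L / 2 - -(L / 2) = L := by ring
  have hg' : MemLp g 2 (volume.restrict (Set.Ioc (-(L / 2)) (L / 2))) :=
    hg.mono_measure (Measure.restrict_mono Set.Ioc_subset_Icc_self le_rfl)
  -- The half-integer momenta belong to antiperiodic functions. Multiplication by `exp (iπy/L)`
  -- reduces to ordinary Fourier coefficients, and the sign in the exponent reverses the index.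
  have h1 := hasSum_sq_fourierCoeffOn hab (memLp_planeWave_mul hg' (Real.pi / L))
  have h2 := (((Equiv.neg ℤ).hasSum_iff).mpr h1).mul_left L
  have hL' : (L : ℂ) ≠ 0 := Complex.ofReal_ne_zero.mpr hL.ne'
  have e1 : (fun n => ‖fieldCoeff L g n‖ ^ 2) = fun n => L * ((fun n =>
      ‖fourierCoeffOn hab (fun y => planeWave (Real.pi / L) y * g y) n‖ ^ 2) ∘ Equiv.neg ℤ) n := by
    funext n
    have e : fieldCoeff L g n = (√L : ℝ) * fourierCoeffOn hab
        (fun y => planeWave (Real.pi / L) y * g y) (-n) := by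
      have e0 : (((√L)⁻¹ : ℝ) : ℂ) = (√L : ℝ) * ((1 / L : ℝ) : ℂ) := by
        rw [← Complex.ofReal_mul]
        congr 1
        have : √L ≠ 0 := by positivity
        field_simp
        exact (Real.sq_sqrt hL.le).symm
      rw [fourierCoeffOn_eq_integral, fieldCoeff, e0, mul_assoc, hlen, Complex.real_smul]
      congr 2
      refine intervalIntegral.integral_congr fun y _ => ?_
      simp only [neg_neg, fourier_coe_apply, planeWave, fermionMomentum, smul_eq_mul]
      rw [← mul_assoc, ← Complex.exp_add, mul_comm]
      congr 2
      push_cast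
      field_simp
    simp only [Function.comp, Equiv.neg_apply]
    rw [e, norm_mul, mul_pow, Complex.norm_real, Real.norm_eq_abs, sq_abs, Real.sq_sqrt hL.le]
  have e2 : ∫ y in (-(L / 2))..(L / 2), ‖g y‖ ^ 2 = L * ((L / 2 - -(L / 2))⁻¹ •
      ∫ y in (-(L / 2))..(L / 2), ‖planeWave (Real.pi / L) y * g y‖ ^ 2) := by
    rw [hlen, smul_eq_mul, mul_inv_cancel_left₀ hL.ne']
    simp only [norm_mul, norm_planeWave, one_mul]
  rw [e1, e2]
  exact h2

/-- By the anticommutation relations, the squared norms of the smeared annihilator and of its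
adjoint on χ add up to the sum of the squared coefficients times the squared norm of χ. Smearing
with an L² function therefore needs no domain. -/
theorem norm_sum_annihilation_sq_le (r : ℤˣ) (S : Finset ℤ) (c : ℤ → ℂ) (Ψ : Fock) :
    ‖∑ n ∈ S, c n • annihilation (r, n) Ψ‖ ^ 2 ≤ (∑ n ∈ S, ‖c n‖ ^ 2) * ‖Ψ‖ ^ 2 := by
  refine denseRange_toFock.induction_on (p := fun Ψ => ‖∑ n ∈ S, c n • annihilation (r, n) Ψ‖ ^ 2 ≤
    (∑ n ∈ S, ‖c n‖ ^ 2) * ‖Ψ‖ ^ 2) Ψ (isClosed_le (by fun_prop) (by fun_prop)) fun χ => ?_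
  have e1 : ∑ n ∈ S, c n • annihilation (r, n) (toFock χ) =
      toFock (∑ n ∈ S, c n • ann (r, n) χ) := by
    simp only [map_sum, map_smul, annihilation_toFock]
  have e2 : algInner (∑ n ∈ S, c n • ann (r, n) χ) (∑ n ∈ S, c n • ann (r, n) χ) +
      algInner (∑ n ∈ S, conj (c n) • cre (r, n) χ) (∑ n ∈ S, conj (c n) • cre (r, n) χ) =
      ((∑ n ∈ S, ‖c n‖ ^ 2 : ℝ) : ℂ) * algInner χ χ := by
    have e3 : ∀ n m, algInner (cre (r, n) χ) (cre (r, m) χ) =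
        (if n = m then algInner χ χ else 0) - algInner (ann (r, m) χ) (ann (r, n) χ) := by
      intro n m
      rw [← algInner_ann, ann_cre, algInner_sub_right, algInner_cre]
      congr 1
      by_cases hnm : n = m
      · simp [hnm]
      · rw [if_neg (fun e => hnm (congrArg Prod.snd e)), if_neg hnm]; simp [algInner]
    have e4 : ∑ n ∈ S, ∑ m ∈ S, c n * (conj (c m) * algInner (ann (r, m) χ) (ann (r, n) χ)) =
        ∑ n ∈ S, ∑ m ∈ S, conj (c n) * (c m * algInner (ann (r, n) χ) (ann (r, m) χ)) := by
      rw [Finset.sum_comm]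
      exact Finset.sum_congr rfl fun n _ => Finset.sum_congr rfl fun m _ => by ring
    simp only [algInner_sum_left, algInner_sum_right, algInner_smul_left, algInner_smul_right,
      Complex.conj_conj, e3, Finset.mul_sum, mul_sub,
      Finset.sum_sub_distrib]
    rw [← e4]
    simp only [mul_ite, mul_zero, Finset.sum_ite_eq']
    push_cast
    rw [add_sub_cancel, Finset.sum_mul]
    refine Finset.sum_congr rfl fun n hn => ?_
    rw [if_pos hn, ← Complex.mul_conj', mul_assoc]
    ring
  rw [e1]
  rw [algInner_self, algInner_self, algInner_self, ← Complex.ofReal_add, ← Complex.ofReal_mul,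
    Complex.ofReal_inj] at e2
  nlinarith [sq_nonneg ‖toFock (∑ n ∈ S, conj (c n) • cre (r, n) χ)‖]

theorem summable_smeared (r : ℤˣ) {c : ℤ → ℂ} (hc : Summable fun n => ‖c n‖ ^ 2) (Ψ : Fock) :
    Summable fun n => c n • annihilation (r, n) Ψ := by
  rw [summable_iff_vanishing_norm]
  intro ε hε
  obtain ⟨S, hS⟩ := summable_iff_vanishing_norm.mp hc (ε ^ 2 / (‖Ψ‖ ^ 2 + 1)) (by positivity)
  refine ⟨S, fun t ht => lt_of_pow_lt_pow_left₀ 2 hε.le ?_⟩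
  have h1 := (le_abs_self _).trans_lt (hS t ht)
  rw [lt_div_iff₀ (by positivity)] at h1
  refine (norm_sum_annihilation_sq_le r t c Ψ).trans_lt (lt_of_le_of_lt ?_ h1)
  exact mul_le_mul_of_nonneg_left (by linarith) (Finset.sum_nonneg fun _ _ => sq_nonneg _)

theorem norm_tsum_annihilation_le (r : ℤˣ) {c : ℤ → ℂ} {B : ℝ} (hB : 0 ≤ B)
    (hc : HasSum (fun n => ‖c n‖ ^ 2) (B ^ 2)) (Ψ : Fock) :
    ‖∑' n, c n • annihilation (r, n) Ψ‖ ≤ B * ‖Ψ‖ := by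
  have h1 := ((summable_smeared r hc.summable Ψ).hasSum.norm).pow 2
  refine le_of_pow_le_pow_left₀ two_ne_zero (by positivity) (le_of_tendsto' h1 fun S => ?_)
  refine (norm_sum_annihilation_sq_le r S c Ψ).trans ?_
  rw [mul_pow]
  exact mul_le_mul_of_nonneg_right (sum_le_hasSum _ (fun _ _ => sq_nonneg _) hc) (sq_nonneg _)

/-- The `L²` norm on the circle of length `L`. -/
def l2norm (L : ℝ) (g : ℝ → ℂ) : ℝ := √(∫ y in (-(L / 2))..(L / 2), ‖g y‖ ^ 2)

/-- Square integrability on the circle of length `L`. -/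
abbrev MemCircle (L : ℝ) (g : ℝ → ℂ) : Prop :=
  MemLp g 2 (volume.restrict (Set.Icc (-(L / 2)) (L / 2)))

theorem l2norm_nonneg (L : ℝ) (g : ℝ → ℂ) : 0 ≤ l2norm L g := Real.sqrt_nonneg _

theorem l2norm_congr {L : ℝ} {g g' : ℝ → ℂ} (h : ∀ y, ‖g y‖ = ‖g' y‖) : l2norm L g = l2norm L g' := by
  simp only [l2norm, h]

theorem hasSum_fieldCoeff {L : ℝ} (hL : 0 < L) {g : ℝ → ℂ} (hg : MemCircle L g) :
    HasSum (fun n => ‖fieldCoeff L g n‖ ^ 2) (l2norm L g ^ 2) := by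
  rw [l2norm, Real.sq_sqrt]
  · exact hasSum_fieldCoeff_sq hL hg
  · exact intervalIntegral.integral_nonneg (by linarith) fun _ _ => sq_nonneg _

theorem summable_smearedField {L : ℝ} (hL : 0 < L) (r : ℤˣ) {g : ℝ → ℂ} (hg : MemCircle L g) (Ψ : Fock) :
    Summable fun n => fieldCoeff L g n • annihilation (r, n) Ψ :=
  summable_smeared r (hasSum_fieldCoeff hL hg).summable Ψ

theorem norm_smearedField_le {L : ℝ} (hL : 0 < L) (r : ℤˣ) {g : ℝ → ℂ} (hg : MemCircle L g) (Ψ : Fock) :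
    ‖smearedField L r g Ψ‖ ≤ l2norm L g * ‖Ψ‖ :=
  norm_tsum_annihilation_le r (l2norm_nonneg L g) (hasSum_fieldCoeff hL hg) Ψ

theorem intervalIntegrable_field {L : ℝ} (hL : 0 < L) {g : ℝ → ℂ} (hg : MemCircle L g) (n : ℤ) :
    IntervalIntegrable (fun y => g y * Complex.exp (Complex.I * fermionMomentum L n * y)) volume
      (-(L / 2)) (L / 2) := by
  have h1 : MemCircle L fun y => planeWave (fermionMomentum L n) y * g y := memLp_planeWave_mul hg _
  have h2 := h1.integrable one_le_two
  rw [intervalIntegrable_iff_integrableOn_Icc_of_le (by linarith)]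
  exact h2.congr (.of_forall fun y => mul_comm _ _)

theorem fieldCoeff_sub {L : ℝ} (hL : 0 < L) {g g' : ℝ → ℂ} (hg : MemCircle L g) (hg' : MemCircle L g')
    (n : ℤ) : fieldCoeff L (fun y => g y - g' y) n = fieldCoeff L g n - fieldCoeff L g' n := by
  simp only [fieldCoeff, sub_mul]
  rw [intervalIntegral.integral_sub (intervalIntegrable_field hL hg n)
    (intervalIntegrable_field hL hg' n), mul_sub]

theorem smearedField_sub {L : ℝ} (hL : 0 < L) (r : ℤˣ) {g g' : ℝ → ℂ} (hg : MemCircle L g)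
    (hg' : MemCircle L g') (Ψ : Fock) :
    smearedField L r (fun y => g y - g' y) Ψ = smearedField L r g Ψ - smearedField L r g' Ψ := by
  simp only [smearedField_eq, fieldCoeff_sub hL hg hg', sub_smul]
  exact (summable_smearedField hL r hg Ψ).tsum_sub (summable_smearedField hL r hg' Ψ)

theorem smearedField_sum {L : ℝ} (hL : 0 < L) (r : ℤˣ) {g : ℝ → ℂ} (hg : MemCircle L g) {ι : Type*}
    (W : Finset ι) (a : ι → ℂ) (d : ι → Fock) :
    smearedField L r g (∑ w ∈ W, a w • d w) = ∑ w ∈ W, a w • smearedField L r g (d w) := by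
  have h1 : HasSum (fun n => ∑ w ∈ W, a w • (fieldCoeff L g n • annihilation (r, n) (d w)))
      (∑ w ∈ W, a w • smearedField L r g (d w)) :=
    hasSum_sum fun w _ => (summable_smearedField hL r hg (d w)).hasSum.const_smul (a w)
  have h2 := (summable_smearedField hL r hg (∑ w ∈ W, a w • d w)).hasSum
  simp only [map_sum, map_smul, Finset.smul_sum, smul_comm (fieldCoeff L g _)] at h2
  rw [smearedField_eq]
  simp only [map_sum, map_smul, Finset.smul_sum, smul_comm (fieldCoeff L g _)]
  exact h2.unique h1

theorem memCircle_conj {L : ℝ} {f : ℝ → ℂ} (hf : MemCircle L f) : MemCircle L fun x => conj (f x) :=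
  (memLp_congr_norm (Complex.continuous_conj.comp_aestronglyMeasurable hf.1) hf.1
    (.of_forall fun _ => RCLike.norm_conj _)).mpr hf

/-! ### Sectors of fixed charges -/

/-- `Ψ` has the charges `q`. -/
def HasCharge (q : ℤˣ → ℤ) (Ψ : Fock) : Prop := ∀ S r, chg r S ≠ q r → Ψ S = 0

theorem inner_eq_zero_of_hasCharge {q q' : ℤˣ → ℤ} (hq : q ≠ q') {Ψ Ψ' : Fock} (h : HasCharge q Ψ)
    (h' : HasCharge q' Ψ') : inner ℂ Ψ Ψ' = 0 := by
  obtain ⟨r, hr⟩ := Function.ne_iff.mp hq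
  refine (lp.hasSum_inner (𝕜 := ℂ) Ψ Ψ').unique (hasSum_of_eq hasSum_zero (fun S => ?_) rfl)
  by_cases e : chg r S = q r
  · rw [h' S r (by rw [e]; exact hr), inner_zero_right]
  · rw [h S r e, inner_zero_left]

theorem annihilation_apply (m : Mode) (Ψ : Fock) (S : Finset Mode) :
    annihilation m Ψ S = if Occ m S then 0 else jwSign m S * Ψ (S ∆ {m}) := by
  have hc : ∀ T : Finset Mode, Continuous fun Ψ : Fock => Ψ T := fun T =>
    (lp.evalCLM ℂ (fun _ : Finset Mode => ℂ) 2 T).continuous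
  refine denseRange_toFock.induction_on (p := fun Ψ => annihilation m Ψ S =
    if Occ m S then 0 else jwSign m S * Ψ (S ∆ {m})) Ψ (isClosed_eq ?_ ?_) fun χ => ?_
  · exact (hc S).comp (annihilation m).continuous
  · split_ifs
    · exact continuous_const
    · exact continuous_const.mul (hc _)
  · rw [annihilation_toFock, toFock_apply, toFock_apply, ← fop_false, fop_apply]
    by_cases e : Occ m S <;> simp [e]

theorem HasCharge.annihilation {q : ℤˣ → ℤ} {Ψ : Fock} (h : HasCharge q Ψ) (m : Mode) :
    HasCharge (fun r => q r - if m.1 = r then 1 else 0) (annihilation m Ψ) := by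
  intro S r hS
  rw [annihilation_apply]
  split_ifs with e
  · rfl
  · rw [h (S ∆ {m}) r, mul_zero]
    rw [chg_toggle]
    simp only [e, if_false]
    intro e'
    apply hS
    change chg r S = q r - _
    rw [← e', add_sub_cancel_right]

theorem HasCharge.smearedField {q : ℤˣ → ℤ} {Ψ : Fock} (h : HasCharge q Ψ) {L : ℝ} (hL : 0 < L)
    (r : ℤˣ) {g : ℝ → ℂ} (hg : MemCircle L g) :
    HasCharge (fun s => q s - if r = s then 1 else 0) (smearedField L r g Ψ) := by
  intro S s hS
  have h1 := (summable_smearedField hL r hg Ψ).hasSum.mapL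
    (lp.evalCLM ℂ (fun _ : Finset Mode => ℂ) 2 S)
  refine h1.unique (hasSum_of_eq hasSum_zero (fun n => ?_) rfl)
  rw [map_smul]
  change _ • Luttinger.annihilation (r, n) Ψ S = 0
  rw [h.annihilation (r, n) S s hS, smul_zero]

theorem BogParam.hasCharge_dressed {c s : ℕ → ℝ} (h : BogParam c s) (X : BLabel) :
    HasCharge (fun r => (r : ℤ) * X.1 r) (h.dressed X) := by
  intro S r hS
  have h1 := h.comp_charge r X (Finsupp.single S 1)
  rw [charge_single, map_smul, smul_eq_mul, ← sub_eq_zero, ← sub_mul] at h1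
  have h2 : (chg r S : ℂ) - (r : ℤ) * X.1 r ≠ 0 := by
    rw [sub_ne_zero]
    exact_mod_cast hS
  have h3 := (mul_eq_zero.mp h1).resolve_left h2
  have h4 : inner ℂ (toFock (Finsupp.single S 1)) (h.dressed X) = h.dressed X S := by
    simp [toFock, lp.inner_single_left]
  rw [← h4, ← inner_conj_symm, ← h.comp_apply, h3, map_zero]

/-- Both fields change the charges in the same way, so vectors from different sectors stay
orthogonal. Superposed dressed vacua contribute without interference, with weights `‖a w‖ ^ 2`. -/
theorem twoPoint_sum {L : ℝ} (hL : 0 < L) (r : ℤˣ) {f g : ℝ → ℂ} (hf : MemCircle L f)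
    (hg : MemCircle L g) {c s : ℕ → ℝ} (h : BogParam c s) (W : Finset (ℤˣ → ℤ)) (a : (ℤˣ → ℤ) → ℂ) :
    twoPoint L r (∑ w ∈ W, a w • h.dressed (w, 0)) f g =
      ∑ w ∈ W, ((‖a w‖ ^ 2 : ℝ) : ℂ) * twoPoint L r (h.dressed (w, 0)) f g := by
  rw [twoPoint, smearedField_sum hL r (memCircle_conj hf), smearedField_sum hL r hg, sum_inner]
  refine Finset.sum_congr rfl fun w hw => ?_
  rw [inner_sum, Finset.sum_eq_single_of_mem w hw]
  · rw [inner_smul_left, inner_smul_right, ← mul_assoc, Complex.conj_mul', twoPoint]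
    push_cast; rfl
  · intro w' _ hne
    rw [inner_smul_left, inner_smul_right, inner_eq_zero_of_hasCharge ?_
      ((h.hasCharge_dressed (w, 0)).smearedField hL r (memCircle_conj hf))
      ((h.hasCharge_dressed (w', 0)).smearedField hL r hg), mul_zero, mul_zero]
    intro e
    refine hne (funext fun t => ?_)
    have := congrFun e t
    simp only [sub_left_inj] at this
    exact (mul_left_cancel₀ t.ne_zero this).symm

/-! ### Klein factors on the Fock space -/

theorem norm_toFock_klein (w : ℤˣ → ℤ) (χ : FockAlg) : ‖toFock (klein w χ)‖ = ‖toFock χ‖ := by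
  have h1 : algInner (klein w χ) (klein w χ) = algInner χ χ := algInner_klein w χ χ
  rw [algInner_self, algInner_self, Complex.ofReal_inj] at h1
  exact (sq_eq_sq₀ (norm_nonneg _) (norm_nonneg _)).mp h1

/-- The Klein factor as an operator on the Fock space. -/
def kleinOp (w : ℤˣ → ℤ) : Fock →L[ℂ] Fock := (toFock ∘ₗ klein w).extendOfNorm toFock

theorem kleinOp_toFock (w : ℤˣ → ℤ) (χ : FockAlg) : kleinOp w (toFock χ) = toFock (klein w χ) :=
  LinearMap.extendOfNorm_eq denseRange_toFock
    ⟨1, fun χ => by simpa using (norm_toFock_klein w χ).le⟩ χ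

theorem inner_kleinOp (w : ℤˣ → ℤ) (Ψ Φ : Fock) : inner ℂ (kleinOp w Ψ) (kleinOp w Φ) = inner ℂ Ψ Φ := by
  refine denseRange_toFock.induction_on₂ (p := fun Ψ Φ =>
    inner ℂ (kleinOp w Ψ) (kleinOp w Φ) = inner ℂ Ψ Φ) (isClosed_eq (by fun_prop) (by fun_prop))
    (fun χ ψ => ?_) Ψ Φ
  rw [kleinOp_toFock, kleinOp_toFock]
  exact algInner_klein w χ ψ

theorem annihilation_kleinOp (w : ℤˣ → ℤ) (m : Mode) (Ψ : Fock) :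
    annihilation (shiftMode w m) (kleinOp w Ψ) = kleinOp w (annihilation m Ψ) := by
  refine denseRange_toFock.induction_on (p := fun Ψ =>
    annihilation (shiftMode w m) (kleinOp w Ψ) = kleinOp w (annihilation m Ψ)) Ψ
    (isClosed_eq (by fun_prop) (by fun_prop)) fun χ => ?_
  rw [kleinOp_toFock, annihilation_toFock, annihilation_toFock, kleinOp_toFock, ← fop_false, ← fop_false,
    klein_fop]

/-- Commuting the Klein factor past the annihilation operators shifts the summation index, which is
undone on the test function by a plane wave. -/
theorem smearedField_kleinOp {L : ℝ} (hL : 0 < L) (w : ℤˣ → ℤ) (r : ℤˣ) {g : ℝ → ℂ} (hg : MemCircle L g)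
    (Ψ : Fock) : smearedField L r g (kleinOp w Ψ) =
      kleinOp w (smearedField L r (fun y => planeWave (2 * Real.pi * w r / L) y * g y) Ψ) := by
  have h1 := (summable_smearedField hL r (memLp_planeWave_mul hg (2 * Real.pi * w r / L)) Ψ).hasSum.mapL
    (kleinOp w)
  rw [smearedField_eq, ← (Equiv.addRight (w r)).tsum_eq]
  refine HasSum.tsum_eq ?_
  convert h1 using 2 with n
  · rw [map_smul, ← annihilation_kleinOp, fieldCoeff_planeWave hL.ne']
    rfl
  · rfl

theorem klein_zero (χ : FockAlg) : klein 0 χ = χ := by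
  refine LinearMap.congr_fun (f := klein 0) (g := LinearMap.id) (Finsupp.lhom_ext fun S c => ?_) χ
  have h0 : shiftMode 0 = Equiv.refl _ := by
    ext m <;> simp [shiftMode]
  have h1 : shiftSea 0 = ∅ := by
    ext m
    simp [mem_shiftSea, h0]
  have h2 : shiftSet 0 S = S := by
    rw [shiftSet, h0, h1]
    simp
  rw [klein_single, h2]
  simp [kleinSign, h1, jwSign]

theorem BogParam.hasSum_dressed {c s : ℕ → ℝ} (h : BogParam c s) (w : ℤˣ → ℤ) (x : BOcc) :
    HasSum (fun m : BOcc => (h.coeff x m : ℂ) • toFock (bosState (w, m))) (h.dressed (w, x)) := by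
  have hinj : Function.Injective fun m : BOcc => ((w, m) : BLabel) := fun _ _ e => congrArg Prod.snd e
  have h1 := bosBasis.hasSum_repr (h.dressed (w, x))
  have h2 := (hinj.hasSum_iff fun Y hY => ?_).mpr h1
  · convert h2 using 2 with m
    simp only [Function.comp]
    rw [bosBasis.repr_apply_apply, bosBasis_apply, h.inner_bosState_dressed]
    simp [dcoeff]
  · have : Y.1 ≠ w := fun e => hY ⟨Y.2, by rw [← e]⟩
    rw [bosBasis.repr_apply_apply, bosBasis_apply, h.inner_bosState_dressed]
    simp [dcoeff, this]

/-- The Bogoliubov coefficients do not depend on the sector, while a Klein factor changes only the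
sector. All dressed vacua are therefore translates of a single one. -/
theorem BogParam.kleinOp_dressed {c s : ℕ → ℝ} (h : BogParam c s) (w : ℤˣ → ℤ) (x : BOcc) :
    kleinOp w (h.dressed (0, x)) = h.dressed (w, x) := by
  refine ((h.hasSum_dressed 0 x).mapL (kleinOp w)).unique ?_
  convert h.hasSum_dressed w x using 2 with m
  rw [map_smul, kleinOp_toFock, bosState, klein_zero]
  rfl

theorem conj_planeWave_mul (q : ℝ) (f : ℝ → ℂ) (x : ℝ) :
    conj (planeWave (-q) x * f x) = planeWave q x * conj (f x) := by
  rw [map_mul, planeWave, ← Complex.exp_conj, planeWave]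
  simp

theorem BogParam.twoPoint_dressed {c s : ℕ → ℝ} (h : BogParam c s) {L : ℝ} (hL : 0 < L) (r : ℤˣ)
    {f g : ℝ → ℂ} (hf : MemCircle L f) (hg : MemCircle L g) (w : ℤˣ → ℤ) :
    twoPoint L r (h.dressed (w, 0)) f g = twoPoint L r (h.dressed (0, 0))
      (fun x => planeWave (-(2 * Real.pi * w r / L)) x * f x)
      (fun y => planeWave (2 * Real.pi * w r / L) y * g y) := by
  simp only [twoPoint, conj_planeWave_mul]
  rw [← h.kleinOp_dressed, smearedField_kleinOp hL w r (memCircle_conj hf), smearedField_kleinOp hL w r hg,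
    inner_kleinOp]

theorem norm_twoPoint_sub_le {L : ℝ} (hL : 0 < L) (r : ℤˣ) {f f' g g' : ℝ → ℂ} (hf : MemCircle L f)
    (hf' : MemCircle L f') (hg : MemCircle L g) (hg' : MemCircle L g') (Ψ : Fock) (hΨ : ‖Ψ‖ = 1) :
    ‖twoPoint L r Ψ f g - twoPoint L r Ψ f' g'‖ ≤
      l2norm L (fun x => f x - f' x) * l2norm L g + l2norm L f' * l2norm L (fun x => g x - g' x) := by
  have hF := memCircle_conj hf
  have hF' := memCircle_conj hf'
  have e1 := smearedField_sub hL r hF hF' Ψ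
  have e2 := smearedField_sub hL r hg hg' Ψ
  have n1 := norm_smearedField_le hL r (hF.sub hF') Ψ
  have n2 := norm_smearedField_le hL r (hg.sub hg') Ψ
  have n3 := norm_smearedField_le hL r hg Ψ
  have n4 := norm_smearedField_le hL r hF' Ψ
  rw [hΨ, mul_one] at n1 n2 n3 n4
  have e3 : l2norm L (fun x => conj (f x) - conj (f' x)) = l2norm L fun x => f x - f' x :=
    l2norm_congr fun x => by rw [← map_sub, RCLike.norm_conj]
  have e4 : l2norm L (fun x => conj (f' x)) = l2norm L f' := l2norm_congr fun x => RCLike.norm_conj _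
  replace n1 : ‖smearedField L r (fun x => conj (f x)) Ψ - smearedField L r (fun x => conj (f' x)) Ψ‖ ≤
    l2norm L fun x => f x - f' x := by rw [← e1, ← e3]; exact n1
  replace n2 : ‖smearedField L r g Ψ - smearedField L r g' Ψ‖ ≤ l2norm L fun x => g x - g' x := by
    rw [← e2]; exact n2
  rw [e4] at n4
  have e5 : twoPoint L r Ψ f g - twoPoint L r Ψ f' g' =
      inner ℂ (smearedField L r (fun x => conj (f x)) Ψ - smearedField L r (fun x => conj (f' x)) Ψ)
        (smearedField L r g Ψ) +
      inner ℂ (smearedField L r (fun x => conj (f' x)) Ψ)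
        (smearedField L r g Ψ - smearedField L r g' Ψ) := by
    rw [inner_sub_left, inner_sub_right, twoPoint, twoPoint]; ring
  rw [e5]
  refine (norm_add_le _ _).trans (add_le_add ?_ ?_)
  · exact (norm_inner_le_norm _ _).trans (mul_le_mul n1 n3 (norm_nonneg _) (l2norm_nonneg _ _))
  · exact (norm_inner_le_norm _ _).trans (mul_le_mul n4 n2 (norm_nonneg _) (l2norm_nonneg _ _))

/-! ### Closed operators and the continuity equation -/

/-- The closure is meaningful only for a closable operator. Closability follows from the densely
defined formal adjoint `A'`. -/
theorem mem_graph_closedOp {A A' : FockAlg →ₗ[ℂ] FockAlg}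
    (hA : ∀ χ ψ, algInner (A χ) ψ = algInner χ (A' ψ)) {u : ℕ → FockAlg} {x y : Fock}
    (hx : Tendsto (fun n => toFock (u n)) atTop (𝓝 x))
    (hy : Tendsto (fun n => toFock (A (u n))) atTop (𝓝 y)) : (x, y) ∈ (closedOp A).graph := by
  let P : (FockAlg →ₗ[ℂ] FockAlg) → Fock →ₗ.[ℂ] Fock := fun A =>
    { domain := LinearMap.range toFock
      toFun := toFock ∘ₗ A ∘ₗ (LinearEquiv.ofInjective toFock toFock_injective).symm.toLinearMap }
  have hP : ∀ A χ, (toFock χ, toFock (A χ)) ∈ (P A).graph := fun A χ => by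
    refine (LinearPMap.mem_graph_iff _).mpr ⟨⟨toFock χ, LinearMap.mem_range_self _ χ⟩, rfl, ?_⟩
    change toFock (A ((LinearEquiv.ofInjective toFock toFock_injective).symm
      (LinearEquiv.ofInjective toFock toFock_injective χ))) = _
    rw [LinearEquiv.symm_apply_apply]
  have hd : Dense ((P A').domain : Set Fock) := denseRange_toFock
  have hadj : (P A').IsFormalAdjoint (P A) := by
    have e : ∀ A (x : (P A).domain) χ, toFock χ = x → P A x = toFock (A χ) := fun A x χ hx => by
      obtain ⟨z, hz1, hz2⟩ := (LinearPMap.mem_graph_iff _).mp (hP A χ)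
      have hzx : z = x := Subtype.ext (hz1.trans hx)
      rw [← hzx]
      exact hz2
    intro x y
    obtain ⟨χ, hχ⟩ := x.2
    obtain ⟨ψ, hψ⟩ := y.2
    rw [e A' x χ hχ, e A y ψ hψ, ← hχ, ← hψ]
    have := hA ψ χ
    rw [← algInner_conj, ← algInner_conj (A' χ)] at this
    exact ((starRingEnd ℂ).injective this).symm
  have hc : (P A).IsClosable :=
    ((P A').adjoint_isClosed hd).isClosable.leIsClosable (hadj.le_adjoint hd)
  have h1 : (x, y) ∈ (P A).graph.topologicalClosure :=
    mem_closure_of_tendsto (hx.prodMk_nhds hy) (.of_forall fun n => hP A (u n))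
  rwa [hc.graph_closure_eq_closure_graph] at h1

/-- An operator connecting only eigenvectors of a fixed energy difference evolves by a pure phase.
The difference is required only where the matrix element is nonzero, because the index shift `σ` is
truncated at empty modes. -/
theorem evolution_shift {ι : Type*} (b : HilbertBasis ι ℂ Fock) (E : ι → ℝ) {a : ι → ℂ} {σ : ι → ι}
    {e t : ℝ} (hE : ∀ i, a i ≠ 0 → E (σ i) = E i + e) {Ψ y y' : Fock}
    (hy : ∀ i, b.repr y i = a i * b.repr Ψ (σ i))
    (hy' : ∀ i, b.repr y' i = a i * b.repr (evolution b E t Ψ) (σ i)) :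
    evolution b E (-t) y' = Complex.exp ((-(t * e) : ℝ) * Complex.I) • y := by
  refine hilbertBasis_ext b fun i => ?_
  rw [map_smul, lp.coeFn_smul, Pi.smul_apply, smul_eq_mul, repr_evolution, hy, hy', repr_evolution]
  by_cases ha : a i = 0
  · rw [ha]; ring
  · rw [hE i ha]
    have : Complex.exp ((-(t * e) : ℝ) * Complex.I) = Complex.exp ((-(-t * E i) : ℝ) * Complex.I) *
        Complex.exp ((-(t * (E i + e)) : ℝ) * Complex.I) := by
      rw [← Complex.exp_add]; congr 1; push_cast; ring
    rw [this]; ring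

theorem algInner_bogd (c s : ℕ → ℝ) (j : BMode) (χ ψ : FockAlg) :
    algInner (bog c s bosd bos j χ) ψ = algInner χ (bog c s bos bosd j ψ) := by
  change algInner (((c j.2 : ℝ) : ℂ) • bosd j χ + ((s j.2 : ℝ) : ℂ) • bos (bar j) χ) ψ =
    algInner χ (((c j.2 : ℝ) : ℂ) • bos j ψ + ((s j.2 : ℝ) : ℂ) • bosd (bar j) ψ)
  simp only [algInner_add_left, algInner_add_right, algInner_smul_left, algInner_smul_right,
    Complex.conj_ofReal, algInner_bosd, algInner_bosd_right]

namespace BogParam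

variable {c s : ℕ → ℝ} (h : BogParam c s)

include h

theorem comp_bogd (j : BMode) (X : BLabel) (ψ : FockAlg) :
    h.comp X (bog c s bosd bos j ψ) =
      ((√(X.2 j) : ℝ) : ℂ) * h.comp (X.1, X.2 - Finsupp.single j 1) ψ := by
  have : h.comp X ∘ₗ bog c s bosd bos j =
      ((√(X.2 j) : ℝ) : ℂ) • h.comp (X.1, X.2 - Finsupp.single j 1) := by
    refine LinearMap.ext_on_range span_bosState fun Y => ?_
    obtain ⟨w, m⟩ := Y
    simp only [LinearMap.comp_apply, LinearMap.smul_apply, bog, LinearMap.add_apply, map_add,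
      map_smul, bos_bosState, bosd_bosState, comp_bosState, smul_eq_mul]
    unfold dcoeff
    simp only
    split_ifs
    · have := h.lower_coeff j X.2 m
      refine Eq.trans ?_ ((congrArg Complex.ofReal this).trans (Complex.ofReal_mul _ _))
      push_cast
      rfl
    · simp
  exact LinearMap.congr_fun this ψ

theorem hasSum_bogd (j : BMode) (χ : FockAlg) :
    HasSum (fun X : BLabel => ((X.2 j : ℂ) + 1) * (conj (h.comp X χ) * h.comp X χ))
      (algInner (bog c s bosd bos j χ) (bog c s bosd bos j χ)) := by
  rw [algInner_bogd, (ccr_bos.bog h.sub_sq).comm, if_pos rfl, algInner_add_right,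
    ← algInner_conj, algInner_bogd]
  refine hasSum_of_eq ((h.hasSum_bog j χ χ).add (h.hasSum_comp χ χ)) (fun X => by ring) ?_
  rw [algInner_self]
  simp

end BogParam

namespace Model

/-- Operators bounded relative to the quadratic form of the Hamiltonian. -/
def FormBounded (M : Model) (L : ℝ) (A : FockAlg →ₗ[ℂ] FockAlg) : Prop :=
  ∃ C c : ℝ, ∀ χ, ‖toFock (A χ)‖ ^ 2 ≤ C * (M.form L χ χ).re + c * ‖toFock χ‖ ^ 2

end Model

namespace Model.Admissible

variable {M : Model} {L : ℝ} (h : M.Admissible L)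

include h

theorem formBounded (hL : 0 < L) {A : FockAlg →ₗ[ℂ] FockAlg} {k : BLabel → ℝ} {C c : ℝ}
    (hk : ∀ X, k X ≤ C * M.energy L X + c)
    (hA : ∀ χ, HasSum (fun X => (k X : ℂ) * (conj (h.bogParam.comp X χ) * h.bogParam.comp X χ))
      (algInner (A χ) (A χ))) : M.FormBounded L A := by
  refine ⟨C, c, fun χ => ?_⟩
  have h1 := Complex.hasSum_re (hA χ)
  have h2 := (Complex.hasSum_re (h.hasSum_form hL χ χ)).mul_left C
  have h3 := (Complex.hasSum_re (h.bogParam.hasSum_comp χ χ)).mul_left c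
  rw [algInner_self, Complex.ofReal_re] at h1 h3
  refine hasSum_le (fun X => ?_) h1 (h2.add h3)
  rw [Complex.conj_mul', ← Complex.ofReal_pow, Complex.re_ofReal_mul, Complex.re_ofReal_mul,
    Complex.ofReal_re]
  nlinarith [hk X, sq_nonneg ‖h.bogParam.comp X χ‖]

/-- The approximating sequence supplied by the closed form is Cauchy in the form norm, so one
sequence serves all form-bounded operators at once. This lets several limits be combined linearly.
-/
theorem exists_approx (hL : 0 < L) {Ψ : Fock} (hΨ : Ψ ∈ h.hamiltonian.domain) :
    ∃ u : ℕ → FockAlg, Tendsto (fun n => toFock (u n)) atTop (𝓝 Ψ) ∧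
      ∀ A, M.FormBounded L A → ∃ y, Tendsto (fun n => toFock (A (u n))) atTop (𝓝 y) := by
  obtain ⟨u, h1, h2, -⟩ := (h.isHamiltonian hL Ψ (h.hamiltonian ⟨Ψ, hΨ⟩)).mp
    (h.hamiltonian.mem_graph ⟨Ψ, hΨ⟩)
  refine ⟨u, h1, fun A ⟨C, c, hA⟩ => cauchySeq_tendsto_of_complete ?_⟩
  rw [cauchySeq_iff_tendsto_dist_atTop_0]
  have h3 : Tendsto (fun nm : ℕ × ℕ => ‖toFock (u nm.1 - u nm.2)‖) atTop (𝓝 0) := by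
    have := cauchySeq_iff_tendsto_dist_atTop_0.mp h1.cauchySeq
    simpa only [dist_eq_norm, ← map_sub] using this
  have h4 : Tendsto (fun nm : ℕ × ℕ => √(C * (M.form L (u nm.1 - u nm.2) (u nm.1 - u nm.2)).re +
      c * ‖toFock (u nm.1 - u nm.2)‖ ^ 2)) atTop (𝓝 0) := by
    have h5 := (Complex.continuous_re.tendsto _).comp h2
    have := ((h5.const_mul C).add ((h3.pow 2).const_mul c)).sqrt
    simpa using this
  refine squeeze_zero (fun _ => dist_nonneg) (fun nm => ?_) h4
  rw [dist_eq_norm, ← map_sub, ← map_sub]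
  exact Real.le_sqrt_of_sq_le (hA _)

theorem repr_of_tendsto {A : FockAlg →ₗ[ℂ] FockAlg} {u : ℕ → FockAlg} {Ψ y : Fock}
    (hu : Tendsto (fun n => toFock (u n)) atTop (𝓝 Ψ))
    (hy : Tendsto (fun n => toFock (A (u n))) atTop (𝓝 y)) {a : BLabel → ℂ} {σ : BLabel → BLabel}
    (hA : ∀ X χ, h.bogParam.comp X (A χ) = a X * h.bogParam.comp (σ X) χ) (X : BLabel) :
    h.bogParam.basis.repr y X = a X * h.bogParam.basis.repr Ψ (σ X) := by
  have h1 := tendsto_repr_apply h.bogParam.basis hy X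
  have h2 := (tendsto_repr_apply h.bogParam.basis hu (σ X)).const_mul (a X)
  simp only [← BogParam.comp_eq_repr, hA] at h1 h2
  exact tendsto_nhds_unique h1 h2

theorem evolution_mem_domain {Ψ : Fock} (hΨ : Ψ ∈ h.hamiltonian.domain) (t : ℝ) :
    evolution h.bogParam.basis (M.energy L) t Ψ ∈ h.hamiltonian.domain := by
  refine LinearPMap.mem_domain_of_mem_graph
    (y := evolution h.bogParam.basis (M.energy L) t (h.hamiltonian ⟨Ψ, hΨ⟩)) ?_
  refine (mem_graph_diagonal _ _ _ _).mpr fun X => ?_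
  rw [repr_evolution, repr_evolution, h.repr_hamiltonian]
  ring

theorem exists_le_energy (hL : 0 < L) : ∃ C : ℝ, 0 ≤ C ∧
    (∀ X, M.bosE L X.2 ≤ M.energy L X + C) ∧ ∀ X, M.zeroE L X.1 ≤ M.energy L X + C := by
  obtain ⟨C, hC⟩ := h.exists_le_zeroE hL
  refine ⟨|C| + |M.vacE L|, by positivity, fun X => ?_, fun X => ?_⟩
  · have h1 := hC X.1
    rw [energy]
    linarith [le_abs_self C, neg_abs_le (M.vacE L)]
  · have h1 := h.bosE_nonneg hL X.2
    rw [energy]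
    linarith [abs_nonneg C, neg_abs_le (M.vacE L)]

theorem le_bosE (hL : 0 < L) (j : BMode) (x : BOcc) : M.om L j.2 * x j ≤ M.bosE L x := by
  by_cases hj : j ∈ x.support
  · exact Finset.single_le_sum (f := fun j => M.om L j.2 * (x j : ℝ))
      (fun i _ => mul_nonneg (h.om_pos hL i.2).le (Nat.cast_nonneg _)) hj
  · rw [Finsupp.notMem_support_iff.mp hj]
    simpa using h.bosE_nonneg hL x

theorem exists_le_occ (hL : 0 < L) (j : BMode) :
    ∃ C c : ℝ, ∀ X : BLabel, (X.2 j : ℝ) ≤ C * M.energy L X + c := by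
  obtain ⟨C, -, hC, -⟩ := h.exists_le_energy hL
  have h0 := h.om_pos hL j.2
  refine ⟨(M.om L j.2)⁻¹, (M.om L j.2)⁻¹ * C, fun X => ?_⟩
  rw [← mul_add, le_inv_mul_iff₀ h0]
  exact (h.le_bosE hL j X.2).trans (hC X)

theorem formBounded_bog (hL : 0 < L) (j : BMode) :
    M.FormBounded L (bog (M.bc L) (M.bs L) bos bosd j) := by
  obtain ⟨C, c, hC⟩ := h.exists_le_occ hL j
  exact h.formBounded hL hC fun χ => hasSum_of_eq (h.bogParam.hasSum_bog j χ χ)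
    (fun X => by push_cast; rfl) rfl

theorem formBounded_bogd (hL : 0 < L) (j : BMode) :
    M.FormBounded L (bog (M.bc L) (M.bs L) bosd bos j) := by
  obtain ⟨C, c, hC⟩ := h.exists_le_occ hL j
  exact h.formBounded hL (k := fun X => (X.2 j : ℝ) + 1) (C := C) (c := c + 1)
    (fun X => by linarith [hC X]) fun χ => hasSum_of_eq (h.bogParam.hasSum_bogd j χ)
    (fun X => by push_cast; rfl) rfl

theorem exists_sq_le (hL : 0 < L) : ∃ C c : ℝ, ∀ X : BLabel,
    ((X.1 1 - X.1 (-1) : ℝ) ^ 2 ≤ C * M.energy L X + c) ∧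
    ((X.1 1 + X.1 (-1) : ℝ) ^ 2 ≤ C * M.energy L X + c) := by
  obtain ⟨C, -, -, hC⟩ := h.exists_le_energy hL
  have hk := h.kv_pos
  have hv := h.vk_pos
  set a := Real.pi / (2 * L) with ha
  have ha0 : 0 < a := by positivity
  set m := min M.kv M.vk with hm
  have hm0 : 0 < m := lt_min hk hv
  set B := a * (M.kv * M.jmin L ^ 2) with hB
  refine ⟨2 / (a * m), 2 / (a * m) * (C + B) + 2 * M.jmin L ^ 2, fun X => ?_⟩
  have h1 := hC X
  rw [h.zeroE_eq_sq hL, ← ha, ← hB] at h1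
  set p : ℝ := (X.1 1 - X.1 (-1) : ℝ)
  set q : ℝ := (X.1 1 + X.1 (-1) : ℝ)
  have h2 : a * (m * p ^ 2 + m * (q - M.jmin L) ^ 2) ≤ M.energy L X + (C + B) := by
    have h3 : a * (m * p ^ 2 + m * (q - M.jmin L) ^ 2) ≤
        a * (M.vk * p ^ 2 + M.kv * (q - M.jmin L) ^ 2) := by
      gcongr
      · exact min_le_right _ _
      · exact min_le_left _ _
    linarith
  have h4 : p ^ 2 + (q - M.jmin L) ^ 2 ≤ (a * m)⁻¹ * (M.energy L X + (C + B)) := by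
    rw [le_inv_mul_iff₀ (by positivity)]
    linarith
  have e : 2 / (a * m) * M.energy L X + (2 / (a * m) * (C + B) + 2 * M.jmin L ^ 2) =
      2 * ((a * m)⁻¹ * (M.energy L X + (C + B))) + 2 * M.jmin L ^ 2 := by ring
  rw [e]
  constructor
  · nlinarith [sq_nonneg (q - M.jmin L), sq_nonneg p, sq_nonneg (M.jmin L)]
  · nlinarith [sq_nonneg (q - 2 * M.jmin L), sq_nonneg p]

theorem formBounded_charge (hL : 0 < L) (r : ℤˣ) : M.FormBounded L (charge r) := by
  obtain ⟨C, c, hC⟩ := h.exists_sq_le hL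
  refine h.formBounded hL (k := fun X => (X.1 r : ℝ) ^ 2) (C := C) (c := c) (fun X => ?_) fun χ =>
    hasSum_of_eq (h.bogParam.hasSum_comp _ _) (fun X => ?_) rfl
  · have := hC X
    rcases Int.units_eq_one_or r with rfl | rfl
    · nlinarith [sq_nonneg (X.1 1 : ℝ), sq_nonneg (X.1 (-1) : ℝ)]
    · nlinarith [sq_nonneg (X.1 1 : ℝ), sq_nonneg (X.1 (-1) : ℝ)]
  · rw [BogParam.comp_charge, map_mul, map_mul, map_intCast, map_intCast]
    have : (((r : ℤ) : ℂ)) * ((r : ℤ) : ℂ) = 1 := by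
      rcases Int.units_eq_one_or r with e | e <;> rw [e] <;> simp
    push_cast
    linear_combination (-(X.1 r : ℂ) ^ 2 * (conj (h.bogParam.comp X χ) * h.bogParam.comp X χ)) * this

end Model.Admissible

theorem algInner_density_left (r : ℤˣ) (n : ℤ) (χ ψ : FockAlg) :
    algInner (density r n χ) ψ = algInner χ (density r (-n) ψ) := by
  rw [algInner_density, neg_neg]

theorem mem_totalDensity {n : ℤ} {u : ℕ → FockAlg} {x y : Fock}
    (hx : Tendsto (fun k => toFock (u k)) atTop (𝓝 x))
    (hy : Tendsto (fun k => toFock ((density 1 n + density (-1) n) (u k))) atTop (𝓝 y)) :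
    (x, y) ∈ (Model.totalDensity n).graph := by
  refine mem_graph_closedOp (A' := density 1 (-n) + density (-1) (-n)) (fun χ ψ => ?_) hx hy
  simp only [LinearMap.add_apply, algInner_add_left, algInner_add_right, algInner_density_left]

theorem mem_current {M : Model} {L : ℝ} {n : ℤ} {u : ℕ → FockAlg} {x y : Fock}
    (hx : Tendsto (fun k => toFock (u k)) atTop (𝓝 x))
    (hy : Tendsto (fun k => toFock ((density 1 n - density (-1) n) (u k))) atTop (𝓝 y)) :
    (x, ((M.K (momentum L n) * M.v (momentum L n) : ℝ) : ℂ) • y) ∈ (M.current L n).graph := by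
  refine mem_graph_closedOp (A' := ((M.K (momentum L n) * M.v (momentum L n) : ℝ) : ℂ) •
    (density 1 (-n) - density (-1) (-n))) (fun χ ψ => ?_) hx ?_
  · simp only [LinearMap.sub_apply, LinearMap.smul_apply, sub_eq_add_neg, algInner_smul_left,
      algInner_smul_right, Complex.conj_ofReal, algInner_add_left, algInner_add_right]
    rw [← neg_one_smul ℂ (density (-1) n χ), ← neg_one_smul ℂ (density (-1) (-n) ψ), algInner_smul_left,
      algInner_smul_right, algInner_density_left, algInner_density_left]
    simp
  · simpa only [LinearMap.smul_apply, map_smul] using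
      hy.const_smul ((M.K (momentum L n) * M.v (momentum L n) : ℝ) : ℂ)

theorem hasDerivAt_exp_smul (ω t : ℝ) (y : Fock) :
    HasDerivAt (fun s : ℝ => Complex.exp ((-(s * ω) : ℝ) * Complex.I) • y)
      ((-(ω * Complex.I)) • Complex.exp ((-(t * ω) : ℝ) * Complex.I) • y) t := by
  have h1 : HasDerivAt (fun s : ℝ => (((-(s * ω) : ℝ) : ℂ) * Complex.I)) (-(ω * Complex.I)) t := by
    have := (((hasDerivAt_id t).mul_const ω).neg.ofReal_comp).mul_const Complex.I
    simpa using this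
  have h2 := h1.cexp.smul_const y
  rw [smul_smul, mul_comm]
  exact h2

namespace Model.Admissible

variable {M : Model} {L : ℝ} (h : M.Admissible L)

include h

/-- `A₁` lowers the energy by ω and `A₂` raises it by ω. Differentiating their phases turns the sum,
which is the density, into ω times the difference, which is proportional to the current; `hω`
matches the constants. -/
theorem continuity_of_eq (hL : 0 < L) {n : ℤ} {A₁ A₂ : FockAlg →ₗ[ℂ] FockAlg} {a b ω : ℝ}
    {a₁ a₂ : BLabel → ℂ} {σ₁ σ₂ : BLabel → BLabel}
    (hD : density 1 n + density (-1) n = (a : ℂ) • (A₁ + A₂))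
    (hJ : density 1 n - density (-1) n = (b : ℂ) • (A₁ - A₂))
    (h1 : M.FormBounded L A₁) (h2 : M.FormBounded L A₂)
    (hc1 : ∀ X χ, h.bogParam.comp X (A₁ χ) = a₁ X * h.bogParam.comp (σ₁ X) χ)
    (hc2 : ∀ X χ, h.bogParam.comp X (A₂ χ) = a₂ X * h.bogParam.comp (σ₂ X) χ)
    (hσ1 : ∀ X, a₁ X ≠ 0 → M.energy L (σ₁ X) = M.energy L X + ω)
    (hσ2 : ∀ X, a₂ X ≠ 0 → M.energy L (σ₂ X) = M.energy L X + -ω)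
    (hω : ω * a = momentum L n * ((M.K (momentum L n) * M.v (momentum L n)) * b))
    (Ψ : h.hamiltonian.domain) : ∃ R J : ℝ → Fock,
      (∀ t, (evolution h.bogParam.basis (M.energy L) t Ψ, R t) ∈ (totalDensity n).graph) ∧
      (∀ t, (evolution h.bogParam.basis (M.energy L) t Ψ, J t) ∈ (M.current L n).graph) ∧
      ∀ t, HasDerivAt (fun s => evolution h.bogParam.basis (M.energy L) (-s) (R s))
        (-(Complex.I * momentum L n) • evolution h.bogParam.basis (M.energy L) (-t) (J t)) t := by
  obtain ⟨v, hv, hv'⟩ := h.exists_approx hL Ψ.2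
  obtain ⟨z₁, hz₁⟩ := hv' A₁ h1
  obtain ⟨z₂, hz₂⟩ := hv' A₂ h2
  choose u hu hu' using fun t => h.exists_approx hL (h.evolution_mem_domain Ψ.2 t)
  choose y₁ hy₁ using fun t => hu' t A₁ h1
  choose y₂ hy₂ using fun t => hu' t A₂ h2
  set k : ℂ := ((M.K (momentum L n) * M.v (momentum L n) : ℝ) : ℂ) with hk
  have e1 : ∀ t, evolution h.bogParam.basis (M.energy L) (-t) (y₁ t) =
      Complex.exp ((-(t * ω) : ℝ) * Complex.I) • z₁ := fun t =>
    evolution_shift _ _ hσ1 (h.repr_of_tendsto hv hz₁ hc1) (h.repr_of_tendsto (hu t) (hy₁ t) hc1)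
  have e2 : ∀ t, evolution h.bogParam.basis (M.energy L) (-t) (y₂ t) =
      Complex.exp ((-(t * -ω) : ℝ) * Complex.I) • z₂ := fun t =>
    evolution_shift _ _ hσ2 (h.repr_of_tendsto hv hz₂ hc2) (h.repr_of_tendsto (hu t) (hy₂ t) hc2)
  refine ⟨fun t => (a : ℂ) • (y₁ t + y₂ t), fun t => k • ((b : ℂ) • (y₁ t - y₂ t)),
    fun t => mem_totalDensity (hu t) ?_, fun t => mem_current (hu t) ?_, fun t => ?_⟩
  · simpa only [hD, LinearMap.smul_apply, LinearMap.add_apply, map_smul, map_add] using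
      ((hy₁ t).add (hy₂ t)).const_smul (a : ℂ)
  · simpa only [hJ, LinearMap.smul_apply, LinearMap.sub_apply, map_smul, map_sub] using
      ((hy₁ t).sub (hy₂ t)).const_smul (b : ℂ)
  · have h3 := ((hasDerivAt_exp_smul ω t z₁).add (hasDerivAt_exp_smul (-ω) t z₂)).const_smul (a : ℂ)
    simp only [map_smul, map_add, map_sub, e1, e2]
    refine h3.congr_deriv ?_
    have hω' : (ω : ℂ) * a = momentum L n * (k * b) := by
      rw [hk]; exact_mod_cast congrArg Complex.ofReal hω
    rw [smul_add, smul_smul (a : ℂ), smul_smul (a : ℂ), smul_smul k, smul_smul (-(Complex.I * _)), smul_sub,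
      sub_eq_add_neg, ← neg_smul]
    rw [show (a : ℂ) * -(ω * Complex.I) = -(Complex.I * momentum L n) * (k * b) by
      linear_combination (-Complex.I) * hω',
      show (a : ℂ) * -(((-ω : ℝ) : ℂ) * Complex.I) = -(-(Complex.I * momentum L n) * (k * b)) by
        push_cast
        linear_combination (Complex.I) * hω']

omit h in
theorem bosE_add (x y : BOcc) : M.bosE L (x + y) = M.bosE L x + M.bosE L y :=
  Finsupp.sum_add_index' (fun _ => by simp) fun _ _ _ => by push_cast; ring

omit h in
theorem bosE_single (j : BMode) : M.bosE L (Finsupp.single j 1) = M.om L j.2 := by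
  rw [bosE, Finsupp.sum_single_index] <;> simp

/-- The sum of an annihilator and its partner creator is only rescaled by the Bogoliubov
transformation, by `c - s`, the inverse of `c + s`. For the difference in the next lemma the two
factors are exchanged. -/
theorem bos_add_bosd (j : BMode) :
    bos j + bosd (bar j) = ((M.bc L j.2 - M.bs L j.2 : ℝ) : ℂ) •
      (bog (M.bc L) (M.bs L) bos bosd j + bog (M.bc L) (M.bs L) bosd bos (bar j)) := by
  have e : (((M.bc L j.2 - M.bs L j.2 : ℝ) : ℂ)) * ((M.bc L j.2 : ℂ) + M.bs L j.2) = 1 := by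
    have := h.sub_sq j.2
    rw [← Complex.ofReal_add, ← Complex.ofReal_mul, ← Complex.ofReal_one]
    congr 1; linarith
  have e1 : bog (M.bc L) (M.bs L) bos bosd j + bog (M.bc L) (M.bs L) bosd bos (bar j) =
      ((M.bc L j.2 : ℂ) + M.bs L j.2) • (bos j + bosd (bar j)) := by
    simp only [bog, bar_bar, bar_snd]
    module
  rw [e1, smul_smul, e, one_smul]

theorem bos_sub_bosd (j : BMode) :
    bos j - bosd (bar j) = ((M.bc L j.2 + M.bs L j.2 : ℝ) : ℂ) •
      (bog (M.bc L) (M.bs L) bos bosd j - bog (M.bc L) (M.bs L) bosd bos (bar j)) := by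
  have e : (((M.bc L j.2 + M.bs L j.2 : ℝ) : ℂ)) * ((M.bc L j.2 : ℂ) - M.bs L j.2) = 1 := by
    have := h.sub_sq j.2
    rw [← Complex.ofReal_sub, ← Complex.ofReal_mul, ← Complex.ofReal_one]
    congr 1; linarith
  have e1 : bog (M.bc L) (M.bs L) bos bosd j - bog (M.bc L) (M.bs L) bosd bos (bar j) =
      ((M.bc L j.2 : ℂ) - M.bs L j.2) • (bos j - bosd (bar j)) := by
    simp only [bog, bar_bar, bar_snd]
    module
  rw [e1, smul_smul, e, one_smul]

/-- Equivalently K = (c − s)/(c + s). The mismatch of the rescalings of density and current is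
compensated exactly by the factor `K v` in the definition of the current. -/
theorem om_mul_sub (n : ℕ) : M.om L n * (M.bc L n - M.bs L n) = momentum L (n + 1) *
    (M.vF * (1 + M.gt₄ (momentum L (n + 1)) - M.gt₂ (momentum L (n + 1))) * (M.bc L n + M.bs L n)) := by
  have h1 := h.om_mul_add_sq n
  have h2 := h.om_mul_mul n
  have h3 := h.sub_sq n
  linear_combination (M.bc L n + M.bs L n) * (h1 - h2) -
    M.om L n * (M.bc L n - M.bs L n) * h3

theorem continuity_mode (hL : 0 < L) (j : BMode) {n : ℤ} (hn : n = (j.1 : ℤ) * (j.2 + 1))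
    (hD : density 1 n + density (-1) n = ((√(j.2 + 1) : ℝ) : ℂ) • (bos j + bosd (bar j)))
    (hJ : density 1 n - density (-1) n =
      (((j.1 : ℤ) * √(j.2 + 1) : ℝ) : ℂ) • (bos j - bosd (bar j)))
    (Ψ : h.hamiltonian.domain) : ∃ R J : ℝ → Fock,
      (∀ t, (evolution h.bogParam.basis (M.energy L) t Ψ, R t) ∈ (totalDensity n).graph) ∧
      (∀ t, (evolution h.bogParam.basis (M.energy L) t Ψ, J t) ∈ (M.current L n).graph) ∧
      ∀ t, HasDerivAt (fun s => evolution h.bogParam.basis (M.energy L) (-s) (R s))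
        (-(Complex.I * momentum L n) • evolution h.bogParam.basis (M.energy L) (-t) (J t)) t := by
  rw [h.bos_add_bosd, smul_smul, ← Complex.ofReal_mul] at hD
  rw [h.bos_sub_bosd, smul_smul, ← Complex.ofReal_mul] at hJ
  refine h.continuity_of_eq hL (ω := M.om L j.2) hD hJ (h.formBounded_bog hL j)
    (h.formBounded_bogd hL (bar j)) (h.bogParam.comp_bog j) (h.bogParam.comp_bogd (bar j))
    (fun X _ => ?_) (fun X hX => ?_) ?_ Ψ
  · rw [energy, energy, bosE_add, bosE_single]; ring
  · have h0 : X.2 (bar j) ≠ 0 := fun e => hX (by simp [e])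
    have h1 := bosE_add (M := M) (L := L) (X.2 - Finsupp.single (bar j) 1) (Finsupp.single (bar j) 1)
    rw [tsub_add_cancel_of_le (single_le_of_ne h0), bosE_single, bar_snd] at h1
    rw [energy, energy, h1]; ring
  · have h1 := h.om_mul_sub j.2
    rw [h.K_mul_v]
    have e4 := h.even₄ (j.2 + 1)
    have e2 := h.even₂ (j.2 + 1)
    have e0 : M.gt₄ (momentum L n) = M.gt₄ (momentum L (j.2 + 1)) ∧
        M.gt₂ (momentum L n) = M.gt₂ (momentum L (j.2 + 1)) ∧
        momentum L n = (j.1 : ℤ) * momentum L (j.2 + 1) := by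
      rw [hn]
      rcases Int.units_eq_one_or j.1 with e | e <;> rw [e]
      · simp
      · have : momentum L (((-1 : ℤˣ) : ℤ) * ((j.2 : ℤ) + 1)) = -momentum L (j.2 + 1) := by
          simp only [momentum]; push_cast; ring
        rw [this, gt₄, gt₂, gt₄, gt₂, ← e4, ← e2]
        simp
    have hε : (((j.1 : ℤ) : ℝ)) * ((j.1 : ℤ) : ℝ) = 1 := by
      rcases Int.units_eq_one_or j.1 with e | e <;> rw [e] <;> simp
    rw [e0.1, e0.2.1, e0.2.2]
    linear_combination (√(j.2 + 1)) * h1 - momentum L (j.2 + 1) *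
      (M.vF * (1 + M.gt₄ (momentum L (j.2 + 1)) - M.gt₂ (momentum L (j.2 + 1))) *
        (√(j.2 + 1) * (M.bc L j.2 + M.bs L j.2))) * hε

theorem continuity (hL : 0 < L) (n : ℤ) (Ψ : h.hamiltonian.domain) : ∃ R J : ℝ → Fock,
      (∀ t, (evolution h.bogParam.basis (M.energy L) t Ψ, R t) ∈ (totalDensity n).graph) ∧
      (∀ t, (evolution h.bogParam.basis (M.energy L) t Ψ, J t) ∈ (M.current L n).graph) ∧
      ∀ t, HasDerivAt (fun s => evolution h.bogParam.basis (M.energy L) (-s) (R s))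
        (-(Complex.I * momentum L n) • evolution h.bogParam.basis (M.energy L) (-t) (J t)) t := by
  rcases lt_trichotomy n 0 with hn | rfl | hn
  · obtain ⟨k, rfl⟩ : ∃ k : ℕ, n = -((k : ℤ) + 1) := ⟨(-n - 1).toNat, by omega⟩
    have hb : bar ((-1 : ℤˣ), k) = (1, k) := by simp [bar]
    refine h.continuity_mode hL (-1, k) (by push_cast; ring) ?_ ?_ Ψ
    · refine LinearMap.ext fun χ => ?_
      rw [LinearMap.add_apply, density_one_neg, density_neg_one_neg, ← smul_add,
        add_comm (bosd (1, k) χ), LinearMap.smul_apply, LinearMap.add_apply, hb]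
    · refine LinearMap.ext fun χ => ?_
      rw [LinearMap.sub_apply, density_one_neg, density_neg_one_neg, LinearMap.smul_apply,
        LinearMap.sub_apply, hb]
      push_cast
      module
  -- At zero momentum the charges are conserved, so both phases are trivial and the two chiral
  -- charges play the roles of `A₁` and `A₂`.
  · refine h.continuity_of_eq hL (ω := 0) (a := 1) (b := 1) (A₁ := charge 1) (A₂ := charge (-1))
      (σ₁ := id) (σ₂ := id)
      (by rw [Complex.ofReal_one, one_smul]; rfl) (by rw [Complex.ofReal_one, one_smul]; rfl)
      (h.formBounded_charge hL 1) (h.formBounded_charge hL (-1)) (fun X χ => h.bogParam.comp_charge 1 X χ) (fun X χ => h.bogParam.comp_charge (-1) X χ)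
      (by simp) (by simp) (by simp [momentum]) Ψ
  · obtain ⟨k, rfl⟩ : ∃ k : ℕ, n = (k : ℤ) + 1 := ⟨(n - 1).toNat, by omega⟩
    refine h.continuity_mode hL (1, k) (by push_cast; ring) ?_ ?_ Ψ
    · refine LinearMap.ext fun χ => ?_
      simp [density_one_pos, density_neg_one_pos, bar]
    · refine LinearMap.ext fun χ => ?_
      simp [density_one_pos, density_neg_one_pos, bar, smul_sub]

/-! ### The average current -/

theorem mem_current_dressed (hL : 0 < L) (X : BLabel) :
    (h.bogParam.dressed X, ((M.kv * (X.1 1 + X.1 (-1)) : ℝ) : ℂ) • h.bogParam.dressed X) ∈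
      (M.current L 0).graph := by
  have hX : h.bogParam.dressed X ∈ h.hamiltonian.domain := by
    rw [← BogParam.basis_apply]
    exact LinearPMap.mem_domain_of_mem_graph (basis_mem_graph _ _ X)
  obtain ⟨u, hu, hu'⟩ := h.exists_approx hL hX
  obtain ⟨y₁, hy₁⟩ := hu' _ (h.formBounded_charge hL 1)
  obtain ⟨y₂, hy₂⟩ := hu' _ (h.formBounded_charge hL (-1))
  have h1 := h.repr_of_tendsto (σ := id) hu hy₁ (fun Y χ => h.bogParam.comp_charge 1 Y χ)
  have h2 := h.repr_of_tendsto (σ := id) hu hy₂ (fun Y χ => h.bogParam.comp_charge (-1) Y χ)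
  have h3 : y₁ - y₂ = ((X.1 1 + X.1 (-1) : ℝ) : ℂ) • h.bogParam.dressed X := by
    classical
    refine hilbertBasis_ext h.bogParam.basis fun Y => ?_
    rw [map_sub, lp.coeFn_sub, Pi.sub_apply, h1, h2, map_smul, lp.coeFn_smul, Pi.smul_apply,
      smul_eq_mul, id, ← BogParam.basis_apply, repr_self_apply]
    split_ifs with e
    · rw [e]
      push_cast
      ring
    · simp
  have h4 := mem_current (M := M) (L := L) (n := 0) hu (y := y₁ - y₂)
    (by simpa only [charge, LinearMap.sub_apply, map_sub] using hy₁.sub hy₂)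
  have h5 : M.K (momentum L (0 : ℤ)) * M.v (momentum L (0 : ℤ)) = M.kv := by
    rw [← h.K_mul_v_zero]; simp [momentum]
  rw [h3, smul_smul, h5, ← Complex.ofReal_mul] at h4
  exact h4

theorem hasAverageCurrent (hL : 0 < L) (W : Finset (ℤˣ → ℤ)) (a : (ℤˣ → ℤ) → ℂ) :
    M.HasAverageCurrent L (∑ w ∈ W, a w • h.bogParam.dressed (w, 0))
      (M.kv * (∑ w ∈ W, ‖a w‖ ^ 2 * (w 1 + w (-1))) / L) := by
  classical
  refine ⟨∑ w ∈ W, a w • ((M.kv * (w 1 + w (-1)) : ℝ) : ℂ) • h.bogParam.dressed (w, 0), ?_, ?_⟩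
  · have := Submodule.sum_mem (M.current L 0).graph fun w (_ : w ∈ W) =>
      Submodule.smul_mem _ (a w) (h.mem_current_dressed hL (w, 0))
    convert this using 1
    exact Prod.ext (by simp [Prod.fst_sum]) (by simp [Prod.snd_sum])
  · rw [Complex.ofReal_div]
    congr 1
    rw [sum_inner, Finset.mul_sum, Complex.ofReal_sum]
    refine Finset.sum_congr rfl fun w hw => ?_
    rw [inner_sum, Finset.sum_eq_single_of_mem w hw]
    · rw [inner_smul_left, inner_smul_right, inner_smul_right,
        orthonormal_iff_ite.mp h.bogParam.orthonormal_dressed, if_pos rfl, mul_one, ← mul_assoc,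
        Complex.conj_mul']
      push_cast; ring
    · intro w' _ hne
      rw [inner_smul_left, inner_smul_right, inner_smul_right,
        orthonormal_iff_ite.mp h.bogParam.orthonormal_dressed, if_neg]
      · simp
      · intro e
        exact hne (congrArg Prod.fst e).symm

end Model.Admissible

/-! ### Dephasing -/

/-- A bound on the `L²` norm of the change of `g` when its momentum is shifted by at most `η`. -/
def dephase (η : ℝ) (g : ℝ → ℂ) : ℝ := √(∫ x, (min 2 (η * |x|)) ^ 2 * ‖g x‖ ^ 2)

theorem norm_planeWave_sub_le {q q' η : ℝ} (hq : |q - q'| ≤ η) (x : ℝ) :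
    ‖planeWave q x - planeWave q' x‖ ≤ min 2 (η * |x|) := by
  refine le_min ?_ ?_
  · refine (norm_sub_le _ _).trans ?_
    rw [norm_planeWave, norm_planeWave]
    norm_num
  · have e : planeWave q x - planeWave q' x =
        planeWave q' x * (Complex.exp (((q - q') * x : ℝ) * Complex.I) - 1) := by
      rw [mul_sub, mul_one, planeWave, planeWave, ← Complex.exp_add]
      congr 2
      push_cast
      ring
    rw [e, norm_mul, norm_planeWave, one_mul]
    refine (norm_exp_sub_one_le _).trans ?_
    rw [abs_mul]
    exact mul_le_mul_of_nonneg_right hq (abs_nonneg x)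

theorem min_sq_le {η : ℝ} (hη : 0 ≤ η) (x : ℝ) : (min 2 (η * |x|)) ^ 2 ≤ 4 := by
  have h1 : 0 ≤ min 2 (η * |x|) := le_min (by norm_num) (by positivity)
  have h2 : min 2 (η * |x|) ≤ 2 := min_le_left _ _
  nlinarith

theorem aestronglyMeasurable_dephase {g : ℝ → ℂ} (hg : MemLp g 2 volume) (η : ℝ) :
    AEStronglyMeasurable (fun x => (min 2 (η * |x|)) ^ 2 * ‖g x‖ ^ 2) volume := by
  refine AEStronglyMeasurable.mul (Continuous.aestronglyMeasurable (by fun_prop)) ?_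
  exact hg.integrable_norm_pow (two_ne_zero) |>.1

theorem integrable_sq {g : ℝ → ℂ} {μ : Measure ℝ} (hg : MemLp g 2 μ) : Integrable (fun x => ‖g x‖ ^ 2) μ :=
  hg.integrable_norm_pow two_ne_zero

theorem integrable_dephase {g : ℝ → ℂ} (hg : MemLp g 2 volume) {η : ℝ} (hη : 0 ≤ η) :
    Integrable (fun x => (min 2 (η * |x|)) ^ 2 * ‖g x‖ ^ 2) volume := by
  refine ((integrable_sq hg).const_mul 4).mono' (aestronglyMeasurable_dephase hg η)
    (.of_forall fun x => ?_)
  rw [Real.norm_of_nonneg (by positivity)]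
  exact mul_le_mul_of_nonneg_right (min_sq_le hη x) (sq_nonneg _)

/-- The factor tends to zero pointwise and never exceeds 2. The cutoff at 2 avoids any decay
assumption on `g` beyond square integrability. -/
theorem tendsto_dephase {g : ℝ → ℂ} (hg : MemLp g 2 volume) {η : ℝ → ℝ} (hη0 : ∀ᶠ L in atTop, 0 ≤ η L)
    (hη : Tendsto η atTop (𝓝 0)) : Tendsto (fun L => dephase (η L) g) atTop (𝓝 0) := by
  have h1 : Tendsto (fun L => ∫ x, (min 2 (η L * |x|)) ^ 2 * ‖g x‖ ^ 2) atTop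
      (𝓝 (∫ _ : ℝ, (0 : ℝ))) := by
    refine tendsto_integral_filter_of_dominated_convergence (fun x => 4 * ‖g x‖ ^ 2)
      (.of_forall fun L => aestronglyMeasurable_dephase hg _) ?_ ((integrable_sq hg).const_mul 4)
      (.of_forall fun x => ?_)
    · filter_upwards [hη0] with L hL
      refine .of_forall fun x => ?_
      rw [Real.norm_of_nonneg (by positivity)]
      exact mul_le_mul_of_nonneg_right (min_sq_le hL x) (sq_nonneg _)
    · have := (((tendsto_const_nhds (x := (2 : ℝ))).min (hη.mul_const |x|)).pow 2).mul_const (‖g x‖ ^ 2)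
      simpa using this
  simpa [dephase] using h1.sqrt

theorem intervalIntegral_le_integral {L : ℝ} (hL : 0 < L) {F G : ℝ → ℝ} (hG : Integrable G volume)
    (hF : ∀ x, 0 ≤ F x) (hFG : ∀ x, F x ≤ G x) :
    ∫ x in (-(L / 2))..(L / 2), F x ≤ ∫ x, G x := by
  rw [intervalIntegral.integral_of_le (by linarith)]
  exact (integral_mono_of_nonneg (.of_forall hF) hG.integrableOn (.of_forall hFG)).trans
    (setIntegral_le_integral hG (.of_forall fun x => (hF x).trans (hFG x)))

theorem l2norm_planeWave_sub_le {L : ℝ} (hL : 0 < L) {g : ℝ → ℂ} (hg : MemLp g 2 volume) {q q' η : ℝ}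
    (hq : |q - q'| ≤ η) :
    l2norm L (fun x => planeWave q x * g x - planeWave q' x * g x) ≤ dephase η g := by
  have hη : 0 ≤ η := (abs_nonneg _).trans hq
  refine Real.sqrt_le_sqrt (intervalIntegral_le_integral hL (integrable_dephase hg hη)
    (fun x => sq_nonneg _) fun x => ?_)
  change ‖planeWave q x * g x - planeWave q' x * g x‖ ^ 2 ≤ _
  rw [← sub_mul, norm_mul, mul_pow]
  gcongr
  exact norm_planeWave_sub_le hq x

theorem l2norm_planeWave_mul_le {L : ℝ} (hL : 0 < L) {g : ℝ → ℂ} (hg : MemLp g 2 volume) (q : ℝ) :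
    l2norm L (fun x => planeWave q x * g x) ≤ √(∫ x, ‖g x‖ ^ 2) :=
  Real.sqrt_le_sqrt (intervalIntegral_le_integral hL (integrable_sq hg) (fun x => sq_nonneg _)
    fun x => by rw [norm_mul, norm_planeWave, one_mul])

theorem norm_twoPoint_planeWave_sub_le {L : ℝ} (hL : 0 < L) (r : ℤˣ) {f g : ℝ → ℂ}
    (hf : MemLp f 2 volume) (hg : MemLp g 2 volume) {Ψ : Fock} (hΨ : ‖Ψ‖ = 1) {q q' η : ℝ}
    (hq : |q - q'| ≤ η) :
    ‖twoPoint L r Ψ (fun x => planeWave (-q) x * f x) (fun y => planeWave q y * g y) -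
      twoPoint L r Ψ (fun x => planeWave (-q') x * f x) (fun y => planeWave q' y * g y)‖ ≤
    dephase η f * √(∫ x, ‖g x‖ ^ 2) + √(∫ x, ‖f x‖ ^ 2) * dephase η g := by
  have hf' : MemCircle L f := hf.restrict _
  have hg' : MemCircle L g := hg.restrict _
  refine (norm_twoPoint_sub_le hL r (memLp_planeWave_mul hf' _) (memLp_planeWave_mul hf' _)
    (memLp_planeWave_mul hg' _) (memLp_planeWave_mul hg' _) Ψ hΨ).trans ?_
  have hq' : |-q - -q'| ≤ η := by rwa [neg_sub_neg, abs_sub_comm]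
  exact add_le_add
    (mul_le_mul (l2norm_planeWave_sub_le hL hf hq') (l2norm_planeWave_mul_le hL hg _) (l2norm_nonneg _ _)
      (Real.sqrt_nonneg _))
    (mul_le_mul (l2norm_planeWave_mul_le hL hf _) (l2norm_planeWave_sub_le hL hg hq) (l2norm_nonneg _ _)
      (Real.sqrt_nonneg _))

/-! ### Ground state expectation values -/

namespace Model.Admissible

variable {M : Model} {L : ℝ} (h : M.Admissible L)

include h

theorem neutral : M.neutral.Admissible L where
  vF_pos := h.vF_pos
  mu_sum := by simp [Model.neutral, two_mul]
  even₂ := h.even₂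
  even₄ := h.even₄
  stable := h.stable
  finite_energy := h.finite_energy
  implementable := h.implementable

/-- The Bogoliubov parameters do not involve the chemical potentials, so both models have the same
dressed vectors and differ only in the energies of the sectors. -/
theorem dressed_neutral (X : BLabel) : h.neutral.bogParam.dressed X = h.bogParam.dressed X := rfl

/-- The sign `r` cancels the opposite deviations of the two chemical potentials, so the wave vector
is the same for both chiralities. -/
theorem mul_momentumShift (r : ℤˣ) : (r : ℤ) * M.momentumShift r = M.kv⁻¹ * (M.μ 1 - M.μ₀) := by
  rw [momentumShift, h.K_mul_v_zero]
  have := h.mu_sum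
  rcases Int.units_eq_one_or r with rfl | rfl
  · simp
  · have e : M.μ (-1) - M.μ₀ = -(M.μ 1 - M.μ₀) := by linarith
    rw [e]
    push_cast
    ring

theorem momentum_sub (hL : 0 < L) (r : ℤˣ) (x : ℝ) : 2 * Real.pi * x / L - (r : ℤ) * M.momentumShift r =
    2 * Real.pi * (x - M.jmin L / 2) / L := by
  have := h.kv_pos
  have := Real.pi_pos
  rw [h.mul_momentumShift, jmin]
  field_simp

/-- Here the interaction drops out of the conductance: the current carries the factor `kv`, and the
preferred charge imbalance its inverse. -/
theorem kv_mul_jmin (hL : 0 < L) : M.kv * M.jmin L / L = (M.μ 1 - M.μ (-1)) / (2 * Real.pi) := by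
  have := h.kv_pos
  have := Real.pi_pos
  have e : M.μ 1 - M.μ (-1) = 2 * (M.μ 1 - M.μ₀) := by linarith [h.mu_sum]
  rw [e, jmin]
  field_simp

theorem eq_smul_of_isGroundState (hL : 0 < L) {k : ℤ} (hk : M.jmin L = 2 * k) {Ψ : Fock}
    (hΨ : M.IsGroundState L Ψ) :
    ∃ c : ℂ, ‖c‖ ^ 2 = 1 ∧ Ψ = c • h.bogParam.dressed (fun _ => k, 0) := by
  obtain ⟨W, a, hW, ha, rfl⟩ := h.exists_sum_of_isGroundState hL hΨ
  have h1 : ∀ w ∈ W, w = fun _ => k := fun w hw => h.eq_of_isMin hL hk (hW w hw)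
  have h2 : W.Nonempty := by
    rw [Finset.nonempty_iff_ne_empty]
    rintro rfl
    simp at ha
  rw [Finset.eq_singleton_iff_nonempty_unique_mem.mpr ⟨h2, h1⟩, Finset.sum_singleton] at ha ⊢
  exact ⟨_, ha, rfl⟩

theorem twoPoint_smul_dressed (hL : 0 < L) (r : ℤˣ) {f g : ℝ → ℂ} (hf : MemCircle L f)
    (hg : MemCircle L g) {c : ℂ} (hc : ‖c‖ ^ 2 = 1) (w : ℤˣ → ℤ) :
    twoPoint L r (c • h.bogParam.dressed (w, 0)) f g = twoPoint L r (h.bogParam.dressed (0, 0))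
      (fun x => planeWave (-(2 * Real.pi * w r / L)) x * f x)
      (fun y => planeWave (2 * Real.pi * w r / L) y * g y) := by
  rw [← h.bogParam.twoPoint_dressed hL r hf hg]
  have := twoPoint_sum hL r hf hg h.bogParam {w} fun _ => c
  rw [Finset.sum_singleton, Finset.sum_singleton, hc] at this
  simpa using this

theorem twoPoint_neutral (hL : 0 < L) (r : ℤˣ) {f g : ℝ → ℂ} (hf : MemCircle L f) (hg : MemCircle L g)
    {Ψ : Fock} (hΨ : M.neutral.IsGroundState L Ψ) :
    twoPoint L r Ψ f g = twoPoint L r (h.bogParam.dressed (0, 0)) f g := by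
  have hk : M.neutral.jmin L = 2 * (0 : ℤ) := by simp [jmin, Model.neutral]
  obtain ⟨c, hc, rfl⟩ := h.neutral.eq_smul_of_isGroundState hL hk hΨ
  rw [h.neutral.twoPoint_smul_dressed hL r hf hg hc, h.dressed_neutral]
  simp [planeWave]

theorem isGroundState_unique (hL : 0 < L) {k : ℤ} (hk : M.jmin L = 2 * k) {Ψ Ψ' : Fock}
    (hΨ : M.IsGroundState L Ψ) (hΨ' : M.IsGroundState L Ψ') : ∃ c : ℂ, Ψ' = c • Ψ := by
  obtain ⟨c, hc, rfl⟩ := h.eq_smul_of_isGroundState hL hk hΨ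
  obtain ⟨c', hc', rfl⟩ := h.eq_smul_of_isGroundState hL hk hΨ'
  have : c ≠ 0 := by rintro rfl; simp at hc
  exact ⟨c' * c⁻¹, by rw [smul_smul, inv_mul_cancel_right₀ this]⟩

theorem hasAverageCurrent_of_unique (hL : 0 < L) {k : ℤ} (hk : M.jmin L = 2 * k) {Ψ : Fock}
    (hΨ : M.IsGroundState L Ψ) :
    M.HasAverageCurrent L Ψ ((M.μ 1 - M.μ (-1)) / (2 * Real.pi)) := by
  obtain ⟨c, hc, rfl⟩ := h.eq_smul_of_isGroundState hL hk hΨ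
  have := h.hasAverageCurrent hL {fun _ => k} fun _ => c
  rw [Finset.sum_singleton, Finset.sum_singleton, hc] at this
  rw [← h.kv_mul_jmin hL, hk]
  convert this using 3
  ring

theorem twoPoint_of_unique (hL : 0 < L) {k : ℤ} (hk : M.jmin L = 2 * k) {Ψ Ψ₀ : Fock}
    (hΨ : M.IsGroundState L Ψ) (hΨ₀ : M.neutral.IsGroundState L Ψ₀) (r : ℤˣ) {f g : ℝ → ℂ}
    (hf : MemCircle L f) (hg : MemCircle L g) :
    twoPoint L r Ψ f g = twoPoint L r Ψ₀
      (fun x => planeWave (-((r : ℤ) * M.momentumShift r)) x * f x)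
      (fun y => planeWave ((r : ℤ) * M.momentumShift r) y * g y) := by
  obtain ⟨c, hc, rfl⟩ := h.eq_smul_of_isGroundState hL hk hΨ
  rw [h.twoPoint_smul_dressed hL r hf hg hc, h.twoPoint_neutral hL r (memLp_planeWave_mul hf _)
    (memLp_planeWave_mul hg _) hΨ₀]
  have := h.momentum_sub hL r k
  rw [hk, mul_div_cancel_left₀ _ two_ne_zero, sub_self, mul_zero, zero_div, sub_eq_zero] at this
  rw [this]

/-- The average current is a convex combination over minimizing sectors, in each of which `w 1 + w
(-1)` differs from `jmin` by at most 1. -/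
theorem exists_averageCurrent (hL : 0 < L) {Ψ : Fock} (hΨ : M.IsGroundState L Ψ) :
    ∃ I : ℝ, M.HasAverageCurrent L Ψ I ∧ |I - (M.μ 1 - M.μ (-1)) / (2 * Real.pi)| ≤ M.kv / L := by
  obtain ⟨W, a, hW, ha, rfl⟩ := h.exists_sum_of_isGroundState hL hΨ
  refine ⟨_, h.hasAverageCurrent hL W a, ?_⟩
  have e : M.kv * (∑ w ∈ W, ‖a w‖ ^ 2 * (w 1 + w (-1) : ℝ)) / L - M.kv * M.jmin L / L =
      M.kv / L * ∑ w ∈ W, ‖a w‖ ^ 2 * (w 1 + w (-1) - M.jmin L : ℝ) := by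
    simp only [mul_sub (‖_‖ ^ 2), Finset.sum_sub_distrib, ← Finset.sum_mul, ha]
    ring
  have hk := h.kv_pos
  rw [← h.kv_mul_jmin hL, e, abs_mul, abs_of_pos (by positivity)]
  refine mul_le_of_le_one_right (by positivity) ?_
  rw [← ha]
  refine (Finset.abs_sum_le_sum_abs _ _).trans (Finset.sum_le_sum fun w hw => ?_)
  rw [abs_mul, abs_of_nonneg (sq_nonneg _)]
  exact mul_le_of_le_one_right (sq_nonneg _) (h.bound_of_isMin hL (hW w hw)).1

/-- Each minimizing sector carries a plane wave of momentum `2 * π * w r / L`, which misses the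
target by 2π(w_r − J/2)/L, with J = `jmin`. The uniform bound on the minimizers makes this O(1/L),
and the convex weights preserve the estimate. -/
theorem norm_twoPoint_sub_le (hL : 0 < L) {Ψ Ψ₀ : Fock} (hΨ : M.IsGroundState L Ψ)
    (hΨ₀ : M.neutral.IsGroundState L Ψ₀) (r : ℤˣ) {f g : ℝ → ℂ} (hf : MemLp f 2 volume)
    (hg : MemLp g 2 volume) :
    ‖twoPoint L r Ψ f g - twoPoint L r Ψ₀
      (fun x => planeWave (-((r : ℤ) * M.momentumShift r)) x * f x)
      (fun y => planeWave ((r : ℤ) * M.momentumShift r) y * g y)‖ ≤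
    dephase (2 * Real.pi * (1 + M.kv / M.vk) / L) f * √(∫ x, ‖g x‖ ^ 2) +
      √(∫ x, ‖f x‖ ^ 2) * dephase (2 * Real.pi * (1 + M.kv / M.vk) / L) g := by
  have hf' : MemCircle L f := hf.restrict _
  have hg' : MemCircle L g := hg.restrict _
  obtain ⟨W, a, hW, ha, rfl⟩ := h.exists_sum_of_isGroundState hL hΨ
  rw [twoPoint_sum hL r hf' hg', h.twoPoint_neutral hL r (memLp_planeWave_mul hf' _)
    (memLp_planeWave_mul hg' _) hΨ₀]
  set z := twoPoint L r (h.bogParam.dressed (0, 0))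
      (fun x => planeWave (-((r : ℤ) * M.momentumShift r)) x * f x)
      (fun y => planeWave ((r : ℤ) * M.momentumShift r) y * g y) with hz
  set B := dephase (2 * Real.pi * (1 + M.kv / M.vk) / L) f * √(∫ x, ‖g x‖ ^ 2) +
      √(∫ x, ‖f x‖ ^ 2) * dephase (2 * Real.pi * (1 + M.kv / M.vk) / L) g with hB
  have e : ∑ w ∈ W, ((‖a w‖ ^ 2 : ℝ) : ℂ) * twoPoint L r (h.bogParam.dressed (w, 0)) f g - z =
      ∑ w ∈ W, ((‖a w‖ ^ 2 : ℝ) : ℂ) * (twoPoint L r (h.bogParam.dressed (w, 0)) f g - z) := by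
    simp only [mul_sub, Finset.sum_sub_distrib, ← Finset.sum_mul, ← Complex.ofReal_sum, ha]
    simp
  have e1 : B = ∑ w ∈ W, ‖a w‖ ^ 2 * B := by rw [← Finset.sum_mul, ha, one_mul]
  rw [e, e1]
  refine (norm_sum_le _ _).trans (Finset.sum_le_sum fun w hw => ?_)
  rw [norm_mul, Complex.norm_of_nonneg (sq_nonneg _)]
  refine mul_le_mul_of_nonneg_left ?_ (sq_nonneg _)
  rw [h.bogParam.twoPoint_dressed hL r hf' hg', hz, hB]
  refine norm_twoPoint_planeWave_sub_le hL r hf hg (h.bogParam.orthonormal_dressed.1 _) ?_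
  rw [h.momentum_sub hL, abs_div, abs_mul, abs_of_pos hL, abs_of_pos Real.two_pi_pos]
  gcongr
  exact (h.bound_of_isMin hL (hW w hw)).2 r

end Model.Admissible

namespace Model

variable {M : Model}

theorem exists_tendsto_averageCurrent (h : ∀ L : ℝ, 0 < L → M.Admissible L) {Ψ : ℝ → Fock}
    (hΨ : ∀ L, 0 < L → M.IsGroundState L (Ψ L)) :
    ∃ I : ℝ → ℝ, (∀ L, 0 < L → M.HasAverageCurrent L (Ψ L) (I L)) ∧
      Tendsto I atTop (𝓝 ((M.μ 1 - M.μ (-1)) / (2 * Real.pi))) := by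
  have h1 : ∀ L : ℝ, ∃ I : ℝ, 0 < L → M.HasAverageCurrent L (Ψ L) I ∧
      |I - (M.μ 1 - M.μ (-1)) / (2 * Real.pi)| ≤ M.kv / L := fun L => by
    by_cases hL : 0 < L
    · obtain ⟨I, hI⟩ := (h L hL).exists_averageCurrent hL (hΨ L hL)
      exact ⟨I, fun _ => hI⟩
    · exact ⟨0, fun h0 => absurd h0 hL⟩
  choose I hI using h1
  refine ⟨I, fun L hL => (hI L hL).1, ?_⟩
  rw [tendsto_iff_norm_sub_tendsto_zero]
  refine squeeze_zero' (.of_forall fun _ => norm_nonneg _) ?_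
    (tendsto_const_nhds (x := M.kv).div_atTop tendsto_id)
  filter_upwards [eventually_gt_atTop 0] with L hL
  exact (hI L hL).2

theorem tendsto_twoPoint_sub (h : ∀ L : ℝ, 0 < L → M.Admissible L) {Ψ Ψ₀ : ℝ → Fock}
    (hΨ : ∀ L, 0 < L → M.IsGroundState L (Ψ L)) (hΨ₀ : ∀ L, 0 < L → M.neutral.IsGroundState L (Ψ₀ L))
    (r : ℤˣ) {f g : ℝ → ℂ} (hf : MemLp f 2 volume) (hg : MemLp g 2 volume) :
    Tendsto (fun L => twoPoint L r (Ψ L) f g - twoPoint L r (Ψ₀ L)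
      (fun x => planeWave (-((r : ℤ) * M.momentumShift r)) x * f x)
      (fun y => planeWave ((r : ℤ) * M.momentumShift r) y * g y)) atTop (𝓝 0) := by
  have hη : Tendsto (fun L : ℝ => 2 * Real.pi * (1 + M.kv / M.vk) / L) atTop (𝓝 0) :=
    tendsto_const_nhds.div_atTop tendsto_id
  have hη0 : ∀ᶠ L : ℝ in atTop, 0 ≤ 2 * Real.pi * (1 + M.kv / M.vk) / L := by
    filter_upwards [eventually_gt_atTop 0] with L hL
    have hk := (h L hL).kv_pos
    have hv := (h L hL).vk_pos
    positivity
  have h1 := ((tendsto_dephase hf hη0 hη).mul_const (√(∫ x, ‖g x‖ ^ 2))).add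
    ((tendsto_dephase hg hη0 hη).const_mul (√(∫ x, ‖f x‖ ^ 2)))
  rw [zero_mul, mul_zero, add_zero] at h1
  refine squeeze_zero_norm' ?_ h1
  filter_upwards [eventually_gt_atTop 0] with L hL
  exact (h L hL).norm_twoPoint_sub_le hL (hΨ L hL) (hΨ₀ L hL) r hf hg

end Model

end Luttinger

end

/-! ### Finite length and the thermodynamic limit combined -/

theorem mainTheorem7 (M : Luttinger.Model) :
    -- finite length
    (∀ L : ℝ, 0 < L → M.Admissible L →
      -- the Hamiltonian and the continuity equation
      (∃ H : Luttinger.Fock →ₗ.[ℂ] Luttinger.Fock, M.IsHamiltonian L H ∧ IsSelfAdjoint H ∧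
        ∃ U : ℝ → Luttinger.Fock →L[ℂ] Luttinger.Fock, Luttinger.IsTimeEvolution H U ∧
          ∀ (n : ℤ) (Ψ : H.domain), ∃ R J : ℝ → Luttinger.Fock,
            (∀ t, (U t Ψ, R t) ∈ (Luttinger.Model.totalDensity n).graph) ∧
            (∀ t, (U t Ψ, J t) ∈ (M.current L n).graph) ∧
            ∀ t, HasDerivAt (fun s => U (-s) (R s))
              (-(Complex.I * Luttinger.momentum L n) • U (-t) (J t)) t) ∧
      (∀ n : ℤ, M.K (Luttinger.momentum L n) * M.v (Luttinger.momentum L n) =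
        M.vF * (1 + M.gt₄ (Luttinger.momentum L n) - M.gt₂ (Luttinger.momentum L n))) ∧
      (∃ Ψ, M.IsGroundState L Ψ) ∧
      -- allowed chemical potentials: unique ground state, current, conductance, two-point function
      ((∃ w : ℤ, M.μ 1 - M.μ₀ = w * (2 * Real.pi * (M.K 0 * M.v 0) / L)) →
        ∀ Ψ, M.IsGroundState L Ψ →
          (∀ Ψ', M.IsGroundState L Ψ' → ∃ c : ℂ, Ψ' = c • Ψ) ∧
          (∃ I : ℝ, M.HasAverageCurrent L Ψ I ∧ I = (M.μ 1 - M.μ (-1)) / (2 * Real.pi) ∧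
            (M.μ 1 ≠ M.μ (-1) → I / (M.μ 1 - M.μ (-1)) = 1 / (2 * Real.pi))) ∧
          ∀ Ψ₀, M.neutral.IsGroundState L Ψ₀ → ∀ (r : ℤˣ) (f g : ℝ → ℂ),
            MemLp f 2 (volume.restrict (Set.Icc (-(L / 2)) (L / 2))) →
            MemLp g 2 (volume.restrict (Set.Icc (-(L / 2)) (L / 2))) →
            Luttinger.twoPoint L r Ψ f g =
              Luttinger.twoPoint L r Ψ₀
                (fun x => Luttinger.planeWave (-((r : ℤ) * M.momentumShift r)) x * f x)
                (fun y => Luttinger.planeWave ((r : ℤ) * M.momentumShift r) y * g y))) ∧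
    -- arbitrary chemical potentials, in the thermodynamic limit
    ((∀ L : ℝ, 0 < L → M.Admissible L) →
      ∀ Ψ Ψ₀ : ℝ → Luttinger.Fock, (∀ L, 0 < L → M.IsGroundState L (Ψ L)) →
        (∀ L, 0 < L → M.neutral.IsGroundState L (Ψ₀ L)) →
        (∃ I : ℝ → ℝ, (∀ L, 0 < L → M.HasAverageCurrent L (Ψ L) (I L)) ∧
          Tendsto I atTop (𝓝 ((M.μ 1 - M.μ (-1)) / (2 * Real.pi))) ∧
          (M.μ 1 ≠ M.μ (-1) →
            Tendsto (fun L => I L / (M.μ 1 - M.μ (-1))) atTop (𝓝 (1 / (2 * Real.pi))))) ∧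
        ∀ (r : ℤˣ) (f g : ℝ → ℂ), MemLp f 2 volume → MemLp g 2 volume →
          Tendsto (fun L => Luttinger.twoPoint L r (Ψ L) f g -
            Luttinger.twoPoint L r (Ψ₀ L)
              (fun x => Luttinger.planeWave (-((r : ℤ) * M.momentumShift r)) x * f x)
              (fun y => Luttinger.planeWave ((r : ℤ) * M.momentumShift r) y * g y))
            atTop (𝓝 0)) := by
  refine ⟨fun L hL h => ⟨?_, h.K_mul_v, ?_, ?_⟩, fun h Ψ Ψ₀ hΨ hΨ₀ => ⟨?_, ?_⟩⟩
  · exact ⟨h.hamiltonian, h.isHamiltonian hL, Luttinger.isSelfAdjoint_diagonal _ _,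
      Luttinger.evolution h.bogParam.basis (M.energy L), Luttinger.isTimeEvolution_evolution _ _,
      h.continuity hL⟩
  · obtain ⟨w, hw⟩ := h.exists_isMin hL
    exact ⟨_, h.isGroundState_dressed hL hw⟩
  · rintro ⟨k, hk⟩ Ψ hΨ
    have hj := h.jmin_eq hL hk
    refine ⟨fun Ψ' hΨ' => h.isGroundState_unique hL hj hΨ hΨ',
      ⟨_, h.hasAverageCurrent_of_unique hL hj hΨ, rfl, fun hne => ?_⟩,
      fun Ψ₀ hΨ₀ r f g hf hg => h.twoPoint_of_unique hL hj hΨ hΨ₀ r hf hg⟩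
    have := sub_ne_zero.mpr hne
    field_simp
  · obtain ⟨I, hI, hlim⟩ := Luttinger.Model.exists_tendsto_averageCurrent h hΨ
    refine ⟨I, hI, hlim, fun hne => ?_⟩
    have h1 := sub_ne_zero.mpr hne
    have h2 := hlim.div_const (M.μ 1 - M.μ (-1))
    rwa [div_right_comm, div_self h1] at h2
  · exact fun r f g hf hg => Luttinger.Model.tendsto_twoPoint_sub h hΨ hΨ₀ r hf hg
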